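/- **Setting.** Let $\mathbb K$ be an algebraically closed field. A Borcherds–Cartan datum consists of an index set $I$; an integer matrix $A=(a_{ij})_{i,j\in I}$ with $a_{ii}\in\{2,0,-2,-4,\dots\}$, $a_{ij}\le 0$ for $i\ne j$, and integers $r_i>0$ with $r_ia_{ij}=r_ja_{ji}$; a free abelian group $P$ with elements $\alpha_i\in P$, $h_i\in \mathrm{Hom}_{\mathbb Z}(P,\mathbb Z)$ $(i\in I)$, and a symmetric bilinear form $(\ ,\ ):P\times P\to\mathbb Z$ such that $\alpha_j(h_i):=h_i(\alpha_j)=a_{ij}$ and $(\lambda,\alpha_i)=r_i\lambda(h_i)$ for all $\lambda\in P$. Write $I^{\rm re}=\{i: a_{ii}=2\}$. Fix $\lambda\in P$ with $\lambda(h_i)\ge 0$ for all $i\in I$. Identify $\nu=\sum_i\nu_i\, i\in\mathbb N[I]$ with $\sum_i\nu_i\alpha_i\in P$ when forming $\lambda-\nu$. **The algebras.** For $\nu\in\mathbb N[I]$ with $\sum_i\nu_i=n$, let $\mathrm{Seq}(\nu)$ be the set of sequences $\mathbf i=i_1\cdots i_n$ in $I$ with $i_1+\dots+i_n=\nu$.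 Let $\mathscr R(\nu)$ be the unital $\mathbb Z$-graded $\mathbb K$-algebra with generators $1_{\mathbf i}$ (degree $0$), $x_{k,\mathbf i}$ ($1\le k\le n$, degree $2r_{i_k}$) and $\tau_{k,\mathbf i}$ ($1\le k<n$, degree $-(\alpha_{i_k},\alpha_{i_{k+1}})$), subject to the following relations. The $1_{\mathbf i}$ are orthogonal idempotents with sum $1$; $x_{k,\mathbf i}=1_{\mathbf i}x_{k,\mathbf i}=x_{k,\mathbf i}1_{\mathbf i}$; $\tau_{k,\mathbf i}=1_{s_k\mathbf i}\tau_{k,\mathbf i}=\tau_{k,\mathbf i}1_{\mathbf i}$. Writing $x_k=\sum_{\mathbf i}x_{k,\mathbf i}$, $\tau_k=\sum_{\mathbf i}\tau_{k,\mathbf i}$: $x_kx_l=x_lx_k$; $\tau_kx_l=x_l\tau_k$ for $l\ne k,k+1$; $\tau_k\tau_l=\tau_l\tau_k$ for $|k-l|>1$; and, with $i=i_k$, $j=i_{k+1}$, $m=i_{k+2}$, - $\tau_k^2 1_{\mathbf i}=0$ if $i=j\in I^{\rm re}$; $=(x_k^{-a_{ii}/2}+x_{k+1}^{-a_{ii}/2})^2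 1_{\mathbf i}$ if $i=j$ and $(\alpha_i,\alpha_i)<0$; $=1_{\mathbf i}$ if $(\alpha_i,\alpha_j)=0$; $=(x_k^{-a_{ij}}+x_{k+1}^{-a_{ji}})1_{\mathbf i}$ if $i\neq j$ and $(\alpha_i,\alpha_j)\ne 0$; - $(x_k\tau_k-\tau_kx_{k+1})1_{\mathbf i}=1_{\mathbf i}=(\tau_kx_k-x_{k+1}\tau_k)1_{\mathbf i}$ if $i=j\in I^{\rm re}$; otherwise both differences are $0$; - $(\tau_k\tau_{k+1}\tau_k-\tau_{k+1}\tau_k\tau_{k+1})1_{\mathbf i}=\sum_{c=0}^{-a_{ij}-1}x_k^c\,x_{k+2}^{-a_{ij}-1-c}1_{\mathbf i}$ if $i=m\in I^{\rm re}$, $i\ne j$ and $(\alpha_i,\alpha_j)\neq0$; otherwise this difference is $0$. Let $\mathscr R^\lambda(\nu)$ be the quotient of $\mathscr R(\nu)$ by the two-sided ideal generated by the elements $x_{1}^{\lambda(h_{i_1})}1_{\mathbf i}$, $\mathbf i\in\mathrm{Seq}(\nu)$ (no relation if $\nu=0$). **The functors.** Modules are $\mathbb Z$-graded left modules and morphisms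 are homogeneous of degree $0$. For $m\in\mathbb Z$ let $q^m$ be the shift $(q^mM)_n=M_{n-m}$, and $q_i=q^{r_i}$. Adding a vertical strand coloured $i$ on the right gives a non-unital graded homomorphism $\mathscr R^\lambda(\nu)\to\mathscr R^\lambda(\nu+i)$ with $1\mapsto 1_{\nu,i}=\sum_{\mathbf i\in\mathrm{Seq}(\nu)}1_{\mathbf i i}$. Put $$E_i^\lambda:\mathscr R^\lambda(\nu+i)\text{-modules}\to\mathscr R^\lambda(\nu)\text{-modules},\quad N\mapsto 1_{\nu,i}N,$$ $$F_i^\lambda:\mathscr R^\lambda(\nu)\text{-modules}\to\mathscr R^\lambda(\nu+i)\text{-modules},\quad M\mapsto \mathscr R^\lambda(\nu+i)1_{\nu,i}\otimes_{\mathscr R^\lambda(\nu)}M,$$ and let $E_i^\lambda=0$ on $\mathscr R^\lambda(\nu)$-modules if $\nu_i=0$. **Theorem.** The functors $E_i^\lambda$ and $F_i^\lambda$ preserve finitely generated graded modules. The following natural isomorphisms hold on the category of all graded modules, and hence also on its full subcategory of finitely generated graded modules. 1. For $i\ne j$ in $I$ and every $\nu\in\mathbb N[I]$ with $\nu_i\geq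 1$, there is a natural isomorphism of functors from graded $\mathscr R^\lambda(\nu)$-modules to graded $\mathscr R^\lambda(\nu+j-i)$-modules $$q_i^{-a_{ij}}F_j^\lambda E_i^\lambda\simeq E_i^\lambda F_j^\lambda .$$ 2. Let $i\in I$, $\nu\in\mathbb N[I]$ and $\mu=\lambda-\nu$. There are natural isomorphisms of endofunctors of the category of graded $\mathscr R^\lambda(\nu)$-modules as follows. (i) If $\mu(h_i)\ge 0$, then $$q_i^{-a_{ii}}F_i^\lambda E_i^\lambda\oplus\bigoplus_{k=0}^{\mu(h_i)-1}q_i^{2k}\,\mathrm{Id}\simeq E_i^\lambda F_i^\lambda .$$ (ii) If $\mu(h_i)<0$, then $i\in I^{\rm re}$ and $$q_i^{-a_{ii}}F_i^\lambda E_i^\lambda\simeq E_i^\lambda F_i^\lambda\oplus\bigoplus_{k=0}^{-\mu(h_i)-1}q_i^{-2k-2}\,\mathrm{Id} .$$ -/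

import Mathlib

open CategoryTheory
open scoped TensorProduct

universe u a v w

noncomputable section

section Grading

variable {K : Type u} [Field K]

/-- The span of all products of generators `g x₁ ⋯ g xₙ` with `deg x₁ + ⋯ + deg xₙ = d`. -/
def monomialGrading {A : Type*} [Ring A] [Algebra K A] {X : Type*} (g : X → A) (deg : X → ℤ)
    (d : ℤ) : Submodule K A :=
  Submodule.span K {y | ∃ l : List X, (l.map deg).sum = d ∧ (l.map g).prod = y}

namespace monomialGrading

variable {A : Type*} [Ring A] [Algebra K A] {X : Type*} {g : X → A} {deg : X → ℤ}

theorem one_mem : (1 : A) ∈ monomialGrading (K := K) g deg 0 :=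
  Submodule.subset_span ⟨[], by simp, by simp⟩

theorem gen_mem (x : X) : g x ∈ monomialGrading (K := K) g deg (deg x) :=
  Submodule.subset_span ⟨[x], by simp, by simp⟩

theorem mul_mem {m n : ℤ} {y z : A} (hy : y ∈ monomialGrading (K := K) g deg m)
    (hz : z ∈ monomialGrading (K := K) g deg n) :
    y * z ∈ monomialGrading (K := K) g deg (m + n) := by
  have h : monomialGrading (K := K) g deg m * monomialGrading (K := K) g deg n ≤
      monomialGrading (K := K) g deg (m + n) := by
    unfold monomialGrading
    rw [Submodule.span_mul_span]
    apply Submodule.span_mono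
    rintro _ ⟨_, ⟨l, hl, rfl⟩, _, ⟨l', hl', rfl⟩, rfl⟩
    exact ⟨l ++ l', by simp [hl, hl'], by simp⟩
  exact h (Submodule.mul_mem_mul hy hz)

theorem mul_mem' {m n d : ℤ} {y z : A} (hy : y ∈ monomialGrading (K := K) g deg m)
    (hz : z ∈ monomialGrading (K := K) g deg n) (h : m + n = d) :
    y * z ∈ monomialGrading (K := K) g deg d := h ▸ mul_mem hy hz

theorem pow_mem {m : ℤ} {y : A} (hy : y ∈ monomialGrading (K := K) g deg m) (n : ℕ) :
    y ^ n ∈ monomialGrading (K := K) g deg (n * m) := by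
  induction n with
  | zero => simpa using one_mem
  | succ n ih =>
    rw [pow_succ]
    exact mul_mem' ih hy (by push_cast; ring)

theorem map_mem {B : Type*} [Ring B] [Algebra K B] (f : A →ₐ[K] B) {d : ℤ} {y : A}
    (hy : y ∈ monomialGrading (K := K) g deg d) :
    f y ∈ monomialGrading (K := K) (fun x => f (g x)) deg d := by
  have h : monomialGrading (K := K) g deg d ≤
      (monomialGrading (K := K) (fun x => f (g x)) deg d).comap f.toLinearMap := by
    unfold monomialGrading
    rw [Submodule.span_le]
    rintro _ ⟨l, hl, rfl⟩
    refine Submodule.subset_span ⟨l, hl, ?_⟩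
    simp [map_list_prod, Function.comp_def]
  exact h hy

/-- A coaction of the group algebra of `ℤ` that has the generators as homogeneous elements. -/
def HasCoaction (K : Type u) [Field K] {A : Type*} [Ring A] [Algebra K A] {X : Type*} (g : X → A)
    (deg : X → ℤ) : Prop :=
  ∃ δ : A →ₐ[K] AddMonoidAlgebra A ℤ, ∀ x, δ (g x) = AddMonoidAlgebra.single (deg x) (g x)

theorem coaction_apply {δ : A →ₐ[K] AddMonoidAlgebra A ℤ}
    (hδ : ∀ x, δ (g x) = AddMonoidAlgebra.single (deg x) (g x)) {d : ℤ} {y : A}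
    (hy : y ∈ monomialGrading (K := K) g deg d) : δ y = AddMonoidAlgebra.single d y := by
  unfold monomialGrading at hy
  induction hy using Submodule.span_induction with
  | mem y hy =>
    obtain ⟨l, rfl, rfl⟩ := hy
    induction l with
    | nil => exact map_one δ
    | cons x l ih =>
      rw [List.map_cons, List.prod_cons, map_mul, ih, hδ, AddMonoidAlgebra.single_mul_single,
        List.map_cons, List.sum_cons]
  | zero => rw [map_zero, AddMonoidAlgebra.single_zero]
  | add y z _ _ hy hz => rw [map_add, hy, hz, AddMonoidAlgebra.single_add]
  | smul c y _ hy => rw [map_smul, hy, AddMonoidAlgebra.smul_single]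

theorem HasCoaction.ringQuot (h : HasCoaction K g deg) (r : A → A → Prop)
    (hr : ∀ y z, r y z → ∃ d, y ∈ monomialGrading (K := K) g deg d ∧
      z ∈ monomialGrading (K := K) g deg d) :
    HasCoaction K (fun x => RingQuot.mkAlgHom K r (g x)) deg := by
  obtain ⟨δ, hδ⟩ := h
  let π := AddMonoidAlgebra.mapAlgHom ℤ (RingQuot.mkAlgHom K r)
  refine ⟨RingQuot.liftAlgHom K ⟨π.comp δ, ?_⟩, ?_⟩
  · intro y z hyz
    obtain ⟨d, hy, hz⟩ := hr y z hyz
    rw [AlgHom.comp_apply, AlgHom.comp_apply, coaction_apply hδ hy, coaction_apply hδ hz,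
      AddMonoidAlgebra.mapAlgHom_single, AddMonoidAlgebra.mapAlgHom_single,
      RingQuot.mkAlgHom_rel K hyz]
  · intro x
    rw [RingQuot.liftAlgHom_mkAlgHom_apply, AlgHom.comp_apply, hδ,
      AddMonoidAlgebra.mapAlgHom_single]


end monomialGrading

/-- A spanning family of submodules, each fixed by its own component of a linear map to `ℤ →₀ V`,
is a direct sum decomposition. -/
theorem isInternal_of_component {V : Type*} [AddCommGroup V] [Module K V] (𝒱 : ℤ → Submodule K V)
    (δ : V →ₗ[K] (ℤ →₀ V)) (hδ : ∀ d, ∀ y ∈ 𝒱 d, δ y = Finsupp.single d y) (h : ⨆ d, 𝒱 d = ⊤) :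
    DirectSum.IsInternal 𝒱 := by
  classical
  refine ⟨?_, ?_⟩
  · intro y z hyz
    have key : ∀ y : DirectSum ℤ (fun d => 𝒱 d), ∀ d,
        δ (DirectSum.coeAddMonoidHom 𝒱 y) d = (y d : V) := by
      intro y d
      induction y using DirectSum.induction_on with
      | zero => simp
      | of i y =>
        rw [DirectSum.coeAddMonoidHom_of, hδ _ _ y.2, DirectSum.coe_of_apply, Finsupp.single_apply]
        split_ifs <;> simp
      | add y z hy hz => simp [hy, hz]
    refine DFinsupp.ext fun d => Subtype.ext ?_
    exact (key y d).symm.trans ((congrArg (fun t => δ t d) hyz).trans (key z d))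
  · have : Function.Surjective (DirectSum.coeLinearMap 𝒱) := by
      rw [← LinearMap.range_eq_top, DirectSum.range_coeLinearMap, h]
    exact this

/-- The components with respect to a direct sum decomposition. -/
theorem exists_component {V : Type*} [AddCommGroup V] [Module K V] {𝒱 : ℤ → Submodule K V}
    (h : DirectSum.IsInternal 𝒱) :
    ∃ δ : V →ₗ[K] (ℤ →₀ V), ∀ d, ∀ y ∈ 𝒱 d, δ y = Finsupp.single d y := by
  classical
  let e := LinearEquiv.ofBijective (DirectSum.coeLinearMap 𝒱) h
  refine ⟨(DirectSum.toModule K ℤ (ℤ →₀ V) fun d =>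
    (Finsupp.lsingle d).comp (𝒱 d).subtype).comp e.symm.toLinearMap, fun d y hy => ?_⟩
  have : e.symm y = DirectSum.lof K ℤ (fun d => 𝒱 d) d ⟨y, hy⟩ := by
    rw [LinearEquiv.symm_apply_eq]
    exact (DirectSum.coeLinearMap_lof 𝒱 d ⟨y, hy⟩).symm
  simp [this]

theorem monomialGrading.isInternal {A : Type*} [Ring A] [Algebra K A] {X : Type*} {g : X → A}
    {deg : X → ℤ} (h : HasCoaction K g deg) (hg : Algebra.adjoin K (Set.range g) = ⊤) :
    DirectSum.IsInternal (monomialGrading (K := K) g deg) := by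
  obtain ⟨δ, hδ⟩ := h
  refine isInternal_of_component _
    ((AddMonoidAlgebra.coeffLinearEquiv K).toLinearMap.comp δ.toLinearMap) ?_ ?_
  · intro d y hy
    simp only [LinearMap.comp_apply, AlgHom.toLinearMap_apply, coaction_apply hδ hy]
    rfl
  · rw [eq_top_iff]
    intro y _
    have hy : y ∈ Algebra.adjoin K (Set.range g) := hg ▸ Algebra.mem_top
    rw [← Subalgebra.mem_toSubmodule, Algebra.adjoin_eq_span] at hy
    refine (Submodule.span_le.2 ?_) hy
    intro z hz
    obtain ⟨l, hl, rfl⟩ := Submonoid.exists_list_of_mem_closure hz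
    obtain ⟨l, rfl⟩ : l ∈ Set.range (List.map g) := by
      rw [Set.range_list_map]
      exact hl
    exact Submodule.mem_iSup_of_mem (l.map deg).sum (Submodule.subset_span ⟨l, rfl, rfl⟩)

/-- An algebra generated by elements with degrees is graded, once it carries a coaction. -/
@[reducible] def monomialGrading.gradedAlgebra {A : Type*} [Ring A] [Algebra K A] {X : Type*} {g : X → A}
    {deg : X → ℤ} (h : HasCoaction K g deg) (hg : Algebra.adjoin K (Set.range g) = ⊤) :
    GradedAlgebra (monomialGrading (K := K) g deg) where
  one_mem := one_mem
  mul_mem _ _ _ _ := mul_mem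
  toDecomposition := (isInternal h hg).chooseDecomposition

end Grading

section GradedModules

variable {K : Type u} [Field K] {A : Type a} [Ring A] [Algebra K A]

/-- Graded left modules `M = ⨁ₙ Mₙ` over a `ℤ`-graded `K`-algebra `A = ⨁ₙ Aₙ`. -/
structure GrMod (𝒜 : ℤ → Submodule K A) where
  /-- The underlying module. -/
  carrier : Type a
  [addCommGroup : AddCommGroup carrier]
  [moduleBase : Module K carrier]
  [module : Module A carrier]
  [isScalarTower : IsScalarTower K A carrier]
  /-- The homogeneous components. -/
  gr : ℤ → Submodule K carrier
  isInternal : DirectSum.IsInternal gr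
  smul_mem : ∀ {m n : ℤ} {r : A} {x : carrier}, r ∈ 𝒜 m → x ∈ gr n → r • x ∈ gr (m + n)

namespace GrMod

attribute [instance] addCommGroup moduleBase module isScalarTower

variable {𝒜 : ℤ → Submodule K A}

/-- Degree-preserving `A`-linear maps. -/
@[ext] structure Hom (M N : GrMod 𝒜) where
  /-- The underlying linear map. -/
  toLin : M.carrier →ₗ[A] N.carrier
  map_mem : ∀ {n : ℤ} {x : M.carrier}, x ∈ M.gr n → toLin x ∈ N.gr n

instance : Category (GrMod 𝒜) where
  Hom := Hom
  id M := ⟨LinearMap.id, fun h => h⟩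
  comp f g := ⟨g.toLin.comp f.toLin, fun h => g.map_mem (f.map_mem h)⟩

@[simp] theorem id_toLin (M : GrMod 𝒜) : Hom.toLin (𝟙 M) = LinearMap.id := rfl

@[simp] theorem comp_toLin {M N L : GrMod 𝒜} (f : M ⟶ N) (g : N ⟶ L) :
    Hom.toLin (f ≫ g) = g.toLin.comp f.toLin := rfl

@[ext] theorem hom_ext {M N : GrMod 𝒜} {f g : M ⟶ N} (h : f.toLin = g.toLin) : f = g :=
  Hom.ext h

theorem iSup_gr (M : GrMod 𝒜) : ⨆ d, M.gr d = ⊤ := M.isInternal.submodule_iSup_eq_top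

theorem map_mem_iSup {V W : Type*} [AddCommGroup V] [Module K V] [AddCommGroup W] [Module K W]
    {𝒱 : ℤ → Submodule K V} {𝒲 : ℤ → Submodule K W} (f : V →ₗ[K] W)
    (hf : ∀ d, ∀ y ∈ 𝒱 d, f y ∈ 𝒲 d) {y : V} (hy : y ∈ ⨆ d, 𝒱 d) : f y ∈ ⨆ d, 𝒲 d := by
  have : (⨆ d, 𝒱 d) ≤ (⨆ d, 𝒲 d).comap f :=
    iSup_le fun d y hy => Submodule.mem_iSup_of_mem d (hf d y hy)
  exact this hy

/-- Finitely generated graded modules. -/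
def FG (M : GrMod 𝒜) : Prop := Module.Finite A M.carrier

/-- The degree shift `M{m}`, with `(M{m})ₙ = Mₙ₋ₘ`. -/
def shiftObj (m : ℤ) (M : GrMod 𝒜) : GrMod 𝒜 where
  carrier := M.carrier
  gr n := M.gr (n - m)
  isInternal := by
    obtain ⟨δ, hδ⟩ := exists_component M.isInternal
    refine isInternal_of_component _ ((Finsupp.lmapDomain M.carrier K (· + m)).comp δ) ?_ ?_
    · intro d y hy
      simp [hδ _ y hy]
    · rw [← M.iSup_gr]
      exact (Equiv.subRight m).iSup_comp (g := M.gr)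
  smul_mem {k n r x} hr hx := by
    have := M.smul_mem hr hx
    rwa [← add_sub_assoc] at this

/-- The functor `M ↦ M{m}`, that is, multiplication by `q ^ m`. -/
def shift (m : ℤ) : GrMod 𝒜 ⥤ GrMod 𝒜 where
  obj := shiftObj m
  map f := ⟨f.toLin, fun h => f.map_mem h⟩

/-- The zero module. -/
def zero : GrMod 𝒜 where
  carrier := PUnit
  gr _ := ⊤
  isInternal := isInternal_of_component _ 0 (fun d y _ => by ext) (by simp)
  smul_mem _ _ := trivial

/-- The zero functor. -/
def zeroFunctor (C : Type*) [Category* C] : C ⥤ GrMod 𝒜 := (Functor.const C).obj zero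

/-- The direct sum of a finite family of graded modules. -/
def dsumObj {ι : Type} [Fintype ι] (M : ι → GrMod 𝒜) : GrMod 𝒜 where
  carrier := ∀ k, (M k).carrier
  gr n := Submodule.pi Set.univ fun k => (M k).gr n
  isInternal := by
    classical
    choose δ hδ using fun k => exists_component (M k).isInternal
    refine isInternal_of_component _ (∑ k, (Finsupp.mapRange.linearMap
      (LinearMap.single K (fun k => (M k).carrier) k)).comp ((δ k).comp (LinearMap.proj k))) ?_ ?_
    · intro d y hy
      have hy' : ∀ k, δ k (y k) = Finsupp.single d (y k) := fun k => hδ k d _ (hy k trivial)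
      simp only [LinearMap.sum_apply, LinearMap.comp_apply, LinearMap.proj_apply, hy',
        Finsupp.mapRange.linearMap_apply, Finsupp.mapRange_single, LinearMap.coe_single]
      rw [← Finsupp.single_finsetSum, Finset.univ_sum_single]
    · rw [eq_top_iff]
      intro y _
      rw [← Finset.univ_sum_single y]
      refine Submodule.sum_mem _ fun k _ => ?_
      refine map_mem_iSup (𝒱 := (M k).gr) (LinearMap.single K (fun k => (M k).carrier) k) ?_
        (by rw [iSup_gr]; trivial)
      intro d z hz j _
      by_cases h : j = k
      · subst h
        simpa using hz
      · simp [h]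
  smul_mem hr hx k _ := (M k).smul_mem hr (hx k trivial)

/-- The direct sum of a finite family of functors to graded modules. -/
def dsum {C : Type*} [Category* C] {ι : Type} [Fintype ι] (F : ι → (C ⥤ GrMod 𝒜)) :
    C ⥤ GrMod 𝒜 where
  obj X := dsumObj fun k => (F k).obj X
  map f := ⟨LinearMap.pi fun k => ((F k).map f).toLin.comp (LinearMap.proj k),
    fun h k _ => ((F k).map f).map_mem (h k trivial)⟩

/-- The direct sum of two functors to graded modules. -/
def add {C : Type*} [Category* C] (F G : C ⥤ GrMod 𝒜) : C ⥤ GrMod 𝒜 := dsum ![F, G]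

section ChangeOfRings

variable {A' : Type a} [Ring A'] [Algebra K A'] {𝒜' : ℤ → Submodule K A'}
  (φ : A →ₙₐ[K] A') (hφ : ∀ d, ∀ r ∈ 𝒜 d, φ r ∈ 𝒜' d)

theorem map_one_mul (r : A) : φ 1 * φ r = φ r := by rw [← map_mul, one_mul]

theorem mul_map_one (r : A) : φ r * φ 1 = φ r := by rw [← map_mul, mul_one]

/-- The subspace `eN = {x ∈ N | e x = x}` for the idempotent `e = φ(1)`. -/
def resCarrier (N : Type*) [AddCommGroup N] [Module K N] [Module A' N] [IsScalarTower K A' N] :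
    Submodule K N where
  carrier := {x | φ 1 • x = x}
  add_mem' {x y} hx hy := by
    simp only [Set.mem_ofPred_eq] at *
    rw [smul_add, hx, hy]
  zero_mem' := smul_zero _
  smul_mem' c x hx := by
    simp only [Set.mem_ofPred_eq] at *
    rw [smul_comm, hx]

/-- The action of `A` on `eN` through `φ`. -/
@[reducible] def resModule (N : Type*) [AddCommGroup N] [Module K N] [Module A' N]
    [IsScalarTower K A' N] : Module A (resCarrier φ N) where
  smul r x := ⟨φ r • x.1, by
    change φ 1 • φ r • x.1 = φ r • x.1
    rw [← mul_smul, map_one_mul]⟩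
  one_smul x := Subtype.ext x.2
  mul_smul r s x := Subtype.ext (by
    change φ (r * s) • x.1 = φ r • φ s • x.1
    rw [map_mul, mul_smul])
  smul_zero r := Subtype.ext (smul_zero _)
  smul_add r x y := Subtype.ext (smul_add _ _ _)
  add_smul r s x := Subtype.ext (by
    change φ (r + s) • x.1 = φ r • x.1 + φ s • x.1
    rw [map_add, add_smul])
  zero_smul x := Subtype.ext (by
    change φ 0 • x.1 = 0
    rw [map_zero, zero_smul])

/-- The graded `A`-module `eN`, where `e = φ(1)` and `A` acts through `φ`. -/
def resObj [GradedAlgebra 𝒜] (N : GrMod 𝒜') : GrMod 𝒜 :=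
  letI := resModule φ N.carrier
  { carrier := resCarrier φ N.carrier
    isScalarTower := ⟨fun c r x => Subtype.ext (by
      change φ (c • r) • x.1 = c • φ r • x.1
      rw [map_smul, smul_assoc])⟩
    gr := fun n => (N.gr n).comap (resCarrier φ N.carrier).subtype
    isInternal := by
      obtain ⟨δ, hδ⟩ := exists_component N.isInternal
      have h1 : φ 1 ∈ 𝒜' 0 := hφ 0 1 SetLike.GradedOne.one_mem
      let p : N.carrier →ₗ[K] resCarrier φ N.carrier :=
        { toFun := fun x => ⟨φ 1 • x, by
            change φ 1 • φ 1 • x = φ 1 • x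
            rw [← mul_smul, map_one_mul]⟩
          map_add' := fun x y => Subtype.ext (smul_add _ _ _)
          map_smul' := fun c x => Subtype.ext (smul_comm _ _ _) }
      have hp : ∀ x : resCarrier φ N.carrier, p x.1 = x := fun x => Subtype.ext x.2
      refine isInternal_of_component _ ((Finsupp.mapRange.linearMap p).comp
        (δ.comp (resCarrier φ N.carrier).subtype)) ?_ ?_
      · intro d y hy
        simp [hδ d y.1 hy, hp]
      · rw [eq_top_iff]
        intro y _
        rw [← hp y]
        refine map_mem_iSup (𝒱 := N.gr) p ?_ (by rw [iSup_gr]; trivial)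
        intro d z hz
        have := N.smul_mem h1 hz
        rwa [zero_add] at this
    smul_mem := fun hr hx => N.smul_mem (hφ _ _ hr) hx }

/-- The functor `N ↦ eN` from graded `A'`-modules to graded `A`-modules, where `e = φ(1)`. -/
def res [GradedAlgebra 𝒜] : GrMod 𝒜' ⥤ GrMod 𝒜 where
  obj := resObj φ hφ
  map {M N} f :=
    letI := resModule φ M.carrier
    letI := resModule φ N.carrier
    ⟨{ toFun := fun x => ⟨f.toLin x.1, by
          change φ 1 • f.toLin x.1 = f.toLin x.1
          rw [← map_smul, show φ 1 • x.1 = x.1 from x.2]⟩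
       map_add' := fun x y => Subtype.ext (map_add _ _ _)
       map_smul' := fun r x => Subtype.ext (map_smul f.toLin (φ r) x.1) }, fun h => f.map_mem h⟩

/-- The left ideal `A'e = {b ∈ A' | b e = b}` for the idempotent `e = φ(1)`. -/
def leftIdeal : Submodule A' A' where
  carrier := {b | b * φ 1 = b}
  add_mem' {x y} hx hy := by
    simp only [Set.mem_ofPred_eq] at *
    rw [add_mul, hx, hy]
  zero_mem' := zero_mul _
  smul_mem' c x hx := by
    simp only [Set.mem_ofPred_eq, smul_eq_mul] at *
    rw [mul_assoc, hx]

/-- The right action of `A` on `A'e` through `φ`. -/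
def leftIdeal.act (b : leftIdeal φ) (r : A) : leftIdeal φ :=
  ⟨b.1 * φ r, by
    change b.1 * φ r * φ 1 = b.1 * φ r
    rw [mul_assoc, mul_map_one]⟩

/-- The relations `b r ⊗ x = b ⊗ r x` defining `A'e ⊗_A M` as a quotient of `A'e ⊗_K M`. -/
def balanced (M : Type*) [AddCommGroup M] [Module K M] [Module A M] :
    Submodule A' (leftIdeal φ ⊗[K] M) :=
  Submodule.span A' {z | ∃ (b : leftIdeal φ) (r : A) (x : M),
    z = leftIdeal.act φ b r ⊗ₜ[K] x - b ⊗ₜ[K] (r • x)}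

/-- The tensor product `A'e ⊗_A M`, a left `A'`-module. -/
abbrev IndCarrier (M : Type*) [AddCommGroup M] [Module K M] [Module A M] : Type _ :=
  (leftIdeal φ ⊗[K] M) ⧸ balanced φ M

/-- The pure tensors of `A'e ⊗_A M`. -/
def indMk (M : Type*) [AddCommGroup M] [Module K M] [Module A M] (b : leftIdeal φ) (x : M) :
    IndCarrier φ M :=
  (balanced φ M).mkQ (b ⊗ₜ[K] x)

/-- The degree `n` part of `A'e ⊗_A M`, spanned by `b ⊗ x` with `deg b + deg x = n`. -/
def indGr (𝒜' : ℤ → Submodule K A') (M : GrMod 𝒜) (n : ℤ) : Submodule K (IndCarrier φ M.carrier) :=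
  Submodule.span K {z | ∃ (k l : ℤ) (b : leftIdeal φ) (x : M.carrier),
    k + l = n ∧ b.1 ∈ 𝒜' k ∧ x ∈ M.gr l ∧ z = indMk φ M.carrier b x}

theorem indMk_act (M : Type*) [AddCommGroup M] [Module K M] [Module A M] (b : leftIdeal φ)
    (r : A) (x : M) : indMk φ M (leftIdeal.act φ b r) x = indMk φ M b (r • x) := by
  unfold indMk
  rw [← sub_eq_zero, ← map_sub, Submodule.mkQ_apply, Submodule.Quotient.mk_eq_zero]
  exact Submodule.subset_span ⟨b, r, x, rfl⟩

/-- The projection `b ↦ b e` onto `A'e`. -/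
def leftIdeal.proj : A' →ₗ[K] leftIdeal φ where
  toFun b := ⟨b * φ 1, by
    change b * φ 1 * φ 1 = b * φ 1
    rw [mul_assoc, mul_map_one]⟩
  map_add' b c := Subtype.ext (add_mul _ _ _)
  map_smul' c b := Subtype.ext (smul_mul_assoc _ _ _)

theorem leftIdeal.proj_coe (b : leftIdeal φ) : leftIdeal.proj φ b.1 = b := Subtype.ext b.2

/-- The pure tensor `b e ⊗ x`, as a bilinear map. -/
def indMk₂ (M : Type*) [AddCommGroup M] [Module K M] [Module A M] :
    A' →ₗ[K] M →ₗ[K] IndCarrier φ M :=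
  ((TensorProduct.mk K (leftIdeal φ) M).compr₂
    ((balanced φ M).mkQ.restrictScalars K)).comp (leftIdeal.proj φ)

theorem indMk₂_apply (M : Type*) [AddCommGroup M] [Module K M] [Module A M] (b : A') (x : M) :
    indMk₂ φ M b x = indMk φ M (leftIdeal.proj φ b) x := rfl

/-- Convolution of families along a bilinear map. -/
def convolve {V W Z : Type*} [AddCommGroup V] [Module K V] [AddCommGroup W] [Module K W]
    [AddCommGroup Z] [Module K Z] (B : V →ₗ[K] W →ₗ[K] Z) :
    (ℤ →₀ V) →ₗ[K] (ℤ →₀ W) →ₗ[K] (ℤ →₀ Z) :=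
  LinearMap.mk₂ K (fun f g => f.sum fun p x => g.sum fun q y => Finsupp.single (p + q) (B x y))
    (fun f f' g => by
      rw [Finsupp.sum_add_index'] <;> intros <;> simp [Finsupp.sum_add])
    (fun c f g => by
      rw [Finsupp.sum_smul_index'] <;> simp [Finsupp.smul_sum])
    (fun f g g' => by
      rw [← Finsupp.sum_add]
      congr 1
      ext1 p
      ext1 x
      rw [Finsupp.sum_add_index'] <;> intros <;> simp)
    (fun c f g => by
      rw [Finsupp.smul_sum]
      congr 1
      ext1 p
      ext1 x
      rw [Finsupp.sum_smul_index'] <;> simp [Finsupp.smul_sum])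

theorem convolve_single {V W Z : Type*} [AddCommGroup V] [Module K V] [AddCommGroup W]
    [Module K W] [AddCommGroup Z] [Module K Z] (B : V →ₗ[K] W →ₗ[K] Z) (p q : ℤ) (x : V) (y : W) :
    convolve B (Finsupp.single p x) (Finsupp.single q y) = Finsupp.single (p + q) (B x y) := by
  simp [convolve]

theorem indGr_isInternal [GradedAlgebra 𝒜] [GradedAlgebra 𝒜']
    (hφ : ∀ d, ∀ r ∈ 𝒜 d, φ r ∈ 𝒜' d) (M : GrMod 𝒜) :
    DirectSum.IsInternal (indGr φ 𝒜' M) := by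
  have hA : ⨆ d, 𝒜 d = ⊤ :=
    (DirectSum.Decomposition.isInternal 𝒜).submodule_iSup_eq_top
  have hA' : ⨆ d, 𝒜' d = ⊤ :=
    (DirectSum.Decomposition.isInternal 𝒜').submodule_iSup_eq_top
  have h1 : φ 1 ∈ 𝒜' 0 := hφ 0 1 SetLike.GradedOne.one_mem
  have hmul : ∀ {m n : ℤ} {r s : A'}, r ∈ 𝒜' m → s ∈ 𝒜' n → r * s ∈ 𝒜' (m + n) :=
    fun hr hs => SetLike.GradedMul.mul_mem hr hs
  have hproj : ∀ {n : ℤ} {b : A'}, b ∈ 𝒜' n → (leftIdeal.proj φ b).1 ∈ 𝒜' n := by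
    intro n b hb
    have := hmul hb h1
    rwa [add_zero] at this
  obtain ⟨δ', hδ'⟩ := exists_component (DirectSum.Decomposition.isInternal 𝒜')
  obtain ⟨δ, hδ⟩ := exists_component M.isInternal
  let D : A' →ₗ[K] M.carrier →ₗ[K] (ℤ →₀ IndCarrier φ M.carrier) :=
    (convolve (indMk₂ φ M.carrier)).compl₁₂ δ' δ
  have hD : ∀ {p q : ℤ} {b : A'} {x : M.carrier}, b ∈ 𝒜' p → x ∈ M.gr q →
      D b x = Finsupp.single (p + q) (indMk φ M.carrier (leftIdeal.proj φ b) x) := by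
    intro p q b x hb hx
    simp only [D, LinearMap.compl₁₂_apply, hδ' p b hb, hδ q x hx, convolve_single, indMk₂_apply]
  have key : ∀ (b : A') (r : A) (x : M.carrier), D (b * φ r) x = D b (r • x) := by
    intro b r x
    have hb : b ∈ ⨆ d, 𝒜' d := by rw [hA']; trivial
    have hr : r ∈ ⨆ d, 𝒜 d := by rw [hA]; trivial
    have hx : x ∈ ⨆ d, M.gr d := by rw [iSup_gr]; trivial
    induction hb using Submodule.iSup_induction' with
    | zero => simp
    | add b c _ _ hb hc => simp only [add_mul, map_add, LinearMap.add_apply, hb, hc]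
    | mem p b hb =>
    induction hr using Submodule.iSup_induction' with
    | zero => simp
    | add r s _ _ hr hs => simp only [map_add, mul_add, LinearMap.add_apply, add_smul, hr, hs]
    | mem t r hr =>
    induction hx using Submodule.iSup_induction' with
    | zero => simp
    | add x y _ _ hx hy => simp only [map_add, smul_add, hx, hy]
    | mem q x hx =>
      rw [hD (hmul hb (hφ t r hr)) hx, hD hb (M.smul_mem hr hx), ← indMk_act, add_assoc]
      congr 2
      apply Subtype.ext
      change b * φ r * φ 1 = b * φ 1 * φ r
      rw [mul_assoc, mul_assoc, mul_map_one, map_one_mul]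
  let D₀ : leftIdeal φ ⊗[K] M.carrier →ₗ[K] (ℤ →₀ IndCarrier φ M.carrier) :=
    TensorProduct.lift (D.comp ((leftIdeal φ).subtype.restrictScalars K))
  have hD₀ : ∀ z ∈ balanced φ M.carrier, ∀ c : A', D₀ (c • z) = 0 := by
    intro z hz
    unfold balanced at hz
    induction hz using Submodule.span_induction with
    | mem z hz =>
      obtain ⟨b, r, x, rfl⟩ := hz
      intro c
      rw [smul_sub, TensorProduct.smul_tmul', TensorProduct.smul_tmul', map_sub, sub_eq_zero]
      change D (c * (b.1 * φ r)) x = D (c * b.1) (r • x)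
      rw [← mul_assoc, key]
    | zero => simp
    | add y z _ _ hy hz =>
      intro c
      rw [smul_add, map_add, hy, hz, add_zero]
    | smul c' z _ hz =>
      intro c
      rw [← mul_smul, hz]
  let D₁ : IndCarrier φ M.carrier →ₗ[K] (ℤ →₀ IndCarrier φ M.carrier) :=
    (((balanced φ M.carrier).restrictScalars K).liftQ D₀ (fun z hz => by
      have := hD₀ z hz 1
      rwa [one_smul] at this)).comp
      (Submodule.Quotient.restrictScalarsEquiv K (balanced φ M.carrier)).symm.toLinearMap
  have hD₁ : ∀ (b : leftIdeal φ) (x : M.carrier), D₁ (indMk φ M.carrier b x) = D b.1 x :=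
    fun b x => rfl
  have main : ∀ (b : A') (x : M.carrier), indMk₂ φ M.carrier b x ∈ ⨆ d, indGr φ 𝒜' M d := by
    intro b x
    have hb : b ∈ ⨆ d, 𝒜' d := by rw [hA']; trivial
    have hx : x ∈ ⨆ d, M.gr d := by rw [iSup_gr]; trivial
    induction hb using Submodule.iSup_induction' with
    | zero => simp
    | add b c _ _ hb hc =>
      rw [map_add, LinearMap.add_apply]
      exact Submodule.add_mem _ hb hc
    | mem p b hb =>
    induction hx using Submodule.iSup_induction' with
    | zero => simp
    | add x y _ _ hx hy =>
      rw [map_add]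
      exact Submodule.add_mem _ hx hy
    | mem q x hx =>
      exact Submodule.mem_iSup_of_mem (p + q) (Submodule.subset_span
        ⟨p, q, _, x, rfl, hproj hb, hx, rfl⟩)
  refine isInternal_of_component _ D₁ ?_ ?_
  · intro d y hy
    unfold indGr at hy
    induction hy using Submodule.span_induction with
    | mem y hy =>
      obtain ⟨k, l, b, x, rfl, hb, hx, rfl⟩ := hy
      rw [hD₁, hD hb hx, leftIdeal.proj_coe]
    | zero => simp
    | add y z _ _ hy hz => rw [map_add, hy, hz, Finsupp.single_add]
    | smul c y _ hy => rw [map_smul, hy, Finsupp.smul_single]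
  · rw [eq_top_iff]
    intro y _
    obtain ⟨z, rfl⟩ := (balanced φ M.carrier).mkQ_surjective y
    induction z using TensorProduct.induction_on with
    | zero => simp
    | add y z hy hz =>
      rw [map_add]
      exact Submodule.add_mem _ (hy trivial) (hz trivial)
    | tmul b x =>
      change indMk φ M.carrier b x ∈ _
      rw [← leftIdeal.proj_coe φ b, ← indMk₂_apply]
      exact main b.1 x

/-- The graded `A'`-module `A'e ⊗_A M`, where `e = φ(1)`. -/
def indObj [GradedAlgebra 𝒜] [GradedAlgebra 𝒜'] (M : GrMod 𝒜) : GrMod 𝒜' where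
  carrier := IndCarrier φ M.carrier
  gr := indGr φ 𝒜' M
  isInternal := indGr_isInternal φ hφ M
  smul_mem {m n r y} hr hy := by
    unfold indGr at hy
    induction hy using Submodule.span_induction with
    | mem y hy =>
      obtain ⟨k, l, b, x, rfl, hb, hx, rfl⟩ := hy
      refine Submodule.subset_span ⟨m + k, l, r • b, x, add_assoc _ _ _,
        SetLike.GradedMul.mul_mem hr hb, hx, ?_⟩
      unfold indMk
      rw [← map_smul, TensorProduct.smul_tmul']
    | zero => rw [smul_zero]; exact Submodule.zero_mem _
    | add y z _ _ hy hz => rw [smul_add]; exact Submodule.add_mem _ hy hz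
    | smul c y _ hy => rw [smul_comm]; exact Submodule.smul_mem _ c hy

/-- The map `A'e ⊗_A M → A'e ⊗_A N` induced by an `A`-linear map. -/
def indMap {M N : GrMod 𝒜} (f : M.carrier →ₗ[A] N.carrier) :
    IndCarrier φ M.carrier →ₗ[A'] IndCarrier φ N.carrier :=
  (balanced φ M.carrier).mapQ (balanced φ N.carrier)
    (TensorProduct.AlgebraTensorModule.map LinearMap.id (f.restrictScalars K)) (by
      unfold balanced
      rw [Submodule.span_le]
      rintro _ ⟨b, r, x, rfl⟩
      refine Submodule.subset_span ⟨b, r, f x, ?_⟩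
      simp)

theorem indMap_mk {M N : GrMod 𝒜} (f : M.carrier →ₗ[A] N.carrier) (b : leftIdeal φ)
    (x : M.carrier) :
    indMap φ f (indMk φ M.carrier b x) = indMk φ N.carrier b (f x) := rfl

theorem ind_ext {M : GrMod 𝒜} {V : Type*} [AddCommGroup V] [Module A' V]
    {f g : IndCarrier φ M.carrier →ₗ[A'] V}
    (h : ∀ b x, f (indMk φ M.carrier b x) = g (indMk φ M.carrier b x)) : f = g := by
  refine LinearMap.ext fun y => ?_
  obtain ⟨z, rfl⟩ := (balanced φ M.carrier).mkQ_surjective y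
  induction z using TensorProduct.induction_on with
  | zero => simp
  | add y z hy hz => rw [map_add, map_add, map_add, hy, hz]
  | tmul b x => exact h b x

theorem indMap_mem {M N : GrMod 𝒜} (f : M ⟶ N) {n : ℤ} {y : IndCarrier φ M.carrier}
    (hy : y ∈ indGr φ 𝒜' M n) : indMap φ f.toLin y ∈ indGr φ 𝒜' N n := by
  unfold indGr at hy
  induction hy using Submodule.span_induction with
  | mem y hy =>
    obtain ⟨k, l, b, x, h, hb, hx, rfl⟩ := hy
    exact Submodule.subset_span ⟨k, l, b, f.toLin x, h, hb, f.map_mem hx, rfl⟩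
  | zero => rw [map_zero]; exact Submodule.zero_mem _
  | add y z _ _ hy hz => rw [map_add]; exact Submodule.add_mem _ hy hz
  | smul c y _ hy =>
    rw [LinearMap.map_smul_of_tower]
    exact Submodule.smul_mem _ c hy

/-- The functor `M ↦ A'e ⊗_A M` from graded `A`-modules to graded `A'`-modules,
where `e = φ(1)`. -/
def ind [GradedAlgebra 𝒜] [GradedAlgebra 𝒜'] : GrMod 𝒜 ⥤ GrMod 𝒜' where
  obj := indObj φ hφ
  map f := ⟨indMap φ f.toLin, indMap_mem φ f⟩
  map_id _ := hom_ext (ind_ext φ fun _ _ => rfl)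
  map_comp _ _ := hom_ext (ind_ext φ fun _ _ => rfl)

end ChangeOfRings
end GrMod
end GradedModules

/-- A Borcherds–Cartan datum: a symmetrizable Borcherds–Cartan matrix `a`, a weight lattice `P`,
simple roots `α`, simple coroots `h` in the dual lattice, and a symmetric bilinear form on `P`. -/
structure BorcherdsCartanDatum (I : Type v) where
  /-- The Borcherds–Cartan matrix. -/
  a : I → I → ℤ
  a_diag : ∀ i, a i i = 2 ∨ (a i i ≤ 0 ∧ Even (a i i))
  a_offDiag : ∀ i j, i ≠ j → a i j ≤ 0
  /-- The symmetrizing diagonal matrix. -/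
  r : I → ℤ
  r_pos : ∀ i, 0 < r i
  r_symm : ∀ i j, r i * a i j = r j * a j i
  /-- The weight lattice. -/
  P : Type w
  [addCommGroup : AddCommGroup P]
  [free : Module.Free ℤ P]
  /-- The simple roots. -/
  α : I → P
  /-- The simple coroots. -/
  h : I → Module.Dual ℤ P
  /-- The symmetric bilinear form. -/
  form : LinearMap.BilinForm ℤ P
  form_symm : ∀ x y, form x y = form y x
  h_α : ∀ i j, h i (α j) = a i j
  form_α : ∀ (x : P) (i : I), form x (α i) = r i * h i x

/-- The set `Seq(ν)` of sequences `i₁ i₂ ⋯ iₙ` in `I` with `i₁ + ⋯ + iₙ = ν`, where `n = ht(ν)`.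
Positions are numbered from `0`. -/
@[ext] structure SeqOf {I : Type v} (ν : I →₀ ℕ) : Type v where
  /-- The entry in a given position. -/
  col : Fin ν.degree → I
  sum_eq : ∑ k, Finsupp.single (col k) 1 = ν

namespace SeqOf

variable {I : Type v} {ν : I →₀ ℕ}

instance : Finite (SeqOf ν) := by
  have hmem : ∀ (s : SeqOf ν) (k : Fin ν.degree), s.col k ∈ ν.support := by
    intro s k
    rw [Finsupp.mem_support_iff]
    have h1 : Finsupp.single (s.col k) 1 ≤ ν := by
      conv_rhs => rw [← s.sum_eq]
      exact Finset.single_le_sum (f := fun k => Finsupp.single (s.col k) 1)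
        (fun _ _ => zero_le) (Finset.mem_univ k)
    have h2 := h1 (s.col k)
    rw [Finsupp.single_eq_same] at h2
    omega
  refine Finite.of_injective (β := Fin ν.degree → ν.support)
    (fun s k => ⟨s.col k, hmem s k⟩) ?_
  intro s s' h
  ext k
  exact congrArg Subtype.val (congrFun h k)

instance : Fintype (SeqOf ν) := Fintype.ofFinite _

/-- The action of the simple transposition exchanging the positions `k` and `k + 1`. -/
def swap (s : SeqOf ν) (k : ℕ) (hk : k + 1 < ν.degree) : SeqOf ν :=
  ⟨s.col ∘ Equiv.swap ⟨k, by omega⟩ ⟨k + 1, hk⟩,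
    (Equiv.sum_comp _ (fun k => Finsupp.single (s.col k) 1)).trans s.sum_eq⟩

@[simp] theorem swap_left (s : SeqOf ν) (k : ℕ) (hk : k + 1 < ν.degree) (h : k < ν.degree) :
    (s.swap k hk).col ⟨k, h⟩ = s.col ⟨k + 1, hk⟩ := by
  simp [swap]

@[simp] theorem swap_right (s : SeqOf ν) (k : ℕ) (hk : k + 1 < ν.degree) :
    (s.swap k hk).col ⟨k + 1, hk⟩ = s.col ⟨k, by omega⟩ := by
  simp [swap]

theorem swap_of_ne (s : SeqOf ν) (k : ℕ) (hk : k + 1 < ν.degree) (l : Fin ν.degree)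
    (h : l.1 ≠ k) (h' : l.1 ≠ k + 1) : (s.swap k hk).col l = s.col l := by
  simp only [swap, Function.comp_apply]
  rw [Equiv.swap_apply_of_ne_of_ne] <;> simpa [Fin.ext_iff]

end SeqOf

/-- The generators of the algebra attached to `ν`: the idempotents `e s`, the dots `x k s` on the
strand in position `k`, and the crossings `t k s` of the strands in the positions `k` and `k + 1`,
where `s` is the sequence at the bottom of the diagram. -/
inductive Gen {I : Type v} (ν : I →₀ ℕ) : Type v
  | e (s : SeqOf ν) : Gen ν
  | x (k : Fin ν.degree) (s : SeqOf ν) : Gen ν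
  | t (k : ℕ) (hk : k + 1 < ν.degree) (s : SeqOf ν) : Gen ν

namespace BorcherdsCartanDatum

attribute [instance] addCommGroup free

variable {I : Type v} (D : BorcherdsCartanDatum.{v, w} I)

/-- Dominant integral weights. -/
def IsDominant (lam : D.P) : Prop := ∀ i, 0 ≤ D.h i lam

/-- The element `∑ᵢ νᵢ αᵢ` of the weight lattice. -/
def root (ν : I →₀ ℕ) : D.P := ν.sum fun i m => m • D.α i

/-- The degrees of the generators. -/
def genDeg {ν : I →₀ ℕ} : Gen ν → ℤ
  | .e _ => 0
  | .x k s => 2 * D.r (s.col k)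
  | .t k hk s => -D.form (D.α (s.col ⟨k, by omega⟩)) (D.α (s.col ⟨k + 1, hk⟩))

section Relations

variable (K : Type u) [Field K] {ν : I →₀ ℕ}

/-- The free generator `e s`. -/
abbrev fe (s : SeqOf ν) : FreeAlgebra K (Gen ν) := FreeAlgebra.ι K (.e s)

/-- The free generator `x k s`. -/
abbrev fx (k : ℕ) (hk : k < ν.degree) (s : SeqOf ν) : FreeAlgebra K (Gen ν) :=
  FreeAlgebra.ι K (.x ⟨k, hk⟩ s)

/-- The free generator `t k s`. -/
abbrev ft (k : ℕ) (hk : k + 1 < ν.degree) (s : SeqOf ν) : FreeAlgebra K (Gen ν) :=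
  FreeAlgebra.ι K (.t k hk s)

variable (ν)

/-- The defining relations of `𝓡(ν)`. A product `y * z` is the diagram `y` on top of `z`. -/
inductive Rel : FreeAlgebra K (Gen ν) → FreeAlgebra K (Gen ν) → Prop
  | sum_e : Rel (∑ s, fe K s) 1
  | e_mul_self (s : SeqOf ν) : Rel (fe K s * fe K s) (fe K s)
  | e_mul_of_ne (s s' : SeqOf ν) (h : s ≠ s') : Rel (fe K s * fe K s') 0
  | e_mul_x (k : ℕ) (hk : k < ν.degree) (s : SeqOf ν) : Rel (fe K s * fx K k hk s) (fx K k hk s)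
  | x_mul_e (k : ℕ) (hk : k < ν.degree) (s : SeqOf ν) : Rel (fx K k hk s * fe K s) (fx K k hk s)
  | e_mul_t (k : ℕ) (hk : k + 1 < ν.degree) (s : SeqOf ν) :
      Rel (fe K (s.swap k hk) * ft K k hk s) (ft K k hk s)
  | t_mul_e (k : ℕ) (hk : k + 1 < ν.degree) (s : SeqOf ν) :
      Rel (ft K k hk s * fe K s) (ft K k hk s)
  | x_mul_x (k l : ℕ) (hk : k < ν.degree) (hl : l < ν.degree) (s : SeqOf ν) :
      Rel (fx K k hk s * fx K l hl s) (fx K l hl s * fx K k hk s)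
  | x_mul_t (k l : ℕ) (hk : k + 1 < ν.degree) (hl : l < ν.degree) (s : SeqOf ν) (h : l ≠ k)
      (h' : l ≠ k + 1) :
      Rel (fx K l hl (s.swap k hk) * ft K k hk s) (ft K k hk s * fx K l hl s)
  | t_mul_t (k l : ℕ) (hk : k + 1 < ν.degree) (hl : l + 1 < ν.degree) (s : SeqOf ν) (h : k + 1 < l) :
      Rel (ft K l hl (s.swap k hk) * ft K k hk s) (ft K k hk (s.swap l hl) * ft K l hl s)
  /- Two consecutive crossings of strands of colours `i`, `j`. -/
  | t_sq_real (k : ℕ) (hk : k + 1 < ν.degree) (s : SeqOf ν) (i : I)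
      (hi : s.col ⟨k, by omega⟩ = i) (hj : s.col ⟨k + 1, hk⟩ = i) (h : D.a i i = 2) :
      Rel (ft K k hk (s.swap k hk) * ft K k hk s) 0
  | t_sq_neg (k : ℕ) (hk : k + 1 < ν.degree) (s : SeqOf ν) (i : I)
      (hi : s.col ⟨k, by omega⟩ = i) (hj : s.col ⟨k + 1, hk⟩ = i) (h : D.form (D.α i) (D.α i) < 0) :
      Rel (ft K k hk (s.swap k hk) * ft K k hk s)
        ((fx K k (by omega) s ^ (-D.a i i / 2).toNat +
          fx K (k + 1) hk s ^ (-D.a i i / 2).toNat) ^ 2 * fe K s)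
  | t_sq_zero (k : ℕ) (hk : k + 1 < ν.degree) (s : SeqOf ν) (i j : I)
      (hi : s.col ⟨k, by omega⟩ = i) (hj : s.col ⟨k + 1, hk⟩ = j) (h : D.form (D.α i) (D.α j) = 0) :
      Rel (ft K k hk (s.swap k hk) * ft K k hk s) (fe K s)
  | t_sq_ne (k : ℕ) (hk : k + 1 < ν.degree) (s : SeqOf ν) (i j : I)
      (hi : s.col ⟨k, by omega⟩ = i) (hj : s.col ⟨k + 1, hk⟩ = j) (hij : i ≠ j)
      (h : D.form (D.α i) (D.α j) ≠ 0) :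
      Rel (ft K k hk (s.swap k hk) * ft K k hk s)
        ((fx K k (by omega) s ^ (-D.a i j).toNat + fx K (k + 1) hk s ^ (-D.a j i).toNat) * fe K s)
  /- A dot moving through a crossing. -/
  | x_mul_t_real (k : ℕ) (hk : k + 1 < ν.degree) (s : SeqOf ν) (i : I)
      (hi : s.col ⟨k, by omega⟩ = i) (hj : s.col ⟨k + 1, hk⟩ = i) (h : D.a i i = 2) :
      Rel (fx K k (by omega) (s.swap k hk) * ft K k hk s - ft K k hk s * fx K (k + 1) hk s)
        (fe K s)
  | t_mul_x_real (k : ℕ) (hk : k + 1 < ν.degree) (s : SeqOf ν) (i : I)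
      (hi : s.col ⟨k, by omega⟩ = i) (hj : s.col ⟨k + 1, hk⟩ = i) (h : D.a i i = 2) :
      Rel (ft K k hk s * fx K k (by omega) s - fx K (k + 1) hk (s.swap k hk) * ft K k hk s)
        (fe K s)
  | x_mul_t_other (k : ℕ) (hk : k + 1 < ν.degree) (s : SeqOf ν) (i j : I)
      (hi : s.col ⟨k, by omega⟩ = i) (hj : s.col ⟨k + 1, hk⟩ = j) (h : ¬(i = j ∧ D.a i i = 2)) :
      Rel (fx K k (by omega) (s.swap k hk) * ft K k hk s) (ft K k hk s * fx K (k + 1) hk s)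
  | t_mul_x_other (k : ℕ) (hk : k + 1 < ν.degree) (s : SeqOf ν) (i j : I)
      (hi : s.col ⟨k, by omega⟩ = i) (hj : s.col ⟨k + 1, hk⟩ = j) (h : ¬(i = j ∧ D.a i i = 2)) :
      Rel (ft K k hk s * fx K k (by omega) s) (fx K (k + 1) hk (s.swap k hk) * ft K k hk s)
  /- The braid relations for strands of colours `i`, `j`, `m`. -/
  | braid_real (k : ℕ) (hk : k + 1 < ν.degree) (hk' : k + 1 + 1 < ν.degree) (s : SeqOf ν) (i j : I)
      (hi : s.col ⟨k, by omega⟩ = i) (hj : s.col ⟨k + 1, hk⟩ = j) (hm : s.col ⟨k + 1 + 1, hk'⟩ = i)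
      (h : D.a i i = 2) (hij : i ≠ j) (h' : D.form (D.α i) (D.α j) ≠ 0) :
      Rel (ft K k hk ((s.swap k hk).swap (k + 1) hk') * ft K (k + 1) hk' (s.swap k hk) *
            ft K k hk s -
          ft K (k + 1) hk' ((s.swap (k + 1) hk').swap k hk) * ft K k hk (s.swap (k + 1) hk') *
            ft K (k + 1) hk' s)
        (∑ c ∈ Finset.range (-D.a i j).toNat, fx K k (by omega) s ^ c *
          fx K (k + 1 + 1) hk' s ^ ((-D.a i j).toNat - 1 - c) * fe K s)
  | braid_other (k : ℕ) (hk : k + 1 < ν.degree) (hk' : k + 1 + 1 < ν.degree) (s : SeqOf ν)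
      (i j m : I) (hi : s.col ⟨k, by omega⟩ = i) (hj : s.col ⟨k + 1, hk⟩ = j)
      (hm : s.col ⟨k + 1 + 1, hk'⟩ = m)
      (h : ¬(i = m ∧ D.a i i = 2 ∧ i ≠ j ∧ D.form (D.α i) (D.α j) ≠ 0)) :
      Rel (ft K k hk ((s.swap k hk).swap (k + 1) hk') * ft K (k + 1) hk' (s.swap k hk) *
            ft K k hk s)
        (ft K (k + 1) hk' ((s.swap (k + 1) hk').swap k hk) * ft K k hk (s.swap (k + 1) hk') *
            ft K (k + 1) hk' s)

/-- The algebra `𝓡(ν)`. -/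
abbrev KLR : Type (max u v) := RingQuot (D.Rel K ν)

variable {ν}

/-- The generators of `𝓡(ν)`. -/
def klrGen (g : Gen ν) : D.KLR K ν := RingQuot.mkAlgHom K (D.Rel K ν) (FreeAlgebra.ι K g)

variable (ν)

/-- The cyclotomic relations `x₁ ^ λ(h_{i₁}) = 0` on the strands with bottom sequence `i₁ ⋯ iₙ`. -/
inductive CycRel (lam : D.P) : D.KLR K ν → D.KLR K ν → Prop
  | x_pow (s : SeqOf ν) (h0 : 0 < ν.degree) :
      CycRel lam (D.klrGen K (.x ⟨0, h0⟩ s) ^ (D.h (s.col ⟨0, h0⟩) lam).toNat * D.klrGen K (.e s)) 0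

/-- The cyclotomic quotient `𝓡^λ(ν)`, by the two-sided ideal generated by the cyclotomic
relations. -/
def Cyc (lam : D.P) : Type (max u v) := RingQuot (D.CycRel K ν lam)

instance (lam : D.P) : Ring (D.Cyc K ν lam) := inferInstanceAs (Ring (RingQuot (D.CycRel K ν lam)))

instance (lam : D.P) : Algebra K (D.Cyc K ν lam) :=
  inferInstanceAs (Algebra K (RingQuot (D.CycRel K ν lam)))

/-- The quotient map `𝓡(ν) → 𝓡^λ(ν)`. -/
def cycProj (lam : D.P) : D.KLR K ν →ₐ[K] D.Cyc K ν lam :=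
  RingQuot.mkAlgHom K (D.CycRel K ν lam)

theorem cycProj_rel (lam : D.P) {y z : D.KLR K ν} (h : D.CycRel K ν lam y z) :
    D.cycProj K ν lam y = D.cycProj K ν lam z :=
  RingQuot.mkAlgHom_rel K h

/-- The universal property of `𝓡^λ(ν)`. -/
def cycLift (lam : D.P) {B : Type*} [Ring B] [Algebra K B] (f : D.KLR K ν →ₐ[K] B)
    (hf : ∀ ⦃y z⦄, D.CycRel K ν lam y z → f y = f z) : D.Cyc K ν lam →ₐ[K] B :=
  RingQuot.liftAlgHom K ⟨f, hf⟩

theorem cycLift_cycProj (lam : D.P) {B : Type*} [Ring B] [Algebra K B] (f : D.KLR K ν →ₐ[K] B)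
    (hf : ∀ ⦃y z⦄, D.CycRel K ν lam y z → f y = f z) (y : D.KLR K ν) :
    D.cycLift K ν lam f hf (D.cycProj K ν lam y) = f y :=
  RingQuot.liftAlgHom_mkAlgHom_apply K f hf y

variable {ν}

/-- The images of the generators in `𝓡^λ(ν)`. -/
def cycGen (lam : D.P) (g : Gen ν) : D.Cyc K ν lam := D.cycProj K ν lam (D.klrGen K g)

variable (ν)

/-- The `ℤ`-grading of `𝓡^λ(ν)`. -/
def cycGrading (lam : D.P) : ℤ → Submodule K (D.Cyc K ν lam) :=
  monomialGrading (D.cycGen K lam) D.genDeg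

end Relations
end BorcherdsCartanDatum

namespace BorcherdsCartanDatum

variable {I : Type v} (D : BorcherdsCartanDatum.{v, w} I)

theorem form_α_α (i j : I) : D.form (D.α i) (D.α j) = D.r j * D.a j i := by
  rw [D.form_α, D.h_α]

theorem toNat_a (i j : I) (h : i ≠ j) : ((-D.a i j).toNat : ℤ) = -D.a i j :=
  Int.toNat_of_nonneg (by have := D.a_offDiag i j h; omega)

section Grading

variable (K : Type u) [Field K] (ν : I →₀ ℕ)

theorem rel_homogeneous (y z : FreeAlgebra K (Gen ν)) (h : D.Rel K ν y z) :
    ∃ d, y ∈ monomialGrading (K := K) (FreeAlgebra.ι K) D.genDeg d ∧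
      z ∈ monomialGrading (K := K) (FreeAlgebra.ι K) D.genDeg d := by
  have he : ∀ s : SeqOf ν, fe K s ∈ monomialGrading (K := K) (FreeAlgebra.ι K) D.genDeg 0 :=
    fun s => monomialGrading.gen_mem (deg := D.genDeg) (Gen.e s)
  have hx : ∀ (k : ℕ) (hk : k < ν.degree) (s : SeqOf ν) (i : I), s.col ⟨k, hk⟩ = i →
      fx K k hk s ∈ monomialGrading (K := K) (FreeAlgebra.ι K) D.genDeg (2 * D.r i) := by
    rintro k hk s i rfl
    exact monomialGrading.gen_mem (deg := D.genDeg) (Gen.x ⟨k, hk⟩ s)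
  have ht : ∀ (k : ℕ) (hk : k + 1 < ν.degree) (s : SeqOf ν) (i j : I),
      s.col ⟨k, by omega⟩ = i → s.col ⟨k + 1, hk⟩ = j →
      ft K k hk s ∈ monomialGrading (K := K) (FreeAlgebra.ι K) D.genDeg
        (-D.form (D.α i) (D.α j)) := by
    rintro k hk s i j rfl rfl
    exact monomialGrading.gen_mem (deg := D.genDeg) (Gen.t k hk s)
  have mm : ∀ {m n d : ℤ} {y z : FreeAlgebra K (Gen ν)},
      y ∈ monomialGrading (K := K) (FreeAlgebra.ι K) D.genDeg m →
      z ∈ monomialGrading (K := K) (FreeAlgebra.ι K) D.genDeg n → m + n = d →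
      y * z ∈ monomialGrading (K := K) (FreeAlgebra.ι K) D.genDeg d :=
    fun hy hz h => monomialGrading.mul_mem' hy hz h
  have tt : ∀ (k : ℕ) (hk : k + 1 < ν.degree) (s : SeqOf ν) (i j : I),
      s.col ⟨k, by omega⟩ = i → s.col ⟨k + 1, hk⟩ = j →
      ft K k hk (s.swap k hk) * ft K k hk s ∈ monomialGrading (K := K) (FreeAlgebra.ι K) D.genDeg
        (-2 * D.form (D.α i) (D.α j)) := by
    intro k hk s i j hi hj
    refine mm (ht k hk _ j i (by simpa) (by simpa)) (ht k hk s i j hi hj) ?_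
    rw [D.form_symm (D.α j)]
    ring
  have pw : ∀ {m d : ℤ} {y : FreeAlgebra K (Gen ν)} (n : ℕ),
      y ∈ monomialGrading (K := K) (FreeAlgebra.ι K) D.genDeg m → n * m = d →
      y ^ n ∈ monomialGrading (K := K) (FreeAlgebra.ι K) D.genDeg d :=
    fun n hy h => h ▸ monomialGrading.pow_mem hy n
  have xt : ∀ (k l l' : ℕ) (hk : k + 1 < ν.degree) (hl : l < ν.degree) (hl' : l' < ν.degree)
      (s : SeqOf ν) (i j m : I), s.col ⟨k, by omega⟩ = i → s.col ⟨k + 1, hk⟩ = j →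
      s.col ⟨l', hl'⟩ = m → (s.swap k hk).col ⟨l, hl⟩ = m →
      fx K l hl (s.swap k hk) * ft K k hk s ∈ monomialGrading (K := K) (FreeAlgebra.ι K) D.genDeg
        (2 * D.r m - D.form (D.α i) (D.α j)) ∧
      ft K k hk s * fx K l' hl' s ∈ monomialGrading (K := K) (FreeAlgebra.ι K) D.genDeg
        (2 * D.r m - D.form (D.α i) (D.α j)) := by
    intro k l l' hk hl hl' s i j m hi hj hm hm'
    exact ⟨mm (hx l hl _ m hm') (ht k hk s i j hi hj) (by ring),
      mm (ht k hk s i j hi hj) (hx l' hl' s m hm) (by ring)⟩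
  have braid : ∀ (k : ℕ) (hk : k + 1 < ν.degree) (hk' : k + 1 + 1 < ν.degree) (s : SeqOf ν)
      (i j m : I), s.col ⟨k, by omega⟩ = i → s.col ⟨k + 1, hk⟩ = j →
      s.col ⟨k + 1 + 1, hk'⟩ = m →
      ft K k hk ((s.swap k hk).swap (k + 1) hk') * ft K (k + 1) hk' (s.swap k hk) *
        ft K k hk s ∈ monomialGrading (K := K) (FreeAlgebra.ι K) D.genDeg
        (-D.form (D.α i) (D.α j) - D.form (D.α i) (D.α m) - D.form (D.α j) (D.α m)) ∧
      ft K (k + 1) hk' ((s.swap (k + 1) hk').swap k hk) * ft K k hk (s.swap (k + 1) hk') *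
        ft K (k + 1) hk' s ∈ monomialGrading (K := K) (FreeAlgebra.ι K) D.genDeg
        (-D.form (D.α i) (D.α j) - D.form (D.α i) (D.α m) - D.form (D.α j) (D.α m)) := by
    intro k hk hk' s i j m hi hj hm
    have e1 : (s.swap k hk).col ⟨k + 1 + 1, hk'⟩ = m := by
      rw [SeqOf.swap_of_ne _ _ _ _ (by simp only []; omega) (by simp only []; omega), hm]
    have e2 : (s.swap (k + 1) hk').col ⟨k, by omega⟩ = i := by
      rw [SeqOf.swap_of_ne _ _ _ _ (by simp only []; omega) (by simp only []; omega), hi]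
    have e3 : ((s.swap k hk).swap (k + 1) hk').col ⟨k, by omega⟩ = j := by
      rw [SeqOf.swap_of_ne _ _ _ _ (by simp only []; omega) (by simp only []; omega)]
      simpa
    have e4 : ((s.swap (k + 1) hk').swap k hk).col ⟨k + 1 + 1, hk'⟩ = j := by
      rw [SeqOf.swap_of_ne _ _ _ _ (by simp only []; omega) (by simp only []; omega)]
      simpa
    constructor
    · exact mm (mm (ht k hk _ j m e3 (by simpa)) (ht (k + 1) hk' _ i m (by simpa) e1) rfl)
        (ht k hk s i j hi hj) (by ring)
    · exact mm (mm (ht (k + 1) hk' _ i j (by simpa) e4) (ht k hk _ i m e2 (by simpa)) rfl)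
        (ht (k + 1) hk' s j m hj hm) (by ring)
  cases h with
  | sum_e => exact ⟨0, Submodule.sum_mem _ fun s _ => he s, monomialGrading.one_mem⟩
  | e_mul_self s => exact ⟨0, mm (he s) (he s) (by ring), he s⟩
  | e_mul_of_ne s s' h => exact ⟨0, mm (he s) (he s') (by ring), Submodule.zero_mem _⟩
  | e_mul_x k hk s => exact ⟨_, mm (he s) (hx k hk s _ rfl) (by ring), hx k hk s _ rfl⟩
  | x_mul_e k hk s => exact ⟨_, mm (hx k hk s _ rfl) (he s) (by ring), hx k hk s _ rfl⟩
  | e_mul_t k hk s => exact ⟨_, mm (he _) (ht k hk s _ _ rfl rfl) (by ring), ht k hk s _ _ rfl rfl⟩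
  | t_mul_e k hk s => exact ⟨_, mm (ht k hk s _ _ rfl rfl) (he s) (by ring), ht k hk s _ _ rfl rfl⟩
  | x_mul_x k l hk hl s =>
    exact ⟨_, mm (hx k hk s _ rfl) (hx l hl s _ rfl) rfl,
      mm (hx l hl s _ rfl) (hx k hk s _ rfl) (by ring)⟩
  | x_mul_t k l hk hl s h h' =>
    exact ⟨_, xt k l l hk hl hl s _ _ _ rfl rfl rfl (SeqOf.swap_of_ne _ _ _ _ h h')⟩
  | t_mul_t k l hk hl s h =>
    refine ⟨_, mm (ht l hl _ (s.col ⟨l, by omega⟩) (s.col ⟨l + 1, hl⟩)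
      (SeqOf.swap_of_ne _ _ _ _ ?_ ?_) (SeqOf.swap_of_ne _ _ _ _ ?_ ?_))
      (ht k hk s _ _ rfl rfl) rfl,
      mm (ht k hk _ (s.col ⟨k, by omega⟩) (s.col ⟨k + 1, hk⟩)
      (SeqOf.swap_of_ne _ _ _ _ ?_ ?_) (SeqOf.swap_of_ne _ _ _ _ ?_ ?_))
      (ht l hl s _ _ rfl rfl) (add_comm _ _)⟩ <;> simp only [] <;> omega
  | t_sq_real k hk s i hi hj h => exact ⟨_, tt k hk s i i hi hj, Submodule.zero_mem _⟩
  | t_sq_neg k hk s i hi hj h =>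
    have hr := D.r_pos i
    have ha : D.a i i ≠ 2 := by
      intro ha
      rw [form_α_α, ha] at h
      omega
    obtain ⟨hle, c, hc⟩ := (D.a_diag i).resolve_left ha
    have hn : ((-D.a i i / 2).toNat : ℤ) = -c := by omega
    have e : ((-D.a i i / 2).toNat : ℤ) * (2 * D.r i) = -D.form (D.α i) (D.α i) := by
      rw [hn, form_α_α, hc]
      ring
    refine ⟨_, tt k hk s i i hi hj, mm (pw 2 (Submodule.add_mem _ (pw _ (hx _ _ s i hi) e)
      (pw _ (hx _ _ s i hj) e)) rfl) (he s) ?_⟩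
    push_cast
    ring
  | t_sq_zero k hk s i j hi hj h =>
    refine ⟨0, ?_, he s⟩
    have := tt k hk s i j hi hj
    rwa [h, mul_zero] at this
  | t_sq_ne k hk s i j hi hj hij h =>
    refine ⟨_, tt k hk s i j hi hj, mm (Submodule.add_mem _ (pw _ (hx _ _ s i hi) ?_)
      (pw _ (hx _ _ s j hj) rfl)) (he s) ?_⟩
    · rw [D.toNat_a i j hij, D.toNat_a j i hij.symm]
      linear_combination -2 * D.r_symm i j
    · rw [D.toNat_a j i hij.symm, form_α_α]
      ring
  | x_mul_t_real k hk s i hi hj h =>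
    obtain ⟨h1, h2⟩ := xt k k (k + 1) hk (by omega) hk s i i i hi hj hj (by simpa)
    refine ⟨0, ?_, he s⟩
    have := Submodule.sub_mem _ h1 h2
    rwa [form_α_α, h, mul_comm 2, sub_self] at this
  | t_mul_x_real k hk s i hi hj h =>
    obtain ⟨h1, h2⟩ := xt k (k + 1) k hk hk (by omega) s i i i hi hj hi (by simpa)
    refine ⟨0, ?_, he s⟩
    have := Submodule.sub_mem _ h2 h1
    rwa [form_α_α, h, mul_comm 2, sub_self] at this
  | x_mul_t_other k hk s i j hi hj h =>
    exact ⟨_, xt k k (k + 1) hk (by omega) hk s i j j hi hj hj (by simpa)⟩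
  | t_mul_x_other k hk s i j hi hj h =>
    exact ⟨_, (xt k (k + 1) k hk hk (by omega) s i j i hi hj hi (by simpa)).symm⟩
  | braid_real k hk hk' s i j hi hj hm h hij h' =>
    obtain ⟨h1, h2⟩ := braid k hk hk' s i j i hi hj hm
    refine ⟨_, Submodule.sub_mem _ h1 h2, Submodule.sum_mem _ fun c hc => ?_⟩
    rw [Finset.mem_range] at hc
    refine mm (mm (pw c (hx _ _ s i hi) rfl) (pw _ (hx _ _ s i hm) rfl) rfl) (he s) ?_
    have e : ((((-D.a i j).toNat - 1 - c : ℕ)) : ℤ) = -D.a i j - 1 - c := by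
      have := D.toNat_a i j hij
      omega
    rw [e, D.form_symm (D.α i) (D.α j), form_α_α D j i, form_α_α, h]
    ring
  | braid_other k hk hk' s i j m hi hj hm h => exact ⟨_, braid k hk hk' s i j m hi hj hm⟩

theorem klr_hasCoaction : monomialGrading.HasCoaction K (D.klrGen K (ν := ν)) D.genDeg :=
  monomialGrading.HasCoaction.ringQuot
    ⟨FreeAlgebra.lift K fun g => AddMonoidAlgebra.single (D.genDeg g) (FreeAlgebra.ι K g),
      fun g => FreeAlgebra.lift_ι_apply _ g⟩ _ (D.rel_homogeneous K ν)

theorem cyc_hasCoaction (lam : D.P) :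
    monomialGrading.HasCoaction K (D.cycGen K (ν := ν) lam) D.genDeg := by
  refine monomialGrading.HasCoaction.ringQuot (D.klr_hasCoaction K ν) _ ?_
  rintro _ _ ⟨s, h0⟩
  exact ⟨_, monomialGrading.mul_mem (monomialGrading.pow_mem (monomialGrading.gen_mem _) _)
    (monomialGrading.gen_mem _), Submodule.zero_mem _⟩

variable {ν} in
/-- The quotient map from the free algebra. -/
def cycMk (lam : D.P) : FreeAlgebra K (Gen ν) →ₐ[K] D.Cyc K ν lam :=
  (D.cycProj K ν lam).comp (RingQuot.mkAlgHom K (D.Rel K ν))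

theorem cycMk_surjective (lam : D.P) : Function.Surjective (D.cycMk K (ν := ν) lam) :=
  (RingQuot.mkAlgHom_surjective K _).comp (RingQuot.mkAlgHom_surjective K _)

theorem cycMk_ι (lam : D.P) (g : Gen ν) : D.cycMk K lam (FreeAlgebra.ι K g) = D.cycGen K lam g :=
  rfl

theorem cycMk_rel (lam : D.P) {y z : FreeAlgebra K (Gen ν)} (h : D.Rel K ν y z) :
    D.cycMk K lam y = D.cycMk K lam z :=
  congrArg (D.cycProj K ν lam) (RingQuot.mkAlgHom_rel K h)

theorem cycGen_adjoin (lam : D.P) :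
    Algebra.adjoin K (Set.range (D.cycGen K (ν := ν) lam)) = ⊤ := by
  have : Set.range (D.cycGen K (ν := ν) lam) =
      D.cycMk K (ν := ν) lam '' Set.range (FreeAlgebra.ι K) := by
    rw [← Set.range_comp]
    rfl
  rw [this, ← AlgHom.map_adjoin, FreeAlgebra.adjoin_range_ι, Algebra.map_top,
    AlgHom.range_eq_top]
  exact D.cycMk_surjective K ν lam

instance cycGradedAlgebra (lam : D.P) : GradedAlgebra (D.cycGrading K ν lam) :=
  monomialGrading.gradedAlgebra (D.cyc_hasCoaction K ν lam) (D.cycGen_adjoin K ν lam)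

end Grading
end BorcherdsCartanDatum

section Corner

variable {K : Type u} [Field K] {A : Type*} [Ring A] [Algebra K A] {e : A}
  (he : IsIdempotentElem e)

/-- The corner `eAe` is closed under scalars. -/
instance cornerSMul : SMul K he.Corner where
  smul c y := ⟨c • y.1, by
    obtain ⟨r, hr⟩ := y.2
    exact ⟨c • r, by rw [← hr]; simp⟩⟩

instance cornerModule : Module K he.Corner where
  one_smul y := Subtype.ext (one_smul K y.1)
  mul_smul c d y := Subtype.ext (mul_smul c d y.1)
  smul_zero c := Subtype.ext (smul_zero c)
  smul_add c y z := Subtype.ext (smul_add c y.1 z.1)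
  add_smul c d y := Subtype.ext (add_smul c d y.1)
  zero_smul y := Subtype.ext (zero_smul K y.1)

/-- The corner `eAe` is an algebra. -/
instance cornerAlgebra : Algebra K he.Corner :=
  Algebra.ofModule (fun c y z => Subtype.ext (smul_mul_assoc c y.1 z.1))
    (fun c y z => Subtype.ext (mul_smul_comm c y.1 z.1))

/-- The inclusion of the corner `eAe`, which does not preserve the unit. -/
def cornerIncl : he.Corner →ₙₐ[K] A where
  toFun y := y.1
  map_smul' _ _ := rfl
  map_zero' := rfl
  map_add' _ _ := rfl
  map_mul' _ _ := rfl

theorem corner_ext {y z : he.Corner} (h : cornerIncl (K := K) he y = cornerIncl (K := K) he z) :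
    y = z := Subtype.ext h

theorem cornerIncl_one : cornerIncl (K := K) he 1 = e := rfl

theorem idem_mul_cornerIncl (y : he.Corner) :
    e * cornerIncl (K := K) he y = cornerIncl (K := K) he y :=
  ((Subsemigroup.mem_corner_iff he).1 y.2).1

theorem cornerIncl_mul_idem (y : he.Corner) :
    cornerIncl (K := K) he y * e = cornerIncl (K := K) he y :=
  ((Subsemigroup.mem_corner_iff he).1 y.2).2

/-- An element of the corner `eAe`. -/
def cornerMk (y : A) (h₁ : e * y = y) (h₂ : y * e = y) : he.Corner :=
  ⟨y, (Subsemigroup.mem_corner_iff he).2 ⟨h₁, h₂⟩⟩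

theorem cornerIncl_mk (y : A) (h₁ : e * y = y) (h₂ : y * e = y) :
    cornerIncl (K := K) he (cornerMk he y h₁ h₂) = y := rfl

end Corner

section Append

variable {I : Type v} {ν ν' : I →₀ ℕ} {i : I}

theorem degree_of_add (h : ν + Finsupp.single i 1 = ν') : ν'.degree = ν.degree + 1 := by
  rw [← h, map_add, Finsupp.degree_single]

theorem sum_append {M : Type*} [AddCommMonoid M] {n n' : ℕ} (hn : n' = n + 1) (f : Fin n → M)
    (m : M) : (∑ k : Fin n', if hk : k.1 < n then f ⟨k.1, hk⟩ else m) = (∑ k, f k) + m := by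
  subst hn
  rw [Fin.sum_univ_castSucc]
  simp

namespace SeqOf

/-- The sequence `i₁ ⋯ iₙ i`. -/
def append (h : ν + Finsupp.single i 1 = ν') (s : SeqOf ν) : SeqOf ν' where
  col k := if hk : k.1 < ν.degree then s.col ⟨k.1, hk⟩ else i
  sum_eq := by
    refine Eq.trans ?_ ((sum_append (degree_of_add h) (fun k => Finsupp.single (s.col k) 1)
      (Finsupp.single i 1)).trans ((congrArg (· + Finsupp.single i 1) s.sum_eq).trans h))
    refine Finset.sum_congr rfl fun k _ => ?_
    split_ifs <;> rfl

theorem append_col (h : ν + Finsupp.single i 1 = ν') (s : SeqOf ν) (k : ℕ) (hk : k < ν.degree)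
    (hk' : k < ν'.degree) : (s.append h).col ⟨k, hk'⟩ = s.col ⟨k, hk⟩ := by
  simp [append, hk]

theorem append_injective (h : ν + Finsupp.single i 1 = ν') :
    Function.Injective (append (ν := ν) h) := by
  intro s s' hs
  ext k
  have := degree_of_add h
  rw [← append_col h s k.1 k.2 (by omega), ← append_col h s' k.1 k.2 (by omega), hs]

theorem append_swap (h : ν + Finsupp.single i 1 = ν') (s : SeqOf ν) (k : ℕ)
    (hk : k + 1 < ν.degree) (hk' : k + 1 < ν'.degree) :
    (s.append h).swap k hk' = (s.swap k hk).append h := by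
  ext ⟨l, hl⟩
  by_cases h1 : l = k
  · subst h1
    rw [swap_left, append_col h s _ hk, append_col h _ _ (by omega), swap_left]
  by_cases h2 : l = k + 1
  · subst h2
    rw [swap_right, append_col h s k (by omega), append_col h _ _ (by omega), swap_right]
  rw [swap_of_ne _ _ _ _ h1 h2]
  by_cases h3 : l < ν.degree
  · rw [append_col h s l h3, append_col h _ l h3, swap_of_ne _ _ _ _ h1 h2]
  · simp [append, h3]

end SeqOf

/-- Adding a vertical strand of colour `i` on the right of a generator. -/
def Gen.append (h : ν + Finsupp.single i 1 = ν') : Gen ν → Gen ν'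
  | .e s => .e (s.append h)
  | .x k s => .x ⟨k.1, by have := degree_of_add h; omega⟩ (s.append h)
  | .t k hk s => .t k (by have := degree_of_add h; omega) (s.append h)

end Append

namespace BorcherdsCartanDatum

variable {I : Type v} (D : BorcherdsCartanDatum.{v, w} I) (K : Type u) [Field K]
  {ν ν' : I →₀ ℕ} {i : I} (h : ν + Finsupp.single i 1 = ν') (lam : D.P)

theorem genDeg_append (g : Gen ν) : D.genDeg (g.append h) = D.genDeg g := by
  cases g with
  | e s => rfl
  | x k s => simp [Gen.append, genDeg, SeqOf.append_col]
  | t k hk s =>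
    simp only [Gen.append, genDeg]
    rw [SeqOf.append_col h s k (by omega), SeqOf.append_col h s (k + 1) hk]

/-- The idempotent `1_{ν,i} = ∑ 1_{i₁ ⋯ iₙ i}` of `𝓡^λ(ν + i)`. -/
def idem : D.Cyc K ν' lam := ∑ s : SeqOf ν, D.cycGen K lam (.e (s.append h))

theorem cycGen_e_mul_self (s : SeqOf ν) :
    D.cycGen K lam (.e s) * D.cycGen K lam (.e s) = D.cycGen K lam (.e s) := by
  simpa only [map_mul, cycMk_ι] using D.cycMk_rel K ν lam (.e_mul_self s)

theorem cycGen_e_mul_of_ne (s s' : SeqOf ν) (h : s ≠ s') :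
    D.cycGen K lam (.e s) * D.cycGen K lam (.e s') = 0 := by
  simpa only [map_mul, cycMk_ι, map_zero] using D.cycMk_rel K ν lam (.e_mul_of_ne s s' h)

theorem e_mul_idem (s : SeqOf ν) : D.cycGen K lam (.e (s.append h)) * D.idem K h lam =
    D.cycGen K lam (.e (s.append h)) := by
  rw [idem, Finset.mul_sum, Finset.sum_eq_single s, cycGen_e_mul_self]
  · intro s' _ hs
    exact D.cycGen_e_mul_of_ne K lam _ _ fun hh => hs (SeqOf.append_injective h hh).symm
  · simp

theorem idem_mul_e (s : SeqOf ν) : D.idem K h lam * D.cycGen K lam (.e (s.append h)) =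
    D.cycGen K lam (.e (s.append h)) := by
  rw [idem, Finset.sum_mul, Finset.sum_eq_single s, cycGen_e_mul_self]
  · intro s' _ hs
    exact D.cycGen_e_mul_of_ne K lam _ _ fun hh => hs (SeqOf.append_injective h hh)
  · simp

theorem idem_idem : IsIdempotentElem (D.idem K h lam) := by
  unfold IsIdempotentElem
  conv_lhs =>
    lhs
    rw [idem]
  rw [Finset.sum_mul, Finset.sum_congr rfl fun s _ => D.e_mul_idem K h lam s]
  rfl

theorem gen_mul_idem (g : Gen ν) : D.cycGen K lam (g.append h) * D.idem K h lam =
    D.cycGen K lam (g.append h) := by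
  cases g with
  | e s => exact D.e_mul_idem K h lam s
  | x k s =>
    have := D.cycMk_rel K ν' lam (.x_mul_e k.1 (by have := degree_of_add h; omega) (s.append h))
    simp only [map_mul, cycMk_ι] at this
    simp only [Gen.append]
    rw [← this, mul_assoc, e_mul_idem]
  | t k hk s =>
    have := D.cycMk_rel K ν' lam (.t_mul_e k (by have := degree_of_add h; omega) (s.append h))
    simp only [map_mul, cycMk_ι] at this
    simp only [Gen.append]
    rw [← this, mul_assoc, e_mul_idem]

theorem idem_mul_gen (g : Gen ν) : D.idem K h lam * D.cycGen K lam (g.append h) =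
    D.cycGen K lam (g.append h) := by
  cases g with
  | e s => exact D.idem_mul_e K h lam s
  | x k s =>
    have := D.cycMk_rel K ν' lam (.e_mul_x k.1 (by have := degree_of_add h; omega) (s.append h))
    simp only [map_mul, cycMk_ι] at this
    simp only [Gen.append]
    rw [← this, ← mul_assoc, idem_mul_e]
  | t k hk s =>
    have := D.cycMk_rel K ν' lam (.e_mul_t k (by have := degree_of_add h; omega) (s.append h))
    rw [SeqOf.append_swap h s k hk] at this
    simp only [map_mul, cycMk_ι] at this
    simp only [Gen.append]
    rw [← this, ← mul_assoc, idem_mul_e]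

/-- The map of free algebras adding a strand of colour `i` on the right. -/
def freeAppend : FreeAlgebra K (Gen ν) →ₐ[K] FreeAlgebra K (Gen ν') :=
  FreeAlgebra.lift K fun g => FreeAlgebra.ι K (g.append h)

theorem freeAppend_e (s : SeqOf ν) : freeAppend K h (fe K s) = fe K (s.append h) :=
  FreeAlgebra.lift_ι_apply _ _

theorem freeAppend_x (k : ℕ) (hk : k < ν.degree) (s : SeqOf ν) : freeAppend K h (fx K k hk s) =
    fx K k (by have := degree_of_add h; omega) (s.append h) :=
  FreeAlgebra.lift_ι_apply _ _

theorem freeAppend_t (k : ℕ) (hk : k + 1 < ν.degree) (s : SeqOf ν) :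
    freeAppend K h (ft K k hk s) =
      ft K k (by have := degree_of_add h; omega) (s.append h) :=
  FreeAlgebra.lift_ι_apply _ _

theorem rel_append {y z : FreeAlgebra K (Gen ν)} (hyz : D.Rel K ν y z) :
    (y = ∑ s, fe K s ∧ z = 1) ∨ D.Rel K ν' (freeAppend K h y) (freeAppend K h z) := by
  have hd := degree_of_add h
  have hc := SeqOf.append_col h
  have hs := fun (s : SeqOf ν) (k : ℕ) (hk : k + 1 < ν.degree) =>
    SeqOf.append_swap h s k hk (by omega)
  cases hyz with
  | sum_e => exact Or.inl ⟨rfl, rfl⟩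
  | e_mul_self s =>
    right
    simp only [map_mul, freeAppend_e]
    exact .e_mul_self _
  | e_mul_of_ne s s' hne =>
    right
    simp only [map_mul, freeAppend_e, map_zero]
    exact .e_mul_of_ne _ _ fun hh => hne (SeqOf.append_injective h hh)
  | e_mul_x k hk s =>
    right
    simp only [map_mul, freeAppend_e, freeAppend_x]
    exact .e_mul_x _ _ _
  | x_mul_e k hk s =>
    right
    simp only [map_mul, freeAppend_e, freeAppend_x]
    exact .x_mul_e _ _ _
  | e_mul_t k hk s =>
    right
    simp only [map_mul, freeAppend_e, freeAppend_t, ← hs]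
    exact .e_mul_t _ _ _
  | t_mul_e k hk s =>
    right
    simp only [map_mul, freeAppend_e, freeAppend_t]
    exact .t_mul_e _ _ _
  | x_mul_x k l hk hl s =>
    right
    simp only [map_mul, freeAppend_x]
    exact .x_mul_x _ _ _ _ _
  | x_mul_t k l hk hl s h1 h2 =>
    right
    simp only [map_mul, freeAppend_x, freeAppend_t, ← hs]
    exact .x_mul_t _ _ _ _ _ h1 h2
  | t_mul_t k l hk hl s h1 =>
    right
    simp only [map_mul, freeAppend_t, ← hs]
    exact .t_mul_t _ _ _ _ _ h1
  | t_sq_real k hk s i hi hj h1 =>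
    right
    simp only [map_mul, map_zero, freeAppend_t, ← hs]
    exact .t_sq_real _ _ _ i ((hc _ _ _ _).trans hi) ((hc _ _ _ _).trans hj) h1
  | t_sq_neg k hk s i hi hj h1 =>
    right
    simp only [map_mul, map_add, map_pow, freeAppend_e, freeAppend_x, freeAppend_t, ← hs]
    exact .t_sq_neg _ _ _ i ((hc _ _ _ _).trans hi) ((hc _ _ _ _).trans hj) h1
  | t_sq_zero k hk s i j hi hj h1 =>
    right
    simp only [map_mul, freeAppend_e, freeAppend_t, ← hs]
    exact .t_sq_zero _ _ _ i j ((hc _ _ _ _).trans hi) ((hc _ _ _ _).trans hj) h1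
  | t_sq_ne k hk s i j hi hj hij h1 =>
    right
    simp only [map_mul, map_add, map_pow, freeAppend_e, freeAppend_x, freeAppend_t, ← hs]
    exact .t_sq_ne _ _ _ i j ((hc _ _ _ _).trans hi) ((hc _ _ _ _).trans hj) hij h1
  | x_mul_t_real k hk s i hi hj h1 =>
    right
    simp only [map_mul, map_sub, freeAppend_e, freeAppend_x, freeAppend_t, ← hs]
    exact .x_mul_t_real _ _ _ i ((hc _ _ _ _).trans hi) ((hc _ _ _ _).trans hj) h1
  | t_mul_x_real k hk s i hi hj h1 =>
    right
    simp only [map_mul, map_sub, freeAppend_e, freeAppend_x, freeAppend_t, ← hs]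
    exact .t_mul_x_real _ _ _ i ((hc _ _ _ _).trans hi) ((hc _ _ _ _).trans hj) h1
  | x_mul_t_other k hk s i j hi hj h1 =>
    right
    simp only [map_mul, freeAppend_x, freeAppend_t, ← hs]
    exact .x_mul_t_other _ _ _ i j ((hc _ _ _ _).trans hi) ((hc _ _ _ _).trans hj) h1
  | t_mul_x_other k hk s i j hi hj h1 =>
    right
    simp only [map_mul, freeAppend_x, freeAppend_t, ← hs]
    exact .t_mul_x_other _ _ _ i j ((hc _ _ _ _).trans hi) ((hc _ _ _ _).trans hj) h1
  | braid_real k hk hk' s i j hi hj hm h1 h2 h3 =>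
    right
    simp only [map_mul, map_sub, map_sum, map_pow, freeAppend_e, freeAppend_x, freeAppend_t, ← hs]
    exact .braid_real _ _ _ _ i j ((hc _ _ _ _).trans hi) ((hc _ _ _ _).trans hj) ((hc _ _ _ _).trans hm) h1 h2 h3
  | braid_other k hk hk' s i j m hi hj hm h1 =>
    right
    simp only [map_mul, freeAppend_t, ← hs]
    exact .braid_other _ _ _ _ i j m ((hc _ _ _ _).trans hi) ((hc _ _ _ _).trans hj) ((hc _ _ _ _).trans hm) h1

/-- The map from the free algebra to the corner `1_{ν,i} 𝓡^λ(ν + i) 1_{ν,i}`. -/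
def freeToCorner : FreeAlgebra K (Gen ν) →ₐ[K] (D.idem_idem K h lam).Corner :=
  FreeAlgebra.lift K fun g => cornerMk (D.idem_idem K h lam) (D.cycGen K lam (g.append h))
    (D.idem_mul_gen K h lam g) (D.gen_mul_idem K h lam g)

theorem freeToCorner_coe (y : FreeAlgebra K (Gen ν)) :
    cornerIncl (K := K) (D.idem_idem K h lam) (D.freeToCorner K h lam y) =
      D.cycMk K lam (freeAppend K h y) * D.idem K h lam := by
  induction y using FreeAlgebra.induction with
  | grade0 c =>
    rw [AlgHom.commutes, AlgHom.commutes, AlgHom.commutes, Algebra.algebraMap_eq_smul_one,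
      Algebra.algebraMap_eq_smul_one, smul_one_mul, map_smul, cornerIncl_one]
  | grade1 g =>
    rw [freeToCorner, FreeAlgebra.lift_ι_apply, cornerIncl_mk, freeAppend,
      FreeAlgebra.lift_ι_apply, cycMk_ι, gen_mul_idem]
  | mul y z hy hz =>
    rw [map_mul, map_mul, map_mul, map_mul, mul_assoc, ← hz,
      ← idem_mul_cornerIncl (K := K) (D.idem_idem K h lam) (D.freeToCorner K h lam z),
      ← mul_assoc, ← mul_assoc, ← hy, cornerIncl_mul_idem]
  | add y z hy hz =>
    rw [map_add, map_add, hy, hz, map_add, map_add, add_mul]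

theorem freeToCorner_rel {y z : FreeAlgebra K (Gen ν)} (hyz : D.Rel K ν y z) :
    D.freeToCorner K h lam y = D.freeToCorner K h lam z := by
  apply corner_ext (K := K)
  rw [freeToCorner_coe, freeToCorner_coe]
  rcases D.rel_append K h hyz with ⟨rfl, rfl⟩ | hyz
  · have : D.cycMk K lam (freeAppend K h (∑ s, fe K s)) = D.idem K h lam := by
      simp only [map_sum, freeAppend_e, cycMk_ι]
      rfl
    rw [this, map_one, map_one, one_mul]
    exact D.idem_idem K h lam
  · rw [D.cycMk_rel K ν' lam hyz]

/-- The unital homomorphism from `𝓡(ν)` to the corner `1_{ν,i} 𝓡^λ(ν + i) 1_{ν,i}`. -/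
def klrToCorner : D.KLR K ν →ₐ[K] (D.idem_idem K h lam).Corner :=
  RingQuot.liftAlgHom K ⟨D.freeToCorner K h lam, fun _ _ hyz => D.freeToCorner_rel K h lam hyz⟩

theorem klrToCorner_mk (y : FreeAlgebra K (Gen ν)) :
    D.klrToCorner K h lam (RingQuot.mkAlgHom K (D.Rel K ν) y) = D.freeToCorner K h lam y :=
  RingQuot.liftAlgHom_mkAlgHom_apply K _ _ _

theorem klrToCorner_cycRel {y z : D.KLR K ν} (hyz : D.CycRel K ν lam y z) :
    D.klrToCorner K h lam y = D.klrToCorner K h lam z := by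
  obtain ⟨s, h0⟩ := hyz
  have e : D.klrGen K (.x ⟨0, h0⟩ s) ^ (D.h (s.col ⟨0, h0⟩) lam).toNat * D.klrGen K (.e s) =
      RingQuot.mkAlgHom K (D.Rel K ν)
        (fx K 0 h0 s ^ (D.h (s.col ⟨0, h0⟩) lam).toNat * fe K s) := by
    rw [map_mul, map_pow]
    rfl
  rw [e, klrToCorner_mk, map_zero]
  apply corner_ext (K := K)
  rw [freeToCorner_coe, map_mul, map_pow, freeAppend_x, freeAppend_e, map_mul, map_pow,
    cycMk_ι, cycMk_ι, map_zero]
  have h0' : 0 < ν'.degree := by have := degree_of_add h; omega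
  have := D.cycProj_rel K ν' lam (CycRel.x_pow (s.append h) h0')
  rw [SeqOf.append_col h s 0 h0, map_mul, map_pow, map_zero] at this
  exact (congrArg (· * D.idem K h lam) this).trans (zero_mul _)

/-- The unital homomorphism from `𝓡^λ(ν)` to the corner `1_{ν,i} 𝓡^λ(ν + i) 1_{ν,i}`. -/
def cycToCorner : D.Cyc K ν lam →ₐ[K] (D.idem_idem K h lam).Corner :=
  D.cycLift K ν lam (D.klrToCorner K h lam) fun _ _ hyz => D.klrToCorner_cycRel K h lam hyz

/-- The non-unital homomorphism `𝓡^λ(ν) → 𝓡^λ(ν + i)` that adds a vertical strand of colour `i`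
on the right of a diagram. It sends `1` to the idempotent `1_{ν,i}`. -/
def strand : D.Cyc K ν lam →ₙₐ[K] D.Cyc K ν' lam :=
  (cornerIncl (D.idem_idem K h lam)).comp (D.cycToCorner K h lam : _ →ₙₐ[K] _)

theorem strand_apply (y : D.Cyc K ν lam) : D.strand K h lam y =
    cornerIncl (K := K) (D.idem_idem K h lam) (D.cycToCorner K h lam y) := rfl

theorem strand_one : D.strand K h lam 1 = D.idem K h lam := by
  rw [strand_apply, map_one, cornerIncl_one]

theorem strand_gen (g : Gen ν) :
    D.strand K h lam (D.cycGen K lam g) = D.cycGen K lam (g.append h) := by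
  rw [strand_apply, cycToCorner, cycGen, cycLift_cycProj, klrGen, klrToCorner_mk, freeToCorner,
    FreeAlgebra.lift_ι_apply, cornerIncl_mk]

theorem strand_mem (d : ℤ) (y : D.Cyc K ν lam) (hy : y ∈ D.cycGrading K ν lam d) :
    D.strand K h lam y ∈ D.cycGrading K ν' lam d := by
  unfold cycGrading monomialGrading at hy
  induction hy using Submodule.span_induction with
  | mem y hy =>
    obtain ⟨l, rfl, rfl⟩ := hy
    induction l with
    | nil =>
      simp only [List.map_nil, List.prod_nil, strand_one]
      exact Submodule.sum_mem _ fun s _ => monomialGrading.gen_mem (Gen.e (s.append h))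
    | cons g l ih =>
      simp only [List.map_cons, List.prod_cons, map_mul, strand_gen, List.sum_cons]
      rw [← D.genDeg_append h g]
      exact monomialGrading.mul_mem (monomialGrading.gen_mem _) ih
  | zero => rw [map_zero]; exact Submodule.zero_mem _
  | add y z _ _ hy hz => rw [map_add]; exact Submodule.add_mem _ hy hz
  | smul c y _ hy => rw [map_smul]; exact Submodule.smul_mem _ c hy

variable (ν) in
/-- Graded `𝓡^λ(ν)`-modules. -/
abbrev CycMod (lam : D.P) := GrMod (D.cycGrading K ν lam)

/-- The functor `E_i^λ : N ↦ 1_{ν,i} N` from `𝓡^λ(ν + i)`-modules to `𝓡^λ(ν)`-modules. -/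
def E : D.CycMod K ν' lam ⥤ D.CycMod K ν lam := GrMod.res (D.strand K h lam) (D.strand_mem K h lam)

/-- The functor `F_i^λ : M ↦ 𝓡^λ(ν + i) 1_{ν,i} ⊗ M` (tensor product over `𝓡^λ(ν)`) from
`𝓡^λ(ν)`-modules to `𝓡^λ(ν + i)`-modules. -/
def F : D.CycMod K ν lam ⥤ D.CycMod K ν' lam := GrMod.ind (D.strand K h lam) (D.strand_mem K h lam)

/-- The endofunctor `E_i^λ F_i^λ` of graded `𝓡^λ(ν)`-modules. -/
def EF (i : I) (ν : I →₀ ℕ) : D.CycMod K ν lam ⥤ D.CycMod K ν lam :=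
  D.F K (i := i) rfl lam ⋙ D.E K (i := i) rfl lam

open scoped Classical in
/-- The endofunctor `F_i^λ E_i^λ` of graded `𝓡^λ(ν)`-modules; it is zero when `ν - i ∉ ℕ[I]`. -/
def FE (i : I) (ν : I →₀ ℕ) : D.CycMod K ν lam ⥤ D.CycMod K ν lam :=
  if h : ν - Finsupp.single i 1 + Finsupp.single i 1 = ν then D.E K h lam ⋙ D.F K h lam
  else GrMod.zeroFunctor _

/-- Multiplication by `q_i ^ m`, where `q_i = q ^ r_i`. -/
def qShift (i : I) (m : ℤ) : D.CycMod K ν lam ⥤ D.CycMod K ν lam := GrMod.shift (D.r i * m)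

end BorcherdsCartanDatum

end

noncomputable section

set_option linter.unusedSectionVars false
set_option linter.unusedSimpArgs false

namespace SeqOf

variable {I : Type v} [Inhabited I] {ν ν' : I →₀ ℕ} {i : I}

/-- The entry in position `k`, with a default value outside of the range. -/
def c (s : SeqOf ν) (k : ℕ) : I := if h : k < ν.degree then s.col ⟨k, h⟩ else default

theorem c_eq (s : SeqOf ν) {k : ℕ} (h : k < ν.degree) : s.c k = s.col ⟨k, h⟩ := dif_pos h

theorem ext_c {s s' : SeqOf ν} (h : ∀ k < ν.degree, s.c k = s'.c k) : s = s' := by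
  ext ⟨k, hk⟩
  rw [← c_eq s hk, ← c_eq s' hk, h k hk]

/-- The simple transposition of the positions `k` and `k + 1`, trivial outside of the range. -/
def sw (s : SeqOf ν) (k : ℕ) : SeqOf ν := if h : k + 1 < ν.degree then s.swap k h else s

theorem sw_eq (s : SeqOf ν) {k : ℕ} (h : k + 1 < ν.degree) : s.sw k = s.swap k h := dif_pos h

theorem c_sw (s : SeqOf ν) {k : ℕ} (h : k + 1 < ν.degree) (l : ℕ) :
    (s.sw k).c l = if l = k then s.c (k + 1) else if l = k + 1 then s.c k else s.c l := by
  rw [sw_eq s h]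
  by_cases hl : l < ν.degree
  · rw [c_eq _ hl]
    split_ifs with h1 h2
    · subst h1; rw [swap_left, c_eq _ h]
    · subst h2; rw [swap_right, c_eq]
    · rw [swap_of_ne _ _ _ _ h1 h2, c_eq _ hl]
  · rw [if_neg (by omega), if_neg (by omega), c, c, dif_neg hl, dif_neg hl]

theorem sw_sw (s : SeqOf ν) (k : ℕ) : (s.sw k).sw k = s := by
  by_cases h : k + 1 < ν.degree
  · refine ext_c fun l _ => ?_
    simp only [c_sw _ h]
    split_ifs <;> first | rfl | (subst_vars; rfl) | (exfalso; omega)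
  · rw [sw, dif_neg h, sw, dif_neg h]

theorem sw_eq_self (s : SeqOf ν) {k : ℕ} (h : s.c k = s.c (k + 1)) : s.sw k = s := by
  by_cases hk : k + 1 < ν.degree
  · refine ext_c fun l _ => ?_
    rw [c_sw _ hk]
    split_ifs with h1 h2
    · rw [h1, h]
    · rw [h2, h]
    · rfl
  · rw [sw, dif_neg hk]

theorem append_c (h : ν + Finsupp.single i 1 = ν') (s : SeqOf ν) {k : ℕ} (hk : k ≤ ν.degree) :
    (s.append h).c k = if k < ν.degree then s.c k else i := by
  rw [c_eq _ (by rw [degree_of_add h]; omega)]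
  split_ifs with h1
  · rw [append_col h s k h1, c_eq]
  · simp [append, h1]

theorem append_sw (h : ν + Finsupp.single i 1 = ν') (s : SeqOf ν) {k : ℕ}
    (hk : k + 1 < ν.degree) : (s.append h).sw k = (s.sw k).append h := by
  have := degree_of_add h
  rw [sw_eq s hk, sw_eq _ (by omega), append_swap]

theorem exists_append (h : ν + Finsupp.single i 1 = ν') (s : SeqOf ν')
    (hs : s.c ν.degree = i) : ∃ r : SeqOf ν, r.append h = s := by
  have hd := degree_of_add h
  have key : ∀ (n' : ℕ) (hn : n' = ν.degree + 1) (f : Fin n' → I →₀ ℕ),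
      ∑ k, f k = (∑ k : Fin ν.degree, f ⟨k.1, by omega⟩) + f ⟨ν.degree, by omega⟩ := by
    rintro _ rfl f
    exact Fin.sum_univ_castSucc f
  have hsum := key _ hd (fun k => Finsupp.single (s.col k) 1)
  have hl : s.col ⟨ν.degree, by omega⟩ = i := (c_eq s (by omega)).symm.trans hs
  simp only [hl] at hsum
  refine ⟨⟨fun k => s.col ⟨k.1, by omega⟩,
    (add_right_cancel (h.trans (s.sum_eq.symm.trans hsum))).symm⟩, ?_⟩
  refine ext_c fun k hk => ?_
  rw [append_c h _ (by omega)]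
  split_ifs with h1
  · rw [c_eq _ h1, c_eq _ hk]
  · rw [← hs]
    congr 1
    omega

theorem exists_sub (s : SeqOf ν) {n : ℕ} (hn : ν.degree = n + 1) (hs : s.c n = i) :
    ν - Finsupp.single i 1 + Finsupp.single i 1 = ν := by
  refine tsub_add_cancel_of_le ?_
  rw [← s.sum_eq, ← hs, c_eq s (by omega)]
  exact Finset.single_le_sum (f := fun k => Finsupp.single (s.col k) 1)
    (fun _ _ => zero_le) (Finset.mem_univ _)

/-- Auxiliary: the new entry is moved `d` steps to the left. -/
def insAux (h : ν + Finsupp.single i 1 = ν') (s : SeqOf ν) : ℕ → SeqOf ν'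
  | 0 => s.append h
  | d + 1 => (insAux h s d).sw (ν.degree - 1 - d)

/-- The sequence with `i` inserted in position `k`. -/
def ins (h : ν + Finsupp.single i 1 = ν') (k : ℕ) (s : SeqOf ν) : SeqOf ν' :=
  insAux h s (ν.degree - k)

theorem ins_degree (h : ν + Finsupp.single i 1 = ν') (s : SeqOf ν) :
    ins h ν.degree s = s.append h := by rw [ins, Nat.sub_self, insAux]

theorem ins_succ (h : ν + Finsupp.single i 1 = ν') (s : SeqOf ν) {k : ℕ} (hk : k < ν.degree) :
    ins h k s = (ins h (k + 1) s).sw k := by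
  obtain ⟨d, hd⟩ : ∃ d, ν.degree = k + 1 + d := ⟨ν.degree - (k + 1), by omega⟩
  rw [ins, ins, show ν.degree - k = d + 1 by omega, show ν.degree - (k + 1) = d by omega, insAux,
    show ν.degree - 1 - d = k by omega]

theorem ins_c (h : ν + Finsupp.single i 1 = ν') (s : SeqOf ν) {k : ℕ} (hk : k ≤ ν.degree) {j : ℕ}
    (hj : j ≤ ν.degree) :
    (ins h k s).c j = if j < k then s.c j else if j = k then i else s.c (j - 1) := by
  have hd := degree_of_add h
  obtain ⟨d, hd'⟩ : ∃ d, ν.degree = k + d := ⟨ν.degree - k, by omega⟩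
  induction d generalizing k j with
  | zero =>
    obtain rfl : k = ν.degree := by omega
    rw [ins_degree, append_c h s hj]
    split_ifs <;> first | rfl | omega
  | succ d ih =>
    rw [ins_succ h s (by omega), c_sw _ (by omega), ih (by omega) (by omega) (by omega),
      ih (by omega) (by omega) (by omega), ih (by omega) hj (by omega)]
    split_ifs <;> first | rfl | omega | (congr 1; omega)

theorem ins_injective (h : ν + Finsupp.single i 1 = ν') {k : ℕ} (hk : k ≤ ν.degree) :
    Function.Injective (ins (ν := ν) h k) := by
  intro s s' hs
  refine ext_c fun j hj => ?_
  by_cases h1 : j < k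
  · have := congrArg (fun t => t.c j) hs
    simpa only [ins_c h _ hk hj.le, if_pos h1] using this
  · have := congrArg (fun t => t.c (j + 1)) hs
    simpa only [ins_c h _ hk (show j + 1 ≤ _ from hj), if_neg (show ¬ j + 1 < k by omega),
      if_neg (show ¬ j + 1 = k by omega), Nat.add_sub_cancel] using this

theorem ins_sw_lt (h : ν + Finsupp.single i 1 = ν') (s : SeqOf ν) {k l : ℕ} (hl : l + 1 < k)
    (hk : k ≤ ν.degree) : (ins h k s).sw l = ins h k (s.sw l) := by
  have hd := degree_of_add h
  refine ext_c fun j hj => ?_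
  rw [c_sw _ (by omega), ins_c h s hk (by omega), ins_c h s hk (by omega),
    ins_c h s hk (by omega), ins_c h _ hk (by omega), c_sw _ (by omega), c_sw _ (by omega)]
  split_ifs <;> first | rfl | omega

theorem ins_sw_gt (h : ν + Finsupp.single i 1 = ν') (s : SeqOf ν) {k l : ℕ} (hl : k ≤ l)
    (hk : l + 1 < ν.degree) : (ins h k s).sw (l + 1) = ins h k (s.sw l) := by
  have hd := degree_of_add h
  refine ext_c fun j hj => ?_
  rw [c_sw _ (by omega), ins_c h s (by omega) (by omega), ins_c h s (by omega) (by omega),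
    ins_c h s (by omega) (by omega), ins_c h _ (by omega) (by omega), c_sw _ (by omega),
    c_sw _ (by omega)]
  split_ifs <;> first | rfl | omega

theorem sum_c {M : Type*} [AddCommMonoid M] (s : SeqOf ν) (f : I → M) :
    ∑ k ∈ Finset.range ν.degree, f (s.c k) = ν.sum fun j m => m • f j := by
  have h1 : ∀ k : Fin ν.degree, f (s.c k) = f (s.col k) := fun k => by rw [c_eq s k.2]
  rw [Finset.sum_range (fun k => f (s.c k)), Finset.sum_congr rfl fun k _ => h1 k]
  have h2 := congrArg (Finsupp.liftAddHom fun j => (multiplesHom M) (f j)) s.sum_eq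
  rw [map_sum] at h2
  simp only [Finsupp.liftAddHom_apply_single, multiplesHom_apply, one_smul] at h2
  exact h2

end SeqOf

namespace BorcherdsCartanDatum

variable {I : Type v} (D : BorcherdsCartanDatum.{v, w} I)

theorem form_self_ne_zero {i : I} (h : D.a i i = 2) : D.form (D.α i) (D.α i) ≠ 0 := by
  rw [form_α_α, h]
  have := D.r_pos i
  omega

theorem form_eq_zero_iff (i j : I) : D.form (D.α i) (D.α j) = 0 ↔ D.a i j = 0 := by
  rw [form_α_α, ← r_symm, mul_eq_zero]
  have := D.r_pos i
  constructor
  · rintro (h | h)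
    · omega
    · exact h
  · exact Or.inr

section Polys

variable {B : Type*} [Ring B]

open scoped Classical in
/-- The polynomial giving the square of a crossing of strands of colours `i`, `j`. -/
def quad (i j : I) (y z : B) : B :=
  if i = j then
    if D.a i i = 2 then 0
    else if D.form (D.α i) (D.α i) = 0 then 1
    else (y ^ (-D.a i i / 2).toNat + z ^ (-D.a i i / 2).toNat) ^ 2
  else if D.form (D.α i) (D.α j) = 0 then 1
  else y ^ (-D.a i j).toNat + z ^ (-D.a j i).toNat

open scoped Classical in
/-- The correction term in the braid relation for strands of colours `i`, `j`, `m`. -/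
def braidCorr (i j m : I) (y z : B) : B :=
  if i = m ∧ D.a i i = 2 ∧ i ≠ j ∧ D.form (D.α i) (D.α j) ≠ 0 then
    ∑ c ∈ Finset.range (-D.a i j).toNat, y ^ c * z ^ ((-D.a i j).toNat - 1 - c)
  else 0

open scoped Classical in
/-- The indicator of two equal real colours. -/
def delta (B : Type*) [Ring B] (i j : I) : B := if i = j ∧ D.a i i = 2 then 1 else 0

theorem quad_symm (i j : I) (y z : B) : D.quad i j y z = D.quad j i z y := by
  unfold quad
  by_cases h : i = j
  · subst h
    simp only [if_true, add_comm]
  · rw [if_neg h, if_neg (Ne.symm h), D.form_symm (D.α j), add_comm]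

theorem delta_symm (i j : I) : D.delta B i j = D.delta B j i := by
  unfold delta
  by_cases h : i = j
  · subst h; rfl
  · rw [if_neg (by tauto), if_neg (by tauto)]

theorem quad_commute {i j : I} {b y z : B} (hy : Commute b y) (hz : Commute b z) :
    Commute b (D.quad i j y z) := by
  unfold quad
  split_ifs
  · exact Commute.zero_right _
  · exact Commute.one_right _
  · exact ((hy.pow_right _).add_right (hz.pow_right _)).pow_right _
  · exact Commute.one_right _
  · exact (hy.pow_right _).add_right (hz.pow_right _)

theorem delta_commute (i j : I) (b : B) : Commute (D.delta B i j) b := by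
  unfold delta
  split_ifs
  · exact Commute.one_left _
  · exact Commute.zero_left _

theorem map_quad {B' : Type*} [Ring B'] (f : B →+* B') (i j : I) (y z : B) :
    f (D.quad i j y z) = D.quad i j (f y) (f z) := by
  unfold quad
  split_ifs <;> simp

theorem map_braidCorr {B' : Type*} [Ring B'] (f : B →+* B') (i j m : I) (y z : B) :
    f (D.braidCorr i j m y z) = D.braidCorr i j m (f y) (f z) := by
  unfold braidCorr
  split_ifs <;> simp

theorem map_delta {B' : Type*} [Ring B'] (f : B →+* B') (i j : I) :
    f (D.delta B i j) = D.delta B' i j := by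
  unfold delta
  split_ifs <;> simp

end Polys

variable [Inhabited I]

/-- Elements of a ring that satisfy the defining relations of `𝓡(ν)`, except that the sum of the
idempotents need not be `1`. -/
structure Rep (ν : I →₀ ℕ) (B : Type*) [Ring B] where
  /-- The idempotents. -/
  E : SeqOf ν → B
  /-- The dots. -/
  X : ℕ → B
  /-- The crossings. -/
  T : ℕ → B
  E_mul_self : ∀ s, E s * E s = E s
  E_mul_of_ne : ∀ s s', s ≠ s' → E s * E s' = 0
  X_mul_E : ∀ k s, k < ν.degree → X k * E s = E s * X k
  T_mul_E : ∀ k s, k + 1 < ν.degree → T k * E s = E (s.sw k) * T k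
  X_mul_X : ∀ k l s, k < ν.degree → l < ν.degree → X k * X l * E s = X l * X k * E s
  X_mul_T : ∀ k l s, k + 1 < ν.degree → l < ν.degree → l ≠ k → l ≠ k + 1 →
    X l * T k * E s = T k * X l * E s
  T_mul_T : ∀ k l s, k + 1 < l → l + 1 < ν.degree → T l * T k * E s = T k * T l * E s
  T_sq : ∀ k s, k + 1 < ν.degree →
    T k * T k * E s = D.quad (s.c k) (s.c (k + 1)) (X k) (X (k + 1)) * E s
  X_T : ∀ k s, k + 1 < ν.degree →
    (X k * T k - T k * X (k + 1)) * E s = D.delta B (s.c k) (s.c (k + 1)) * E s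
  T_X : ∀ k s, k + 1 < ν.degree →
    (T k * X k - X (k + 1) * T k) * E s = D.delta B (s.c k) (s.c (k + 1)) * E s
  braid : ∀ k s, k + 2 < ν.degree →
    (T k * T (k + 1) * T k - T (k + 1) * T k * T (k + 1)) * E s =
      D.braidCorr (s.c k) (s.c (k + 1)) (s.c (k + 2)) (X k) (X (k + 2)) * E s

namespace Rep

variable {D} {ν ν' : I →₀ ℕ} {i : I} {B : Type*} [Ring B]

/-- The sum of the idempotents. -/
def one (ρ : D.Rep ν B) : B := ∑ s, ρ.E s

theorem one_mul_E (ρ : D.Rep ν B) (s : SeqOf ν) : ρ.one * ρ.E s = ρ.E s := by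
  rw [one, Finset.sum_mul, Finset.sum_eq_single s (fun s' _ h => ρ.E_mul_of_ne _ _ h) (by simp),
    E_mul_self]

theorem E_mul_one (ρ : D.Rep ν B) (s : SeqOf ν) : ρ.E s * ρ.one = ρ.E s := by
  rw [one, Finset.mul_sum, Finset.sum_eq_single s (fun s' _ h => ρ.E_mul_of_ne _ _ h.symm)
    (by simp), E_mul_self]

theorem one_idem (ρ : D.Rep ν B) : IsIdempotentElem ρ.one := by
  unfold IsIdempotentElem
  conv_lhs => rhs; rw [one]
  rw [Finset.mul_sum, Finset.sum_congr rfl fun s _ => ρ.one_mul_E s]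
  rfl

/-- The image of elements satisfying the relations under a ring homomorphism. -/
def map {B' : Type*} [Ring B'] (ρ : D.Rep ν B) (f : B →+* B') : D.Rep ν B' where
  E s := f (ρ.E s)
  X k := f (ρ.X k)
  T k := f (ρ.T k)
  E_mul_self s := by rw [← map_mul, ρ.E_mul_self]
  E_mul_of_ne s s' h := by rw [← map_mul, ρ.E_mul_of_ne s s' h, map_zero]
  X_mul_E k s h := by rw [← map_mul, ρ.X_mul_E k s h, map_mul]
  T_mul_E k s h := by rw [← map_mul, ρ.T_mul_E k s h, map_mul]
  X_mul_X k l s hk hl := by simp only [← map_mul, ρ.X_mul_X k l s hk hl]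
  X_mul_T k l s hk hl h h' := by simp only [← map_mul, ρ.X_mul_T k l s hk hl h h']
  T_mul_T k l s h h' := by simp only [← map_mul, ρ.T_mul_T k l s h h']
  T_sq k s h := by
    simpa only [map_mul, map_sub, map_quad, map_delta, map_braidCorr] using congrArg f (ρ.T_sq k s h)
  X_T k s h := by
    simpa only [map_mul, map_sub, map_quad, map_delta, map_braidCorr] using congrArg f (ρ.X_T k s h)
  T_X k s h := by
    simpa only [map_mul, map_sub, map_quad, map_delta, map_braidCorr] using congrArg f (ρ.T_X k s h)
  braid k s h := by
    simpa only [map_mul, map_sub, map_quad, map_delta, map_braidCorr] using congrArg f (ρ.braid k s h)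

/-- Adding a strand of colour `i` on the right. -/
def append (ρ : D.Rep ν' B) (h : ν + Finsupp.single i 1 = ν') : D.Rep ν B where
  E s := ρ.E (s.append h)
  X := ρ.X
  T := ρ.T
  E_mul_self s := ρ.E_mul_self _
  E_mul_of_ne s s' hs := ρ.E_mul_of_ne _ _ fun hh => hs (SeqOf.append_injective h hh)
  X_mul_E k s hk := ρ.X_mul_E _ _ (by rw [degree_of_add h]; omega)
  T_mul_E k s hk := by
    rw [ρ.T_mul_E _ _ (by rw [degree_of_add h]; omega), SeqOf.append_sw h s hk]
  X_mul_X k l s hk hl := ρ.X_mul_X k l _ (by rw [degree_of_add h]; omega)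
    (by rw [degree_of_add h]; omega)
  X_mul_T k l s hk hl := ρ.X_mul_T k l _ (by rw [degree_of_add h]; omega)
    (by rw [degree_of_add h]; omega)
  T_mul_T k l s hk hl := ρ.T_mul_T k l _ hk (by rw [degree_of_add h]; omega)
  T_sq k s hk := by
    rw [ρ.T_sq _ _ (by rw [degree_of_add h]; omega), SeqOf.append_c h s (by omega),
      SeqOf.append_c h s (by omega), if_pos (by omega), if_pos (by omega)]
  X_T k s hk := by
    rw [ρ.X_T _ _ (by rw [degree_of_add h]; omega), SeqOf.append_c h s (by omega),
      SeqOf.append_c h s (by omega), if_pos (by omega), if_pos (by omega)]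
  T_X k s hk := by
    rw [ρ.T_X _ _ (by rw [degree_of_add h]; omega), SeqOf.append_c h s (by omega),
      SeqOf.append_c h s (by omega), if_pos (by omega), if_pos (by omega)]
  braid k s hk := by
    rw [ρ.braid _ _ (by rw [degree_of_add h]; omega), SeqOf.append_c h s (by omega),
      SeqOf.append_c h s (by omega), SeqOf.append_c h s (by omega), if_pos (by omega),
      if_pos (by omega), if_pos (by omega)]

section Lift

variable {K : Type u} [Field K] [Algebra K B] (ρ : D.Rep ν B)

/-- The elements of the ring that correspond to the generators. -/
def gen : Gen ν → B
  | .e s => ρ.E s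
  | .x k s => ρ.X k * ρ.E s
  | .t k _ s => ρ.T k * ρ.E s

theorem one_mul_gen (g : Gen ν) : ρ.one * ρ.gen g = ρ.gen g := by
  cases g with
  | e s => exact ρ.one_mul_E s
  | x k s => rw [gen, ρ.X_mul_E _ _ k.2, ← mul_assoc, one_mul_E]
  | t k hk s => rw [gen, ρ.T_mul_E _ _ hk, ← mul_assoc, one_mul_E]

theorem gen_mul_one (g : Gen ν) : ρ.gen g * ρ.one = ρ.gen g := by
  cases g with
  | e s => exact ρ.E_mul_one s
  | x k s => rw [gen, mul_assoc, E_mul_one]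
  | t k hk s => rw [gen, mul_assoc, E_mul_one]

variable (K) in
/-- The map from the free algebra to the corner of the sum of the idempotents. -/
def freeLift : FreeAlgebra K (Gen ν) →ₐ[K] ρ.one_idem.Corner :=
  FreeAlgebra.lift K fun g => cornerMk ρ.one_idem (ρ.gen g) (ρ.one_mul_gen g) (ρ.gen_mul_one g)

theorem freeLift_coe (g : Gen ν) :
    cornerIncl (K := K) ρ.one_idem (ρ.freeLift K (FreeAlgebra.ι K g)) = ρ.gen g := by
  rw [freeLift, FreeAlgebra.lift_ι_apply, cornerIncl_mk]

/-- The element `w` of the corner acts on the idempotent of `s` as `b`. -/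
def Acts (s : SeqOf ν) (w : ρ.one_idem.Corner) (b : B) : Prop :=
  cornerIncl (K := K) ρ.one_idem (w * ρ.freeLift K (fe K s)) = b * ρ.E s ∧ Commute b (ρ.E s)

variable {ρ} {s : SeqOf ν}

theorem Acts.one : ρ.Acts (K := K) s 1 1 := by
  refine ⟨?_, Commute.one_left _⟩
  rw [one_mul, one_mul, freeLift_coe]
  rfl

theorem Acts.add {w w' : ρ.one_idem.Corner} {b b' : B} (h : ρ.Acts (K := K) s w b)
    (h' : ρ.Acts (K := K) s w' b') : ρ.Acts (K := K) s (w + w') (b + b') :=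
  ⟨by rw [add_mul, map_add, h.1, h'.1, add_mul], h.2.add_left h'.2⟩

theorem Acts.zero : ρ.Acts (K := K) s 0 0 :=
  ⟨by rw [zero_mul, map_zero, zero_mul], Commute.zero_left _⟩

theorem Acts.sum {ι : Type*} {t : Finset ι} {w : ι → ρ.one_idem.Corner} {b : ι → B}
    (h : ∀ j, ρ.Acts (K := K) s (w j) (b j)) :
    ρ.Acts (K := K) s (∑ j ∈ t, w j) (∑ j ∈ t, b j) := by
  classical
  induction t using Finset.induction_on with
  | empty => simpa using Acts.zero
  | insert j t hj ih => rw [Finset.sum_insert hj, Finset.sum_insert hj]; exact (h j).add ih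

theorem Acts.mul {w w' : ρ.one_idem.Corner} {b b' : B} (h : ρ.Acts (K := K) s w b)
    (h' : ρ.Acts (K := K) s w' b') : ρ.Acts (K := K) s (w * w') (b * b') := by
  refine ⟨?_, h.2.mul_left h'.2⟩
  have e : w' * ρ.freeLift K (fe K s) = ρ.freeLift K (fe K s) * (w' * ρ.freeLift K (fe K s)) := by
    apply corner_ext (K := K)
    rw [map_mul (cornerIncl ρ.one_idem) (ρ.freeLift K (fe K s)), h'.1, freeLift_coe, gen,
      h'.2.eq, ← mul_assoc, E_mul_self]
  rw [mul_assoc, e, ← mul_assoc, map_mul, h.1, h'.1, mul_assoc, mul_assoc, ← mul_assoc (ρ.E s),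
    ← h'.2.eq, mul_assoc b', E_mul_self]

theorem Acts.pow {w : ρ.one_idem.Corner} {b : B} (h : ρ.Acts (K := K) s w b) (m : ℕ) :
    ρ.Acts (K := K) s (w ^ m) (b ^ m) := by
  induction m with
  | zero => simpa using Acts.one
  | succ m ih => rw [pow_succ, pow_succ]; exact ih.mul h

theorem Acts.x {k : ℕ} (hk : k < ν.degree) : ρ.Acts (K := K) s (ρ.freeLift K (fx K k hk s)) (ρ.X k) := by
  refine ⟨?_, ρ.X_mul_E k s hk⟩
  rw [map_mul, freeLift_coe, freeLift_coe, gen, gen, mul_assoc, E_mul_self]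

theorem Acts.mul_e {w : ρ.one_idem.Corner} {b : B} (h : ρ.Acts (K := K) s w b) :
    cornerIncl (K := K) ρ.one_idem (w * ρ.freeLift K (fe K s)) = b * ρ.E s := h.1

variable (ρ)

theorem freeLift_rel {y z : FreeAlgebra K (Gen ν)} (hyz : D.Rel K ν y z) :
    ρ.freeLift K y = ρ.freeLift K z := by
  have ht : ∀ (k : ℕ) (hk : k + 1 < ν.degree) (s : SeqOf ν),
      cornerIncl (K := K) ρ.one_idem (ρ.freeLift K (ft K k hk s)) = ρ.T k * ρ.E s :=
    fun k hk s => ρ.freeLift_coe _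
  have hx : ∀ (k : ℕ) (hk : k < ν.degree) (s : SeqOf ν),
      cornerIncl (K := K) ρ.one_idem (ρ.freeLift K (fx K k hk s)) = ρ.X k * ρ.E s :=
    fun k hk s => ρ.freeLift_coe _
  have he : ∀ s : SeqOf ν, cornerIncl (K := K) ρ.one_idem (ρ.freeLift K (fe K s)) = ρ.E s :=
    fun s => ρ.freeLift_coe _
  have EE : ∀ (s : SeqOf ν) (b : B), ρ.E s * (ρ.E s * b) = ρ.E s * b :=
    fun s b => by rw [← mul_assoc, E_mul_self]
  have Eid : ∀ (k : ℕ) (hk : k + 1 < ν.degree) (s : SeqOf ν),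
      ρ.E (s.swap k hk) * (ρ.T k * ρ.E s) = ρ.T k * ρ.E s := fun k hk s => by
    rw [← SeqOf.sw_eq s hk, ρ.T_mul_E k s hk, ← mul_assoc, E_mul_self]
  have EX : ∀ (k : ℕ) (_ : k < ν.degree) (s : SeqOf ν),
      ρ.E s * (ρ.X k * ρ.E s) = ρ.X k * ρ.E s := fun k hk s => by
    rw [ρ.X_mul_E k s hk, ← mul_assoc, E_mul_self]
  have E2 : ∀ (k l : ℕ) (hk : k + 1 < ν.degree) (hl : l + 1 < ν.degree) (s : SeqOf ν),
      ρ.E ((s.swap l hl).swap k hk) * (ρ.T k * (ρ.T l * ρ.E s)) = ρ.T k * (ρ.T l * ρ.E s) :=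
    fun k l hk hl s => by
      rw [← SeqOf.sw_eq s hl, ← SeqOf.sw_eq _ hk, ρ.T_mul_E l s hl, ← mul_assoc (ρ.T k),
        ρ.T_mul_E k _ hk, mul_assoc, EE]
  apply corner_ext (K := K)
  cases hyz with
  | sum_e =>
    simp only [map_sum, he, map_one, cornerIncl_one]
    rfl
  | e_mul_self s => simp only [map_mul, he, ρ.E_mul_self]
  | e_mul_of_ne s s' hne => simp only [map_mul, he, ρ.E_mul_of_ne s s' hne, map_zero]
  | e_mul_x k hk s => simp only [map_mul, he, hx, ρ.X_mul_E k s hk, EE]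
  | x_mul_e k hk s => simp only [map_mul, he, hx, mul_assoc, ρ.E_mul_self]
  | e_mul_t k hk s => simp only [map_mul, he, ht, Eid]
  | t_mul_e k hk s => simp only [map_mul, he, ht, mul_assoc, ρ.E_mul_self]
  | x_mul_x k l hk hl s =>
    have := ρ.X_mul_X k l s hk hl
    simp only [mul_assoc] at this
    simp only [map_mul, hx, ρ.X_mul_E _ s hk, ρ.X_mul_E _ s hl, EE, mul_assoc] at this ⊢
    simpa only [← mul_assoc, ρ.X_mul_E _ s hk, ρ.X_mul_E _ s hl, EE, ρ.E_mul_self] using this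
  | x_mul_t k l hk hl s h h' =>
    have := ρ.X_mul_T k l s hk hl h h'
    simp only [map_mul, hx, ht, mul_assoc, Eid] at this ⊢
    rw [this, ρ.X_mul_E _ s hl, EE]
  | t_mul_t k l hk hl s h =>
    have := ρ.T_mul_T k l s h hl
    simp only [map_mul, ht, mul_assoc, Eid] at this ⊢
    rw [this]
  | t_sq_real k hk s i hi hj h =>
    have := ρ.T_sq k s hk
    rw [s.c_eq hk, s.c_eq (by omega), hi, hj, quad, if_pos rfl, if_pos h, zero_mul] at this
    simp only [map_mul, ht, mul_assoc, Eid] at this ⊢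
    rw [this, map_zero, map_zero]
  | t_sq_neg k hk s i hi hj h =>
    have h2 : D.a i i ≠ 2 := fun h2 => by
      rw [form_α_α, h2] at h
      have := D.r_pos i
      omega
    have := ρ.T_sq k s hk
    rw [s.c_eq hk, s.c_eq (by omega), hi, hj, quad, if_pos rfl, if_neg h2, if_neg h.ne] at this
    simp only [map_mul (ρ.freeLift K), map_pow (ρ.freeLift K), map_add (ρ.freeLift K)]
    rw [Acts.mul_e (((Acts.x _).pow _ |>.add ((Acts.x _).pow _)).pow 2), ← this]
    simp only [ht, mul_assoc, Eid, map_mul]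
  | t_sq_zero k hk s i j hi hj h =>
    have := ρ.T_sq k s hk
    have h1 : D.quad i j (ρ.X k) (ρ.X (k + 1)) = 1 := by
      unfold quad
      by_cases hij : i = j
      · subst hij
        rw [if_pos rfl, if_neg (fun h2 => D.form_self_ne_zero h2 h), if_pos h]
      · rw [if_neg hij, if_pos h]
    rw [s.c_eq hk, s.c_eq (by omega), hi, hj, h1, one_mul] at this
    simp only [map_mul, ht, he, mul_assoc, Eid] at this ⊢
    exact this
  | t_sq_ne k hk s i j hi hj hij h =>
    have := ρ.T_sq k s hk
    rw [s.c_eq hk, s.c_eq (by omega), hi, hj, quad, if_neg hij, if_neg h] at this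
    simp only [map_mul (ρ.freeLift K), map_pow (ρ.freeLift K), map_add (ρ.freeLift K)]
    rw [Acts.mul_e (((Acts.x _).pow _ |>.add ((Acts.x _).pow _))), ← this]
    simp only [ht, mul_assoc, Eid, map_mul]
  | x_mul_t_real k hk s i hi hj h =>
    have := ρ.X_T k s hk
    rw [s.c_eq hk, s.c_eq (by omega), hi, hj, delta, if_pos ⟨rfl, h⟩, one_mul, sub_mul] at this
    simp only [map_mul, map_sub, hx, ht, he, mul_assoc, Eid] at this ⊢
    rw [EX _ hk, this]
  | t_mul_x_real k hk s i hi hj h =>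
    have := ρ.T_X k s hk
    rw [s.c_eq hk, s.c_eq (by omega), hi, hj, delta, if_pos ⟨rfl, h⟩, one_mul, sub_mul] at this
    simp only [map_mul, map_sub, hx, ht, he, mul_assoc, Eid] at this ⊢
    rw [EX _ (by omega), this]
  | x_mul_t_other k hk s i j hi hj h =>
    have := ρ.X_T k s hk
    rw [s.c_eq hk, s.c_eq (by omega), hi, hj, delta, if_neg h, zero_mul, sub_mul, sub_eq_zero] at this
    simp only [map_mul, hx, ht, mul_assoc, Eid] at this ⊢
    rw [this, ρ.X_mul_E _ s hk, EE]
  | t_mul_x_other k hk s i j hi hj h =>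
    have := ρ.T_X k s hk
    rw [s.c_eq hk, s.c_eq (by omega), hi, hj, delta, if_neg h, zero_mul, sub_mul, sub_eq_zero] at this
    simp only [map_mul, hx, ht, mul_assoc, Eid] at this ⊢
    rw [← this, ρ.X_mul_E _ s (by omega), EE]
  | braid_real k hk hk' s i j hi hj hm h hij h' =>
    have := ρ.braid k s hk'
    rw [s.c_eq hk, s.c_eq (show k < _ by omega), s.c_eq hk', hi, hj, hm, braidCorr,
      if_pos ⟨rfl, h, hij, h'⟩] at this
    rw [← Finset.sum_mul]
    simp only [map_mul (ρ.freeLift K), map_pow (ρ.freeLift K), map_sum (ρ.freeLift K),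
      map_sub (ρ.freeLift K)]
    rw [Acts.mul_e (Acts.sum fun c => ((Acts.x _).pow _).mul ((Acts.x _).pow _)), ← this]
    simp only [ht, mul_assoc, map_mul, map_sub, sub_mul, Eid, E2]
  | braid_other k hk hk' s i j m hi hj hm h =>
    have := ρ.braid k s hk'
    rw [s.c_eq hk, s.c_eq (show k < _ by omega), s.c_eq hk', hi, hj, hm, braidCorr,
      if_neg h, zero_mul, sub_mul, sub_eq_zero] at this
    simp only [map_mul, ht, mul_assoc, Eid, E2] at this ⊢
    exact this

end Lift

end Rep

end BorcherdsCartanDatum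

section AgreeOn

variable {B : Type*} [Ring B]

/-- The elements `w` and `b` agree after multiplication by `e`, which commutes with `b`. -/
def AgreeOn (e w b : B) : Prop := w * e = b * e ∧ Commute b e

variable {e : B}

theorem AgreeOn.one : AgreeOn e 1 1 := ⟨rfl, Commute.one_left _⟩

theorem AgreeOn.zero : AgreeOn e 0 0 := ⟨rfl, Commute.zero_left _⟩

theorem AgreeOn.add {w w' b b' : B} (h : AgreeOn e w b) (h' : AgreeOn e w' b') :
    AgreeOn e (w + w') (b + b') := ⟨by rw [add_mul, h.1, h'.1, add_mul], h.2.add_left h'.2⟩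

theorem AgreeOn.mul {w w' b b' : B} (h : AgreeOn e w b) (h' : AgreeOn e w' b') :
    AgreeOn e (w * w') (b * b') :=
  ⟨by rw [mul_assoc, h'.1, h'.2.eq, ← mul_assoc, h.1, mul_assoc, ← h'.2.eq, mul_assoc],
    h.2.mul_left h'.2⟩

theorem AgreeOn.pow {w b : B} (h : AgreeOn e w b) (m : ℕ) : AgreeOn e (w ^ m) (b ^ m) := by
  induction m with
  | zero => simpa using AgreeOn.one
  | succ m ih => rw [pow_succ, pow_succ]; exact ih.mul h

theorem AgreeOn.sum {ι : Type*} {t : Finset ι} {w b : ι → B} (h : ∀ j, AgreeOn e (w j) (b j)) :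
    AgreeOn e (∑ j ∈ t, w j) (∑ j ∈ t, b j) := by
  classical
  induction t using Finset.induction_on with
  | empty => simpa using AgreeOn.zero
  | insert j t hj ih => rw [Finset.sum_insert hj, Finset.sum_insert hj]; exact (h j).add ih

end AgreeOn

namespace BorcherdsCartanDatum

variable {I : Type v} {D : BorcherdsCartanDatum.{v, w} I} [Inhabited I] {ν ν' : I →₀ ℕ} {i : I}

namespace Rep

section Lift

variable {B : Type*} [Ring B] {K : Type u} [Field K] [Algebra K B] (ρ : D.Rep ν B)

variable (K) in
/-- The homomorphism out of `𝓡(ν)` determined by elements that satisfy the relations. -/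
def lift : D.KLR K ν →ₙₐ[K] B :=
  (cornerIncl ρ.one_idem).comp ((RingQuot.liftAlgHom K ⟨ρ.freeLift K, fun _ _ h =>
    ρ.freeLift_rel h⟩ : D.KLR K ν →ₐ[K] ρ.one_idem.Corner) : _ →ₙₐ[K] _)

theorem lift_gen (g : Gen ν) : ρ.lift K (D.klrGen K g) = ρ.gen g := by
  rw [← ρ.freeLift_coe (K := K) g]
  exact congrArg (cornerIncl ρ.one_idem) (RingQuot.liftAlgHom_mkAlgHom_apply K _ _ _)

theorem lift_one : ρ.lift K 1 = ρ.one :=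
  (congrArg (cornerIncl ρ.one_idem) (map_one (RingQuot.liftAlgHom K (s := D.Rel K ν) ⟨ρ.freeLift K, fun _ _ h =>
    ρ.freeLift_rel h⟩))).trans (cornerIncl_one (K := K) _)

theorem ext_E (h1 : ρ.one = 1) {a b : B} (h : ∀ s, a * ρ.E s = b * ρ.E s) : a = b := by
  rw [← mul_one a, ← mul_one b, ← h1, one, Finset.mul_sum, Finset.mul_sum,
    Finset.sum_congr rfl fun s _ => h s]

end Lift

end Rep

section Universal

variable (D) (K : Type u) [Field K] (ν)

theorem klr_rel {y z : FreeAlgebra K (Gen ν)} (h : D.Rel K ν y z) :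
    RingQuot.mkAlgHom K (D.Rel K ν) y = RingQuot.mkAlgHom K (D.Rel K ν) z :=
  RingQuot.mkAlgHom_rel K h

theorem mk_ι (g : Gen ν) :
    RingQuot.mkAlgHom K (D.Rel K ν) (FreeAlgebra.ι K g) = D.klrGen K g := rfl

variable {ν}

/-- The idempotents of `𝓡(ν)`. -/
def kE (s : SeqOf ν) : D.KLR K ν := D.klrGen K (.e s)

theorem klrGen_e (s : SeqOf ν) : D.klrGen K (.e s) = D.kE K s := rfl

variable (ν)

/-- The dot on the strand in position `k`. -/
def kX (k : ℕ) : D.KLR K ν := if h : k < ν.degree then ∑ s, D.klrGen K (.x ⟨k, h⟩ s) else 0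

/-- The crossing of the strands in the positions `k` and `k + 1`. -/
def kT (k : ℕ) : D.KLR K ν := if h : k + 1 < ν.degree then ∑ s, D.klrGen K (.t k h s) else 0

variable {ν}

theorem kE_mul_self (s : SeqOf ν) : D.kE K s * D.kE K s = D.kE K s := by
  simpa only [map_mul, mk_ι, klrGen_e] using D.klr_rel ν K (.e_mul_self s)

theorem kE_mul_of_ne (s s' : SeqOf ν) (h : s ≠ s') : D.kE K s * D.kE K s' = 0 := by
  simpa only [map_mul, mk_ι, klrGen_e, map_zero] using D.klr_rel ν K (.e_mul_of_ne s s' h)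

theorem kE_mul_x {k : ℕ} (hk : k < ν.degree) (s : SeqOf ν) :
    D.kE K s * D.klrGen K (.x ⟨k, hk⟩ s) = D.klrGen K (.x ⟨k, hk⟩ s) := by
  simpa only [map_mul, mk_ι, klrGen_e] using D.klr_rel ν K (.e_mul_x k hk s)

theorem x_mul_kE {k : ℕ} (hk : k < ν.degree) (s : SeqOf ν) :
    D.klrGen K (.x ⟨k, hk⟩ s) * D.kE K s = D.klrGen K (.x ⟨k, hk⟩ s) := by
  simpa only [map_mul, mk_ι, klrGen_e] using D.klr_rel ν K (.x_mul_e k hk s)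

theorem kE_mul_t {k : ℕ} (hk : k + 1 < ν.degree) (s : SeqOf ν) :
    D.kE K (s.swap k hk) * D.klrGen K (.t k hk s) = D.klrGen K (.t k hk s) := by
  simpa only [map_mul, mk_ι, klrGen_e] using D.klr_rel ν K (.e_mul_t k hk s)

theorem t_mul_kE {k : ℕ} (hk : k + 1 < ν.degree) (s : SeqOf ν) :
    D.klrGen K (.t k hk s) * D.kE K s = D.klrGen K (.t k hk s) := by
  simpa only [map_mul, mk_ι, klrGen_e] using D.klr_rel ν K (.t_mul_e k hk s)

theorem kX_mul_kE {k : ℕ} (hk : k < ν.degree) (s : SeqOf ν) :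
    D.kX ν K k * D.kE K s = D.klrGen K (.x ⟨k, hk⟩ s) := by
  rw [kX, dif_pos hk, Finset.sum_mul, Finset.sum_eq_single s, x_mul_kE]
  · intro s' _ hs
    rw [← x_mul_kE, mul_assoc, kE_mul_of_ne _ _ _ _ hs, mul_zero]
  · simp

theorem kE_mul_kX {k : ℕ} (hk : k < ν.degree) (s : SeqOf ν) :
    D.kE K s * D.kX ν K k = D.klrGen K (.x ⟨k, hk⟩ s) := by
  rw [kX, dif_pos hk, Finset.mul_sum, Finset.sum_eq_single s, kE_mul_x]
  · intro s' _ hs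
    rw [← kE_mul_x, ← mul_assoc, kE_mul_of_ne _ _ _ _ hs.symm, zero_mul]
  · simp

theorem kT_mul_kE {k : ℕ} (hk : k + 1 < ν.degree) (s : SeqOf ν) :
    D.kT ν K k * D.kE K s = D.klrGen K (.t k hk s) := by
  rw [kT, dif_pos hk, Finset.sum_mul, Finset.sum_eq_single s, t_mul_kE]
  · intro s' _ hs
    rw [← t_mul_kE, mul_assoc, kE_mul_of_ne _ _ _ _ hs, mul_zero]
  · simp

theorem kE_mul_kT {k : ℕ} (hk : k + 1 < ν.degree) (s : SeqOf ν) :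
    D.kE K (s.swap k hk) * D.kT ν K k = D.klrGen K (.t k hk s) := by
  rw [kT, dif_pos hk, Finset.mul_sum, Finset.sum_eq_single s, kE_mul_t]
  · intro s' _ hs
    rw [← kE_mul_t, ← mul_assoc, kE_mul_of_ne, zero_mul]
    intro hh
    apply hs
    rw [← SeqOf.sw_eq, ← SeqOf.sw_eq] at hh
    rw [← SeqOf.sw_sw s k, hh, SeqOf.sw_sw]
  · simp

theorem kX_mul {k : ℕ} (hk : k < ν.degree) {s : SeqOf ν} {y : D.KLR K ν} (hy : D.kE K s * y = y) :
    D.kX ν K k * y = D.klrGen K (.x ⟨k, hk⟩ s) * y := by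
  conv_lhs => rw [← hy, ← mul_assoc, kX_mul_kE D K hk]

theorem kT_mul {k : ℕ} (hk : k + 1 < ν.degree) {s : SeqOf ν} {y : D.KLR K ν}
    (hy : D.kE K s * y = y) : D.kT ν K k * y = D.klrGen K (.t k hk s) * y := by
  conv_lhs => rw [← hy, ← mul_assoc, kT_mul_kE D K hk]

theorem kTT {k l : ℕ} (hk : k + 1 < ν.degree) (hl : l + 1 < ν.degree) (s : SeqOf ν) :
    D.kT ν K l * D.kT ν K k * D.kE K s =
      D.klrGen K (.t l hl (s.swap k hk)) * D.klrGen K (.t k hk s) := by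
  rw [mul_assoc, kT_mul_kE D K hk, kT_mul D K hl (kE_mul_t D K hk s)]

theorem kTTT {k l m : ℕ} (hk : k + 1 < ν.degree) (hl : l + 1 < ν.degree) (hm : m + 1 < ν.degree)
    (s : SeqOf ν) :
    D.kT ν K m * D.kT ν K l * D.kT ν K k * D.kE K s =
      D.klrGen K (.t m hm ((s.swap k hk).swap l hl)) * D.klrGen K (.t l hl (s.swap k hk)) *
        D.klrGen K (.t k hk s) := by
  rw [mul_assoc, mul_assoc, ← mul_assoc (D.kT ν K l), kTT D K hk hl,
    kT_mul D K hm (s := (s.swap k hk).swap l hl), mul_assoc]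
  rw [← mul_assoc, kE_mul_t D K hl]

theorem kXT {k l : ℕ} (hk : k + 1 < ν.degree) (hl : l < ν.degree) (s : SeqOf ν) :
    D.kX ν K l * D.kT ν K k * D.kE K s =
      D.klrGen K (.x ⟨l, hl⟩ (s.swap k hk)) * D.klrGen K (.t k hk s) := by
  rw [mul_assoc, kT_mul_kE D K hk, kX_mul D K hl (kE_mul_t D K hk s)]

theorem kTX {k l : ℕ} (hk : k + 1 < ν.degree) (hl : l < ν.degree) (s : SeqOf ν) :
    D.kT ν K k * D.kX ν K l * D.kE K s =
      D.klrGen K (.t k hk s) * D.klrGen K (.x ⟨l, hl⟩ s) := by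
  rw [mul_assoc, kX_mul_kE D K hl, kT_mul D K hk (kE_mul_x D K hl s)]

theorem agreeOn_x {k : ℕ} (hk : k < ν.degree) (s : SeqOf ν) :
    AgreeOn (D.kE K s) (D.klrGen K (.x ⟨k, hk⟩ s)) (D.kX ν K k) :=
  ⟨by rw [kX_mul_kE D K hk, x_mul_kE], by
    unfold Commute SemiconjBy; rw [kX_mul_kE D K hk, kE_mul_kX D K hk]⟩

/-- The generators of `𝓡(ν)` satisfy the relations. -/
def univ : D.Rep ν (D.KLR K ν) where
  E := D.kE K
  X := D.kX ν K
  T := D.kT ν K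
  E_mul_self := D.kE_mul_self K
  E_mul_of_ne := D.kE_mul_of_ne K
  X_mul_E k s hk := by rw [kX_mul_kE D K hk, kE_mul_kX D K hk]
  T_mul_E k s hk := by rw [kT_mul_kE D K hk, SeqOf.sw_eq s hk, kE_mul_kT D K hk]
  X_mul_X k l s hk hl := by
    rw [mul_assoc, kX_mul_kE D K hl, kX_mul D K hk (kE_mul_x D K hl s), mul_assoc,
      kX_mul_kE D K hk, kX_mul D K hl (kE_mul_x D K hk s)]
    simpa only [map_mul, mk_ι, klrGen_e] using D.klr_rel ν K (.x_mul_x k l hk hl s)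
  X_mul_T k l s hk hl h h' := by
    rw [kXT D K hk hl, kTX D K hk hl]
    simpa only [map_mul, mk_ι, klrGen_e] using D.klr_rel ν K (.x_mul_t k l hk hl s h h')
  T_mul_T k l s h hl := by
    rw [kTT D K (by omega) hl, kTT D K hl (by omega)]
    simpa only [map_mul, mk_ι, klrGen_e] using D.klr_rel ν K (.t_mul_t k l (by omega) hl s h)
  T_sq k s hk := by
    rw [kTT D K hk hk]
    unfold quad
    split_ifs with h1 h2 h3 h4
    · simpa only [map_mul, mk_ι, map_zero, zero_mul] using D.klr_rel ν K
        (.t_sq_real k hk s _ (s.c_eq _).symm ((s.c_eq hk).symm.trans h1.symm) h2)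
    · simpa only [map_mul, mk_ι, klrGen_e, one_mul] using D.klr_rel ν K
        (.t_sq_zero k hk s _ _ (s.c_eq _).symm ((s.c_eq hk).symm.trans h1.symm) h3)
    · have h4 : D.form (D.α (s.c k)) (D.α (s.c k)) < 0 := by
        have := D.a_diag (s.c k)
        rw [form_α_α] at h3 ⊢
        refine lt_of_le_of_ne (mul_nonpos_of_nonneg_of_nonpos (D.r_pos _).le ?_) h3
        tauto
      rw [← ((((agreeOn_x D K (show k < _ by omega) s).pow _).add ((agreeOn_x D K hk s).pow _)).pow 2).1]
      simpa only [map_mul, map_add, map_pow, mk_ι, klrGen_e] using D.klr_rel ν K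
        (.t_sq_neg k hk s _ (s.c_eq _).symm ((s.c_eq hk).symm.trans h1.symm) h4)
    · simpa only [map_mul, mk_ι, klrGen_e, one_mul] using D.klr_rel ν K
        (.t_sq_zero k hk s _ _ (s.c_eq _).symm (s.c_eq hk).symm h4)
    · rw [← (((agreeOn_x D K (show k < _ by omega) s).pow _).add ((agreeOn_x D K hk s).pow _)).1]
      simpa only [map_mul, map_add, map_pow, mk_ι, klrGen_e] using D.klr_rel ν K
        (.t_sq_ne k hk s _ _ (s.c_eq _).symm (s.c_eq hk).symm h1 h4)
  X_T k s hk := by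
    rw [sub_mul, kXT D K hk, kTX D K hk]
    unfold delta
    split_ifs with h
    · simpa only [map_mul, map_sub, mk_ι, klrGen_e, one_mul] using D.klr_rel ν K
        (.x_mul_t_real k hk s _ (s.c_eq _).symm ((s.c_eq hk).symm.trans h.1.symm) h.2)
    · rw [zero_mul, sub_eq_zero]
      simpa only [map_mul, mk_ι, klrGen_e] using D.klr_rel ν K
        (.x_mul_t_other k hk s _ _ (s.c_eq _).symm (s.c_eq hk).symm h)
  T_X k s hk := by
    rw [sub_mul, kXT D K hk, kTX D K hk]
    unfold delta
    split_ifs with h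
    · simpa only [map_mul, map_sub, mk_ι, klrGen_e, one_mul] using D.klr_rel ν K
        (.t_mul_x_real k hk s _ (s.c_eq _).symm ((s.c_eq hk).symm.trans h.1.symm) h.2)
    · rw [zero_mul, sub_eq_zero]
      simpa only [map_mul, mk_ι, klrGen_e] using D.klr_rel ν K
        (.t_mul_x_other k hk s _ _ (s.c_eq _).symm (s.c_eq hk).symm h)
  braid k s hk := by
    rw [sub_mul, kTTT D K (show k + 1 < _ by omega) hk, kTTT D K hk (show k + 1 < _ by omega)]
    unfold braidCorr
    split_ifs with h
    · rw [← (AgreeOn.sum fun c => ((agreeOn_x D K (show k < _ by omega) s).pow _).mul ((agreeOn_x D K hk s).pow _)).1,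
        Finset.sum_mul]
      simpa only [map_mul, map_sum, map_sub, map_pow, mk_ι, klrGen_e] using D.klr_rel ν K
        (.braid_real k (by omega) hk s _ _ (s.c_eq _).symm (s.c_eq _).symm
          ((s.c_eq hk).symm.trans h.1.symm) h.2.1 h.2.2.1 h.2.2.2)
    · rw [zero_mul, sub_eq_zero]
      simpa only [map_mul, mk_ι, klrGen_e] using D.klr_rel ν K
        (.braid_other k (by omega) hk s _ _ _ (s.c_eq _).symm (s.c_eq _).symm (s.c_eq hk).symm h)

end Universal

end BorcherdsCartanDatum

section BraidIdentities

/-- Elements of a ring that commute as the rational functions attached to two strands. -/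
structure CrossingRels {S : Type*} [Ring S] (P Q ε u v f g T : S) : Prop where
  PP : P * P = P
  QQ : Q * Q = Q
  QP : Commute Q P
  eP : ε * P = P * Q
  Pe : P * ε = P * Q
  Qe : Q * ε = P * Q
  eQ : ε * Q = P * Q
  uP : Commute u P
  uQ : Commute u Q
  ue : Commute u ε
  vP : Commute v P
  vQ : Commute v Q
  ve : Commute v ε
  vu : Commute v u
  fP : f * P = 0
  Pf : P * f = 0
  fQ : Commute f Q
  fe : Commute f ε
  fu : Commute f u
  fv : Commute f v
  gP : Commute g P
  gQ : g * Q = 0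
  Qg : Q * g = 0
  ge : Commute g ε
  gu : Commute g u
  gv : Commute g v
  TP : T * P = Q * T
  TQ : T * Q = P * T
  Te : T * ε = ε * T
  Tu : T * u = v * T + ε * (u * v)
  Tv : T * v = u * T - ε * (u * v)
  PTf : P * (T * f) = P * (g * T)
  QTg : Q * (T * g) = Q * (f * T)
  Tgf : T * (g * f) = g * (f * T)

namespace CrossingRels

variable {S : Type*} [Ring S] {P Q ε u v f g T : S} (h : CrossingRels P Q ε u v f g T)
include h

theorem TP_mul (w : S) : T * (P * w) = Q * (T * w) := by rw [← mul_assoc, h.TP, mul_assoc]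

theorem TQ_mul (w : S) : T * (Q * w) = P * (T * w) := by rw [← mul_assoc, h.TQ, mul_assoc]

theorem Te_mul (w : S) : T * (ε * w) = ε * (T * w) := by rw [← mul_assoc, h.Te, mul_assoc]

theorem Tu_mul (w : S) : T * (u * w) = v * (T * w) + ε * (u * (v * w)) := by
  rw [← mul_assoc, h.Tu]; simp only [add_mul, mul_assoc]

theorem Tv_mul (w : S) : T * (v * w) = u * (T * w) - ε * (u * (v * w)) := by
  rw [← mul_assoc, h.Tv]; simp only [sub_mul, mul_assoc]

theorem Pe_mul (w : S) : P * (ε * w) = P * (Q * w) := by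
  rw [← mul_assoc, h.Pe, mul_assoc]

theorem Qe_mul (w : S) : Q * (ε * w) = P * (Q * w) := by
  rw [← mul_assoc, h.Qe, mul_assoc]

theorem PP_mul (w : S) : P * (P * w) = P * w := by rw [← mul_assoc, h.PP]

theorem QQ_mul (w : S) : Q * (Q * w) = Q * w := by rw [← mul_assoc, h.QQ]

theorem fP_mul (w : S) : f * (P * w) = 0 := by rw [← mul_assoc, h.fP, zero_mul]

theorem Pf_mul (w : S) : P * (f * w) = 0 := by rw [← mul_assoc, h.Pf, zero_mul]

theorem gQ_mul (w : S) : g * (Q * w) = 0 := by rw [← mul_assoc, h.gQ, zero_mul]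

theorem Qg_mul (w : S) : Q * (g * w) = 0 := by rw [← mul_assoc, h.Qg, zero_mul]

theorem nil12 (w : S) : P * (u * (T * w)) - Q * (v * (P * (u * w))) - T * (Q * (v * w)) = 0 := by
  simp only [h.TP_mul, h.TQ_mul, h.Te_mul, h.Tu_mul, h.Tv_mul, h.PP_mul,
    h.QQ_mul, h.QP.left_comm, h.uP.left_comm, h.uQ.left_comm, h.ue.left_comm, h.vP.left_comm,
    h.vQ.left_comm, h.ve.left_comm, h.vu.left_comm, h.Pe_mul, h.Qe_mul, mul_add, mul_sub, mul_neg]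
  abel

theorem nil21 (w : S) : -(P * (u * (u * (T * (P * (u * w)))))) +
    P * (u * (Q * (v * (P * (u * (u * w)))))) + Q * (v * (P * (u * (u * (T * w))))) = 0 := by
  simp only [h.TP_mul, h.TQ_mul, h.Te_mul, h.Tu_mul, h.Tv_mul, h.PP_mul,
    h.QQ_mul, h.QP.left_comm, h.uP.left_comm, h.uQ.left_comm, h.ue.left_comm, h.vP.left_comm,
    h.vQ.left_comm, h.ve.left_comm, h.vu.left_comm, h.Pe_mul, h.Qe_mul, mul_add, mul_sub, mul_neg]
  abel

theorem nil22 (w : S) : -(P * (u * (u * (T * w)))) + P * (u * (Q * (v * (P * (u * w))))) +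
    Q * (v * (P * (u * (Q * (v * w))))) + T * (Q * (v * (v * w))) = 0 := by
  simp only [h.TP_mul, h.TQ_mul, h.Te_mul, h.Tu_mul, h.Tv_mul, h.PP_mul,
    h.QQ_mul, h.QP.left_comm, h.uP.left_comm, h.uQ.left_comm, h.ue.left_comm, h.vP.left_comm,
    h.vQ.left_comm, h.ve.left_comm, h.vu.left_comm, h.Pe_mul, h.Qe_mul, mul_add, mul_sub, mul_neg]
  abel

theorem nil11 (w : S) : P * (u * (T * (P * (u * w)))) - Q * (v * (P * (u * (u * w)))) -
    T * (P * (u * (T * w))) + Q * (T * (T * (v * w))) = 0 := by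
  simp only [h.TP_mul, h.TQ_mul, h.Te_mul, h.Tu_mul, h.Tv_mul, h.PP_mul,
    h.QQ_mul, h.QP.left_comm, h.uP.left_comm, h.uQ.left_comm, h.ue.left_comm, h.vP.left_comm,
    h.vQ.left_comm, h.ve.left_comm, h.vu.left_comm, h.Pe_mul, h.Qe_mul, mul_add, mul_sub, mul_neg]
  abel

theorem nil31 (w : S) : T * (Q * (v * (v * (P * (u * (u * w)))))) -
    Q * (v * (v * (P * (u * (u * (T * w)))))) = 0 := by
  simp only [h.TP_mul, h.TQ_mul, h.Te_mul, h.Tu_mul, h.Tv_mul, h.PP_mul,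
    h.QQ_mul, h.QP.left_comm, h.uP.left_comm, h.uQ.left_comm, h.ue.left_comm, h.vP.left_comm,
    h.vQ.left_comm, h.ve.left_comm, h.vu.left_comm, h.Pe_mul, h.Qe_mul, mul_add, mul_sub, mul_neg]
  abel

theorem nil32 (w : S) : -(T * (Q * (v * (v * (P * (u * w)))))) +
    Q * (v * (v * (P * (u * (Q * (v * w)))))) + Q * (v * (T * (Q * (v * (v * w))))) = 0 := by
  simp only [h.TP_mul, h.TQ_mul, h.Te_mul, h.Tu_mul, h.Tv_mul, h.PP_mul,
    h.QQ_mul, h.QP.left_comm, h.uP.left_comm, h.uQ.left_comm, h.ue.left_comm, h.vP.left_comm,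
    h.vQ.left_comm, h.ve.left_comm, h.vu.left_comm, h.Pe_mul, h.Qe_mul, mul_add, mul_sub, mul_neg]
  abel

theorem nil33 (w : S) : -(T * (Q * (v * (T * w)))) - Q * (v * (v * (P * (u * w)))) -
    Q * (v * (T * (Q * (v * w)))) + P * (T * (T * (u * w))) = 0 := by
  simp only [h.TP_mul, h.TQ_mul, h.Te_mul, h.Tu_mul, h.Tv_mul, h.PP_mul,
    h.QQ_mul, h.QP.left_comm, h.uP.left_comm, h.uQ.left_comm, h.ue.left_comm, h.vP.left_comm,
    h.vQ.left_comm, h.ve.left_comm, h.vu.left_comm, h.Pe_mul, h.Qe_mul, mul_add, mul_sub, mul_neg]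
  abel

theorem entry11 : P * u * T * (P * u) + Q * v * (-(P * u * u) + f) - T * (P * u) * T =
    Q * ((f - T * T) * v) := by
  have := h.nil11 1
  simp only [mul_one] at this
  simp only [mul_assoc, mul_add, mul_sub, sub_mul, mul_neg]
  rw [h.fv.eq, ← sub_eq_zero]
  refine Eq.trans ?_ this
  abel

theorem entry12 : P * u * T - Q * v * (P * u) = T * (Q * v) := by
  have := h.nil12 1
  simp only [mul_one] at this
  simp only [mul_assoc]
  rw [← sub_eq_zero, this]

theorem entry21 : (-(P * u * u) + f) * T * (P * u) - P * u * (Q * v) * (-(P * u * u) + f) =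
    Q * v * (-(P * u * u) + f) * T := by
  have := h.nil21 1
  simp only [mul_one] at this
  have e1 : f * (T * (P * u)) = Q * (v * (f * T)) := by
    rw [h.TP_mul, h.Tu, mul_add, mul_add, h.Qe_mul, h.fP_mul, add_zero, h.fQ.left_comm,
      h.fv.left_comm]
  have e2 : P * (u * (Q * (v * f))) = 0 := by
    rw [← h.fv.eq, h.uQ.left_comm, ← h.fu.left_comm, ← h.fQ.left_comm, h.Pf_mul]
  simp only [mul_assoc, mul_add, add_mul, mul_neg, neg_mul]
  rw [e1, e2, ← sub_eq_zero]
  refine Eq.trans ?_ this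
  abel

theorem entry22 : (-(P * u * u) + f) * T + P * u * (Q * v) * (P * u) + Q * v * (P * u) * (Q * v) -
    T * (-(Q * v * v) + g) = f * T - T * g := by
  have := h.nil22 1
  simp only [mul_one] at this
  simp only [mul_assoc, mul_add, add_mul, mul_neg, neg_mul]
  rw [← sub_eq_zero]
  refine Eq.trans ?_ this
  abel

theorem entry31 : T * (-(Q * v * v) + g) * (-(P * u * u) + f) =
    (-(Q * v * v) + g) * (-(P * u * u) + f) * T := by
  have := h.nil31 1
  simp only [mul_one] at this
  have e1 : T * (Q * (v * (v * f))) = g * (P * (u * (u * T))) := by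
    have z1 : P * (ε * (u * (v * (v * f)))) = 0 := by
      rw [h.Pe_mul, ← h.fv.eq, ← h.fv.left_comm, ← h.fu.left_comm, ← h.fQ.left_comm, h.Pf_mul]
    have z2 : P * (u * (ε * (u * (v * f)))) = 0 := by
      rw [← h.uP.left_comm, h.Pe_mul, ← h.fv.eq, ← h.fu.left_comm, ← h.fQ.left_comm, h.Pf_mul,
        mul_zero]
    rw [h.TQ_mul, h.Tv_mul, h.Tv_mul, mul_sub, mul_sub, mul_sub, z1, z2, sub_zero, sub_zero,
      ← h.uP.left_comm, ← h.uP.left_comm, h.PTf, ← h.gP.left_comm, ← h.gu.left_comm,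
      ← h.gu.left_comm, ← h.uP.left_comm, ← h.uP.left_comm]
  have e2 : T * (g * (P * (u * u))) = Q * (v * (v * (f * T))) := by
    have z1 : Q * (ε * (u * (v * (u * g)))) = 0 := by
      rw [h.Qe_mul, ← h.gu.eq, ← h.gv.left_comm, ← h.gu.left_comm, h.Qg_mul, mul_zero]
    have z2 : Q * (v * (ε * (u * (v * g)))) = 0 := by
      rw [← h.vQ.left_comm, h.Qe_mul, ← h.gv.eq, ← h.gu.left_comm, h.Qg_mul, mul_zero, mul_zero]
    rw [h.gP.left_comm, h.gu.left_comm, h.gu.eq, h.TP_mul, h.Tu_mul, h.Tu_mul, mul_add, mul_add,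
      mul_add, z1, z2, add_zero, add_zero, ← h.vQ.left_comm, ← h.vQ.left_comm, h.QTg,
      h.vQ.left_comm, h.vQ.left_comm]
  simp only [mul_assoc, mul_add, add_mul, mul_neg, neg_mul, h.Tgf, e1, e2, neg_neg]
  rw [← sub_eq_zero]
  refine Eq.trans ?_ this
  abel

theorem entry32 : T * (-(Q * v * v) + g) * (P * u) = (-(Q * v * v) + g) * (P * u) * (Q * v) +
    Q * v * T * (-(Q * v * v) + g) := by
  have := h.nil32 1
  simp only [mul_one] at this
  have e1 : T * (g * (P * u)) = Q * (v * (T * g)) := by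
    rw [h.gP.left_comm, h.gu.eq, h.TP_mul, h.Tu_mul, mul_add, h.Qe_mul, ← h.gv.eq,
      ← h.gu.left_comm, h.Qg_mul, mul_zero, add_zero]
  have e2 : g * (P * (u * (Q * v))) = 0 := by
    rw [h.uQ.left_comm, ← h.QP.left_comm, h.gQ_mul]
  simp only [mul_assoc, mul_add, add_mul, mul_neg, neg_mul, e1, e2]
  rw [← sub_eq_zero]
  refine Eq.trans ?_ this
  abel

theorem entry33 : -(T * (Q * v) * T) + (-(Q * v * v) + g) * (P * u) - Q * v * T * (Q * v) =
    P * ((g - T * T) * u) := by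
  have := h.nil33 1
  simp only [mul_one] at this
  simp only [mul_assoc, mul_add, add_mul, mul_neg, neg_mul, sub_mul, mul_sub]
  rw [h.gP.left_comm, ← sub_eq_zero]
  refine Eq.trans ?_ this
  abel

end CrossingRels

end BraidIdentities

section DividedDifferences

variable {S : Type*} [Ring S] {T x y ε : S}

theorem mul_pow_divided (h : T * x = y * T + ε) (hx : Commute ε x) (hy : Commute ε y)
    (hxy : Commute x y) (N : ℕ) :
    T * x ^ N = y ^ N * T + ε * ∑ c ∈ Finset.range N, x ^ c * y ^ (N - 1 - c) := by
  induction N with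
  | zero => simp
  | succ N ih =>
    rw [pow_succ', ← mul_assoc, h, add_mul, mul_assoc, ih, mul_add, ← mul_assoc, ← pow_succ',
      add_assoc, Finset.sum_range_succ, mul_add ε]
    congr 1
    have e : y * (ε * ∑ c ∈ Finset.range N, x ^ c * y ^ (N - 1 - c)) =
        ε * ∑ c ∈ Finset.range N, x ^ c * y ^ (N + 1 - 1 - c) := by
      rw [← mul_assoc, ← hy.eq, mul_assoc, Finset.mul_sum]
      congr 1
      refine Finset.sum_congr rfl fun c hc => ?_
      rw [← mul_assoc, ((hxy.pow_left c).symm).eq, mul_assoc, ← pow_succ']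
      congr 2
      have := Finset.mem_range.1 hc
      omega
    rw [e]
    simp

end DividedDifferences

namespace BorcherdsCartanDatum

variable {I : Type v} {D : BorcherdsCartanDatum.{v, w} I} [Inhabited I] {β : I →₀ ℕ}
  {S : Type*} [Ring S]

namespace Rep

/-- The element `∑ φ(s) 1_s`. -/
def diag (ρ : D.Rep β S) (φ : SeqOf β → S) : S := ∑ s, φ s * ρ.E s

variable (ρ : D.Rep β S)

theorem diag_mul_E (φ : SeqOf β → S) (s : SeqOf β) : ρ.diag φ * ρ.E s = φ s * ρ.E s := by
  rw [diag, Finset.sum_mul, Finset.sum_eq_single s, mul_assoc, ρ.E_mul_self]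
  · intro s' _ hs
    rw [mul_assoc, ρ.E_mul_of_ne _ _ hs, mul_zero]
  · simp

theorem diag_commute {φ : SeqOf β → S} {b : S} (hE : ∀ s, Commute b (ρ.E s))
    (hφ : ∀ s, Commute b (φ s)) : Commute b (ρ.diag φ) :=
  Commute.sum_right _ _ _ fun s _ => (hφ s).mul_right (hE s)

theorem E_commute_E (s s' : SeqOf β) : Commute (ρ.E s) (ρ.E s') := by
  by_cases h : s = s'
  · subst h; exact Commute.refl _
  · exact (ρ.E_mul_of_ne _ _ h).trans (ρ.E_mul_of_ne _ _ (Ne.symm h)).symm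

section Total

variable (h1 : ρ.one = 1)
include h1

theorem X_comm_E {k : ℕ} (hk : k < β.degree) (s : SeqOf β) : Commute (ρ.X k) (ρ.E s) :=
  ρ.X_mul_E k s hk

theorem X_comm_X {k l : ℕ} (hk : k < β.degree) (hl : l < β.degree) : Commute (ρ.X k) (ρ.X l) :=
  ρ.ext_E h1 fun s => ρ.X_mul_X k l s hk hl

theorem X_comm_T {k l : ℕ} (hk : k + 1 < β.degree) (hl : l < β.degree) (h : l ≠ k)
    (h' : l ≠ k + 1) : Commute (ρ.X l) (ρ.T k) :=
  ρ.ext_E h1 fun s => ρ.X_mul_T k l s hk hl h h'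

theorem T_comm_T {k l : ℕ} (h : k + 1 < l) (hl : l + 1 < β.degree) : Commute (ρ.T l) (ρ.T k) :=
  ρ.ext_E h1 fun s => ρ.T_mul_T k l s h hl

theorem T_sq_eq {k : ℕ} (hk : k + 1 < β.degree) :
    ρ.T k * ρ.T k = ρ.diag fun s => D.quad (s.c k) (s.c (k + 1)) (ρ.X k) (ρ.X (k + 1)) :=
  ρ.ext_E h1 fun s => by rw [ρ.T_sq k s hk, diag_mul_E]

/-- The indicator of the positions `k` and `k + 1` having equal real colours. -/
def eps (ρ : D.Rep β S) (k : ℕ) : S := ρ.diag fun s => D.delta S (s.c k) (s.c (k + 1))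

theorem X_T_eq {k : ℕ} (hk : k + 1 < β.degree) :
    ρ.X k * ρ.T k - ρ.T k * ρ.X (k + 1) = ρ.eps k :=
  ρ.ext_E h1 fun s => by rw [ρ.X_T k s hk, eps, diag_mul_E]

theorem T_X_eq {k : ℕ} (hk : k + 1 < β.degree) :
    ρ.T k * ρ.X k - ρ.X (k + 1) * ρ.T k = ρ.eps k :=
  ρ.ext_E h1 fun s => by rw [ρ.T_X k s hk, eps, diag_mul_E]

theorem braid_eq {k : ℕ} (hk : k + 2 < β.degree) :
    ρ.T k * ρ.T (k + 1) * ρ.T k - ρ.T (k + 1) * ρ.T k * ρ.T (k + 1) = ρ.diag fun s =>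
      D.braidCorr (s.c k) (s.c (k + 1)) (s.c (k + 2)) (ρ.X k) (ρ.X (k + 2)) :=
  ρ.ext_E h1 fun s => by rw [ρ.braid k s hk, diag_mul_E]

end Total

theorem eps_comm {b : S} (k : ℕ) (hE : ∀ s, Commute b (ρ.E s)) : Commute b (ρ.eps k) :=
  ρ.diag_commute hE fun s => (D.delta_commute _ _ _).symm

theorem T_mul_diag {k : ℕ} (hk : k + 1 < β.degree) (h1 : ρ.one = 1) {φ : SeqOf β → S}
    (hφ : ∀ s b, Commute (φ s) b) : ρ.T k * ρ.diag φ = ρ.diag (fun s => φ (s.sw k)) * ρ.T k := by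
  refine ρ.ext_E h1 fun s => ?_
  rw [mul_assoc, diag_mul_E, mul_assoc, ρ.T_mul_E k s hk, ← mul_assoc (ρ.diag _), diag_mul_E,
    SeqOf.sw_sw, ← mul_assoc, ← (hφ s _).eq, mul_assoc, ρ.T_mul_E k s hk, mul_assoc]

end Rep

variable (D β S) in
/-- Elements satisfying the relations of `𝓡(β)`, together with a central element `t` for which
all the differences `t - x_k` are invertible. -/
structure LocRep extends D.Rep β S where
  one_eq : toRep.one = 1
  /-- The central element. -/
  t : S
  t_comm : ∀ b, Commute t b
  /-- The differences. -/
  dif : ℕ → Sˣ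
  dif_eq : ∀ k, k < β.degree → (dif k : S) = t - X k

namespace LocRep

variable (ρ : D.LocRep β S)

/-- The inverse of `t - x_k`. -/
def U (k : ℕ) : S := ↑(ρ.dif k)⁻¹

theorem U_comm {k : ℕ} (hk : k < β.degree) {b : S} (h : Commute b (ρ.X k)) : Commute b (ρ.U k) := by
  refine Commute.units_inv_right ?_
  rw [ρ.dif_eq k hk]
  exact (ρ.t_comm b).symm.sub_right h

theorem U_mul {k : ℕ} (hk : k < β.degree) : ρ.U k * (ρ.t - ρ.X k) = 1 := by
  rw [← ρ.dif_eq k hk, U, Units.inv_mul]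

theorem mul_U {k : ℕ} (hk : k < β.degree) : (ρ.t - ρ.X k) * ρ.U k = 1 := by
  rw [← ρ.dif_eq k hk, U, Units.mul_inv]

theorem X_comm_U {k l : ℕ} (hk : k < β.degree) (hl : l < β.degree) : Commute (ρ.X k) (ρ.U l) :=
  ρ.U_comm hl (ρ.X_comm_X ρ.one_eq hk hl)

theorem E_comm_U {l : ℕ} (hl : l < β.degree) (s : SeqOf β) : Commute (ρ.U l) (ρ.E s) :=
  (ρ.U_comm hl (ρ.X_comm_E ρ.one_eq hl s).symm).symm

theorem U_comm_U {k l : ℕ} (hk : k < β.degree) (hl : l < β.degree) : Commute (ρ.U k) (ρ.U l) :=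
  ρ.U_comm hl (ρ.X_comm_U hl hk).symm

variable (i : I)

/-- The indicator of the real colour `i` in position `l`. -/
def P (l : ℕ) : S := ρ.diag fun s => D.delta S i (s.c l)

/-- The polynomials `Q_{i,s_l}(t, x_l)`. -/
def f (l : ℕ) : S := ρ.diag fun s => D.quad i (s.c l) ρ.t (ρ.X l)

theorem P_comm (l : ℕ) {b : S} (hE : ∀ s, Commute b (ρ.E s)) : Commute b (ρ.P i l) :=
  ρ.diag_commute hE fun _ => (D.delta_commute _ _ _).symm

theorem f_comm {l : ℕ} {b : S} (hE : ∀ s, Commute b (ρ.E s)) (hX : Commute b (ρ.X l)) :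
    Commute b (ρ.f i l) :=
  ρ.diag_commute hE fun _ => D.quad_commute (ρ.t_comm b).symm hX

theorem E_comm_P (l : ℕ) (s : SeqOf β) : Commute (ρ.P i l) (ρ.E s) :=
  (ρ.P_comm i l fun s' => ρ.E_commute_E s s').symm

theorem E_comm_f {l : ℕ} (hl : l < β.degree) (s : SeqOf β) : Commute (ρ.f i l) (ρ.E s) :=
  (ρ.f_comm i (fun s' => ρ.E_commute_E s s') (ρ.X_comm_E ρ.one_eq hl s).symm).symm

theorem P_mul_E (l : ℕ) (s : SeqOf β) : ρ.P i l * ρ.E s = D.delta S i (s.c l) * ρ.E s :=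
  ρ.diag_mul_E _ _

theorem f_mul_E (l : ℕ) (s : SeqOf β) :
    ρ.f i l * ρ.E s = D.quad i (s.c l) ρ.t (ρ.X l) * ρ.E s := ρ.diag_mul_E _ _

theorem eps_mul_E (l : ℕ) (s : SeqOf β) :
    ρ.eps l * ρ.E s = D.delta S (s.c l) (s.c (l + 1)) * ρ.E s := ρ.diag_mul_E _ _

theorem T_mul_U {l : ℕ} (hl : l + 1 < β.degree) :
    ρ.T l * ρ.U l = ρ.U (l + 1) * ρ.T l + ρ.eps l * (ρ.U l * ρ.U (l + 1)) := by
  have hl' : l < β.degree := by omega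
  have h := ρ.T_X_eq ρ.one_eq hl
  have h2 : (ρ.t - ρ.X (l + 1)) * ρ.T l = ρ.T l * (ρ.t - ρ.X l) + ρ.eps l := by
    rw [← h, sub_mul, mul_sub, (ρ.t_comm (ρ.T l)).eq]
    abel
  have h3 : ρ.T l = ρ.U (l + 1) * ρ.T l * (ρ.t - ρ.X l) + ρ.U (l + 1) * ρ.eps l := by
    rw [mul_assoc, ← mul_add, ← h2, ← mul_assoc, ρ.U_mul hl, one_mul]
  conv_lhs => rw [h3, add_mul, mul_assoc, ρ.mul_U hl', mul_one]
  rw [mul_assoc, (ρ.eps_comm l fun s => ρ.E_comm_U hl s).left_comm, (ρ.U_comm_U hl' hl).eq]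

theorem T_mul_U' {l : ℕ} (hl : l + 1 < β.degree) :
    ρ.T l * ρ.U (l + 1) = ρ.U l * ρ.T l - ρ.eps l * (ρ.U l * ρ.U (l + 1)) := by
  have hl' : l < β.degree := by omega
  have h := ρ.X_T_eq ρ.one_eq hl
  have h2 : (ρ.t - ρ.X l) * ρ.T l = ρ.T l * (ρ.t - ρ.X (l + 1)) - ρ.eps l := by
    rw [← h, sub_mul, mul_sub, (ρ.t_comm (ρ.T l)).eq]
    abel
  have h3 : ρ.T l = ρ.U l * ρ.T l * (ρ.t - ρ.X (l + 1)) - ρ.U l * ρ.eps l := by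
    rw [mul_assoc, ← mul_sub, ← h2, ← mul_assoc, ρ.U_mul hl', one_mul]
  conv_lhs => rw [h3, sub_mul, mul_assoc, ρ.mul_U hl, mul_one]
  rw [mul_assoc, (ρ.eps_comm l fun s => ρ.E_comm_U hl' s).left_comm]

theorem delta_eq_one {j : I} (hj : D.a j j = 2) : D.delta S j j = 1 := if_pos ⟨rfl, hj⟩

/-- The crossing of two strands exchanges `p` and `p'` on the idempotent `s`. -/
structure Exch (l : ℕ) (s : SeqOf β) (p p' : S) : Prop where
  left : ρ.T l * (p * ρ.E s) = p' * (ρ.T l * ρ.E s)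
  right : ρ.T l * (p' * ρ.E s) = p * (ρ.T l * ρ.E s)
  comm : ∀ s, Commute p (ρ.E s)
  comm' : ∀ s, Commute p' (ρ.E s)

variable {ρ} {i} {l : ℕ} {s : SeqOf β} {p p' r r' : S}

theorem Exch.of_comm (h : ∀ b, Commute p b) : ρ.Exch l s p p where
  left := (h _).symm.left_comm _
  right := (h _).symm.left_comm _
  comm s := h _
  comm' s := h _

theorem Exch.add (h : ρ.Exch l s p p') (h' : ρ.Exch l s r r') : ρ.Exch l s (p + r) (p' + r') where
  left := by rw [add_mul, mul_add, h.left, h'.left, add_mul]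
  right := by rw [add_mul, mul_add, h.right, h'.right, add_mul]
  comm s := (h.comm s).add_left (h'.comm s)
  comm' s := (h.comm' s).add_left (h'.comm' s)

theorem Exch.mul (h : ρ.Exch l s p p') (h' : ρ.Exch l s r r') : ρ.Exch l s (p * r) (p' * r') where
  left := by
    rw [mul_assoc, (h'.comm s).eq, ← mul_assoc p, ← mul_assoc, h.left, mul_assoc, mul_assoc,
      ← (h'.comm s).eq, h'.left, ← mul_assoc]
  right := by
    rw [mul_assoc, (h'.comm' s).eq, ← mul_assoc p', ← mul_assoc, h.right, mul_assoc, mul_assoc,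
      ← (h'.comm' s).eq, h'.right, ← mul_assoc]
  comm s := (h.comm s).mul_left (h'.comm s)
  comm' s := (h.comm' s).mul_left (h'.comm' s)

theorem Exch.pow (h : ρ.Exch l s p p') (m : ℕ) : ρ.Exch l s (p ^ m) (p' ^ m) := by
  induction m with
  | zero => simpa using Exch.of_comm Commute.one_left
  | succ m ih => rw [pow_succ, pow_succ]; exact ih.mul h

theorem Exch.symm (h : ρ.Exch l s p p') : ρ.Exch l s p' p := ⟨h.right, h.left, h.comm', h.comm⟩

theorem Exch.X (hl : l + 1 < β.degree) (h : D.delta S (s.c l) (s.c (l + 1)) = 0) :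
    ρ.Exch l s (ρ.X l) (ρ.X (l + 1)) where
  left := by
    have := ρ.T_X l s hl
    rw [h, zero_mul, sub_mul, sub_eq_zero] at this
    simpa only [mul_assoc] using this
  right := by
    have := ρ.X_T l s hl
    rw [h, zero_mul, sub_mul, sub_eq_zero] at this
    simpa only [mul_assoc] using this.symm
  comm s := ρ.X_comm_E ρ.one_eq (by omega) s
  comm' s := ρ.X_comm_E ρ.one_eq hl s

theorem Exch.quad (h : ρ.Exch l s p p') (j m : I) :
    ρ.Exch l s (D.quad j m ρ.t p) (D.quad j m ρ.t p') := by
  unfold BorcherdsCartanDatum.quad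
  have ht : ρ.Exch l s ρ.t ρ.t := Exch.of_comm ρ.t_comm
  split_ifs
  · exact Exch.of_comm Commute.zero_left
  · exact Exch.of_comm Commute.one_left
  · exact ((ht.pow _).add (h.pow _)).pow 2
  · exact Exch.of_comm Commute.one_left
  · exact (ht.pow _).add (h.pow _)

variable (ρ) (i)

theorem T_pow (hl : l + 1 < β.degree) (N : ℕ) : ρ.T l * ρ.X l ^ N = ρ.X (l + 1) ^ N * ρ.T l +
    ρ.eps l * ∑ c ∈ Finset.range N, ρ.X l ^ c * ρ.X (l + 1) ^ (N - 1 - c) := by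
  refine mul_pow_divided ?_ ?_ ?_ ?_ N
  · rw [← ρ.T_X_eq ρ.one_eq hl]; abel
  · exact (ρ.eps_comm l fun s => ρ.X_comm_E ρ.one_eq (by omega) s).symm
  · exact (ρ.eps_comm l fun s => ρ.X_comm_E ρ.one_eq hl s).symm
  · exact ρ.X_comm_X ρ.one_eq (by omega) hl

theorem T_pow' (hl : l + 1 < β.degree) (N : ℕ) : ρ.T l * ρ.X (l + 1) ^ N = ρ.X l ^ N * ρ.T l -
    ρ.eps l * ∑ c ∈ Finset.range N, ρ.X l ^ c * ρ.X (l + 1) ^ (N - 1 - c) := by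
  have hl' : l < β.degree := by omega
  have h := mul_pow_divided (T := ρ.T l) (x := ρ.X (l + 1)) (y := ρ.X l) (ε := -ρ.eps l) ?_ ?_ ?_
    (ρ.X_comm_X ρ.one_eq hl hl') N
  · rw [h, neg_mul, ← sub_eq_add_neg]
    congr 2
    rw [← Finset.sum_range_reflect]
    refine Finset.sum_congr rfl fun c hc => ?_
    have := Finset.mem_range.1 hc
    rw [show N - 1 - (N - 1 - c) = c by omega]
    exact ((ρ.X_comm_X ρ.one_eq hl hl').pow_pow _ _).eq
  · rw [← ρ.X_T_eq ρ.one_eq hl]; abel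
  · exact (ρ.eps_comm l fun s => ρ.X_comm_E ρ.one_eq hl s).symm.neg_left
  · exact (ρ.eps_comm l fun s => ρ.X_comm_E ρ.one_eq hl' s).symm.neg_left

/-- Elements of the form `∑ φ(s) 1_s` can be moved through a crossing up to a permutation. -/
theorem diag_mul_T_E (hl : l + 1 < β.degree) (φ : SeqOf β → S) (s : SeqOf β) :
    ρ.diag φ * (ρ.T l * ρ.E s) = φ (s.sw l) * (ρ.T l * ρ.E s) := by
  rw [ρ.T_mul_E l s hl, ← mul_assoc, ρ.diag_mul_E, mul_assoc]

theorem f_mul_T_E (hl : l + 1 < β.degree) (s : SeqOf β) : ρ.f i l * (ρ.T l * ρ.E s) =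
    D.quad i (s.c (l + 1)) ρ.t (ρ.X l) * (ρ.T l * ρ.E s) := by
  rw [f, ρ.diag_mul_T_E hl, SeqOf.c_sw _ hl, if_pos rfl]

theorem g_mul_T_E (hl : l + 1 < β.degree) (s : SeqOf β) : ρ.f i (l + 1) * (ρ.T l * ρ.E s) =
    D.quad i (s.c l) ρ.t (ρ.X (l + 1)) * (ρ.T l * ρ.E s) := by
  rw [f, ρ.diag_mul_T_E hl, SeqOf.c_sw _ hl, if_neg (by omega), if_pos rfl]

theorem delta_cases (B : Type*) [Ring B] (j m : I) :
    D.delta B j m = 0 ∨ (j = m ∧ D.a j j = 2 ∧ D.delta B j m = 1) := by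
  unfold delta
  split_ifs with h
  · exact Or.inr ⟨h.1, h.2, rfl⟩
  · exact Or.inl rfl

theorem quad_real {j : I} (hj : D.a j j = 2) (y z : S) : D.quad j j y z = 0 := by
  rw [quad, if_pos rfl, if_pos hj]

theorem delta_mul_quad (j m : I) (y z : S) : D.delta S j m * D.quad j m y z = 0 := by
  rcases delta_cases (D := D) S j m with h | ⟨rfl, h, -⟩
  · rw [h, zero_mul]
  · rw [quad_real h, mul_zero]

theorem diag_mul_diag {φ ψ : SeqOf β → S} (h : ∀ s s', Commute (ψ s) (ρ.E s')) :
    ρ.diag φ * ρ.diag ψ = ρ.diag fun s => φ s * ψ s := by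
  refine ρ.ext_E ρ.one_eq fun s => ?_
  rw [mul_assoc, ρ.diag_mul_E, (h s s).eq, ← mul_assoc, ρ.diag_mul_E, ρ.diag_mul_E, mul_assoc,
    ← (h s s).eq, mul_assoc]

theorem delta_mul_delta (j m n : I) : D.delta S j m * D.delta S m n = D.delta S j m * D.delta S j n := by
  rcases delta_cases (D := D) S j m with h | ⟨rfl, h, -⟩
  · rw [h, zero_mul, zero_mul]
  · rfl

theorem delta_idem (j m : I) : D.delta S j m * D.delta S j m = D.delta S j m := by
  rcases delta_cases (D := D) S j m with h | ⟨_, _, h⟩ <;> simp [h]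

/-- Two positive powers of symmetric sums move through a crossing. -/
theorem T_fg_E (hl : l + 1 < β.degree) (s : SeqOf β) :
    ρ.T l * (ρ.f i (l + 1) * ρ.f i l) * ρ.E s = ρ.f i (l + 1) * (ρ.f i l * ρ.T l) * ρ.E s := by
  have hl' : l < β.degree := by omega
  have hq : ∀ (j : I) (k : ℕ) (_ : k < β.degree) (s' : SeqOf β),
      Commute (D.quad i j ρ.t (ρ.X k)) (ρ.E s') := fun j k hk s' =>
    (D.quad_commute (ρ.t_comm _).symm (ρ.X_comm_E ρ.one_eq hk s').symm).symm
  have hqq : ∀ (j m : I) (k k' : ℕ) (_ : k < β.degree) (_ : k' < β.degree),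
      Commute (D.quad i j ρ.t (ρ.X k)) (D.quad i m ρ.t (ρ.X k')) := fun j m k k' hk hk' =>
    D.quad_commute (ρ.t_comm _).symm (D.quad_commute (ρ.t_comm _).symm
      (ρ.X_comm_X ρ.one_eq hk' hk)).symm
  have e1 : (ρ.f i (l + 1) * ρ.f i l) * ρ.E s =
      D.quad i (s.c (l + 1)) ρ.t (ρ.X (l + 1)) * D.quad i (s.c l) ρ.t (ρ.X l) * ρ.E s := by
    rw [mul_assoc, f_mul_E, (hq _ _ hl' s).eq, ← mul_assoc, f_mul_E, mul_assoc, ← (hq _ _ hl' s).eq,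
      mul_assoc]
  have e2 : ρ.f i (l + 1) * (ρ.f i l * ρ.T l) * ρ.E s =
      D.quad i (s.c l) ρ.t (ρ.X (l + 1)) * D.quad i (s.c (l + 1)) ρ.t (ρ.X l) *
        (ρ.T l * ρ.E s) := by
    rw [mul_assoc, mul_assoc, f_mul_T_E ρ i hl, ← mul_assoc,
      ← (ρ.f_comm i (fun s' => hq (s.c (l + 1)) l hl' s')
        (D.quad_commute (ρ.t_comm _).symm (ρ.X_comm_X ρ.one_eq hl hl')).symm).eq, mul_assoc,
      g_mul_T_E ρ i hl, ← mul_assoc, (hqq _ _ _ _ hl' hl).eq]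
  rw [mul_assoc, e1, e2]
  rcases delta_cases (D := D) S (s.c l) (s.c (l + 1)) with h | ⟨h, hr, -⟩
  · rw [(((Exch.X hl h).symm.quad i (s.c (l + 1))).mul ((Exch.X hl h).quad i (s.c l))).left,
      (hqq _ _ _ _ hl hl').eq]
  · rw [← h]
    unfold quad
    split_ifs with h1 h2 h3
    · simp
    · simp
    · exact absurd (h1 ▸ hr) h2
    · simp
    · set N := (-D.a (s.c l) i).toNat
      set r := ρ.t ^ (-D.a i (s.c l)).toNat
      have hr : ∀ b, Commute r b := fun b => (ρ.t_comm b).pow_left _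
      have hx := ρ.T_pow hl N
      have hy := ρ.T_pow' hl N
      set x := ρ.X l ^ N
      set y := ρ.X (l + 1) ^ N
      have hxy : Commute x y := (ρ.X_comm_X ρ.one_eq hl' hl).pow_pow _ _
      set ε := ρ.eps l * ∑ c ∈ Finset.range N, ρ.X l ^ c * ρ.X (l + 1) ^ (N - 1 - c)
      have hε : Commute ε x := by
        refine Commute.mul_left ?_ (Commute.sum_left _ _ _ fun c _ => Commute.mul_left ?_ ?_)
        · exact (ρ.eps_comm l fun s => (ρ.X_comm_E ρ.one_eq hl' s).pow_left _).symm
        · exact Commute.pow_pow_self _ _ _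
        · exact (ρ.X_comm_X ρ.one_eq hl hl').pow_pow _ _
      have s1 : ρ.T l * (x + y) = (x + y) * ρ.T l := by rw [mul_add, hx, hy, add_mul]; abel
      have s2 : ρ.T l * (y * x) = (y * x) * ρ.T l := by
        rw [← mul_assoc, hy, sub_mul, mul_assoc, hx, mul_add, ← mul_assoc, hxy.eq, hε.eq]
        abel
      have e : (r + y) * (r + x) = r * r + r * (x + y) + y * x := by
        rw [add_mul, mul_add, mul_add, mul_add, ← (hr y).eq]; abel
      have e' : ρ.T l * ((r + y) * (r + x)) = (r + y) * (r + x) * ρ.T l := by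
        rw [e, mul_add, mul_add, s2, add_mul, add_mul, ← mul_assoc _ r (x + y), ← (hr (ρ.T l)).eq,
          mul_assoc r, s1, ((hr _).mul_left (hr _)).eq, mul_assoc r]
      rw [← mul_assoc, e', mul_assoc]

theorem crossingRels (hl : l + 1 < β.degree) : CrossingRels (ρ.P i l) (ρ.P i (l + 1)) (ρ.eps l)
    (ρ.U l) (ρ.U (l + 1)) (ρ.f i l) (ρ.f i (l + 1)) (ρ.T l) := by
  have hl' : l < β.degree := by omega
  have hd : ∀ (j m : I) (b : S), Commute (D.delta S j m) b := fun j m b => D.delta_commute j m b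
  have hq : ∀ (j : I) (k : ℕ) (_ : k < β.degree) (s' : SeqOf β),
      Commute (D.quad i j ρ.t (ρ.X k)) (ρ.E s') := fun j k hk s' =>
    (D.quad_commute (ρ.t_comm _).symm (ρ.X_comm_E ρ.one_eq hk s').symm).symm
  have TQ : ρ.T l * ρ.P i (l + 1) = ρ.P i l * ρ.T l := by
    rw [P, ρ.T_mul_diag hl ρ.one_eq fun s b => hd _ _ _]
    simp only [SeqOf.c_sw _ hl, if_neg (show ¬ l + 1 = l by omega), if_true]
    rfl
  have TP : ρ.T l * ρ.P i l = ρ.P i (l + 1) * ρ.T l := by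
    rw [P, ρ.T_mul_diag hl ρ.one_eq fun s b => hd _ _ _]
    simp only [SeqOf.c_sw _ hl, if_true]
    rfl
  have hfP : ∀ k, k < β.degree → ρ.P i k * ρ.f i k = 0 := fun k hk => by
    rw [P, f, ρ.diag_mul_diag fun s s' => hq _ _ hk s']
    simp only [delta_mul_quad]
    exact ρ.ext_E ρ.one_eq fun s => by rw [ρ.diag_mul_E]
  have cfP : ∀ k m, m < β.degree → Commute (ρ.f i m) (ρ.P i k) := fun k m hm =>
    ρ.P_comm i k (ρ.E_comm_f i hm)
  have cfU : ∀ k m, k < β.degree → m < β.degree → Commute (ρ.f i k) (ρ.U m) := fun k m hk hm =>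
    (ρ.f_comm i (ρ.E_comm_U hm) (ρ.X_comm_U hk hm).symm).symm
  have key : ∀ s, ρ.P i l * (ρ.T l * ρ.f i l) * ρ.E s = ρ.P i l * (ρ.f i (l + 1) * ρ.T l) * ρ.E s := by
    intro s
    have e1 : ρ.P i l * (ρ.T l * ρ.E s) = D.delta S i (s.c (l + 1)) * (ρ.T l * ρ.E s) := by
      rw [P, ρ.diag_mul_T_E hl, SeqOf.c_sw _ hl, if_pos rfl]
    rw [mul_assoc, mul_assoc, f_mul_E, mul_assoc, mul_assoc, g_mul_T_E ρ i hl]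
    rw [(hq _ _ hl' s).eq, ← mul_assoc (ρ.T l), ← mul_assoc, e1, (cfP l (l + 1) hl |> fun _ =>
      (D.quad_commute (i := i) (j := s.c l) (ρ.t_comm _).symm
        (ρ.P_comm i l (ρ.X_comm_E ρ.one_eq hl)).symm)).left_comm, e1, mul_assoc, mul_assoc,
        ← (hq _ _ hl' s).eq]
    rcases delta_cases (D := D) S i (s.c (l + 1)) with h | ⟨h, hr, h1⟩
    · simp [h]
    · rw [← h]
      rcases delta_cases (D := D) S (s.c l) (s.c (l + 1)) with h2 | ⟨h2, hr2, -⟩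
      · rw [((Exch.X hl h2).quad i (s.c l)).left, (hd _ _ _).left_comm]
      · rw [h2, ← h, quad_real hr, quad_real hr]
        simp
  have key' : ∀ s, ρ.P i (l + 1) * (ρ.T l * ρ.f i (l + 1)) * ρ.E s =
      ρ.P i (l + 1) * (ρ.f i l * ρ.T l) * ρ.E s := by
    intro s
    have e1 : ρ.P i (l + 1) * (ρ.T l * ρ.E s) = D.delta S i (s.c l) * (ρ.T l * ρ.E s) := by
      rw [P, ρ.diag_mul_T_E hl, SeqOf.c_sw _ hl, if_neg (by omega), if_pos rfl]
    rw [mul_assoc, mul_assoc, f_mul_E, mul_assoc, mul_assoc, f_mul_T_E ρ i hl]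
    rw [(hq _ _ hl s).eq, ← mul_assoc (ρ.T l), ← mul_assoc, e1,
      (D.quad_commute (i := i) (j := s.c (l + 1)) (ρ.t_comm _).symm
        (ρ.P_comm i (l + 1) (ρ.X_comm_E ρ.one_eq hl')).symm).left_comm, e1, mul_assoc, mul_assoc,
        ← (hq _ _ hl s).eq]
    rcases delta_cases (D := D) S i (s.c l) with h | ⟨h, hr, h1⟩
    · simp [h]
    · rw [← h]
      rcases delta_cases (D := D) S (s.c l) (s.c (l + 1)) with h2 | ⟨h2, hr2, -⟩
      · rw [((Exch.X hl h2).quad i (s.c (l + 1))).right, (hd _ _ _).left_comm]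
      · rw [← h2, ← h, quad_real hr, quad_real hr]
        simp
  constructor
  · rw [P, ρ.diag_mul_diag fun s s' => hd _ _ _]; simp only [delta_idem]
  · rw [P, ρ.diag_mul_diag fun s s' => hd _ _ _]; simp only [delta_idem]
  · exact ρ.P_comm i l (ρ.E_comm_P i _)
  · rw [P, P, Rep.eps, ρ.diag_mul_diag fun s s' => hd _ _ _, ρ.diag_mul_diag fun s s' => hd _ _ _]
    congr 1; ext s
    rw [(hd _ _ _).eq, delta_mul_delta]
  · rw [P, P, Rep.eps, ρ.diag_mul_diag fun s s' => hd _ _ _, ρ.diag_mul_diag fun s s' => hd _ _ _]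
    congr 1; ext s
    rw [delta_mul_delta]
  · rw [P, P, Rep.eps, ρ.diag_mul_diag fun s s' => hd _ _ _, ρ.diag_mul_diag fun s s' => hd _ _ _]
    congr 1; ext s
    rw [D.delta_symm (s.c l), delta_mul_delta, (hd _ _ _).eq]
  · rw [P, P, Rep.eps, ρ.diag_mul_diag fun s s' => hd _ _ _, ρ.diag_mul_diag fun s s' => hd _ _ _]
    congr 1; ext s
    rw [(hd _ _ _).eq, D.delta_symm (s.c l), delta_mul_delta, (hd _ _ _).eq]
  · exact ρ.P_comm i l (ρ.E_comm_U hl')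
  · exact ρ.P_comm i _ (ρ.E_comm_U hl')
  · exact ρ.eps_comm _ (ρ.E_comm_U hl')
  · exact ρ.P_comm i l (ρ.E_comm_U hl)
  · exact ρ.P_comm i _ (ρ.E_comm_U hl)
  · exact ρ.eps_comm _ (ρ.E_comm_U hl)
  · exact ρ.U_comm_U hl hl'
  · rw [(cfP l l hl').eq, hfP l hl']
  · exact hfP l hl'
  · exact cfP _ _ hl'
  · exact ρ.eps_comm _ (ρ.E_comm_f i hl')
  · exact cfU _ _ hl' hl'
  · exact cfU _ _ hl' hl
  · exact cfP _ _ hl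
  · rw [(cfP _ _ hl).eq, hfP _ hl]
  · exact hfP _ hl
  · exact ρ.eps_comm _ (ρ.E_comm_f i hl)
  · exact cfU _ _ hl hl'
  · exact cfU _ _ hl hl
  · exact TP
  · exact TQ
  · rw [Rep.eps, ρ.T_mul_diag hl ρ.one_eq fun s b => hd _ _ _]
    simp only [SeqOf.c_sw _ hl, if_neg (show ¬ l + 1 = l by omega), if_true]
    congr 2; ext s
    rw [delta_symm]
  · exact ρ.T_mul_U hl
  · exact ρ.T_mul_U' hl
  · exact ρ.ext_E ρ.one_eq key
  · exact ρ.ext_E ρ.one_eq key'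
  · exact ρ.ext_E ρ.one_eq (ρ.T_fg_E i hl)

end LocRep

end BorcherdsCartanDatum

namespace BorcherdsCartanDatum

variable {I : Type v} {D : BorcherdsCartanDatum.{v, w} I} [Inhabited I] {β ν' : I →₀ ℕ} {i : I}
  {S : Type*} [Ring S]

namespace LocRep

variable (ρ : D.LocRep β S)

theorem delta_of_not {j m : I} (h : ¬ (j = m ∧ D.a j j = 2)) : D.delta S j m = 0 := if_neg h

/-- The difference of two values of a quadratic polynomial is a divided difference. -/
theorem quad_sub_quad {i j : I} (hi : D.a i i = 2) {y y' z d : S} (hyy : Commute y y')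
    (hd : (y - y') * d = 1) :
    (D.quad i j y z - D.quad i j y' z) * d = D.braidCorr i j i y y' := by
  unfold quad braidCorr
  by_cases h1 : i = j
  · rw [if_pos h1, if_pos h1, if_pos hi, if_pos hi, if_neg (by tauto), sub_self, zero_mul]
  · rw [if_neg h1, if_neg h1]
    by_cases h2 : D.form (D.α i) (D.α j) = 0
    · rw [if_pos h2, if_pos h2, if_neg (by tauto), sub_self, zero_mul]
    · rw [if_neg h2, if_neg h2, if_pos ⟨rfl, hi, h1, h2⟩, add_sub_add_right_eq_sub,
        ← hyy.geom_sum₂_mul, mul_assoc, hd, mul_one]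

theorem TT_comm_E (hl : l + 1 < β.degree) (s : SeqOf β) : Commute (ρ.T l * ρ.T l) (ρ.E s) := by
  rw [ρ.T_sq_eq ρ.one_eq hl]
  exact (ρ.diag_commute (fun s => ρ.E_commute_E _ _) fun _ =>
    D.quad_commute (ρ.X_comm_E ρ.one_eq (by omega) s).symm (ρ.X_comm_E ρ.one_eq hl s).symm).symm

theorem P_mul_corr (hl : l + 1 < β.degree) :
    ρ.P i (l + 1) * ((ρ.f i l - ρ.T l * ρ.T l) * ρ.U (l + 1)) =
      ρ.diag fun s => D.braidCorr i (s.c l) (s.c (l + 1)) ρ.t (ρ.X (l + 1)) := by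
  have hl' : l < β.degree := by omega
  refine ρ.ext_E ρ.one_eq fun s => ?_
  have h2 : ∀ s', Commute ((ρ.f i l - ρ.T l * ρ.T l) * ρ.U (l + 1)) (ρ.E s') := fun s' =>
    ((ρ.E_comm_f i hl' s').sub_left (ρ.TT_comm_E hl s')).mul_left (ρ.E_comm_U hl s')
  rw [ρ.diag_mul_E, mul_assoc, (h2 s).eq, ← mul_assoc, P_mul_E, mul_assoc, ← (h2 s).eq, mul_assoc,
    (ρ.E_comm_U hl s).eq, ← mul_assoc (_ - _), sub_mul, f_mul_E, ρ.T_sq _ _ hl, ← sub_mul,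
    mul_assoc, ← (ρ.E_comm_U hl s).eq, ← mul_assoc, ← mul_assoc]
  congr 1
  by_cases h : i = s.c (l + 1) ∧ D.a i i = 2
  · rw [← h.1, delta_eq_one h.2, one_mul, D.quad_symm (s.c l)]
    exact quad_sub_quad h.2 (ρ.t_comm _) (ρ.mul_U hl)
  · rw [delta_of_not h, zero_mul, zero_mul, braidCorr, if_neg (by tauto)]

theorem P_mul_corr' (hl : l + 1 < β.degree) :
    ρ.P i l * ((ρ.f i (l + 1) - ρ.T l * ρ.T l) * ρ.U l) =
      ρ.diag fun s => D.braidCorr (s.c l) (s.c (l + 1)) i (ρ.X l) ρ.t := by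
  have hl' : l < β.degree := by omega
  refine ρ.ext_E ρ.one_eq fun s => ?_
  have h2 : ∀ s', Commute ((ρ.f i (l + 1) - ρ.T l * ρ.T l) * ρ.U l) (ρ.E s') := fun s' =>
    ((ρ.E_comm_f i hl s').sub_left (ρ.TT_comm_E hl s')).mul_left (ρ.E_comm_U hl' s')
  rw [ρ.diag_mul_E, mul_assoc, (h2 s).eq, ← mul_assoc, P_mul_E, mul_assoc, ← (h2 s).eq, mul_assoc,
    (ρ.E_comm_U hl' s).eq, ← mul_assoc (_ - _), sub_mul, f_mul_E, ρ.T_sq _ _ hl, ← sub_mul,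
    mul_assoc, ← (ρ.E_comm_U hl' s).eq, ← mul_assoc, ← mul_assoc]
  congr 1
  by_cases h : i = s.c l ∧ D.a i i = 2
  · rw [← h.1, delta_eq_one h.2, one_mul]
    have h3 := quad_sub_quad (j := s.c (l + 1)) (z := ρ.X (l + 1)) h.2 (ρ.t_comm (ρ.X l)).symm
      (d := -ρ.U l) (by rw [mul_neg, ← neg_mul, neg_sub, ρ.mul_U hl'])
    rw [← h3, mul_neg, ← neg_mul, neg_sub]
  · rw [delta_of_not h, zero_mul, zero_mul, braidCorr, if_neg]
    rintro ⟨h3, h4, -⟩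
    rw [h3] at h4
    exact h ⟨h3.symm, h4⟩

theorem corr_mid (hl : l + 1 < β.degree) :
    ρ.f i l * ρ.T l - ρ.T l * ρ.f i (l + 1) =
      ρ.diag fun s => D.braidCorr (s.c l) i (s.c (l + 1)) (ρ.X l) (ρ.X (l + 1)) := by
  have hl' : l < β.degree := by omega
  refine ρ.ext_E ρ.one_eq fun s => ?_
  rw [ρ.diag_mul_E, sub_mul, mul_assoc, mul_assoc, f_mul_T_E ρ i hl, f_mul_E]
  by_cases h : s.c l = s.c (l + 1) ∧ D.a (s.c l) (s.c l) = 2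
  · rw [← h.1]
    unfold quad braidCorr
    by_cases h1 : i = s.c l
    · rw [if_pos h1, if_pos h1, if_pos (h1 ▸ h.2), if_pos (h1 ▸ h.2),
        if_neg (fun hh => hh.2.2.1 h1.symm)]
      simp
    · rw [if_neg h1, if_neg h1, D.form_symm]
      by_cases h2 : D.form (D.α (s.c l)) (D.α i) = 0
      · rw [if_pos h2, if_pos h2, if_neg (by tauto)]
        simp
      · rw [if_neg h2, if_neg h2, if_pos ⟨rfl, h.2, fun hh => h1 hh.symm, h2⟩]
        have e := ρ.T_pow' hl (-D.a (s.c l) i).toNat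
        have e2 := ρ.eps_mul_E l s
        rw [← h.1, delta_eq_one h.2, one_mul] at e2
        have c1 : Commute (∑ c ∈ Finset.range (-D.a (s.c l) i).toNat,
            ρ.X l ^ c * ρ.X (l + 1) ^ ((-D.a (s.c l) i).toNat - 1 - c)) (ρ.E s) :=
          Commute.sum_left _ _ _ fun c _ => ((ρ.X_comm_E ρ.one_eq hl' s).pow_left _).mul_left
            ((ρ.X_comm_E ρ.one_eq hl s).pow_left _)
        rw [add_mul, add_mul, mul_add, ← mul_assoc _ _ (ρ.E s), ← mul_assoc _ _ (ρ.E s),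
          ← mul_assoc (ρ.T l), ← mul_assoc (ρ.T l), e,
          ((ρ.t_comm (ρ.T l)).pow_left _).eq, sub_mul, mul_assoc (ρ.eps l), c1.eq,
          ← mul_assoc (ρ.eps l), e2, ← c1.eq]
        abel
  · rw [((Exch.X hl (delta_of_not h)).quad i (s.c (l + 1))).right, sub_self, braidCorr,
      if_neg (by tauto), zero_mul]

end LocRep
end BorcherdsCartanDatum

namespace BorcherdsCartanDatum

variable {I : Type v} {D : BorcherdsCartanDatum.{v, w} I} [Inhabited I] {β ν' : I →₀ ℕ} {i : I}
  {S : Type*} [Ring S]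

namespace LocRep

variable (ρ : D.LocRep β S)

variable (i) in
/-- The coefficient `D_l` of a crossing of the additional strand. -/
def dd (l : ℕ) : S := ρ.P i l * ρ.U l

variable (i) in
/-- The coefficient `Q_l` of a crossing of the additional strand. -/
def qq (l : ℕ) : S := -(ρ.P i l * ρ.U l * ρ.U l) + ρ.f i l

/-- The eigenvalues of the dots: the additional strand is in position `j` in the row `j`. -/
def xr (l j : ℕ) : S := if l < j then ρ.X l else if l = j then ρ.t else ρ.X (l - 1)

open scoped Classical in
/-- The idempotents in the row `j`. -/
def er (h : β + Finsupp.single i 1 = ν') (s' : SeqOf ν') (j : ℕ) : S :=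
  if j ≤ β.degree then ∑ s, if SeqOf.ins h j s = s' then ρ.E s else 0 else 0

variable (K : Type u) [Field K] [Algebra K S]

variable (i) in
/-- The action of the crossings. -/
def tOp (l : ℕ) : Module.End K (ℕ → S) where
  toFun v j := if j < l then ρ.T (l - 1) * v j else
    if j = l then ρ.dd i l * v l + v (l + 1) else
    if j = l + 1 then ρ.qq i l * v l - ρ.dd i l * v (l + 1) else ρ.T l * v j
  map_add' v w := by
    ext j
    simp only [Pi.add_apply]
    split_ifs <;> simp only [mul_add] <;> abel
  map_smul' c v := by
    ext j
    simp only [Pi.smul_apply, RingHom.id_apply]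
    split_ifs <;> simp only [mul_smul_comm, smul_add, smul_sub]

/-- Multiplication by a sequence of elements. -/
def dOp : (ℕ → S) →+* Module.End K (ℕ → S) := (Algebra.lmul K (ℕ → S)).toRingHom

theorem dOp_apply (a v : ℕ → S) (j : ℕ) : dOp K a v j = a j * v j := rfl

variable {K} {l j : ℕ}

theorem tOp_lt (v : ℕ → S) (h : j < l) : ρ.tOp i K l v j = ρ.T (l - 1) * v j := if_pos h

theorem tOp_eq (v : ℕ → S) : ρ.tOp i K l v l = ρ.dd i l * v l + v (l + 1) := by
  simp [tOp]

theorem tOp_succ (v : ℕ → S) :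
    ρ.tOp i K l v (l + 1) = ρ.qq i l * v l - ρ.dd i l * v (l + 1) := by
  simp [tOp]

theorem tOp_gt (v : ℕ → S) (h : l + 1 < j) : ρ.tOp i K l v j = ρ.T l * v j := by
  simp only [tOp, LinearMap.coe_mk, AddHom.coe_mk, if_neg (show ¬ j < l by omega),
    if_neg (show ¬ j = l by omega), if_neg (show ¬ j = l + 1 by omega)]

theorem xr_lt (h : l < j) : ρ.xr l j = ρ.X l := if_pos h

theorem xr_eq : ρ.xr l l = ρ.t := by simp [xr]

theorem xr_gt (h : j < l) : ρ.xr l j = ρ.X (l - 1) := by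
  rw [xr, if_neg (by omega), if_neg (by omega)]

section Er

variable (h : β + Finsupp.single i 1 = ν') (s' : SeqOf ν')

theorem er_of_lt (hj : β.degree < j) : ρ.er h s' j = 0 := if_neg (by omega)

theorem er_cases (s' : SeqOf ν') (hj : j ≤ β.degree) : (ρ.er h s' j = 0 ∧ ∀ s, SeqOf.ins h j s ≠ s') ∨
    ∃ s, SeqOf.ins h j s = s' ∧ ρ.er h s' j = ρ.E s := by
  classical
  by_cases hs : ∃ s, SeqOf.ins h j s = s'
  · obtain ⟨s, rfl⟩ := hs
    refine Or.inr ⟨s, rfl, ?_⟩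
    rw [er, if_pos hj, Finset.sum_eq_single s]
    · simp
    · intro s'' _ hs
      rw [if_neg fun hh => hs (SeqOf.ins_injective h hj hh)]
    · simp
  · push Not at hs
    refine Or.inl ⟨?_, hs⟩
    rw [er, if_pos hj, Finset.sum_eq_zero]
    intro s _
    rw [if_neg (hs s)]

theorem er_ins (hj : j ≤ β.degree) (s : SeqOf β) : ρ.er h (SeqOf.ins h j s) j = ρ.E s := by
  rcases ρ.er_cases h (SeqOf.ins h j s) hj with ⟨-, h2⟩ | ⟨s2, h2, h3⟩
  · exact absurd rfl (h2 s)
  · rw [h3, SeqOf.ins_injective h hj h2]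

open scoped Classical in
theorem er_mul {s' s'' : SeqOf ν'} : ρ.er h s' j * ρ.er h s'' j = if s' = s'' then ρ.er h s' j else 0 := by
  by_cases hj : j ≤ β.degree
  · rcases ρ.er_cases h s' hj with ⟨h1, -⟩ | ⟨s, h1, h2⟩
    · rw [h1, zero_mul]; simp
    · rcases ρ.er_cases h s'' hj with ⟨h3, h4⟩ | ⟨r, h3, h4⟩
      · rw [h3, mul_zero, if_neg]
        rintro rfl
        exact h4 s h1
      · rw [h2, h4]
        split_ifs with hh
        · rw [hh, ← h3] at h1
          rw [SeqOf.ins_injective h hj h1, ρ.E_mul_self]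
        · refine ρ.E_mul_of_ne _ _ ?_
          rintro rfl
          exact hh (h1.symm.trans h3)
  · rw [er_of_lt _ _ _ (by omega)]; simp

theorem er_comm {b : S} (hb : ∀ s, Commute b (ρ.E s)) : Commute b (ρ.er h s' j) := by
  by_cases hj : j ≤ β.degree
  · rcases ρ.er_cases h s' hj with ⟨h1, -⟩ | ⟨s, h1, h2⟩
    · rw [h1]; exact Commute.zero_right _
    · rw [h2]; exact hb s
  · rw [er_of_lt _ _ _ (by omega)]; exact Commute.zero_right _

theorem diag_mul_er {φ : SeqOf β → S} {c : S} (hφ : ∀ s, SeqOf.ins h j s = s' → φ s = c) (w : S) :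
    ρ.diag φ * (ρ.er h s' j * w) = c * (ρ.er h s' j * w) := by
  rw [← mul_assoc, ← mul_assoc]
  congr 1
  by_cases hj : j ≤ β.degree
  · rcases ρ.er_cases h s' hj with ⟨h1, -⟩ | ⟨s, h1, h2⟩
    · rw [h1]; simp
    · rw [h2, ρ.diag_mul_E, hφ s h1]
  · rw [er_of_lt _ _ _ (by omega)]; simp

/-- A crossing on the left of the additional strand. -/
theorem T_mul_er_gt {l : ℕ} (hl : l + 1 < j) : ρ.T l * ρ.er h s' j = ρ.er h (s'.sw l) j * ρ.T l := by
  by_cases hj : j ≤ β.degree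
  · rcases ρ.er_cases h s' hj with ⟨h1, h2⟩ | ⟨s, rfl, h2⟩
    · rcases ρ.er_cases h (s'.sw l) hj with ⟨h3, -⟩ | ⟨r, h3, h4⟩
      · rw [h1, h3, zero_mul, mul_zero]
      · exfalso
        refine h2 (r.sw l) ?_
        rw [← SeqOf.ins_sw_lt h r hl hj, h3, SeqOf.sw_sw]
    · rw [h2, SeqOf.ins_sw_lt h s hl hj, er_ins _ _ hj, ρ.T_mul_E _ _ (by omega)]
  · rw [er_of_lt _ _ _ (by omega), er_of_lt _ _ _ (by omega), zero_mul, mul_zero]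

theorem T_mul_er_lt {l : ℕ} (hl : j ≤ l) (hk : l + 1 < β.degree) :
    ρ.T l * ρ.er h s' j = ρ.er h (s'.sw (l + 1)) j * ρ.T l := by
  have hj : j ≤ β.degree := by omega
  rcases ρ.er_cases h s' hj with ⟨h1, h2⟩ | ⟨s, rfl, h2⟩
  · rcases ρ.er_cases h (s'.sw (l + 1)) hj with ⟨h3, -⟩ | ⟨r, h3, h4⟩
    · rw [h1, h3, zero_mul, mul_zero]
    · exfalso
      refine h2 (r.sw l) ?_
      rw [← SeqOf.ins_sw_gt h r hl hk, h3, SeqOf.sw_sw]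
  · rw [h2, SeqOf.ins_sw_gt h s hl hk, er_ins _ _ hj, ρ.T_mul_E _ _ (by omega)]

theorem er_sw (hj : j < β.degree) : ρ.er h (s'.sw j) j = ρ.er h s' (j + 1) := by
  rcases ρ.er_cases h s' (j := j + 1) hj with ⟨h1, h2⟩ | ⟨s, rfl, h2⟩
  · rcases ρ.er_cases h (s'.sw j) hj.le with ⟨h3, -⟩ | ⟨r, h3, h4⟩
    · rw [h1, h3]
    · exfalso
      refine h2 r ?_
      rw [SeqOf.ins_succ h r hj] at h3
      rw [← SeqOf.sw_sw (SeqOf.ins h (j + 1) r) j, h3, SeqOf.sw_sw]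
  · rw [h2, ← SeqOf.ins_succ h s hj, er_ins _ _ hj.le]

theorem er_sw' (hj : j < β.degree) : ρ.er h (s'.sw j) (j + 1) = ρ.er h s' j := by
  rw [← er_sw _ _ _ hj, SeqOf.sw_sw]

theorem P_mul_er (hj : j < β.degree) : ρ.P i j * ρ.er h (s'.sw j) j = ρ.P i j * ρ.er h s' j := by
  have key : ∀ s'' : SeqOf ν', (∃ s, SeqOf.ins h j s = s'' ∧ i = s.c j) → s''.sw j = s'' := by
    rintro _ ⟨s, rfl, hs⟩
    refine SeqOf.sw_eq_self _ ?_
    rw [SeqOf.ins_c h s hj.le hj.le, SeqOf.ins_c h s hj.le (show j + 1 ≤ β.degree from hj)]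
    simpa using hs
  have key2 : ∀ s'' : SeqOf ν', s''.sw j ≠ s'' → ρ.P i j * ρ.er h s'' j = 0 := by
    intro s'' hs
    rcases ρ.er_cases h s'' hj.le with ⟨h1, -⟩ | ⟨s, h1, h2⟩
    · rw [h1, mul_zero]
    · rw [h2, P_mul_E, delta_of_not, zero_mul]
      intro hh
      exact hs (key s'' ⟨s, h1, hh.1⟩)
  by_cases hs : s'.sw j = s'
  · rw [hs]
  · rw [key2 _ hs, key2 _ (by rw [SeqOf.sw_sw]; exact Ne.symm hs)]

theorem dd_mul_er (hj : j < β.degree) : ρ.dd i j * ρ.er h (s'.sw j) j = ρ.er h s' j * ρ.dd i j := by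
  rw [dd, mul_assoc, (ρ.er_comm h (s'.sw j) (ρ.E_comm_U hj)).eq, ← mul_assoc, P_mul_er _ _ _ hj,
    (ρ.er_comm h s' (ρ.E_comm_P i j)).eq, mul_assoc]

theorem dd_comm_er (hj : j < β.degree) : Commute (ρ.dd i j) (ρ.er h s' j) :=
  ρ.er_comm h s' fun s => (ρ.E_comm_P i j s).mul_left (ρ.E_comm_U hj s)

theorem qq_comm_er (hj : j < β.degree) : Commute (ρ.qq i j) (ρ.er h s' j) :=
  ρ.er_comm h s' fun s => (((ρ.E_comm_P i j s).mul_left (ρ.E_comm_U hj s)).mul_left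
    (ρ.E_comm_U hj s)).neg_left.add_left (ρ.E_comm_f i hj s)

end Er

theorem dd_comm_X (hl : l < β.degree) (hj : j < β.degree) : Commute (ρ.dd i l) (ρ.X j) :=
  ((ρ.P_comm i l (ρ.X_comm_E ρ.one_eq hj)).mul_right (ρ.X_comm_U hj hl)).symm

theorem qq_comm_X (hl : l < β.degree) (hj : j < β.degree) : Commute (ρ.qq i l) (ρ.X j) :=
  (((((ρ.P_comm i l (ρ.X_comm_E ρ.one_eq hj)).mul_right (ρ.X_comm_U hj hl)).mul_right
    (ρ.X_comm_U hj hl)).neg_right).add_right (ρ.f_comm i (ρ.X_comm_E ρ.one_eq hj)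
      (ρ.X_comm_X ρ.one_eq hj hl))).symm

theorem dd_mul_dif (hl : l < β.degree) : ρ.dd i l * (ρ.t - ρ.X l) = ρ.P i l := by
  rw [dd, mul_assoc, ρ.U_mul hl, mul_one]

theorem dd_sq (hl : l < β.degree) : ρ.dd i l * ρ.dd i l + ρ.qq i l = ρ.f i l := by
  rw [dd, qq, mul_assoc, ((ρ.P_comm i l (ρ.E_comm_U hl)).left_comm), ← mul_assoc (ρ.P i l)]
  have : ρ.P i l * ρ.P i l = ρ.P i l := by
    rw [P, ρ.diag_mul_diag fun s s' => D.delta_commute _ _ _]; simp only [delta_idem]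
  rw [this, mul_assoc, add_neg_cancel_left]

theorem dd_comm_qq (hl : l < β.degree) : Commute (ρ.dd i l) (ρ.qq i l) := by
  have : ρ.qq i l = ρ.f i l - ρ.dd i l * ρ.dd i l := by rw [← ρ.dd_sq hl]; abel
  rw [this]
  refine Commute.sub_right ?_ ((Commute.refl _).mul_right (Commute.refl _))
  exact ρ.f_comm i (fun s => (ρ.E_comm_P i l s).mul_left (ρ.E_comm_U hl s)) (ρ.dd_comm_X hl hl)

end LocRep
end BorcherdsCartanDatum

namespace BorcherdsCartanDatum

variable {I : Type v} {D : BorcherdsCartanDatum.{v, w} I} [Inhabited I] {β ν' : I →₀ ℕ} {i : I}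
  {S : Type*} [Ring S]

namespace LocRep

variable (ρ : D.LocRep β S) (K : Type u) [Field K] [Algebra K S]

theorem quad_dOp (j m : I) (a b v : ℕ → S) (k : ℕ) :
    D.quad j m (dOp K a) (dOp K b) v k = D.quad j m (a k) (b k) * v k := by
  have h1 := D.map_quad (dOp (S := S) K) j m a b
  have h2 := D.map_quad (Pi.evalRingHom (fun _ => S) k) j m a b
  simp only [Pi.evalRingHom_apply] at h2
  rw [← h1, dOp_apply, h2]

theorem braidCorr_dOp (j m n : I) (a b v : ℕ → S) (k : ℕ) :
    D.braidCorr j m n (dOp K a) (dOp K b) v k = D.braidCorr j m n (a k) (b k) * v k := by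
  have h1 := D.map_braidCorr (dOp (S := S) K) j m n a b
  have h2 := D.map_braidCorr (Pi.evalRingHom (fun _ => S) k) j m n a b
  simp only [Pi.evalRingHom_apply] at h2
  rw [← h1, dOp_apply, h2]

theorem delta_end (j m : I) (v : ℕ → S) (k : ℕ) :
    D.delta (Module.End K (ℕ → S)) j m v k = D.delta S j m * v k := by
  have h1 := D.map_delta (dOp (S := S) K) j m
  have h2 := D.map_delta (Pi.evalRingHom (fun _ => S) k) j m
  simp only [Pi.evalRingHom_apply] at h2
  rw [← h1, dOp_apply, h2]

theorem row_cases (j k : ℕ) : j < k ∨ j = k ∨ j = k + 1 ∨ k + 1 < j := by omega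

variable {K} {h : β + Finsupp.single i 1 = ν'} (s' : SeqOf ν') {k : ℕ} (w : ℕ → S)

theorem tOp_sq_apply (hk : k + 1 < ν'.degree) (j : ℕ) :
    ρ.tOp i K k (ρ.tOp i K k (dOp K (ρ.er h s') w)) j =
      D.quad (s'.c k) (s'.c (k + 1)) (ρ.xr k j) (ρ.xr (k + 1) j) * (ρ.er h s' j * w j) := by
  have hd := degree_of_add h
  by_cases hj : j ≤ β.degree
  swap
  · rw [tOp_gt _ _ (by omega), tOp_gt _ _ (by omega), dOp_apply, ρ.er_of_lt h s' (by omega)]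
    simp
  rcases row_cases j k with hjk | rfl | rfl | hjk
  · obtain ⟨m, rfl⟩ : ∃ m, k = m + 1 := ⟨k - 1, by omega⟩
    rw [tOp_lt _ _ hjk, tOp_lt _ _ hjk, dOp_apply, ← mul_assoc, Nat.add_sub_cancel,
      ρ.T_sq_eq ρ.one_eq (by omega), xr_gt _ hjk, xr_gt _ (by omega)]
    refine ρ.diag_mul_er h s' ?_ _
    rintro s rfl
    rw [SeqOf.ins_c h s hj (by omega), SeqOf.ins_c h s hj (by omega)]
    simp (disch := omega) only [if_neg, Nat.add_sub_cancel]
  · have hjn : j < β.degree := by omega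
    rw [tOp_eq, tOp_eq, tOp_succ, xr_eq, xr_gt _ (by omega), Nat.add_sub_cancel, mul_add,
      ← mul_assoc, add_add_sub_cancel, ← add_mul, dd_sq _ hjn]
    refine ρ.diag_mul_er h s' ?_ _
    rintro s rfl
    rw [SeqOf.ins_c h s hj (by omega), SeqOf.ins_c h s hj (by omega)]
    simp
  · have hjn : k < β.degree := by omega
    rw [tOp_succ, tOp_eq, tOp_succ, xr_eq, xr_lt _ (by omega), mul_add, mul_sub,
      ← mul_assoc, ← mul_assoc, ← mul_assoc, (ρ.dd_comm_qq hjn).eq, add_sub_sub_cancel, ← add_mul,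
      add_comm, dd_sq _ hjn]
    refine ρ.diag_mul_er h s' ?_ _
    rintro s rfl
    rw [SeqOf.ins_c h s hj (by omega), SeqOf.ins_c h s hj (by omega), D.quad_symm]
    simp
  · rw [tOp_gt _ _ hjk, tOp_gt _ _ hjk, dOp_apply, ← mul_assoc,
      ρ.T_sq_eq ρ.one_eq (by omega), xr_lt _ hjk, xr_lt _ (by omega)]
    refine ρ.diag_mul_er h s' ?_ _
    rintro s rfl
    rw [SeqOf.ins_c h s hj (by omega), SeqOf.ins_c h s hj (by omega), if_pos (by omega),
      if_pos (by omega)]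

theorem delta_mul_er_right (hk : k < j) (hj : j ≤ β.degree) (hk' : k + 1 < j) (w : S) :
    ρ.eps k * (ρ.er h s' j * w) = D.delta S (s'.c k) (s'.c (k + 1)) * (ρ.er h s' j * w) := by
  refine ρ.diag_mul_er h s' ?_ _
  rintro s rfl
  rw [SeqOf.ins_c h s hj (by omega), SeqOf.ins_c h s hj (by omega), if_pos (by omega),
      if_pos (by omega)]

theorem delta_mul_er_left (hk : j ≤ k) (hk' : k + 1 < β.degree) (w : S) :
    ρ.eps k * (ρ.er h s' j * w) =
      D.delta S (s'.c (k + 1)) (s'.c (k + 2)) * (ρ.er h s' j * w) := by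
  have hj : j ≤ β.degree := by omega
  refine ρ.diag_mul_er h s' ?_ _
  rintro s rfl
  rw [SeqOf.ins_c h s hj (by omega), SeqOf.ins_c h s hj (by omega)]
  simp (disch := omega) only [if_neg, Nat.add_sub_cancel]
  rfl

theorem P_mul_er_left (hj : j < β.degree) (w : S) :
    ρ.P i j * (ρ.er h s' j * w) = D.delta S (s'.c j) (s'.c (j + 1)) * (ρ.er h s' j * w) := by
  refine ρ.diag_mul_er h s' ?_ _
  rintro s rfl
  rw [SeqOf.ins_c h s hj.le hj.le, SeqOf.ins_c h s hj.le (by omega)]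
  simp

theorem P_mul_er_right (hj : j < β.degree) (w : S) :
    ρ.P i j * (ρ.er h s' (j + 1) * w) =
      D.delta S (s'.c j) (s'.c (j + 1)) * (ρ.er h s' (j + 1) * w) := by
  refine ρ.diag_mul_er h s' ?_ _
  rintro s rfl
  rw [SeqOf.ins_c h s hj (by omega), SeqOf.ins_c h s hj (by omega), D.delta_symm]
  simp

theorem X_T_apply (hk : k + 1 < ν'.degree) (j : ℕ) :
    ρ.xr k j * ρ.tOp i K k (dOp K (ρ.er h s') w) j -
      ρ.tOp i K k (dOp K (ρ.xr (k + 1)) (dOp K (ρ.er h s') w)) j =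
    D.delta S (s'.c k) (s'.c (k + 1)) * (ρ.er h s' j * w j) := by
  have hd := degree_of_add h
  by_cases hj : j ≤ β.degree
  swap
  · rw [tOp_gt _ _ (by omega), tOp_gt _ _ (by omega)]
    simp only [dOp_apply]
    rw [ρ.er_of_lt h s' (by omega)]
    simp
  rcases row_cases j k with hjk | rfl | rfl | hjk
  · obtain ⟨m, rfl⟩ : ∃ m, k = m + 1 := ⟨k - 1, by omega⟩
    rw [tOp_lt _ _ hjk, tOp_lt _ _ hjk]
    simp only [dOp_apply]
    rw [Nat.add_sub_cancel,
      xr_gt _ hjk, xr_gt _ (by omega), ← ρ.delta_mul_er_left s' (by omega) (by omega),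
      ← ρ.X_T_eq ρ.one_eq (by omega), sub_mul, mul_assoc, mul_assoc]
    simp only [Nat.add_sub_cancel]
  · have hjn : j < β.degree := by omega
    rw [tOp_eq, tOp_eq]
    simp only [dOp_apply]
    rw [xr_eq, xr_eq,
      xr_gt _ (by omega), ← ρ.P_mul_er_left s' hjn, ← ρ.dd_mul_dif hjn, mul_add, mul_sub, sub_mul,
      ← mul_assoc ρ.t, (ρ.t_comm _).eq, Nat.add_sub_cancel]
    simp only [mul_assoc]
    abel
  · have hjn : k < β.degree := by omega
    rw [tOp_succ, tOp_succ]
    simp only [dOp_apply]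
    rw [xr_eq,
      xr_lt _ (by omega), xr_gt _ (by omega), Nat.add_sub_cancel, ← ρ.P_mul_er_right s' hjn,
      ← ρ.dd_mul_dif hjn, mul_sub, mul_sub, sub_mul, (ρ.qq_comm_X hjn hjn).symm.left_comm,
      (ρ.dd_comm_X hjn hjn).symm.left_comm]
    simp only [mul_assoc]
    abel
  · rw [tOp_gt _ _ hjk, tOp_gt _ _ hjk]
    simp only [dOp_apply]
    rw [xr_lt _ (by omega), xr_lt _ (by omega), ← ρ.delta_mul_er_right s' (by omega) hj hjk,
      ← ρ.X_T_eq ρ.one_eq (by omega), sub_mul, mul_assoc, mul_assoc]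

theorem T_X_apply (hk : k + 1 < ν'.degree) (j : ℕ) :
    ρ.tOp i K k (dOp K (ρ.xr k) (dOp K (ρ.er h s') w)) j -
      ρ.xr (k + 1) j * ρ.tOp i K k (dOp K (ρ.er h s') w) j =
    D.delta S (s'.c k) (s'.c (k + 1)) * (ρ.er h s' j * w j) := by
  have hd := degree_of_add h
  by_cases hj : j ≤ β.degree
  swap
  · rw [tOp_gt _ _ (by omega), tOp_gt _ _ (by omega)]
    simp only [dOp_apply]
    rw [ρ.er_of_lt h s' (by omega)]
    simp
  rcases row_cases j k with hjk | rfl | rfl | hjk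
  · obtain ⟨m, rfl⟩ : ∃ m, k = m + 1 := ⟨k - 1, by omega⟩
    rw [tOp_lt _ _ hjk, tOp_lt _ _ hjk]
    simp only [dOp_apply]
    rw [Nat.add_sub_cancel,
      xr_gt _ hjk, xr_gt _ (by omega), ← ρ.delta_mul_er_left s' (by omega) (by omega),
      ← ρ.T_X_eq ρ.one_eq (by omega), sub_mul, mul_assoc, mul_assoc]
    simp only [Nat.add_sub_cancel]
  · have hjn : j < β.degree := by omega
    rw [tOp_eq, tOp_eq]
    simp only [dOp_apply]
    rw [xr_eq, xr_lt _ (by omega),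
      xr_gt _ (by omega), ← ρ.P_mul_er_left s' hjn, ← ρ.dd_mul_dif hjn, mul_add, mul_sub, sub_mul,
      Nat.add_sub_cancel, (ρ.dd_comm_X hjn hjn).symm.left_comm]
    simp only [mul_assoc]
    abel
  · have hjn : k < β.degree := by omega
    rw [tOp_succ, tOp_succ]
    simp only [dOp_apply]
    rw [xr_eq, xr_eq,
      xr_lt _ (by omega), ← ρ.P_mul_er_right s' hjn,
      ← ρ.dd_mul_dif hjn, mul_sub, mul_sub, sub_mul, ← mul_assoc ρ.t (ρ.qq i k),
      (ρ.t_comm (ρ.qq i k)).eq, ← mul_assoc ρ.t (ρ.dd i k), (ρ.t_comm (ρ.dd i k)).eq]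
    simp only [mul_assoc]
    abel
  · rw [tOp_gt _ _ hjk, tOp_gt _ _ hjk]
    simp only [dOp_apply]
    rw [xr_lt _ (by omega), xr_lt _ (by omega), ← ρ.delta_mul_er_right s' (by omega) hj hjk,
      ← ρ.T_X_eq ρ.one_eq (by omega), sub_mul, mul_assoc, mul_assoc]

theorem X_mul_T_apply {l : ℕ} (hk : k + 1 < ν'.degree) (hl : l < ν'.degree) (h1 : l ≠ k)
    (h2 : l ≠ k + 1) (j : ℕ) :
    ρ.xr l j * ρ.tOp i K k (dOp K (ρ.er h s') w) j =
      ρ.tOp i K k (dOp K (ρ.xr l) (dOp K (ρ.er h s') w)) j := by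
  have hd := degree_of_add h
  by_cases hj : j ≤ β.degree
  swap
  · rw [tOp_gt _ _ (by omega), tOp_gt _ _ (by omega)]
    simp only [dOp_apply]
    rw [ρ.er_of_lt h s' (by omega)]
    simp
  have hx : ∀ {m n : ℕ}, m + 1 < β.degree → n < β.degree → n ≠ m → n ≠ m + 1 → ∀ b,
      ρ.X n * (ρ.T m * b) = ρ.T m * (ρ.X n * b) := fun hm hn h1 h2 b =>
    (ρ.X_comm_T ρ.one_eq hm hn h1 h2).left_comm b
  have hdx : ∀ {m n : ℕ}, m < β.degree → n < β.degree → ∀ b,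
      ρ.X n * (ρ.dd i m * b) = ρ.dd i m * (ρ.X n * b) := fun hm hn b =>
    (ρ.dd_comm_X hm hn).symm.left_comm b
  have hqx : ∀ {m n : ℕ}, m < β.degree → n < β.degree → ∀ b,
      ρ.X n * (ρ.qq i m * b) = ρ.qq i m * (ρ.X n * b) := fun hm hn b =>
    (ρ.qq_comm_X hm hn).symm.left_comm b
  rcases row_cases j k with hjk | rfl | rfl | hjk
  · rw [tOp_lt _ _ hjk, tOp_lt _ _ hjk]
    simp only [dOp_apply]
    rcases lt_trichotomy l j with hlj | rfl | hlj
    · rw [xr_lt _ hlj, hx (by omega) (by omega) (by omega) (by omega)]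
    · rw [xr_eq, (ρ.t_comm _).left_comm]
    · rw [xr_gt _ hlj, hx (by omega) (by omega) (by omega) (by omega)]
  · rw [tOp_eq, tOp_eq]
    simp only [dOp_apply]
    rw [mul_add]
    rcases lt_or_gt_of_ne h1 with hlj | hlj
    · rw [xr_lt _ hlj, xr_lt _ (by omega), hdx (by omega) (by omega)]
    · rw [xr_gt _ hlj, xr_gt _ (by omega), hdx (by omega) (by omega)]
  · rw [tOp_succ, tOp_succ]
    simp only [dOp_apply]
    rw [mul_sub]
    rcases lt_or_gt_of_ne h1 with hlj | hlj
    · rw [xr_lt _ hlj, xr_lt _ (by omega), hdx (by omega) (by omega), hqx (by omega) (by omega)]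
    · rw [xr_gt _ hlj, xr_gt _ (by omega), hdx (by omega) (by omega), hqx (by omega) (by omega)]
  · rw [tOp_gt _ _ hjk, tOp_gt _ _ hjk]
    simp only [dOp_apply]
    rcases lt_trichotomy l j with hlj | rfl | hlj
    · rw [xr_lt _ hlj, hx (by omega) (by omega) (by omega) (by omega)]
    · rw [xr_eq, (ρ.t_comm _).left_comm]
    · rw [xr_gt _ hlj, hx (by omega) (by omega) (by omega) (by omega)]

theorem T_mul_E_apply (hk : k + 1 < ν'.degree) (j : ℕ) :
    ρ.tOp i K k (dOp K (ρ.er h s') w) j = ρ.er h (s'.sw k) j * ρ.tOp i K k w j := by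
  have hd := degree_of_add h
  by_cases hj : j ≤ β.degree
  swap
  · rw [tOp_gt _ _ (by omega), dOp_apply, ρ.er_of_lt h s' (by omega), ρ.er_of_lt h _ (by omega)]
    simp
  rcases row_cases j k with hjk | rfl | rfl | hjk
  · obtain ⟨m, rfl⟩ : ∃ m, k = m + 1 := ⟨k - 1, by omega⟩
    rw [tOp_lt _ _ hjk, tOp_lt _ _ hjk, dOp_apply, Nat.add_sub_cancel, ← mul_assoc,
      ρ.T_mul_er_lt h s' (by omega) (by omega), mul_assoc]
  · have hjn : j < β.degree := by omega
    rw [tOp_eq, tOp_eq]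
    simp only [dOp_apply]
    rw [mul_add, ρ.er_sw h s' hjn, ← mul_assoc, ← mul_assoc,
      (ρ.dd_comm_er h s' hjn).eq, ← ρ.dd_mul_er h s' hjn, ρ.er_sw h s' hjn]
    rw [← ρ.er_sw h s' hjn, (ρ.dd_comm_er h _ hjn).eq]
  · have hjn : k < β.degree := by omega
    rw [tOp_succ, tOp_succ]
    simp only [dOp_apply]
    rw [mul_sub, ρ.er_sw' h s' hjn, ← ρ.er_sw h s' hjn,
      ← mul_assoc, ← mul_assoc, ← mul_assoc, ← mul_assoc, (ρ.qq_comm_er h s' hjn).eq,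
      ρ.dd_mul_er h s' hjn]
  · rw [tOp_gt _ _ hjk, tOp_gt _ _ hjk, dOp_apply, ← mul_assoc,
      ρ.T_mul_er_gt h s' hjk, mul_assoc]

end LocRep
end BorcherdsCartanDatum

namespace BorcherdsCartanDatum

variable {I : Type v} {D : BorcherdsCartanDatum.{v, w} I} [Inhabited I] {β ν' : I →₀ ℕ} {i : I}
  {S : Type*} [Ring S]

namespace LocRep

variable (ρ : D.LocRep β S)

section

variable {k m : ℕ} (hm : m + 1 < β.degree) (hk : k < β.degree) (h1 : k ≠ m) (h2 : k ≠ m + 1)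
include hm h1 h2

theorem P_comm_T : Commute (ρ.P i k) (ρ.T m) := by
  refine Eq.symm ?_
  rw [P, ρ.T_mul_diag hm ρ.one_eq fun s b => D.delta_commute _ _ _]
  simp only [SeqOf.c_sw _ hm, if_neg h1, if_neg h2]

include hk

theorem U_comm_T : Commute (ρ.U k) (ρ.T m) :=
  (ρ.U_comm hk (ρ.X_comm_T ρ.one_eq hm hk h1 h2).symm).symm

theorem f_comm_T : Commute (ρ.f i k) (ρ.T m) := by
  refine ρ.ext_E ρ.one_eq fun s => ?_
  rw [mul_assoc, mul_assoc, f_mul_E, f, ρ.diag_mul_T_E hm, SeqOf.c_sw _ hm, if_neg h1, if_neg h2,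
    (D.quad_commute (ρ.t_comm _).symm (ρ.X_comm_T ρ.one_eq hm hk h1 h2).symm).symm.left_comm]

theorem dd_comm_T : Commute (ρ.dd i k) (ρ.T m) :=
  (ρ.P_comm_T hm h1 h2).mul_left (ρ.U_comm_T hm hk h1 h2)

theorem qq_comm_T : Commute (ρ.qq i k) (ρ.T m) :=
  (((ρ.P_comm_T hm h1 h2).mul_left (ρ.U_comm_T hm hk h1 h2)).mul_left
    (ρ.U_comm_T hm hk h1 h2)).neg_left.add_left (ρ.f_comm_T hm hk h1 h2)

end

variable {K : Type u} [Field K] [Algebra K S]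
variable {h : β + Finsupp.single i 1 = ν'} (s' : SeqOf ν') {k l : ℕ} (w : ℕ → S)

theorem T_mul_T_apply (hk : k + 1 < l) (hl : l + 1 < ν'.degree) (j : ℕ) :
    ρ.tOp i K l (ρ.tOp i K k (dOp K (ρ.er h s') w)) j =
      ρ.tOp i K k (ρ.tOp i K l (dOp K (ρ.er h s') w)) j := by
  have hd := degree_of_add h
  by_cases hj : j ≤ β.degree
  swap
  · rw [tOp_gt _ _ (by omega), tOp_gt _ _ (by omega), tOp_gt _ _ (by omega),
      tOp_gt _ _ (by omega), dOp_apply, ρ.er_of_lt h s' (by omega)]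
    simp
  generalize dOp K (ρ.er h s') w = v
  rcases row_cases j k with hjk | rfl | rfl | hjk
  · rw [tOp_lt _ _ (by omega), tOp_lt _ _ (by omega), tOp_lt _ _ (by omega),
      tOp_lt _ _ (by omega), (ρ.T_comm_T ρ.one_eq (by omega) (by omega)).left_comm]
  · rw [tOp_lt _ _ (by omega), tOp_eq, tOp_eq, tOp_lt _ _ (by omega), tOp_lt _ _ (by omega),
      mul_add, (ρ.dd_comm_T (by omega) (by omega) (by omega) (by omega)).symm.left_comm]
  · rw [tOp_lt _ _ (by omega), tOp_succ, tOp_succ, tOp_lt _ _ (by omega), tOp_lt _ _ (by omega),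
      mul_sub, (ρ.dd_comm_T (by omega) (by omega) (by omega) (by omega)).symm.left_comm,
      (ρ.qq_comm_T (by omega) (by omega) (by omega) (by omega)).symm.left_comm]
  rcases row_cases j l with hjl | rfl | rfl | hjl
  · rw [tOp_lt _ _ (by omega), tOp_gt _ _ (by omega), tOp_gt _ _ (by omega),
      tOp_lt _ _ (by omega), (ρ.T_comm_T ρ.one_eq (by omega) (by omega)).left_comm]
  · rw [tOp_eq, tOp_gt _ _ (by omega), tOp_gt _ _ (by omega), tOp_gt _ _ (by omega), tOp_eq,
      mul_add, (ρ.dd_comm_T (by omega) (by omega) (by omega) (by omega)).symm.left_comm]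
  · rw [tOp_succ, tOp_gt _ _ (by omega), tOp_gt _ _ (by omega), tOp_gt _ _ (by omega), tOp_succ,
      mul_sub, (ρ.dd_comm_T (by omega) (by omega) (by omega) (by omega)).symm.left_comm,
      (ρ.qq_comm_T (by omega) (by omega) (by omega) (by omega)).symm.left_comm]
  · rw [tOp_gt _ _ (by omega), tOp_gt _ _ (by omega), tOp_gt _ _ (by omega),
      tOp_gt _ _ (by omega), (ρ.T_comm_T ρ.one_eq (by omega) (by omega)).left_comm]

theorem braid_apply (hk : k + 2 < ν'.degree) (j : ℕ) :
    ρ.tOp i K k (ρ.tOp i K (k + 1) (ρ.tOp i K k (dOp K (ρ.er h s') w))) j -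
      ρ.tOp i K (k + 1) (ρ.tOp i K k (ρ.tOp i K (k + 1) (dOp K (ρ.er h s') w))) j =
      D.braidCorr (s'.c k) (s'.c (k + 1)) (s'.c (k + 2)) (ρ.xr k j) (ρ.xr (k + 2) j) *
        (ρ.er h s' j * w j) := by
  have hd := degree_of_add h
  by_cases hj : j ≤ β.degree
  swap
  · rw [tOp_gt _ _ (by omega), tOp_gt _ _ (by omega), tOp_gt _ _ (by omega),
      tOp_gt _ _ (by omega), tOp_gt _ _ (by omega), tOp_gt _ _ (by omega), dOp_apply,
      ρ.er_of_lt h s' (by omega)]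
    simp
  have hass : ∀ a b c d : S, a * (b * (c * d)) = a * b * c * d := fun a b c d => by
    simp only [mul_assoc]
  by_cases hjk : j < k
  · obtain ⟨m, rfl⟩ : ∃ m, k = m + 1 := ⟨k - 1, by omega⟩
    rw [tOp_lt _ _ (by omega), tOp_lt _ _ (by omega), tOp_lt _ _ (by omega),
      tOp_lt _ _ (by omega), tOp_lt _ _ (by omega), tOp_lt _ _ (by omega), dOp_apply,
      xr_gt _ (by omega), xr_gt _ (by omega)]
    simp only [Nat.add_sub_cancel]
    rw [hass, hass, ← sub_mul,
      ρ.braid_eq ρ.one_eq (by omega)]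
    refine ρ.diag_mul_er h s' ?_ _
    rintro s rfl
    rw [SeqOf.ins_c h s hj (by omega), SeqOf.ins_c h s hj (by omega),
      SeqOf.ins_c h s hj (by omega)]
    simp (disch := omega) only [if_neg, Nat.add_sub_cancel]
    rfl
  by_cases hjk' : k + 2 < j
  · rw [tOp_gt _ _ (by omega), tOp_gt _ _ (by omega), tOp_gt _ _ (by omega),
      tOp_gt _ _ (by omega), tOp_gt _ _ (by omega), tOp_gt _ _ (by omega), dOp_apply,
      xr_lt _ (by omega), xr_lt _ (by omega)]
    rw [hass, hass, ← sub_mul,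
      ρ.braid_eq ρ.one_eq (by omega)]
    refine ρ.diag_mul_er h s' ?_ _
    rintro s rfl
    rw [SeqOf.ins_c h s hj (by omega), SeqOf.ins_c h s hj (by omega),
      SeqOf.ins_c h s hj (by omega)]
    simp (disch := omega) only [if_pos, Nat.add_sub_cancel]
  have hkn : k + 1 < β.degree := by omega
  have hr := ρ.crossingRels i hkn
  have e11 : ρ.dd i k * ρ.T k * ρ.dd i k + ρ.dd i (k + 1) * ρ.qq i k - ρ.T k * ρ.dd i k * ρ.T k = _ :=
    hr.entry11.trans (ρ.P_mul_corr hkn)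
  have e12 : ρ.dd i k * ρ.T k - ρ.dd i (k + 1) * ρ.dd i k = ρ.T k * ρ.dd i (k + 1) := hr.entry12
  have e21 : ρ.qq i k * ρ.T k * ρ.dd i k - ρ.dd i k * ρ.dd i (k + 1) * ρ.qq i k =
    ρ.dd i (k + 1) * ρ.qq i k * ρ.T k := hr.entry21
  have e22 : ρ.qq i k * ρ.T k + ρ.dd i k * ρ.dd i (k + 1) * ρ.dd i k +
      ρ.dd i (k + 1) * ρ.dd i k * ρ.dd i (k + 1) - ρ.T k * ρ.qq i (k + 1) = _ :=
    hr.entry22.trans (ρ.corr_mid hkn)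
  have e31 : ρ.T k * ρ.qq i (k + 1) * ρ.qq i k = ρ.qq i (k + 1) * ρ.qq i k * ρ.T k := hr.entry31
  have e32 : ρ.T k * ρ.qq i (k + 1) * ρ.dd i k = ρ.qq i (k + 1) * ρ.dd i k * ρ.dd i (k + 1) +
      ρ.dd i (k + 1) * ρ.T k * ρ.qq i (k + 1) := hr.entry32
  have e33 : -(ρ.T k * ρ.dd i (k + 1) * ρ.T k) + ρ.qq i (k + 1) * ρ.dd i k -
      ρ.dd i (k + 1) * ρ.T k * ρ.dd i (k + 1) = _ := hr.entry33.trans (ρ.P_mul_corr' hkn)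
  have a0 : ∀ v, ρ.tOp i K k v k = ρ.dd i k * v k + v (k + 1) := ρ.tOp_eq
  have a1 : ∀ v, ρ.tOp i K k v (k + 1) = ρ.qq i k * v k - ρ.dd i k * v (k + 1) := ρ.tOp_succ
  have a2 : ∀ v, ρ.tOp i K k v (k + 2) = ρ.T k * v (k + 2) := fun v => ρ.tOp_gt v (by omega)
  have b0 : ∀ v, ρ.tOp i K (k + 1) v k = ρ.T k * v k := fun v => ρ.tOp_lt v (by omega)
  have b1 : ∀ v, ρ.tOp i K (k + 1) v (k + 1) = ρ.dd i (k + 1) * v (k + 1) + v (k + 2) := ρ.tOp_eq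
  have b2 : ∀ v, ρ.tOp i K (k + 1) v (k + 2) =
    ρ.qq i (k + 1) * v (k + 1) - ρ.dd i (k + 1) * v (k + 2) := ρ.tOp_succ
  set v := dOp K (ρ.er h s') w with hv
  obtain rfl | rfl | rfl : j = k ∨ j = k + 1 ∨ j = k + 2 := by omega
  · simp only [a0, a1, a2, b0, b1, b2]
    refine Eq.trans ?_ (ρ.diag_mul_er h s' (φ := fun s => D.braidCorr i (s.c j) (s.c (j + 1)) ρ.t (ρ.X (j + 1))) ?_
      (w j))
    rotate_left
    · rintro s rfl
      rw [SeqOf.ins_c h s hj (by omega), SeqOf.ins_c h s hj (by omega),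
        SeqOf.ins_c h s hj (by omega)]
      simp (disch := omega) only [if_neg, Nat.add_sub_cancel, if_true, xr_eq]
      rw [xr_gt _ (by omega)]
      rfl
    · have e12' := congrArg (· * v (j + 1)) e12
      refine Eq.trans ?_ (congrArg (· * v j) e11)
      simp only [mul_add, add_mul, mul_sub, sub_mul, mul_assoc, neg_mul] at e12' ⊢
      rw [← e12']
      abel
  · simp only [a0, a1, a2, b0, b1, b2]
    refine Eq.trans ?_ (ρ.diag_mul_er h s' (φ := fun s => D.braidCorr (s.c k) i (s.c (k + 1)) (ρ.X k) (ρ.X (k + 1))) ?_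
      (w (k + 1)))
    rotate_left
    · rintro s rfl
      rw [SeqOf.ins_c h s hj (by omega), SeqOf.ins_c h s hj (by omega),
        SeqOf.ins_c h s hj (by omega)]
      simp (disch := omega) only [if_neg, if_pos, Nat.add_sub_cancel, if_true]
      rw [xr_lt ρ (show k < k + 1 by omega), xr_gt ρ (show k + 1 < k + 2 by omega)]
      rfl
    · have e12' := congrArg (· * v (k + 2)) e12
      have e21' := congrArg (· * v k) e21
      refine Eq.trans ?_ (congrArg (· * v (k + 1)) e22)
      simp only [mul_add, add_mul, mul_sub, sub_mul, mul_assoc, neg_mul] at e12' e21' ⊢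
      rw [← e12', ← e21']
      abel
  · simp only [a0, a1, a2, b0, b1, b2]
    refine Eq.trans ?_ (ρ.diag_mul_er h s' (φ := fun s => D.braidCorr (s.c k) (s.c (k + 1)) i (ρ.X k) ρ.t) ?_
      (w (k + 2)))
    rotate_left
    · rintro s rfl
      rw [SeqOf.ins_c h s hj (by omega), SeqOf.ins_c h s hj (by omega),
        SeqOf.ins_c h s hj (by omega)]
      simp (disch := omega) only [if_neg, if_pos, Nat.add_sub_cancel, if_true, xr_eq]
      rw [xr_lt _ (by omega)]
    · have e32' := congrArg (· * v (k + 1)) e32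
      have e31' := congrArg (· * v k) e31
      refine Eq.trans ?_ (congrArg (· * v (k + 2)) e33)
      simp only [mul_add, add_mul, mul_sub, sub_mul, mul_assoc, neg_mul] at e32' e31' ⊢
      rw [e32', e31']
      abel

variable (K) (h) in
/-- The action of `𝓡(β + i)` on sequences of elements of a localization of `𝓡(β)`. -/
def bigRep : D.Rep ν' (Module.End K (ℕ → S)) where
  E s := dOp K (ρ.er h s)
  X k := dOp K (ρ.xr k)
  T k := ρ.tOp i K k
  E_mul_self s := by
    rw [← map_mul]; congr 1; ext j
    rw [Pi.mul_apply, er_mul, if_pos rfl]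
  E_mul_of_ne s s' hs := by
    rw [← map_mul, ← map_zero (dOp K)]; congr 1; ext j
    rw [Pi.mul_apply, er_mul, if_neg hs]; rfl
  X_mul_E k s hk := by
    rw [← map_mul, ← map_mul]; congr 1; ext j
    rw [Pi.mul_apply, Pi.mul_apply]
    by_cases hj : j ≤ β.degree
    · refine (ρ.er_comm h s fun s => ?_).eq
      have hd := degree_of_add h
      rcases lt_trichotomy k j with h1 | rfl | h1
      · rw [xr_lt _ h1]; exact ρ.X_comm_E ρ.one_eq (by omega) s
      · rw [xr_eq]; exact ρ.t_comm _
      · rw [xr_gt _ h1]; exact ρ.X_comm_E ρ.one_eq (by omega) s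
    · rw [er_of_lt _ _ _ (by omega), mul_zero, zero_mul]
  T_mul_E k s hk := by ext w j; exact ρ.T_mul_E_apply s w hk j
  X_mul_X k l s hk hl := by
    rw [← map_mul, ← map_mul, ← map_mul, ← map_mul]; congr 1; ext j
    simp only [Pi.mul_apply]
    have hd := degree_of_add h
    by_cases hj : j ≤ β.degree
    · congr 1
      rcases lt_trichotomy k j with h1 | rfl | h1
      · rw [xr_lt _ h1]
        rcases lt_trichotomy l j with h2 | rfl | h2
        · rw [xr_lt _ h2]; exact (ρ.X_comm_X ρ.one_eq (by omega) (by omega)).eq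
        · rw [xr_eq]; exact (ρ.t_comm _).symm
        · rw [xr_gt _ h2]; exact (ρ.X_comm_X ρ.one_eq (by omega) (by omega)).eq
      · rw [xr_eq]; exact ρ.t_comm _
      · rw [xr_gt _ h1]
        rcases lt_trichotomy l j with h2 | rfl | h2
        · rw [xr_lt _ h2]; exact (ρ.X_comm_X ρ.one_eq (by omega) (by omega)).eq
        · rw [xr_eq]; exact (ρ.t_comm _).symm
        · rw [xr_gt _ h2]; exact (ρ.X_comm_X ρ.one_eq (by omega) (by omega)).eq
    · rw [er_of_lt _ _ _ (by omega), mul_zero, mul_zero]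
  X_mul_T k l s hk hl h1 h2 := by ext w j; exact ρ.X_mul_T_apply s w hk hl h1 h2 j
  T_mul_T k l s h1 h2 := by ext w j; exact ρ.T_mul_T_apply s w h1 h2 j
  T_sq k s hk := by
    ext w j; exact (ρ.tOp_sq_apply s w hk j).trans (quad_dOp K _ _ _ _ (dOp K (ρ.er h s) w) j).symm
  X_T k s hk := by ext w j; exact (ρ.X_T_apply s w hk j).trans (delta_end K _ _ (dOp K (ρ.er h s) w) j).symm
  T_X k s hk := by ext w j; exact (ρ.T_X_apply s w hk j).trans (delta_end K _ _ (dOp K (ρ.er h s) w) j).symm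
  braid k s hk := by
    ext w j; exact (ρ.braid_apply s w hk j).trans (braidCorr_dOp K _ _ _ _ _ (dOp K (ρ.er h s) w) j).symm

end LocRep
end BorcherdsCartanDatum

section Leading

open HahnSeries

variable {B : Type*} [Ring B]

/-- The variable `t` of the ring of Laurent series in `t⁻¹`. -/
def hT (B : Type*) [Ring B] : HahnSeries ℤ B := single (-1) 1

/-- The inverse of `t`. -/
def hTinv (B : Type*) [Ring B] : HahnSeries ℤ B := single 1 1

theorem hT_mul_hTinv : hT B * hTinv B = 1 := by
  rw [hT, hTinv, single_mul_single, mul_one, neg_add_cancel]; rfl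

theorem hTinv_mul_hT : hTinv B * hT B = 1 := by
  rw [hT, hTinv, single_mul_single, mul_one, add_neg_cancel]; rfl

theorem coeff_hT_mul (x : HahnSeries ℤ B) (a : ℤ) : (hT B * x).coeff a = x.coeff (a + 1) := by
  rw [hT, coeff_single_mul, one_mul, sub_neg_eq_add]

theorem coeff_mul_hT (x : HahnSeries ℤ B) (a : ℤ) : (x * hT B).coeff a = x.coeff (a + 1) := by
  rw [hT, coeff_mul_single, mul_one, sub_neg_eq_add]

theorem coeff_mul_hTinv (x : HahnSeries ℤ B) (a : ℤ) : (x * hTinv B).coeff a = x.coeff (a - 1) := by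
  rw [hTinv, coeff_mul_single, mul_one]

theorem hT_comm (x : HahnSeries ℤ B) : Commute (hT B) x := by
  ext a
  rw [coeff_hT_mul, coeff_mul_hT]

theorem coeff_hT_pow_mul (N : ℕ) (x : HahnSeries ℤ B) (a : ℤ) :
    (hT B ^ N * x).coeff a = x.coeff (a + N) := by
  induction N generalizing a with
  | zero => simp
  | succ N ih =>
    rw [pow_succ', mul_assoc, coeff_hT_mul, ih]
    congr 1
    push_cast
    ring

theorem coeff_C_mul' (b : B) (x : HahnSeries ℤ B) (a : ℤ) : (C b * x).coeff a = b * x.coeff a := by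
  rw [C_mul_eq_smul]; rfl

theorem coeff_mul_C' (b : B) (x : HahnSeries ℤ B) (a : ℤ) : (x * C b).coeff a = x.coeff a * b := by
  have := coeff_mul_single (Γ' := ℤ) (r := b) (x := x) (a := a) (b := 0)
  rwa [sub_zero] at this

/-- The geometric series `∑ x ^ r t ^ (-r)`. -/
def hGeom (x : B) : HahnSeries ℤ B := ofPowerSeries ℤ B (PowerSeries.mk fun r => x ^ r)

theorem coeff_hGeom (x : B) (r : ℕ) : (hGeom x).coeff (r : ℤ) = x ^ r := by
  have := ofPowerSeries_apply_coeff (Γ := ℤ) (PowerSeries.mk fun r => x ^ r) r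
  rw [PowerSeries.coeff_mk] at this
  exact this

theorem coeff_hGeom_neg (x : B) {a : ℤ} (ha : a < 0) : (hGeom x).coeff a = 0 := by
  rw [hGeom, ofPowerSeries_apply]
  refine embDomain_of_notMem_range ?_
  rintro ⟨r, hr⟩
  change (r : ℤ) = a at hr
  omega

theorem C_comm_hGeom {b x : B} (h : Commute b x) : Commute (C b) (hGeom x) := by
  ext a
  rw [coeff_C_mul', coeff_mul_C']
  rcases lt_or_ge a 0 with ha | ha
  · rw [coeff_hGeom_neg _ ha, mul_zero, zero_mul]
  · obtain ⟨r, rfl⟩ := Int.eq_ofNat_of_zero_le ha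
    rw [coeff_hGeom, (h.pow_right r).eq]

theorem sub_mul_hGeom (x : B) : (hT B - C x) * (hGeom x * hTinv B) = 1 := by
  have h : (hT B - C x) * (hGeom x * hTinv B) = hGeom x - C x * (hGeom x * hTinv B) := by
    rw [sub_mul, ← mul_assoc, (hT_comm _).eq, mul_assoc, hT_mul_hTinv, mul_one]
  rw [h]
  ext a
  rw [coeff_sub, coeff_C_mul', coeff_mul_hTinv]
  rcases lt_trichotomy a 0 with ha | rfl | ha
  · rw [coeff_hGeom_neg _ ha, coeff_hGeom_neg _ (by omega), mul_zero, sub_zero, coeff_one,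
      if_neg (by omega)]
  · rw [coeff_hGeom_neg x (show (0 : ℤ) - 1 < 0 by omega), mul_zero, sub_zero, coeff_one,
      if_pos rfl]
    simpa using coeff_hGeom x 0
  · obtain ⟨r, rfl⟩ : ∃ r : ℕ, a = (r + 1 : ℕ) := ⟨(a - 1).toNat, by omega⟩
    rw [coeff_hGeom, show ((r + 1 : ℕ) : ℤ) - 1 = r by push_cast; ring, coeff_hGeom, coeff_one,
      if_neg (by omega), pow_succ', sub_self]

theorem hGeom_mul_sub (x : B) : (hGeom x * hTinv B) * (hT B - C x) = 1 := by
  rw [mul_sub, mul_assoc, hTinv_mul_hT, mul_one, mul_assoc]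
  have h1 : Commute (hTinv B) (C x) := by
    ext a
    rw [coeff_mul_C', coeff_C_mul', hTinv]
    by_cases ha : a = 1
    · subst ha; simp
    · simp [ha]
  have h2 := sub_mul_hGeom x
  rw [sub_mul, ← mul_assoc (hT B), (hT_comm _).eq, mul_assoc, hT_mul_hTinv, mul_one,
    ← mul_assoc, (C_comm_hGeom (Commute.refl x)).eq] at h2
  rw [h1.eq, ← mul_assoc]
  exact h2

/-- The unit `t - x`. -/
def hDif (x : B) : (HahnSeries ℤ B)ˣ :=
  ⟨hT B - C x, hGeom x * hTinv B, sub_mul_hGeom x, hGeom_mul_sub x⟩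

theorem coeff_mul_of_lt {x y : HahnSeries ℤ B} {p q a : ℤ} (hx : ∀ a < p, x.coeff a = 0)
    (hy : ∀ a < q, y.coeff a = 0) (ha : a < p + q) : (x * y).coeff a = 0 := by
  rw [coeff_mul]
  refine Finset.sum_eq_zero fun ij hij => ?_
  rw [Finset.mem_antidiagonal] at hij
  have h1 : p ≤ ij.1 := by
    by_contra! h
    exact hij.1 (hx _ h)
  have h2 : q ≤ ij.2 := by
    by_contra! h
    exact hij.2.1 (hy _ h)
  omega

theorem coeff_mul_of_eq {x y : HahnSeries ℤ B} {p q : ℤ} (hx : ∀ a < p, x.coeff a = 0)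
    (hy : ∀ a < q, y.coeff a = 0) : (x * y).coeff (p + q) = x.coeff p * y.coeff q := by
  classical
  rw [coeff_mul]
  have key : ∀ ij ∈ Finset.antidiagonal x.isPWO_support y.isPWO_support (p + q),
      ij = (p, q) := by
    intro ij hij
    rw [Finset.mem_antidiagonal] at hij
    have h1 : p ≤ ij.1 := by
      by_contra! h
      exact hij.1 (hx _ h)
    have h2 : q ≤ ij.2 := by
      by_contra! h
      exact hij.2.1 (hy _ h)
    ext <;> simp <;> omega
  by_cases hmem : (p, q) ∈ Finset.antidiagonal x.isPWO_support y.isPWO_support (p + q)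
  · rw [Finset.sum_eq_single (p, q)]
    · intro ij hij hne
      exact absurd (key ij hij) hne
    · exact fun h => absurd hmem h
  · rw [Finset.sum_eq_zero fun ij hij => absurd (key ij hij ▸ hij) hmem]
    by_contra hne
    refine hmem (Finset.mem_antidiagonal.2 ⟨fun h => hne ?_, fun h => hne ?_, rfl⟩)
    · rw [h, zero_mul]
    · rw [h, mul_zero]

/-- On the idempotent `e`, the series `x` has degree at most `d` in `t`. -/
structure DegLE (e : B) (d : ℤ) (x : HahnSeries ℤ B) : Prop where
  comm : ∀ a, Commute (x.coeff a) e
  zero : ∀ a, a < -d → x.coeff a * e = 0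

/-- On the idempotent `e`, the series `x` has the leading term `± t ^ d`. -/
structure LeadAt (e : B) (d : ℤ) (x : HahnSeries ℤ B) : Prop extends DegLE e d x where
  lead : x.coeff (-d) * e = e ∨ x.coeff (-d) * e = -e

variable {e : B} {d d' : ℤ} {x y : HahnSeries ℤ B}

theorem DegLE.comm_C (h : DegLE e d x) : Commute x (C e) := by
  ext a
  rw [coeff_mul_C', coeff_C_mul', (h.comm a).eq]

theorem DegLE.zero_coeff (h : DegLE e d x) : ∀ a < -d, (x * C e).coeff a = 0 := fun a ha => by
  rw [coeff_mul_C', h.zero a ha]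

theorem comm_coeff (h : Commute x (C e)) (a : ℤ) : Commute (x.coeff a) e := by
  have := congrArg (fun z => z.coeff a) h.eq
  rw [coeff_mul_C', coeff_C_mul'] at this
  exact this

theorem DegLE.mul (he : e * e = e) (h : DegLE e d x) (h' : DegLE e d' y) :
    DegLE e (d + d') (x * y) where
  comm := comm_coeff (h.comm_C.mul_left h'.comm_C)
  zero a ha := by
    have h1 : x * y * C e = (x * C e) * (y * C e) := by
      rw [mul_assoc, mul_assoc, ← mul_assoc (C e), ← h'.comm_C.eq, mul_assoc, ← C.map_mul, he]
    rw [← coeff_mul_C', h1]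
    exact coeff_mul_of_lt h.zero_coeff h'.zero_coeff (by omega)

theorem LeadAt.mul (he : e * e = e) (h : LeadAt e d x) (h' : LeadAt e d' y) :
    LeadAt e (d + d') (x * y) where
  toDegLE := h.toDegLE.mul he h'.toDegLE
  lead := by
    have h1 : x * y * C e = (x * C e) * (y * C e) := by
      rw [mul_assoc, mul_assoc, ← mul_assoc (C e), ← h'.comm_C.eq, mul_assoc, ← C.map_mul, he]
    have h2 := coeff_mul_of_eq h.zero_coeff h'.zero_coeff
    rw [← h1, coeff_mul_C', coeff_mul_C', coeff_mul_C', ← neg_add] at h2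
    rw [h2]
    rcases h.lead with h3 | h3 <;> rcases h'.lead with h4 | h4 <;> rw [h3, h4] <;> simp [he]

theorem LeadAt.one : LeadAt e 0 1 where
  comm a := by
    rw [coeff_one]
    split_ifs
    · exact Commute.one_left _
    · exact Commute.zero_left _
  zero a ha := by rw [coeff_one, if_neg (by omega), zero_mul]
  lead := by simp

theorem LeadAt.hT : LeadAt e 1 (hT B) where
  comm a := by
    rw [_root_.hT]
    by_cases h : a = -1
    · subst h; simp
    · simp [h]
  zero a ha := by rw [_root_.hT, coeff_single_of_ne (by omega), zero_mul]
  lead := by simp [_root_.hT]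

theorem LeadAt.pow (he : e * e = e) (h : LeadAt e d x) (m : ℕ) : LeadAt e (m * d) (x ^ m) := by
  induction m with
  | zero => simpa using LeadAt.one
  | succ m ih =>
    rw [pow_succ]
    have := ih.mul he h
    rwa [show (m : ℤ) * d + d = (m + 1 : ℕ) * d by push_cast; ring] at this

theorem DegLE.C {b : B} (h : Commute b e) : DegLE e 0 (C b) where
  comm a := by
    by_cases ha : a = 0
    · subst ha; simpa using h
    · simp [ha]
  zero a ha := by rw [C_apply, coeff_single_of_ne (by omega), zero_mul]

theorem LeadAt.add (h : LeadAt e d x) (h' : DegLE e d' y) (hd : d' < d) : LeadAt e d (x + y) where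
  comm a := by
    rw [coeff_add]
    exact (h.comm a).add_left (h'.comm a)
  zero a ha := by rw [coeff_add, add_mul, h.zero a ha, h'.zero a (by omega), add_zero]
  lead := by rw [coeff_add, add_mul, h'.zero _ (by omega), add_zero]; exact h.lead

theorem LeadAt.neg (h : LeadAt e d x) : LeadAt e d (-x) where
  comm a := by rw [coeff_neg]; exact (h.comm a).neg_left
  zero a ha := by rw [coeff_neg, neg_mul, h.zero a ha, neg_zero]
  lead := by
    rw [coeff_neg, neg_mul]
    rcases h.lead with h3 | h3 <;> simp [h3]

theorem LeadAt.hDif_inv {b : B} (h : Commute b e) : LeadAt e (-1) (↑(hDif b)⁻¹ : HahnSeries ℤ B) where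
  comm := comm_coeff (by
    refine Commute.mul_left (C_comm_hGeom h.symm).symm ?_
    ext a
    rw [coeff_mul_C', coeff_C_mul', hTinv]
    by_cases ha : a = 1
    · subst ha; simp
    · simp [ha])
  zero a ha := by
    change (hGeom b * hTinv B).coeff a * e = 0
    rw [coeff_mul_hTinv, coeff_hGeom_neg _ (by omega), zero_mul]
  lead := by
    change (hGeom b * hTinv B).coeff 1 * e = e ∨ (hGeom b * hTinv B).coeff 1 * e = -e
    left
    rw [coeff_mul_hTinv]
    have := coeff_hGeom b 0
    rw [Nat.cast_zero] at this
    rw [sub_self, this, pow_zero, one_mul]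

theorem LeadAt.congr (h : LeadAt e d x) (hxy : x * C e = y * C e) (hc : Commute y (C e)) :
    LeadAt e d y where
  comm := comm_coeff hc
  zero a ha := by rw [← coeff_mul_C', ← hxy, coeff_mul_C', h.zero a ha]
  lead := by rw [← coeff_mul_C', ← hxy, coeff_mul_C']; exact h.lead

end Leading

namespace BorcherdsCartanDatum

variable {I : Type v} {D : BorcherdsCartanDatum.{v, w} I} [Inhabited I] {β ν' : I →₀ ℕ} {i : I}
  {B : Type*} [Ring B]

/-- The Laurent series over a ring with elements that satisfy the relations of `𝓡(β)`. -/
def Rep.laurent (ρ : D.Rep β B) (h1 : ρ.one = 1) : D.LocRep β (HahnSeries ℤ B) where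
  toRep := ρ.map HahnSeries.C
  one_eq := by
    change ∑ s, HahnSeries.C (ρ.E s) = 1
    rw [← map_sum, ← map_one HahnSeries.C, ← h1]
    rfl
  t := hT B
  t_comm := hT_comm
  dif k := hDif (ρ.X k)
  dif_eq k hk := rfl

namespace Rep

variable (ρ : D.Rep β B) (h1 : ρ.one = 1)

theorem leadAt_quad (i : I) {l : ℕ} (hl : l < β.degree) (s : SeqOf β)
    (h : ¬ (i = s.c l ∧ D.a i i = 2)) : LeadAt (ρ.E s) (-D.a i (s.c l))
      (D.quad i (s.c l) (hT B) (HahnSeries.C (ρ.X l))) := by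
  have he := ρ.E_mul_self s
  have hx : ∀ m : ℕ, DegLE (ρ.E s) 0 (HahnSeries.C (ρ.X l) ^ m) := fun m => by
    rw [← map_pow]
    exact DegLE.C (Commute.pow_left (ρ.X_mul_E l s hl) m)
  have ht : ∀ m : ℕ, LeadAt (ρ.E s) m (hT B ^ m) := fun m => by
    simpa using LeadAt.hT.pow he m
  unfold quad
  by_cases h1 : i = s.c l
  · have h2 : D.a i i ≠ 2 := fun h2 => h ⟨h1, h2⟩
    rw [if_pos h1, if_neg h2, ← h1]
    obtain ⟨h3, p, hp⟩ := (D.a_diag i).resolve_left h2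
    by_cases h4 : D.form (D.α i) (D.α i) = 0
    · rw [if_pos h4, (D.form_eq_zero_iff i i).1 h4]
      exact LeadAt.one
    · rw [if_neg h4]
      have h5 : D.a i i ≠ 0 := fun h => h4 ((D.form_eq_zero_iff i i).2 h)
      have h6 : ((-D.a i i / 2).toNat : ℤ) = -p := by omega
      have := (((ht (-D.a i i / 2).toNat).add (hx (-D.a i i / 2).toNat) (by omega)).pow he 2)
      rw [h6] at this
      rw [show -D.a i i = ((2 : ℕ) : ℤ) * -p by push_cast; omega]
      rw [show (-D.a i i / 2).toNat = (-D.a i i / 2).toNat from rfl] at this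
      have h7 : ((2 : ℕ) : ℤ) * -p / 2 = -D.a i i / 2 := by push_cast; omega
      rw [h7]
      exact this
  · rw [if_neg h1]
    by_cases h4 : D.form (D.α i) (D.α (s.c l)) = 0
    · rw [if_pos h4, (D.form_eq_zero_iff i _).1 h4]
      exact LeadAt.one
    · rw [if_neg h4]
      have h5 : D.a i (s.c l) ≠ 0 := fun h => h4 ((D.form_eq_zero_iff i _).2 h)
      have h6 := D.a_offDiag i _ h1
      have h7 := D.toNat_a i _ h1
      have := (ht (-D.a i (s.c l)).toNat).add (hx (-D.a (s.c l) i).toNat) (by omega)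
      rwa [h7] at this

theorem _root_.BorcherdsCartanDatum.LocRep.qq_mul_E {S : Type*} [Ring S] (ρ : D.LocRep β S) (i : I)
    {l : ℕ} (hl : l < β.degree) (s : SeqOf β) : ρ.qq i l * ρ.E s =
      (-(D.delta _ i (s.c l) * (ρ.U l * ρ.U l)) + D.quad i (s.c l) ρ.t (ρ.X l)) * ρ.E s := by
  have hU := ρ.E_comm_U hl s
  rw [LocRep.qq, add_mul, add_mul, ρ.f_mul_E, neg_mul, neg_mul, mul_assoc (ρ.P i l),
    mul_assoc (ρ.P i l), (hU.mul_left hU).eq, ← mul_assoc, ρ.P_mul_E, mul_assoc,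
    ← (hU.mul_left hU).eq, mul_assoc (D.delta _ _ _)]

theorem leadAt_qq (i : I) {l : ℕ} (hl : l < β.degree) (s : SeqOf β) :
    LeadAt (ρ.E s) (-D.a i (s.c l)) ((ρ.laurent h1).qq i l) := by
  have he := ρ.E_mul_self s
  have hc : Commute ((ρ.laurent h1).qq i l) (HahnSeries.C (ρ.E s)) :=
    ((((ρ.laurent h1).E_comm_P i l s).mul_left ((ρ.laurent h1).E_comm_U hl s)).mul_left
      ((ρ.laurent h1).E_comm_U hl s)).neg_left.add_left ((ρ.laurent h1).E_comm_f i hl s)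
  refine LeadAt.congr ?_ ((ρ.laurent h1).qq_mul_E i hl s).symm hc
  by_cases h : i = s.c l ∧ D.a i i = 2
  · rw [← h.1, LocRep.delta_eq_one h.2, LocRep.quad_real h.2, add_zero, one_mul, h.2]
    have h2 : LeadAt (ρ.E s) (-1) ((ρ.laurent h1).U l) := LeadAt.hDif_inv (ρ.X_mul_E l s hl)
    exact (h2.mul he h2).neg
  · rw [LocRep.delta_of_not h, zero_mul, neg_zero, zero_add]
    exact ρ.leadAt_quad i hl s h

/-- The product of the coefficients `Q_0, …, Q_{k-1}`. -/
def chi (i : I) : ℕ → HahnSeries ℤ B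
  | 0 => 1
  | k + 1 => (ρ.laurent h1).qq i k * chi i k

theorem leadAt_chi (i : I) {k : ℕ} (hk : k ≤ β.degree) (s : SeqOf β) :
    LeadAt (ρ.E s) (-∑ l ∈ Finset.range k, D.a i (s.c l)) (ρ.chi h1 i k) := by
  induction k with
  | zero => exact LeadAt.one
  | succ k ih =>
    rw [Finset.sum_range_succ, neg_add, add_comm]
    exact (ρ.leadAt_qq h1 i hk s).mul (ρ.E_mul_self s) (ih (by omega))

end Rep

end BorcherdsCartanDatum

section Products

variable {B : Type*} [Ring B] (T : ℕ → B)

/-- The product `T_a T_{a+1} ⋯ T_{a+d-1}`. -/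
def upProd (a : ℕ) : ℕ → B
  | 0 => 1
  | d + 1 => upProd a d * T (a + d)

/-- The product `T_{a+d-1} ⋯ T_{a+1} T_a`. -/
def dnProd (a : ℕ) : ℕ → B
  | 0 => 1
  | d + 1 => T (a + d) * dnProd a d

variable {T}

theorem upProd_zero (a : ℕ) : upProd T a 0 = 1 := rfl

theorem upProd_one (a : ℕ) : upProd T a 1 = T a := one_mul _

theorem upProd_succ (a d : ℕ) : upProd T a (d + 1) = upProd T a d * T (a + d) := rfl

theorem dnProd_zero (a : ℕ) : dnProd T a 0 = 1 := rfl

theorem dnProd_succ (a d : ℕ) : dnProd T a (d + 1) = T (a + d) * dnProd T a d := rfl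

theorem upProd_add (a d d' : ℕ) : upProd T a (d + d') = upProd T a d * upProd T (a + d) d' := by
  induction d' with
  | zero => exact (mul_one _).symm
  | succ d' ih => rw [← add_assoc, upProd_succ, ih, upProd_succ, mul_assoc, add_assoc]

theorem upProd_succ' (a d : ℕ) : upProd T a (d + 1) = T a * upProd T (a + 1) d := by
  rw [add_comm d, upProd_add, upProd_one]

theorem commute_upProd {b : B} {a d : ℕ} (h : ∀ m, a ≤ m → m < a + d → Commute b (T m)) :
    Commute b (upProd T a d) := by
  induction d with
  | zero => exact Commute.one_right _
  | succ d ih =>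
    exact (ih fun m h1 h2 => h m h1 (by omega)).mul_right (h _ (by omega) (by omega))

theorem commute_dnProd {b : B} {a d : ℕ} (h : ∀ m, a ≤ m → m < a + d → Commute b (T m)) :
    Commute b (dnProd T a d) := by
  induction d with
  | zero => exact Commute.one_right _
  | succ d ih =>
    exact (h _ (by omega) (by omega)).mul_right (ih fun m h1 h2 => h m h1 (by omega))

end Products

section Strands

variable {K : Type u} [Field K] {B : Type*} [Ring B] [Algebra K B] {X T : ℕ → B} {G Z N : Submodule K B}
  {n : ℕ}

theorem pow_mul_mem {x z : B} (h : ∀ z ∈ Z, x * z ∈ Z) (hz : z ∈ Z) (l : ℕ) : x ^ l * z ∈ Z := by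
  induction l with
  | zero => rwa [pow_zero, one_mul]
  | succ l ih => rw [pow_succ', mul_assoc]; exact h _ ih

theorem upProd_mul_mem {a d : ℕ} {z : B}
    (h : ∀ m, a ≤ m → m < a + d → ∀ z ∈ Z, T m * z ∈ Z) (hz : z ∈ Z) : upProd T a d * z ∈ Z := by
  induction d generalizing z with
  | zero => rwa [upProd_zero, one_mul]
  | succ d ih =>
    rw [upProd_succ, mul_assoc]
    exact ih (fun m h1 h2 => h m h1 (by omega)) (h _ (by omega) (by omega) _ hz)

theorem mul_mem_of_mem_span {s : Set B} {p q b : B} (hb : b ∈ Submodule.span K s)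
    (h : ∀ x ∈ s, p * (x * q) ∈ N) : p * (b * q) ∈ N := by
  induction hb using Submodule.span_induction with
  | mem x hx => exact h x hx
  | zero => rw [zero_mul, mul_zero]; exact N.zero_mem
  | add x y _ _ hx hy => rw [add_mul, mul_add]; exact N.add_mem hx hy
  | smul c x _ hx => rw [smul_mul_assoc, mul_smul_comm]; exact N.smul_mem c hx

variable (K X T) in
/-- Dots `X_0, …, X_n` and crossings `T_0, …, T_{n-1}` that satisfy the relations of a KLR algebra
up to lower terms with coefficients in `G`. -/
structure Strands (G : Submodule K B) (n : ℕ) : Prop where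
  G_comm_X : ∀ j g, j ≤ n → g ∈ G → Commute g (X j)
  G_mul_T : ∀ j g, j < n → g ∈ G → ∃ g' ∈ G, g * T j = T j * g'
  X_comm_X : ∀ j k, j ≤ n → k ≤ n → Commute (X j) (X k)
  X_comm_T : ∀ j k, j ≤ n → k < n → j ≠ k → j ≠ k + 1 → Commute (X j) (T k)
  T_comm_T : ∀ j k, k + 1 < j → j < n → Commute (T j) (T k)
  X_T : ∀ j, j < n → X j * T j - T j * X (j + 1) ∈ G
  T_X : ∀ j, j < n → T j * X j - X (j + 1) * T j ∈ G
  T_T : ∀ j, j < n → T j * T j ∈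
    Submodule.span K {y | ∃ a b, ∃ g ∈ G, y = X j ^ a * X (j + 1) ^ b * g}
  braid : ∀ j, j + 1 < n → T j * T (j + 1) * T j - T (j + 1) * T j * T (j + 1) ∈
    Submodule.span K {y | ∃ a b, ∃ g ∈ G, y = X j ^ a * X (j + 2) ^ b * g}

namespace Strands

theorem flip (H : Strands K X T G n) :
    Strands K (fun j => X (n - j)) (fun j => T (n - 1 - j)) G n where
  G_comm_X j g _ hg := H.G_comm_X _ g (by omega) hg
  G_mul_T j g hj hg := H.G_mul_T _ g (by omega) hg
  X_comm_X j k _ _ := H.X_comm_X _ _ (by omega) (by omega)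
  X_comm_T j k _ _ _ _ := H.X_comm_T _ _ (by omega) (by omega) (by omega) (by omega)
  T_comm_T j k _ _ := (H.T_comm_T _ _ (by omega) (by omega)).symm
  X_T j hj := by
    have := G.neg_mem (H.T_X (n - 1 - j) (by omega))
    rw [neg_sub] at this
    have e : n - j = n - 1 - j + 1 := by omega
    have e' : n - (j + 1) = n - 1 - j := by omega
    rwa [e, e']
  T_X j hj := by
    have := G.neg_mem (H.X_T (n - 1 - j) (by omega))
    rw [neg_sub] at this
    have e : n - j = n - 1 - j + 1 := by omega
    have e' : n - (j + 1) = n - 1 - j := by omega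
    rwa [e, e']
  T_T j hj := by
    have := H.T_T (n - 1 - j) (by omega)
    refine Submodule.span_mono ?_ this
    rintro _ ⟨a, b, g, hg, rfl⟩
    refine ⟨b, a, g, hg, ?_⟩
    have e : n - j = n - 1 - j + 1 := by omega
    have e' : n - (j + 1) = n - 1 - j := by omega
    rw [e, e', ((H.X_comm_X _ _ (by omega) (by omega)).pow_pow a b).eq]
  braid j hj := by
    obtain ⟨m, rfl⟩ : ∃ m, n = j + 2 + m := ⟨n - (j + 2), by omega⟩
    have := Submodule.neg_mem _ (H.braid m (by omega))
    rw [neg_sub] at this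
    have e1 : j + 2 + m - 1 - j = m + 1 := by omega
    have e2 : j + 2 + m - 1 - (j + 1) = m := by omega
    have e3 : j + 2 + m - j = m + 2 := by omega
    have e4 : j + 2 + m - (j + 2) = m := by omega
    rw [e1, e2]
    refine Submodule.span_mono ?_ this
    rintro _ ⟨a, b, g, hg, rfl⟩
    refine ⟨b, a, g, hg, ?_⟩
    rw [e3, e4, ((H.X_comm_X _ _ (by omega) (by omega)).pow_pow a b).eq]

variable (H : Strands K X T G n)
include H

theorem G_mul_upProd {a d : ℕ} (hd : a + d ≤ n) {g : B} (hg : g ∈ G) :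
    ∃ g' ∈ G, g * upProd T a d = upProd T a d * g' := by
  induction d with
  | zero => exact ⟨g, hg, by rw [upProd_zero, mul_one, one_mul]⟩
  | succ d ih =>
    obtain ⟨g', hg', h⟩ := ih (by omega)
    obtain ⟨g'', hg'', h'⟩ := H.G_mul_T (a + d) g' (by omega) hg'
    exact ⟨g'', hg'', by rw [upProd_succ, ← mul_assoc, h, mul_assoc, h', mul_assoc]⟩

theorem T_mul_pow_mem (hG : ∀ g ∈ G, ∀ z ∈ N, g * z ∈ N) (hX : ∀ j ≤ n, ∀ z ∈ N, X j * z ∈ N)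
    {j : ℕ} (hj : j < n) {w : B} (hw : w ∈ N) (hT : T j * w ∈ N) (l : ℕ) :
    T j * (X j ^ l * w) ∈ N := by
  induction l with
  | zero => rwa [pow_zero, one_mul]
  | succ l ih =>
    have e : T j * (X j ^ (l + 1) * w) = (T j * X j - X (j + 1) * T j) * (X j ^ l * w) +
        X (j + 1) * (T j * (X j ^ l * w)) := by rw [pow_succ']; noncomm_ring
    rw [e]
    exact N.add_mem (hG _ (H.T_X j hj) _ (pow_mul_mem (hX j hj.le) hw l)) (hX _ hj _ ih)

theorem T_mul_pow_succ_mem (hG : ∀ g ∈ G, ∀ z ∈ N, g * z ∈ N)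
    (hX : ∀ j ≤ n, ∀ z ∈ N, X j * z ∈ N)
    {j : ℕ} (hj : j < n) {w : B} (hw : w ∈ N) (hT : T j * w ∈ N) (l : ℕ) :
    T j * (X (j + 1) ^ l * w) ∈ N := by
  induction l with
  | zero => rwa [pow_zero, one_mul]
  | succ l ih =>
    have e : T j * (X (j + 1) ^ (l + 1) * w) = X j * (T j * (X (j + 1) ^ l * w)) -
        (X j * T j - T j * X (j + 1)) * (X (j + 1) ^ l * w) := by rw [pow_succ']; noncomm_ring
    rw [e]
    exact N.sub_mem (hX _ hj.le _ ih) (hG _ (H.X_T j hj) _ (pow_mul_mem (hX _ hj) hw l))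

end Strands

variable (K X T) in
/-- The span of the elements `X_k^l T_k ⋯ T_{n-1} z` with `z ∈ Z`. -/
def upSpan (n : ℕ) (Z : Submodule K B) : Submodule K B :=
  Submodule.span K {y | ∃ k d l, ∃ z ∈ Z, k + d = n ∧ y = X k ^ l * (upProd T k d * z)}

theorem mem_upSpan {k d : ℕ} (h : k + d = n) (l : ℕ) {z : B} (hz : z ∈ Z) :
    X k ^ l * (upProd T k d * z) ∈ upSpan K X T n Z :=
  Submodule.subset_span ⟨k, d, l, z, hz, h, rfl⟩

theorem mem_upSpan' {k d : ℕ} (h : k + d = n) {z : B} (hz : z ∈ Z) :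
    upProd T k d * z ∈ upSpan K X T n Z := by
  simpa using mem_upSpan (X := X) h 0 hz

theorem mul_upSpan_mem {b y : B} (hy : y ∈ upSpan K X T n Z)
    (h : ∀ k d l z, z ∈ Z → k + d = n → b * (X k ^ l * (upProd T k d * z)) ∈ N) : b * y ∈ N := by
  induction hy using Submodule.span_induction with
  | mem y hy =>
    obtain ⟨k, d, l, z, hz, hk, rfl⟩ := hy
    exact h k d l z hz hk
  | zero => rw [mul_zero]; exact N.zero_mem
  | add x y _ _ hx hy => rw [mul_add]; exact N.add_mem hx hy
  | smul c x _ hx => rw [mul_smul_comm]; exact N.smul_mem c hx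

namespace Strands

variable (H : Strands K X T G n) (hG : ∀ g ∈ G, ∀ z ∈ Z, g * z ∈ Z)
  (hX : ∀ j < n, ∀ z ∈ Z, X j * z ∈ Z) (hT : ∀ j, j + 1 < n → ∀ z ∈ Z, T j * z ∈ Z)
include H hG

theorem G_mul_upSpan : ∀ g ∈ G, ∀ y ∈ upSpan K X T n Z, g * y ∈ upSpan K X T n Z := by
  intro g hg y hy
  refine mul_upSpan_mem hy fun k d l z hz hk => ?_
  obtain ⟨g', hg', e⟩ := H.G_mul_upProd hk.le hg
  rw [← mul_assoc, ((H.G_comm_X k g (by omega) hg).pow_right l).eq, mul_assoc, ← mul_assoc g, e,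
    mul_assoc]
  exact mem_upSpan hk l (hG g' hg' z hz)

include hX hT

theorem X_mul_upSpan : ∀ j ≤ n, ∀ y ∈ upSpan K X T n Z, X j * y ∈ upSpan K X T n Z := by
  intro j hj y hy
  refine mul_upSpan_mem hy fun k d l z hz hk => ?_
  rw [← mul_assoc, ((H.X_comm_X j k hj (by omega)).pow_right l).eq, mul_assoc]
  rcases lt_trichotomy j k with h | rfl | h
  · rw [← mul_assoc (X j), (commute_upProd fun m h1 h2 =>
      H.X_comm_T j m hj (by omega) (by omega) (by omega)).eq, mul_assoc]
    exact mem_upSpan hk l (hX j (by omega) z hz)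
  · rw [← mul_assoc, ← pow_succ]
    exact mem_upSpan hk _ hz
  · obtain ⟨p, rfl⟩ : ∃ p, j = k + p + 1 := ⟨j - k - 1, by omega⟩
    obtain ⟨d', rfl⟩ : ∃ d', d = p + 1 + d' := ⟨d - p - 1, by omega⟩
    have c1 : Commute (X (k + p + 1)) (upProd T k p) := commute_upProd fun m h1 h2 =>
      H.X_comm_T _ m hj (by omega) (by omega) (by omega)
    have c2 : Commute (X (k + p)) (upProd T (k + p + 1) d') := commute_upProd fun m h1 h2 =>
      H.X_comm_T _ m (by omega) (by omega) (by omega) (by omega)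
    have e : X k ^ l * (X (k + p + 1) * (upProd T k (p + 1 + d') * z)) =
        X k ^ l * (upProd T k (p + 1 + d') * (X (k + p) * z)) -
        X k ^ l * (upProd T k p * ((T (k + p) * X (k + p) - X (k + p + 1) * T (k + p)) *
          (upProd T (k + p + 1) d' * z))) := by
      rw [upProd_add, upProd_succ, ← add_assoc]
      simp only [sub_mul, mul_sub, mul_assoc]
      rw [← mul_assoc (upProd T (k + p + 1) d'), ← c2.eq, mul_assoc, sub_sub_cancel,
        ← mul_assoc (X _) (upProd _ _ _), c1.eq, mul_assoc]
    rw [e]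
    refine Submodule.sub_mem _ (mem_upSpan hk l (hX _ (by omega) z hz)) ?_
    obtain ⟨g', hg', e'⟩ := H.G_mul_upProd (a := k + p + 1) (d := d') (by omega)
      (H.T_X (k + p) (by omega))
    have c3 : Commute (X k ^ l) (upProd T (k + p + 1) d') := commute_upProd fun m h1 h2 =>
      (H.X_comm_T k m (by omega) (by omega) (by omega) (by omega)).pow_left l
    have c4 : Commute (upProd T k p) (upProd T (k + p + 1) d') := commute_upProd fun m h1 h2 =>
      (commute_upProd fun m' h1' h2' => H.T_comm_T m m' (by omega) (by omega)).symm
    rw [← mul_assoc _ (upProd T (k + p + 1) d'), e', mul_assoc, ← mul_assoc (upProd T k p), c4.eq,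
      mul_assoc, ← mul_assoc (X k ^ l), c3.eq, mul_assoc]
    exact mem_upSpan' (by omega) (pow_mul_mem (hX k (by omega)) (upProd_mul_mem
      (fun m h1 h2 => hT m (by omega)) (hG _ hg' _ hz)) l)

theorem T_mul_upSpan : ∀ j < n, ∀ y ∈ upSpan K X T n Z, T j * y ∈ upSpan K X T n Z := by
  have NG := H.G_mul_upSpan hG
  have NX := H.X_mul_upSpan hG hX hT
  intro j hj y hy
  refine mul_upSpan_mem hy fun k d l z hz hk => ?_
  rcases lt_trichotomy (j + 1) k with h | rfl | h
  · rw [← mul_assoc, ((H.X_comm_T k j (by omega) hj (by omega) (by omega)).symm.pow_right l).eq,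
      mul_assoc, ← mul_assoc (T j), (commute_upProd fun m h1 h2 =>
        (H.T_comm_T m j (by omega) (by omega)).symm).eq, mul_assoc]
    exact mem_upSpan hk l (hT j (by omega) z hz)
  · refine H.T_mul_pow_succ_mem NG NX hj (mem_upSpan' hk hz) ?_ l
    rw [← mul_assoc, ← upProd_succ']
    exact mem_upSpan' (by omega) hz
  rcases Nat.lt_succ_iff.1 h |>.eq_or_lt with rfl | h
  · refine H.T_mul_pow_mem NG NX hj (mem_upSpan' hk hz) ?_ l
    obtain ⟨d, rfl⟩ : ∃ d', d = d' + 1 := ⟨d - 1, by omega⟩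
    rw [upProd_succ', ← mul_assoc, ← mul_assoc, mul_assoc, ← one_mul (_ * _)]
    refine mul_mem_of_mem_span (H.T_T k hj) ?_
    rintro _ ⟨a, b, g, hg, rfl⟩
    rw [one_mul, mul_assoc, mul_assoc]
    exact pow_mul_mem (NX _ hj.le) (pow_mul_mem (NX _ hj) (NG g hg _ (mem_upSpan' (by omega) hz))
      b) a
  · obtain ⟨p, rfl⟩ : ∃ p, j = k + p + 1 := ⟨j - k - 1, by omega⟩
    obtain ⟨d', rfl⟩ : ∃ d', d = p + 2 + d' := ⟨d - p - 2, by omega⟩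
    have c1 : Commute (T (k + p + 1)) (upProd T k p) := commute_upProd fun m h1 h2 =>
      H.T_comm_T _ m (by omega) (by omega)
    have c2 : Commute (T (k + p)) (upProd T (k + p + 2) d') := commute_upProd fun m h1 h2 =>
      (H.T_comm_T m _ (by omega) (by omega)).symm
    have c0 : Commute (T (k + p + 1)) (X k ^ l) :=
      (H.X_comm_T k _ (by omega) (by omega) (by omega) (by omega)).symm.pow_right l
    have e : T (k + p + 1) * (X k ^ l * (upProd T k (p + 2 + d') * z)) =
        X k ^ l * (upProd T k (p + 2 + d') * (T (k + p) * z)) -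
        (X k ^ l * upProd T k p) * ((T (k + p) * T (k + p + 1) * T (k + p) -
          T (k + p + 1) * T (k + p) * T (k + p + 1)) * (upProd T (k + p + 2) d' * z)) := by
      rw [upProd_add, upProd_succ, upProd_succ, ← add_assoc, ← add_assoc]
      simp only [sub_mul, mul_sub, mul_assoc]
      rw [← mul_assoc (upProd T (k + p + 2) d'), ← c2.eq, mul_assoc, sub_sub_cancel,
        ← mul_assoc (T _) (X k ^ l), c0.eq, mul_assoc, ← mul_assoc (T _) (upProd _ _ _), c1.eq,
        mul_assoc]
    rw [e]
    refine Submodule.sub_mem _ (mem_upSpan hk l (hT _ (by omega) z hz)) ?_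
    refine mul_mem_of_mem_span (H.braid (k + p) (by omega)) ?_
    rintro _ ⟨a, b, g, hg, rfl⟩
    obtain ⟨g', hg', e'⟩ := H.G_mul_upProd (a := k + p + 2) (d := d') (by omega) hg
    have c3 : Commute (X k ^ l * upProd T k p) (X (k + p + 2) ^ b * upProd T (k + p + 2) d') := by
      refine Commute.mul_right ?_ ?_
      · refine Commute.mul_left ((H.X_comm_X _ _ (by omega) (by omega)).pow_pow l b)
          (commute_upProd fun m h1 h2 => ?_).symm
        exact (H.X_comm_T _ m (by omega) (by omega) (by omega) (by omega)).pow_left b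
      · refine commute_upProd fun m h1 h2 => Commute.mul_left ?_ ?_
        · exact (H.X_comm_T _ m (by omega) (by omega) (by omega) (by omega)).pow_left l
        · exact (commute_upProd fun m' h1' h2' => H.T_comm_T m m' (by omega) (by omega)).symm
    have c4 : Commute (X (k + p) ^ a) (X (k + p + 2) ^ b * upProd T (k + p + 2) d') := by
      refine Commute.mul_right ((H.X_comm_X _ _ (by omega) (by omega)).pow_pow a b) ?_
      exact commute_upProd fun m h1 h2 =>
        (H.X_comm_T _ m (by omega) (by omega) (by omega) (by omega)).pow_left a
    have e2 : X k ^ l * upProd T k p * (X (k + p) ^ a * X (k + p + 2) ^ b * g *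
        (upProd T (k + p + 2) d' * z)) = X (k + p + 2) ^ b * (upProd T (k + p + 2) d' *
        (X k ^ l * (upProd T k p * (X (k + p) ^ a * (g' * z))))) := by
      calc _ = X k ^ l * upProd T k p * (X (k + p) ^ a * X (k + p + 2) ^ b *
            (g * upProd T (k + p + 2) d') * z) := by simp only [mul_assoc]
        _ = X k ^ l * upProd T k p * (X (k + p) ^ a * (X (k + p + 2) ^ b *
            upProd T (k + p + 2) d') * (g' * z)) := by rw [e']; simp only [mul_assoc]
        _ = (X k ^ l * upProd T k p) * (X (k + p + 2) ^ b *
            upProd T (k + p + 2) d') * (X (k + p) ^ a * (g' * z)) := by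
              rw [c4.eq]; simp only [mul_assoc]
        _ = _ := by rw [c3.eq]; simp only [mul_assoc]
    rw [e2]
    exact mem_upSpan (by omega) b (pow_mul_mem (hX k (by omega)) (upProd_mul_mem
      (fun m h1 h2 => hT m (by omega)) (pow_mul_mem (hX _ (by omega)) (hG _ hg' _ hz) a)) l)

end Strands

end Strands

namespace BorcherdsCartanDatum

variable {I : Type v} {D : BorcherdsCartanDatum.{v, w} I} [Inhabited I] {ν : I →₀ ℕ}
  {K : Type u} [Field K] {B : Type*} [Ring B] [Algebra K B]

namespace Rep

variable (ρ : D.Rep ν B)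

variable (K) in
/-- The span of the idempotents. -/
def idemSpan : Submodule K B := Submodule.span K (Set.range ρ.E)

theorem E_mem_idemSpan (s : SeqOf ν) : ρ.E s ∈ ρ.idemSpan K := Submodule.subset_span ⟨s, rfl⟩

theorem eps_mem_idemSpan (k : ℕ) : ρ.eps k ∈ ρ.idemSpan K := by
  refine Submodule.sum_mem _ fun s _ => ?_
  dsimp only [delta]
  split_ifs
  · rw [one_mul]; exact ρ.E_mem_idemSpan s
  · rw [zero_mul]; exact Submodule.zero_mem _

theorem diag_mem_span {x y : B} {φ : SeqOf ν → B}
    (h : ∀ s, φ s ∈ Submodule.span K {z | ∃ a b : ℕ, z = x ^ a * y ^ b}) :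
    ρ.diag φ ∈ Submodule.span K {z | ∃ a b : ℕ, ∃ g ∈ ρ.idemSpan K, z = x ^ a * y ^ b * g} := by
  refine Submodule.sum_mem _ fun s _ => ?_
  have := h s
  generalize φ s = z at this
  induction this using Submodule.span_induction with
  | mem z hz =>
    obtain ⟨a, b, rfl⟩ := hz
    exact Submodule.subset_span ⟨a, b, _, ρ.E_mem_idemSpan s, rfl⟩
  | zero => rw [zero_mul]; exact Submodule.zero_mem _
  | add y z _ _ hy hz => rw [add_mul]; exact Submodule.add_mem _ hy hz
  | smul c z _ hz => rw [smul_mul_assoc]; exact Submodule.smul_mem _ c hz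

theorem quad_mem_span {x y : B} (hxy : Commute x y) (i j : I) :
    D.quad i j x y ∈ Submodule.span K {z | ∃ a b : ℕ, z = x ^ a * y ^ b} := by
  have h (a b : ℕ) : x ^ a * y ^ b ∈ Submodule.span K {z | ∃ a b : ℕ, z = x ^ a * y ^ b} :=
    Submodule.subset_span ⟨a, b, rfl⟩
  have hx (a : ℕ) := by simpa using h a 0
  have hy (b : ℕ) := by simpa using h 0 b
  unfold quad
  split_ifs
  · exact Submodule.zero_mem _
  · simpa using h 0 0
  · rw [pow_two, mul_add, add_mul, add_mul, ← pow_add, ← pow_add, ← (hxy.pow_pow _ _).eq]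
    exact Submodule.add_mem _ (Submodule.add_mem _ (hx _) (h _ _))
      (Submodule.add_mem _ (h _ _) (hy _))
  · simpa using h 0 0
  · exact Submodule.add_mem _ (hx _) (hy _)

theorem braidCorr_mem_span (x y : B) (i j m : I) :
    D.braidCorr i j m x y ∈ Submodule.span K {z | ∃ a b : ℕ, z = x ^ a * y ^ b} := by
  unfold braidCorr
  split_ifs
  · exact Submodule.sum_mem _ fun c _ => Submodule.subset_span ⟨_, _, rfl⟩
  · exact Submodule.zero_mem _

theorem strands (h1 : ρ.one = 1) {n : ℕ} (hn : ν.degree = n + 1) :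
    Strands K ρ.X ρ.T (ρ.idemSpan K) n where
  G_comm_X j g hj hg := by
    induction hg using Submodule.span_induction with
    | mem g hg => obtain ⟨s, rfl⟩ := hg; exact (ρ.X_mul_E j s (by omega)).symm
    | zero => exact Commute.zero_left _
    | add y z _ _ hy hz => exact hy.add_left hz
    | smul c z _ hz => exact hz.smul_left c
  G_mul_T j g hj hg := by
    induction hg using Submodule.span_induction with
    | mem g hg =>
      obtain ⟨s, rfl⟩ := hg
      exact ⟨_, ρ.E_mem_idemSpan (s.sw j), by rw [ρ.T_mul_E _ _ (by omega), SeqOf.sw_sw]⟩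
    | zero => exact ⟨0, Submodule.zero_mem _, by simp⟩
    | add y z _ _ hy hz =>
      obtain ⟨y', hy', e⟩ := hy
      obtain ⟨z', hz', e'⟩ := hz
      exact ⟨_, Submodule.add_mem _ hy' hz', by rw [add_mul, mul_add, e, e']⟩
    | smul c z _ hz =>
      obtain ⟨z', hz', e'⟩ := hz
      exact ⟨_, Submodule.smul_mem _ c hz', by rw [smul_mul_assoc, e', mul_smul_comm]⟩
  X_comm_X j k hj hk := ρ.X_comm_X h1 (by omega) (by omega)
  X_comm_T j k hj hk h h' := ρ.X_comm_T h1 (by omega) (by omega) h h'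
  T_comm_T j k h hj := ρ.T_comm_T h1 h (by omega)
  X_T j hj := by rw [ρ.X_T_eq h1 (by omega)]; exact ρ.eps_mem_idemSpan j
  T_X j hj := by rw [ρ.T_X_eq h1 (by omega)]; exact ρ.eps_mem_idemSpan j
  T_T j hj := by
    rw [ρ.T_sq_eq h1 (by omega)]
    have := ρ.X_comm_X h1 (k := j) (l := j + 1) (by omega) (by omega)
    exact ρ.diag_mem_span fun s => quad_mem_span this _ _
  braid j hj := by
    rw [ρ.braid_eq h1 (by omega)]
    exact ρ.diag_mem_span fun s => braidCorr_mem_span _ _ _ _ _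

end Rep

end BorcherdsCartanDatum

namespace BorcherdsCartanDatum

variable {I : Type v} {D : BorcherdsCartanDatum.{v, w} I} [Inhabited I]

namespace Rep

section Colours

variable {ν : I →₀ ℕ} {B : Type*} [Ring B] (ρ : D.Rep ν B)

theorem exists_E_mul_upProd {a d : ℕ} (hd : a + d < ν.degree) (s : SeqOf ν) :
    ∃ s' : SeqOf ν, ρ.E s * upProd ρ.T a d = upProd ρ.T a d * ρ.E s' ∧ s'.c (a + d) = s.c a ∧
      ∀ j, j < a ∨ a + d < j → s'.c j = s.c j := by
  induction d with
  | zero => exact ⟨s, by rw [upProd_zero, mul_one, one_mul], rfl, fun _ _ => rfl⟩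
  | succ d ih =>
    obtain ⟨s', h, h1, h2⟩ := ih (by omega)
    refine ⟨s'.sw (a + d), ?_, ?_, fun j hj => ?_⟩
    · rw [upProd_succ, ← mul_assoc, h, mul_assoc, mul_assoc, ρ.T_mul_E _ _ (by omega),
        SeqOf.sw_sw]
    · rw [SeqOf.c_sw _ (by omega), if_neg (by omega), if_pos (by omega), h1]
    · rw [SeqOf.c_sw _ (by omega), if_neg (by omega), if_neg (by omega), h2 j (by omega)]

theorem E_mul_T {k : ℕ} (hk : k + 1 < ν.degree) (s : SeqOf ν) :
    ρ.E s * ρ.T k = ρ.T k * ρ.E (s.sw k) := by rw [ρ.T_mul_E _ _ hk, SeqOf.sw_sw]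

theorem exists_E_mul_dnProd {a d : ℕ} (hd : a + d < ν.degree) (s : SeqOf ν) :
    ∃ s' : SeqOf ν, ρ.E s * dnProd ρ.T a d = dnProd ρ.T a d * ρ.E s' ∧ s'.c a = s.c (a + d) := by
  induction d generalizing s with
  | zero => exact ⟨s, by rw [dnProd_zero, mul_one, one_mul], rfl⟩
  | succ d ih =>
    obtain ⟨s', h, h1⟩ := ih (by omega) (s.sw (a + d))
    refine ⟨s', ?_, ?_⟩
    · rw [dnProd_succ, ← mul_assoc, ρ.E_mul_T (by omega), mul_assoc, h, mul_assoc]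
    · rw [h1, SeqOf.c_sw _ (by omega), if_pos rfl]; rfl

theorem exists_upProd_mul_E {a d : ℕ} (hd : a + d < ν.degree) (s : SeqOf ν) :
    ∃ s' : SeqOf ν, upProd ρ.T a d * ρ.E s = ρ.E s' * upProd ρ.T a d ∧ s'.c a = s.c (a + d) := by
  induction d generalizing s with
  | zero => exact ⟨s, by rw [upProd_zero, mul_one, one_mul], rfl⟩
  | succ d ih =>
    obtain ⟨s', h, h1⟩ := ih (by omega) (s.sw (a + d))
    refine ⟨s', ?_, ?_⟩
    · rw [upProd_succ, mul_assoc, ρ.T_mul_E _ _ (by omega), ← mul_assoc, h, mul_assoc]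
    · rw [h1, SeqOf.c_sw _ (by omega), if_pos rfl]; rfl

theorem E_mul_X_pow {k : ℕ} (hk : k < ν.degree) (s : SeqOf ν) (l : ℕ) :
    ρ.E s * ρ.X k ^ l = ρ.X k ^ l * ρ.E s :=
  (Commute.pow_left (show Commute (ρ.X k) (ρ.E s) from ρ.X_mul_E k s hk) l).eq.symm

variable {K : Type u} [Field K] [Algebra K B] {N : Submodule K B} {k m : ℕ} {p q : B}

theorem mul_eps_mul_mem (h : ∀ s : SeqOf ν, s.c k = s.c (k + 1) → p * (ρ.E s * q) ∈ N) :
    p * (ρ.eps k * q) ∈ N := by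
  rw [eps, diag, Finset.sum_mul, Finset.mul_sum]
  refine N.sum_mem fun s _ => ?_
  unfold delta
  split_ifs with h'
  · rw [one_mul]; exact h s h'.1
  · simp

theorem mul_braidCorr_mul_mem (h : ∀ (s : SeqOf ν) (a b : ℕ), s.c k = s.c (k + 2) →
      p * (ρ.X k ^ a * (ρ.X (k + 2) ^ b * (ρ.E s * q))) ∈ N) :
    p * ((ρ.diag fun s => D.braidCorr (s.c k) (s.c (k + 1)) (s.c (k + 2)) (ρ.X k) (ρ.X (k + 2))) *
      q) ∈ N := by
  rw [diag, Finset.sum_mul, Finset.mul_sum]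
  refine N.sum_mem fun s _ => ?_
  unfold braidCorr
  split_ifs with h'
  · rw [mul_assoc, Finset.sum_mul, Finset.mul_sum]
    refine N.sum_mem fun c _ => ?_
    rw [mul_assoc]
    exact h s _ _ h'.1
  · simp

end Colours

section Lift

variable {ν : I →₀ ℕ} {K : Type u} [Field K] {B : Type*} [Ring B] [Algebra K B] (ρ : D.Rep ν B)

theorem one_mul_lift (y : D.KLR K ν) : ρ.one * ρ.lift K y = ρ.lift K y := by
  rw [← lift_one (K := K), ← map_mul, one_mul]

theorem lift_kE_mul (s : SeqOf ν) (y : D.KLR K ν) :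
    ρ.lift K (D.kE K s * y) = ρ.E s * ρ.lift K y := by
  rw [map_mul, kE, lift_gen]; rfl

theorem lift_kX {k : ℕ} (hk : k < ν.degree) : ρ.lift K (D.kX ν K k) = ρ.X k * ρ.one := by
  rw [kX, dif_pos hk, map_sum, one, Finset.mul_sum]
  exact Finset.sum_congr rfl fun s _ => ρ.lift_gen _

theorem lift_kT {k : ℕ} (hk : k + 1 < ν.degree) : ρ.lift K (D.kT ν K k) = ρ.T k * ρ.one := by
  rw [kT, dif_pos hk, map_sum, one, Finset.mul_sum]
  exact Finset.sum_congr rfl fun s _ => ρ.lift_gen _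

theorem lift_kX_mul {k : ℕ} (hk : k < ν.degree) (y : D.KLR K ν) :
    ρ.lift K (D.kX ν K k * y) = ρ.X k * ρ.lift K y := by
  rw [map_mul, lift_kX ρ hk, mul_assoc, one_mul_lift]

theorem lift_kX_pow_mul {k : ℕ} (hk : k < ν.degree) (l : ℕ) (y : D.KLR K ν) :
    ρ.lift K (D.kX ν K k ^ l * y) = ρ.X k ^ l * ρ.lift K y := by
  induction l with
  | zero => rw [pow_zero, pow_zero, one_mul, one_mul]
  | succ l ih => rw [pow_succ', pow_succ', mul_assoc, lift_kX_mul ρ hk, ih, mul_assoc]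

theorem lift_kT_mul {k : ℕ} (hk : k + 1 < ν.degree) (y : D.KLR K ν) :
    ρ.lift K (D.kT ν K k * y) = ρ.T k * ρ.lift K y := by
  rw [map_mul, lift_kT ρ hk, mul_assoc, one_mul_lift]

theorem lift_upProd_mul {a d : ℕ} (hd : d = 0 ∨ a + d < ν.degree) (y : D.KLR K ν) :
    ρ.lift K (upProd (D.kT ν K) a d * y) = upProd ρ.T a d * ρ.lift K y := by
  induction d generalizing y with
  | zero => rw [upProd_zero, upProd_zero, one_mul, one_mul]
  | succ d ih =>
    rw [upProd_succ, upProd_succ, mul_assoc, mul_assoc, ih (by omega), lift_kT_mul ρ (by omega)]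

theorem lift_dnProd_mul {a d : ℕ} (hd : d = 0 ∨ a + d < ν.degree) (y : D.KLR K ν) :
    ρ.lift K (dnProd (D.kT ν K) a d * y) = dnProd ρ.T a d * ρ.lift K y := by
  induction d generalizing y with
  | zero => rw [dnProd_zero, dnProd_zero, one_mul, one_mul]
  | succ d ih =>
    rw [dnProd_succ, dnProd_succ, mul_assoc, mul_assoc, lift_kT_mul ρ (by omega), ih (by omega)]

end Lift

end Rep

section LeftIdeal

variable {ν : I →₀ ℕ} (K : Type u) [Field K]

variable (D ν) in
theorem univ_one : (D.univ K : D.Rep ν (D.KLR K ν)).one = 1 := by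
  have := D.klr_rel ν K .sum_e
  rwa [map_sum, map_one] at this

theorem sum_kE : ∑ s : SeqOf ν, D.kE K s = 1 := univ_one D ν K

variable {K}

/-- A subspace that is stable under the generators is stable under the algebra. -/
theorem klr_mul_mem {V : Type*} [AddCommGroup V] [Module K V] [Module (D.KLR K ν) V]
    [IsScalarTower K (D.KLR K ν) V] {N : Submodule K V}
    (hE : ∀ s : SeqOf ν, ∀ z ∈ N, D.kE K s • z ∈ N)
    (hX : ∀ k < ν.degree, ∀ z ∈ N, D.kX ν K k • z ∈ N)
    (hT : ∀ k, k + 1 < ν.degree → ∀ z ∈ N, D.kT ν K k • z ∈ N)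
    (y : D.KLR K ν) : ∀ z ∈ N, y • z ∈ N := by
  obtain ⟨y, rfl⟩ := RingQuot.mkAlgHom_surjective K (D.Rel K ν) y
  induction y using FreeAlgebra.induction with
  | grade0 c =>
    intro z hz
    rw [AlgHom.commutes, algebraMap_smul]
    exact N.smul_mem c hz
  | grade1 g =>
    intro z hz
    rw [mk_ι]
    cases g with
    | e s => exact hE s z hz
    | x k s => rw [← kX_mul_kE D K k.2 s, mul_smul]; exact hX k k.2 _ (hE s z hz)
    | t k hk s => rw [← kT_mul_kE D K hk s, mul_smul]; exact hT k hk _ (hE s z hz)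
  | mul y z hy hz => intro x hx; rw [map_mul, mul_smul]; exact hy _ (hz x hx)
  | add y z hy hz => intro x hx; rw [map_add, add_smul]; exact N.add_mem (hy x hx) (hz x hx)

end LeftIdeal

section AddStrand

variable {β ν' : I →₀ ℕ} {i : I} (h : β + Finsupp.single i 1 = ν') (K : Type u) [Field K]

variable (D) in
/-- The homomorphism `𝓡(β) → 𝓡(β + i)` that adds a strand of colour `i` on the right. -/
def iota : D.KLR K β →ₙₐ[K] D.KLR K ν' := ((D.univ K).append h).lift K

variable {K} {n : ℕ}

theorem iota_kE_mul (s : SeqOf β) (y : D.KLR K β) :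
    D.iota h K (D.kE K s * y) = D.kE K (s.append h) * D.iota h K y := Rep.lift_kE_mul _ s y

theorem iota_kX_mul {k : ℕ} (hk : k < β.degree) (y : D.KLR K β) :
    D.iota h K (D.kX β K k * y) = D.kX ν' K k * D.iota h K y := Rep.lift_kX_mul _ hk y

theorem iota_kX_pow_mul {k : ℕ} (hk : k < β.degree) (l : ℕ) (y : D.KLR K β) :
    D.iota h K (D.kX β K k ^ l * y) = D.kX ν' K k ^ l * D.iota h K y := Rep.lift_kX_pow_mul _ hk l y

theorem iota_kT_mul {k : ℕ} (hk : k + 1 < β.degree) (y : D.KLR K β) :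
    D.iota h K (D.kT β K k * y) = D.kT ν' K k * D.iota h K y := Rep.lift_kT_mul _ hk y

theorem iota_upProd_mul {a d : ℕ} (hd : d = 0 ∨ a + d < β.degree) (y : D.KLR K β) :
    D.iota h K (upProd (D.kT β K) a d * y) = upProd (D.kT ν' K) a d * D.iota h K y :=
  Rep.lift_upProd_mul _ hd y

theorem iota_dnProd_mul {a d : ℕ} (hd : d = 0 ∨ a + d < β.degree) (y : D.KLR K β) :
    D.iota h K (dnProd (D.kT β K) a d * y) = dnProd (D.kT ν' K) a d * D.iota h K y :=
  Rep.lift_dnProd_mul _ hd y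

theorem iota_one : D.iota h K 1 = ∑ s, D.kE K (SeqOf.append h s) := Rep.lift_one _

theorem iota_one_mul (y : D.KLR K β) : D.iota h K 1 * D.iota h K y = D.iota h K y := by
  rw [← map_mul, one_mul]

theorem iota_mul_one (y : D.KLR K β) : D.iota h K y * D.iota h K 1 = D.iota h K y := by
  rw [← map_mul, mul_one]

theorem kE_append_mul_iota_one (s : SeqOf β) :
    D.kE K (s.append h) * D.iota h K 1 = D.kE K (s.append h) :=
  (congrArg _ (Rep.lift_one _)).trans (((D.univ K).append h).E_mul_one s)

theorem iota_one_mul_kE_append (s : SeqOf β) :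
    D.iota h K 1 * D.kE K (s.append h) = D.kE K (s.append h) :=
  (congrArg (· * _) (Rep.lift_one _)).trans (((D.univ K).append h).one_mul_E s)

theorem kE_mul_iota_one_of_ne {s : SeqOf ν'} (hs : s.c β.degree ≠ i) :
    D.kE K s * D.iota h K 1 = 0 := by
  rw [iota_one, Finset.mul_sum]
  refine Finset.sum_eq_zero fun r _ => D.kE_mul_of_ne K _ _ fun e => hs ?_
  rw [e, SeqOf.append_c h r le_rfl, if_neg (lt_irrefl _)]

theorem kE_mul_iota_of_ne {s : SeqOf ν'} (hs : s.c β.degree ≠ i) (y : D.KLR K β) :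
    D.kE K s * D.iota h K y = 0 := by
  rw [← iota_one_mul, ← mul_assoc, kE_mul_iota_one_of_ne h hs, zero_mul]

theorem kE_mul_iota (s : SeqOf ν') : (∀ y : D.KLR K β, D.kE K s * D.iota h K y = 0) ∨
    (∃ r : SeqOf β, r.append h = s ∧ s.c β.degree = i ∧ (∀ j < β.degree, r.c j = s.c j) ∧
      ∀ y : D.KLR K β, D.kE K s * D.iota h K y = D.iota h K (D.kE K r * y)) := by
  by_cases hs : s.c β.degree = i
  · obtain ⟨r, rfl⟩ := SeqOf.exists_append h s hs
    refine Or.inr ⟨r, rfl, hs, fun j hj => ?_, fun y => (iota_kE_mul h r y).symm⟩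
    rw [SeqOf.append_c h r hj.le, if_pos hj]
  · exact Or.inl (kE_mul_iota_of_ne h hs)

theorem idemSpan_mul_mem {ν : I →₀ ℕ} {N : Submodule K (D.KLR K ν)}
    (hE : ∀ s : SeqOf ν, ∀ z ∈ N, D.kE K s * z ∈ N) :
    ∀ g ∈ (D.univ K : D.Rep ν (D.KLR K ν)).idemSpan K, ∀ z ∈ N, g * z ∈ N := by
  intro g hg z hz
  induction hg using Submodule.span_induction with
  | mem g hg => obtain ⟨s, rfl⟩ := hg; exact hE s z hz
  | zero => rw [zero_mul]; exact N.zero_mem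
  | add y z _ _ hy hz => rw [add_mul]; exact N.add_mem hy hz
  | smul c z _ hz => rw [smul_mul_assoc]; exact N.smul_mem c hz

theorem klr_strands (hn : ν'.degree = n + 1) :
    Strands K (D.kX ν' K) (D.kT ν' K) ((D.univ K).idemSpan K) n :=
  (D.univ K).strands (univ_one D ν' K) hn

variable (D K) in
/-- The span of the elements `x_k^l τ_k ⋯ τ_{n-1} ι(y)` with `y ∈ J`. -/
def strandSpan (J : Submodule K (D.KLR K β)) : Submodule K (D.KLR K ν') :=
  upSpan K (D.kX ν' K) (D.kT ν' K) β.degree (J.map (D.iota h K : D.KLR K β →ₗ[K] D.KLR K ν'))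

variable {J : Submodule K (D.KLR K β)} (hJ : ∀ a, ∀ y ∈ J, a * y ∈ J)
include hJ

theorem kE_mul_map_mem (s : SeqOf ν') :
    ∀ z ∈ J.map (D.iota h K : D.KLR K β →ₗ[K] D.KLR K ν'),
      D.kE K s * z ∈ J.map (D.iota h K : D.KLR K β →ₗ[K] D.KLR K ν') := by
  rintro _ ⟨z, hz, rfl⟩
  rcases kE_mul_iota h (K := K) (D := D) s with e | ⟨r, -, -, -, e⟩
  · exact ⟨0, J.zero_mem, (map_zero (D.iota h K)).trans (e z).symm⟩
  · exact ⟨_, hJ _ z hz, (e z).symm⟩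

theorem mul_strandSpan_mem (y : D.KLR K ν') :
    ∀ z ∈ D.strandSpan h K J, y * z ∈ D.strandSpan h K J := by
  have hn := degree_of_add h
  have H := klr_strands (D := D) (K := K) hn
  have hG := idemSpan_mul_mem (N := J.map (D.iota h K : D.KLR K β →ₗ[K] D.KLR K ν'))
    (kE_mul_map_mem h hJ)
  have hX : ∀ j < β.degree, ∀ z ∈ J.map (D.iota h K : D.KLR K β →ₗ[K] D.KLR K ν'),
      D.kX ν' K j * z ∈ J.map (D.iota h K : D.KLR K β →ₗ[K] D.KLR K ν') := by
    rintro j hj _ ⟨z, hz, rfl⟩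
    exact ⟨_, hJ _ z hz, iota_kX_mul h hj z⟩
  have hT : ∀ j, j + 1 < β.degree → ∀ z ∈ J.map (D.iota h K : D.KLR K β →ₗ[K] D.KLR K ν'),
      D.kT ν' K j * z ∈ J.map (D.iota h K : D.KLR K β →ₗ[K] D.KLR K ν') := by
    rintro j hj _ ⟨z, hz, rfl⟩
    exact ⟨_, hJ _ z hz, iota_kT_mul h hj z⟩
  have NG := H.G_mul_upSpan hG
  have NX := H.X_mul_upSpan hG hX hT
  have NT := H.T_mul_upSpan hG hX hT
  exact klr_mul_mem (fun s => NG _ (Rep.E_mem_idemSpan _ s)) (fun k hk => NX k (by omega))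
    (fun k hk => NT k (by omega)) y

omit hJ in
theorem iota_mem_strandSpan {y : D.KLR K β} (hy : y ∈ J) : D.iota h K y ∈ D.strandSpan h K J := by
  have := mem_upSpan' (X := D.kX ν' K) (T := D.kT ν' K) (k := β.degree) (d := 0) rfl
    (Submodule.mem_map_of_mem (f := (D.iota h K : D.KLR K β →ₗ[K] D.KLR K ν')) hy)
  rwa [upProd_zero, one_mul] at this

/-- The left ideal generated by the image of the homomorphism that adds a strand. -/
theorem mul_iota_mem_strandSpan {y : D.KLR K β} (hy : y ∈ J) (z : D.KLR K ν') :
    z * D.iota h K y ∈ D.strandSpan h K J :=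
  mul_strandSpan_mem h hJ z _ (iota_mem_strandSpan h hy)

end AddStrand

end BorcherdsCartanDatum

section Quotient

variable {K : Type u} [Field K] {B : Type*} [Ring B] [Algebra K B] (L : Submodule B B) {y : B}

theorem lsmul_eq_zero_of_forall (h : ∀ m, y * m ∈ L) : Algebra.lsmul K K (B ⧸ L) y = 0 := by
  refine LinearMap.ext fun m => ?_
  obtain ⟨m, rfl⟩ := Submodule.Quotient.mk_surjective L m
  exact (Submodule.Quotient.mk_eq_zero L).2 (h m)

theorem mem_of_lsmul_eq_zero (h : Algebra.lsmul K K (B ⧸ L) y = 0) : y ∈ L := by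
  have := (Submodule.Quotient.mk_eq_zero L).1 (DFunLike.congr_fun h (Submodule.Quotient.mk 1))
  exact mul_one y ▸ this

end Quotient

namespace BorcherdsCartanDatum

variable {I : Type v} {D : BorcherdsCartanDatum.{v, w} I} [Inhabited I]
  {β ν' : I →₀ ℕ} {i : I} (h : β + Finsupp.single i 1 = ν') {K : Type u} [Field K] (lam : D.P)

variable (K β) in
/-- The kernel of `𝓡(β) → 𝓡^λ(β)`. -/
def cycKer : Submodule K (D.KLR K β) := LinearMap.ker (D.cycProj K β lam).toLinearMap

variable {lam} in
theorem mem_cycKer {y : D.KLR K β} : y ∈ cycKer β K lam ↔ D.cycProj K β lam y = 0 := Iff.rfl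

variable {lam} in
theorem mul_mem_cycKer (a : D.KLR K β) : ∀ y ∈ cycKer β K lam, a * y ∈ cycKer β K lam := by
  intro y hy
  rw [mem_cycKer] at *
  rw [map_mul, hy, mul_zero]

variable {lam} in
theorem cycKer_mul_mem {y : D.KLR K β} (hy : y ∈ cycKer β K lam) (a : D.KLR K β) :
    y * a ∈ cycKer β K lam := by
  rw [mem_cycKer] at *
  rw [map_mul, hy, zero_mul]

theorem kX_pow_mul_kE_mem (h0 : 0 < β.degree) (s : SeqOf β) :
    D.kX β K 0 ^ (D.h (s.c 0) lam).toNat * D.kE K s ∈ cycKer β K lam := by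
  rw [mem_cycKer, ← ((agreeOn_x D K h0 s).pow _).1, s.c_eq h0]
  exact (D.cycProj_rel K β lam (.x_pow s h0)).trans (map_zero _)

theorem kX_pow_mul_upProd_mem {j : ℕ} (hj : j < β.degree) {s : SeqOf β} (hs : s.c j = i)
    (y : D.KLR K β) :
    D.kX β K 0 ^ (D.h i lam).toNat * (upProd (D.kT β K) 0 j * (D.kE K s * y)) ∈
      cycKer β K lam := by
  obtain ⟨s', e, e'⟩ := (D.univ K).exists_upProd_mul_E (a := 0) (d := j) (by omega) s
  rw [zero_add, hs] at e'
  have := kX_pow_mul_kE_mem (K := K) lam (show 0 < β.degree by omega) s'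
  rw [e'] at this
  have e : upProd (D.kT β K) 0 j * (D.kE K s * y) = D.kE K s' * (upProd (D.kT β K) 0 j * y) := by
    rw [← mul_assoc, ← mul_assoc]; exact congrArg (· * y) e
  rw [e, ← mul_assoc]
  exact cycKer_mul_mem this _

theorem kX_pow_mul_upProd_mem_map {j : ℕ} (hj : j < β.degree) {s : SeqOf ν'} (hs : s.c j = i)
    (y : D.KLR K β) :
    D.kX ν' K 0 ^ (D.h i lam).toNat * (upProd (D.kT ν' K) 0 j * (D.kE K s * D.iota h K y)) ∈
      (cycKer β K lam).map (D.iota h K : D.KLR K β →ₗ[K] D.KLR K ν') := by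
  rcases kE_mul_iota h (K := K) (D := D) s with e | ⟨r, -, -, hr, e⟩
  · rw [e, mul_zero, mul_zero]; exact Submodule.zero_mem _
  · rw [e, ← iota_upProd_mul h (by omega), ← iota_kX_pow_mul h (by omega)]
    exact ⟨_, kX_pow_mul_upProd_mem lam hj ((hr j hj).trans hs) y, rfl⟩

/-- The strand of colour `i` is pulled to the left and given its cyclotomic number of dots. -/
def theta : D.KLR K β →ₗ[K] D.KLR K ν' :=
  (LinearMap.mulLeft K (D.kX ν' K 0 ^ (D.h i lam).toNat * upProd (D.kT ν' K) 0 β.degree)).comp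
    (D.iota h K : D.KLR K β →ₗ[K] D.KLR K ν')

theorem theta_apply (y : D.KLR K β) : theta h lam y = D.kX ν' K 0 ^ (D.h i lam).toNat *
    (upProd (D.kT ν' K) 0 β.degree * D.iota h K y) := mul_assoc _ _ _

theorem mul_upProd_mem_strandSpan {J : Submodule K (D.KLR K β)} {b : D.KLR K ν'} {k d : ℕ}
    (hk : k + d = β.degree) (l : ℕ)
    (hb : b ∈ J.map (D.iota h K : D.KLR K β →ₗ[K] D.KLR K ν')) :
    D.kX ν' K k ^ l * (upProd (D.kT ν' K) k d * b) ∈ D.strandSpan h K J := mem_upSpan hk l hb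

theorem kX_mul_theta {j : ℕ} (hj : j < β.degree) (y : D.KLR K β) :
    theta h lam (D.kX β K j * y) - D.kX ν' K (j + 1) * theta h lam y ∈
      D.strandSpan h K (cycKer β K lam) := by
  have hn := degree_of_add h
  have H := klr_strands (D := D) (K := K) hn
  rw [theta_apply, theta_apply, iota_kX_mul h hj]
  set N := (D.h i lam).toNat
  obtain ⟨d, hd⟩ : ∃ d, β.degree = j + 1 + d := ⟨β.degree - j - 1, by omega⟩
  have c0 : Commute (D.kX ν' K (j + 1)) (D.kX ν' K 0 ^ N) :=
    (H.X_comm_X _ _ (by omega) (by omega)).pow_right N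
  have c1 : Commute (D.kX ν' K (j + 1)) (upProd (D.kT ν' K) 0 j) := commute_upProd fun m h1 h2 =>
    H.X_comm_T _ m (by omega) (by omega) (by omega) (by omega)
  have c2 : Commute (D.kX ν' K j) (upProd (D.kT ν' K) (j + 1) d) := commute_upProd fun m h1 h2 =>
    H.X_comm_T _ m (by omega) (by omega) (by omega) (by omega)
  have e := (D.univ K).T_X_eq (univ_one D ν' K) (k := j) (by omega)
  have e1 : D.kX ν' K 0 ^ N * (upProd (D.kT ν' K) 0 β.degree * (D.kX ν' K j * D.iota h K y)) -
      D.kX ν' K (j + 1) * (D.kX ν' K 0 ^ N * (upProd (D.kT ν' K) 0 β.degree * D.iota h K y)) =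
      (D.kX ν' K 0 ^ N * upProd (D.kT ν' K) 0 j) * ((D.univ K).eps j *
        (upProd (D.kT ν' K) (j + 1) d * D.iota h K y)) := by
    rw [← e, hd, upProd_add, upProd_succ, zero_add, zero_add]
    simp only [univ, sub_mul, mul_sub, mul_assoc]
    rw [← mul_assoc (upProd (D.kT ν' K) (j + 1) d), ← c2.eq, mul_assoc,
        ← mul_assoc (D.kX ν' K (j + 1)) (_ ^ N), c0.eq, mul_assoc,
        ← mul_assoc (D.kX ν' K (j + 1)) (upProd _ _ _), c1.eq, mul_assoc]
  rw [e1]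
  refine Rep.mul_eps_mul_mem _ fun s hs => ?_
  obtain ⟨s', e2, hs', hs2⟩ := (D.univ K).exists_E_mul_upProd (a := j + 1) (d := d) (by omega) s
  have c3 : Commute (D.kX ν' K 0 ^ N * upProd (D.kT ν' K) 0 j) (upProd (D.kT ν' K) (j + 1) d) :=
    commute_upProd fun m h1 h2 => Commute.mul_left
      ((H.X_comm_T _ m (by omega) (by omega) (by omega) (by omega)).pow_left N)
      (commute_upProd fun m' h1' h2' => H.T_comm_T m m' (by omega) (by omega)).symm
  have e3 : (D.univ K).E s * (upProd (D.kT ν' K) (j + 1) d * D.iota h K y) =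
      upProd (D.kT ν' K) (j + 1) d * (D.kE K s' * D.iota h K y) := by
    rw [← mul_assoc, ← mul_assoc]; exact congrArg (· * D.iota h K y) e2
  rw [e3, ← mul_assoc, c3.eq, mul_assoc, mul_assoc, ← one_mul (upProd _ _ _ * _),
    ← pow_zero (D.kX ν' K (j + 1))]
  refine mul_upProd_mem_strandSpan h (by omega) 0 ?_
  rcases kE_mul_iota h (K := K) (D := D) s' with e | ⟨r, -, hr, -, -⟩
  · rw [e, mul_zero, mul_zero]; exact Submodule.zero_mem _
  · refine kX_pow_mul_upProd_mem_map h lam hj ?_ y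
    rw [hs2 j (by omega), hs, ← hs', ← hd, hr]

theorem kT_mul_theta {j : ℕ} (hj : j + 1 < β.degree) (y : D.KLR K β) :
    theta h lam (D.kT β K j * y) - D.kT ν' K (j + 1) * theta h lam y ∈
      D.strandSpan h K (cycKer β K lam) := by
  have hn := degree_of_add h
  have H := klr_strands (D := D) (K := K) hn
  rw [theta_apply, theta_apply, iota_kT_mul h hj]
  set N := (D.h i lam).toNat
  obtain ⟨d, hd⟩ : ∃ d, β.degree = j + 2 + d := ⟨β.degree - j - 2, by omega⟩
  have c0 : Commute (D.kT ν' K (j + 1)) (D.kX ν' K 0 ^ N) :=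
    ((H.X_comm_T _ _ (by omega) (by omega) (by omega) (by omega)).pow_left N).symm
  have c1 : Commute (D.kT ν' K (j + 1)) (upProd (D.kT ν' K) 0 j) := commute_upProd fun m h1 h2 =>
    H.T_comm_T _ m (by omega) (by omega)
  have c2 : Commute (D.kT ν' K j) (upProd (D.kT ν' K) (j + 2) d) := commute_upProd fun m h1 h2 =>
    (H.T_comm_T m _ (by omega) (by omega)).symm
  have e := (D.univ K).braid_eq (univ_one D ν' K) (k := j) (by omega)
  have e1 : D.kX ν' K 0 ^ N * (upProd (D.kT ν' K) 0 β.degree * (D.kT ν' K j * D.iota h K y)) -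
      D.kT ν' K (j + 1) * (D.kX ν' K 0 ^ N * (upProd (D.kT ν' K) 0 β.degree * D.iota h K y)) =
      (D.kX ν' K 0 ^ N * upProd (D.kT ν' K) 0 j) * (((D.univ K).T j * (D.univ K).T (j + 1) *
        (D.univ K).T j - (D.univ K).T (j + 1) * (D.univ K).T j * (D.univ K).T (j + 1)) *
        (upProd (D.kT ν' K) (j + 2) d * D.iota h K y)) := by
    rw [hd, upProd_add, upProd_succ, upProd_succ, zero_add, zero_add, zero_add]
    simp only [univ, sub_mul, mul_sub, mul_assoc]
    rw [← mul_assoc (upProd (D.kT ν' K) (j + 2) d), ← c2.eq, mul_assoc,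
        ← mul_assoc (D.kT ν' K (j + 1)) (_ ^ N), c0.eq, mul_assoc,
        ← mul_assoc (D.kT ν' K (j + 1)) (upProd _ _ _), c1.eq, mul_assoc]
  rw [e1, e]
  refine Rep.mul_braidCorr_mul_mem _ fun s a b hs => ?_
  obtain ⟨s', e2, hs', hs2⟩ := (D.univ K).exists_E_mul_upProd (a := j + 2) (d := d) (by omega) s
  have c3 : Commute (D.kX ν' K 0 ^ N * upProd (D.kT ν' K) 0 j * D.kX ν' K j ^ a)
      (D.kX ν' K (j + 2) ^ b * upProd (D.kT ν' K) (j + 2) d) := by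
    refine Commute.mul_right (Commute.pow_right ?_ b) (commute_upProd fun m h1 h2 => ?_)
    · refine Commute.mul_left (Commute.mul_left ?_ ?_) ?_
      · exact (H.X_comm_X _ _ (by omega) (by omega)).pow_left N
      · exact (commute_upProd fun m h1 h2 =>
          H.X_comm_T _ m (by omega) (by omega) (by omega) (by omega)).symm
      · exact (H.X_comm_X _ _ (by omega) (by omega)).pow_left a
    · refine Commute.mul_left (Commute.mul_left ?_ ?_) ?_
      · exact (H.X_comm_T _ m (by omega) (by omega) (by omega) (by omega)).pow_left N
      · exact (commute_upProd fun m' h1' h2' => H.T_comm_T m m' (by omega) (by omega)).symm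
      · exact (H.X_comm_T _ m (by omega) (by omega) (by omega) (by omega)).pow_left a
  have e3 : D.kX ν' K 0 ^ N * upProd (D.kT ν' K) 0 j * ((D.univ K).X j ^ a *
      ((D.univ K).X (j + 2) ^ b * ((D.univ K).E s * (upProd (D.kT ν' K) (j + 2) d *
        D.iota h K y)))) = D.kX ν' K (j + 2) ^ b * (upProd (D.kT ν' K) (j + 2) d *
      (D.kX ν' K 0 ^ N * (upProd (D.kT ν' K) 0 j * (D.kE K s' * D.iota h K (D.kX β K j ^ a * y))))) := by
    calc _ = D.kX ν' K 0 ^ N * upProd (D.kT ν' K) 0 j * D.kX ν' K j ^ a *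
          (D.kX ν' K (j + 2) ^ b * (((D.univ K).E s * upProd (D.univ K).T (j + 2) d) *
          D.iota h K y)) := by simp only [mul_assoc]; rfl
      _ = D.kX ν' K 0 ^ N * upProd (D.kT ν' K) 0 j * D.kX ν' K j ^ a *
          (D.kX ν' K (j + 2) ^ b * upProd (D.kT ν' K) (j + 2) d) *
          (D.kE K s' * D.iota h K y) := by rw [e2]; simp only [mul_assoc]; rfl
      _ = D.kX ν' K (j + 2) ^ b * (upProd (D.kT ν' K) (j + 2) d *
          (D.kX ν' K 0 ^ N * (upProd (D.kT ν' K) 0 j * ((D.kX ν' K j ^ a * D.kE K s') *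
          D.iota h K y)))) := by rw [c3.eq]; simp only [mul_assoc]
      _ = _ := by
        have := (D.univ K).E_mul_X_pow (k := j) (by omega) s' a
        rw [show D.kX ν' K j ^ a * D.kE K s' = _ from this.symm, iota_kX_pow_mul h (by omega)]
        simp only [mul_assoc]; rfl
  rw [e3]
  refine mul_upProd_mem_strandSpan h (by omega) b ?_
  rcases kE_mul_iota h (K := K) (D := D) s' with e | ⟨r, -, hr, -, -⟩
  · rw [e, mul_zero, mul_zero]; exact Submodule.zero_mem _
  · refine kX_pow_mul_upProd_mem_map h lam (by omega) ?_ _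
    rw [hs2 j (by omega), hs, ← hs', ← hd, hr]

theorem kE_mul_theta (s : SeqOf ν') (y : D.KLR K β) :
    D.kE K s * theta h lam y = 0 ∨
      (s.c 0 = i ∧ ∃ y', D.kE K s * theta h lam y = theta h lam y') := by
  have hn := degree_of_add h
  obtain ⟨s', e2, hs', hs2⟩ :=
    (D.univ K).exists_E_mul_upProd (a := 0) (d := β.degree) (by omega) s
  have e := (D.univ K).E_mul_X_pow (k := 0) (by omega) s (D.h i lam).toNat
  have e3 : D.kE K s * theta h lam y = D.kX ν' K 0 ^ (D.h i lam).toNat *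
      (upProd (D.kT ν' K) 0 β.degree * (D.kE K s' * D.iota h K y)) := by
    rw [theta_apply, ← mul_assoc]
    refine (congrArg (· * _) e).trans ?_
    rw [mul_assoc, ← mul_assoc _ (upProd _ _ _)]
    refine (congrArg (_ * ·) (congrArg (· * _) e2)).trans ?_
    rw [mul_assoc]
    rfl
  rw [e3]
  rcases kE_mul_iota h (K := K) (D := D) s' with e | ⟨r, -, hr, -, e⟩
  · exact Or.inl (by rw [e, mul_zero, mul_zero])
  · exact Or.inr ⟨by rw [← hs', zero_add, hr], _, by rw [e, theta_apply]⟩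

/-- The span of the image of `theta` and of the left ideal generated by the cyclotomic relations
with an additional strand. -/
def thetaSpan : Submodule K (D.KLR K ν') :=
  LinearMap.range (theta h lam) ⊔ D.strandSpan h K (cycKer β K lam)

theorem thetaSpan_induction {b : D.KLR K ν'}
    (hb : ∀ y, b * theta h lam y ∈ (thetaSpan h lam : Submodule K (D.KLR K ν'))) :
    ∀ z ∈ (thetaSpan h lam : Submodule K (D.KLR K ν')), b * z ∈ thetaSpan h lam := by
  intro z hz
  obtain ⟨_, ⟨y, rfl⟩, x, hx, rfl⟩ := Submodule.mem_sup.1 hz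
  rw [mul_add]
  exact Submodule.add_mem _ (hb y)
    (Submodule.mem_sup_right (mul_strandSpan_mem h mul_mem_cycKer b x hx))

/-- The left ideal generated by `thetaSpan`. -/
def thetaIdeal : Submodule K (D.KLR K ν') :=
  upSpan K (fun j => D.kX ν' K (β.degree - j)) (fun j => D.kT ν' K (β.degree - 1 - j)) β.degree
    (thetaSpan h lam)

theorem mul_mem_of_sub_mem {z : D.KLR K β} {x : D.KLR K ν'}
    (e : theta h lam z - x ∈ D.strandSpan h K (cycKer β K lam)) : x ∈ thetaSpan h lam := by
  have := Submodule.sub_mem (thetaSpan h lam) (Submodule.mem_sup_left ⟨z, rfl⟩)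
    (Submodule.mem_sup_right e)
  rwa [sub_sub_cancel] at this

theorem mul_thetaIdeal_mem (y : D.KLR K ν') :
    ∀ z ∈ (thetaIdeal h lam : Submodule K (D.KLR K ν')), y * z ∈ thetaIdeal h lam := by
  have hn := degree_of_add h
  have H := (klr_strands (D := D) (K := K) hn).flip
  have hE : ∀ s : SeqOf ν', ∀ z ∈ (thetaSpan h lam : Submodule K (D.KLR K ν')),
      D.kE K s * z ∈ thetaSpan h lam := fun s => thetaSpan_induction h lam fun y => by
    rcases kE_mul_theta h lam s y with e | ⟨-, y', e⟩
    · rw [e]; exact Submodule.zero_mem _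
    · exact Submodule.mem_sup_left ⟨y', e.symm⟩
  have hG := idemSpan_mul_mem hE
  have hX : ∀ j < β.degree, ∀ z ∈ (thetaSpan h lam : Submodule K (D.KLR K ν')),
      D.kX ν' K (β.degree - j) * z ∈ thetaSpan h lam := fun j hj =>
    thetaSpan_induction h lam fun y => by
      have := kX_mul_theta h lam (show β.degree - j - 1 < β.degree by omega) y
      rw [Nat.sub_add_cancel (by omega)] at this
      exact mul_mem_of_sub_mem h lam this
  have hT : ∀ j, j + 1 < β.degree → ∀ z ∈ (thetaSpan h lam : Submodule K (D.KLR K ν')),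
      D.kT ν' K (β.degree - 1 - j) * z ∈ thetaSpan h lam := fun j hj =>
    thetaSpan_induction h lam fun y => by
      have := kT_mul_theta h lam (show β.degree - 1 - j - 1 + 1 < β.degree by omega) y
      rw [Nat.sub_add_cancel (by omega)] at this
      exact mul_mem_of_sub_mem h lam this
  have NG := H.G_mul_upSpan hG
  have NX := H.X_mul_upSpan hG hX hT
  have NT := H.T_mul_upSpan hG hX hT
  refine klr_mul_mem (fun s => NG _ (Rep.E_mem_idemSpan _ s)) (fun k hk => ?_) (fun k hk => ?_) y
  · have := NX (β.degree - k) (by omega)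
    simp only [show β.degree - (β.degree - k) = k by omega] at this
    exact this
  · have := NT (β.degree - 1 - k) (by omega)
    simp only [show β.degree - 1 - (β.degree - 1 - k) = k by omega] at this
    exact this

theorem thetaSpan_le : (thetaSpan h lam : Submodule K (D.KLR K ν')) ≤ thetaIdeal h lam := by
  intro z hz
  have := mem_upSpan' (X := fun j => D.kX ν' K (β.degree - j))
    (T := fun j => D.kT ν' K (β.degree - 1 - j)) (k := β.degree) (d := 0) rfl hz
  rwa [upProd_zero, one_mul] at this

theorem cycRel_mul_mem (s : SeqOf ν') (y : D.KLR K ν') :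
    D.kX ν' K 0 ^ (D.h (s.c 0) lam).toNat * D.kE K s * (y * D.iota h K 1) ∈ thetaIdeal h lam := by
  have hn := degree_of_add h
  have H := klr_strands (D := D) (K := K) hn
  refine mul_upSpan_mem (mul_iota_mem_strandSpan h (J := ⊤) (fun _ _ _ => trivial) trivial y) ?_
  rintro k d l _ ⟨z, -, rfl⟩ hk
  obtain ⟨s', e2, hs', hs2⟩ := (D.univ K).exists_E_mul_upProd (a := k) (d := d) (by omega) s
  have e := (D.univ K).E_mul_X_pow (k := k) (by omega) s l
  have e3 : D.kE K s * (D.kX ν' K k ^ l * (upProd (D.kT ν' K) k d * D.iota h K z)) =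
      D.kX ν' K k ^ l * (upProd (D.kT ν' K) k d * (D.kE K s' * D.iota h K z)) := by
    rw [← mul_assoc]
    refine (congrArg (· * _) e).trans ?_
    rw [mul_assoc, ← mul_assoc _ (upProd _ _ _)]
    refine (congrArg (_ * ·) (congrArg (· * _) e2)).trans ?_
    rw [mul_assoc]
    rfl
  rw [mul_assoc]
  refine (congrArg (_ * ·) e3).symm ▸ ?_
  rw [← mul_assoc, ((H.X_comm_X 0 k (by omega) (by omega)).pow_pow _ _).eq, mul_assoc]
  rcases kE_mul_iota h (K := K) (D := D) s' with e | ⟨r, -, hr, hr', e⟩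
  · rw [e, mul_zero, mul_zero, mul_zero]; exact Submodule.zero_mem _
  rw [e]
  rcases Nat.eq_zero_or_pos k with rfl | hk'
  · obtain rfl : d = β.degree := by omega
    rw [zero_add, hr] at hs'
    rw [← hs', ← theta_apply]
    exact mul_thetaIdeal_mem h lam _ _ (thetaSpan_le h lam (Submodule.mem_sup_left ⟨_, rfl⟩))
  · have c : Commute (D.kX ν' K 0) (upProd (D.kT ν' K) k d) := commute_upProd fun m h1 h2 =>
      H.X_comm_T _ m (by omega) (by omega) (by omega) (by omega)
    rw [← mul_assoc _ (upProd _ _ _), (c.pow_left _).eq, mul_assoc, ← iota_kX_pow_mul h (by omega)]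
    refine thetaSpan_le h lam (Submodule.mem_sup_right (mul_upProd_mem_strandSpan h hk l
      ⟨_, ?_, rfl⟩))
    have := cycKer_mul_mem (kX_pow_mul_kE_mem (K := K) lam (show 0 < β.degree by omega) r) z
    rwa [hr' 0 (by omega), hs2 0 (by omega), mul_assoc] at this

/-- The kernel of the projection to the cyclotomic quotient, on the diagrams whose last strand at
the bottom has colour `i`. -/
theorem mem_thetaIdeal {y : D.KLR K ν'} (hy : D.cycProj K ν' lam (y * D.iota h K 1) = 0) :
    y * D.iota h K 1 ∈ thetaIdeal h lam := by
  let L : Submodule (D.KLR K ν') (D.KLR K ν') :=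
    { carrier := {z | z * D.iota h K 1 ∈ (thetaIdeal h lam : Submodule K (D.KLR K ν'))}
      add_mem' := fun {x z} hx hz => by
        simp only [Set.mem_ofPred_eq, add_mul] at *
        exact Submodule.add_mem _ hx hz
      zero_mem' := by
        simp only [Set.mem_ofPred_eq, zero_mul]
        exact Submodule.zero_mem _
      smul_mem' := fun a z hz => by
        simp only [Set.mem_ofPred_eq, smul_eq_mul, mul_assoc] at *
        exact mul_thetaIdeal_mem h lam a _ hz }
  have hL (z) : z ∈ L ↔ z * D.iota h K 1 ∈ (thetaIdeal h lam : Submodule K (D.KLR K ν')) := Iff.rfl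
  let f : D.KLR K ν' →ₐ[K] Module.End K (D.KLR K ν' ⧸ L) := Algebra.lsmul K K _
  have hf : ∀ ⦃y z⦄, D.CycRel K ν' lam y z → f y = f z := by
    rintro _ _ ⟨s, h0⟩
    rw [map_zero]
    refine lsmul_eq_zero_of_forall L fun m => (hL _).2 ?_
    have := cycRel_mul_mem h lam s m
    rwa [← ((agreeOn_x D K h0 s).pow _).1, s.c_eq h0, ← mul_assoc] at this
  have := D.cycLift_cycProj K ν' lam f hf (y * D.iota h K 1)
  rw [hy, map_zero] at this
  have := (hL _).1 (mem_of_lsmul_eq_zero L this.symm)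
  rwa [mul_assoc, iota_one_mul] at this

end BorcherdsCartanDatum

namespace BorcherdsCartanDatum

variable {I : Type v} {D : BorcherdsCartanDatum.{v, w} I} [Inhabited I]
  {β ν' : I →₀ ℕ} {i : I} (h : β + Finsupp.single i 1 = ν') {K : Type u} [Field K]

namespace LocRep

section General

variable {S : Type*} [Ring S] [Algebra K S] (ρ : D.LocRep β S)

/-- The action on the sequence with the entry `1` in the last row `β.degree`. -/
def col : D.KLR K ν' →ₗ[K] (ℕ → S) :=
  (LinearMap.applyₗ (Pi.single β.degree 1)).comp
    ((ρ.bigRep K h).lift K : D.KLR K ν' →ₗ[K] Module.End K (ℕ → S))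

theorem col_def (y : D.KLR K ν') :
    ρ.col h y = (ρ.bigRep K h).lift K y (Pi.single β.degree 1) := rfl

theorem col_kX_mul {k : ℕ} (hk : k < ν'.degree) (y : D.KLR K ν') (j : ℕ) :
    ρ.col h (D.kX ν' K k * y) j = ρ.xr k j * ρ.col h y j := by
  rw [col_def, Rep.lift_kX_mul _ hk]; rfl

theorem col_kX_pow_mul {k : ℕ} (hk : k < ν'.degree) (l : ℕ) (y : D.KLR K ν') (j : ℕ) :
    ρ.col h (D.kX ν' K k ^ l * y) j = ρ.xr k j ^ l * ρ.col h y j := by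
  induction l with
  | zero => rw [pow_zero, pow_zero, one_mul, one_mul]
  | succ l ih => rw [pow_succ', pow_succ', mul_assoc, col_kX_mul _ _ hk, ih, mul_assoc]

theorem col_kT_mul {k : ℕ} (hk : k + 1 < ν'.degree) (y : D.KLR K ν') :
    ρ.col h (D.kT ν' K k * y) = ρ.tOp i K k (ρ.col h y) := by
  rw [col_def, Rep.lift_kT_mul _ hk]; rfl

theorem col_kE_mul (s : SeqOf ν') (y : D.KLR K ν') (j : ℕ) :
    ρ.col h (D.kE K s * y) j = ρ.er h s j * ρ.col h y j := by
  rw [col_def, Rep.lift_kE_mul]; rfl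

/-- Diagrams without dots or crossings on the last strand act on the last row. -/
theorem col_iota_mul (y : D.KLR K β) (z : D.KLR K ν') :
    ρ.col h (D.iota h K y * z) β.degree = ρ.lift K y * ρ.col h z β.degree := by
  have hn := degree_of_add h
  let f : D.KLR K β →ₗ[K] S := ((LinearMap.proj β.degree).comp (ρ.col h)).comp
    ((LinearMap.mulRight K z).comp (D.iota h K : D.KLR K β →ₗ[K] D.KLR K ν')) -
      (LinearMap.mulRight K (ρ.col h z β.degree)).comp (ρ.lift K : D.KLR K β →ₗ[K] S)
  have hf (y) : y ∈ LinearMap.ker f ↔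
      ρ.col h (D.iota h K y * z) β.degree = ρ.lift K y * ρ.col h z β.degree := sub_eq_zero
  refine (hf y).1 ?_
  rw [← mul_one y, ← smul_eq_mul]
  refine klr_mul_mem (fun s x hx => ?_) (fun k hk x hx => ?_) (fun k hk x hx => ?_) y 1 ?_
  · rw [hf] at *
    rw [smul_eq_mul, iota_kE_mul, mul_assoc, col_kE_mul, hx, Rep.lift_kE_mul, mul_assoc]
    congr 1
    rw [← SeqOf.ins_degree h s, er_ins _ _ le_rfl]
  · rw [hf] at *
    rw [smul_eq_mul, iota_kX_mul h hk, mul_assoc, col_kX_mul _ _ (by omega), hx,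
      Rep.lift_kX_mul _ hk, mul_assoc, xr_lt _ hk]
  · rw [hf] at *
    rw [smul_eq_mul, iota_kT_mul h hk, mul_assoc, col_kT_mul _ _ (by omega), tOp_gt _ _ hk, hx,
      Rep.lift_kT_mul _ hk, mul_assoc]
  · rw [hf, Rep.lift_one, ρ.one_eq, one_mul, iota_one, Finset.sum_mul, map_sum, Finset.sum_apply]
    simp only [col_kE_mul, ← SeqOf.ins_degree h, er_ins _ _ le_rfl]
    rw [← Finset.sum_mul]
    exact (congrArg (· * _) ρ.one_eq).trans (one_mul _)

theorem col_iota (y : D.KLR K β) : ρ.col h (D.iota h K y) = Pi.single β.degree (ρ.lift K y) := by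
  have hn := degree_of_add h
  let f : D.KLR K β →ₗ[K] (ℕ → S) := (ρ.col h).comp (D.iota h K : D.KLR K β →ₗ[K] D.KLR K ν') -
    (LinearMap.single K (fun _ => S) β.degree).comp (ρ.lift K : D.KLR K β →ₗ[K] S)
  have hf (y) : y ∈ LinearMap.ker f ↔
      ρ.col h (D.iota h K y) = Pi.single β.degree (ρ.lift K y) := sub_eq_zero
  refine (hf y).1 ?_
  rw [← mul_one y, ← smul_eq_mul]
  refine klr_mul_mem (fun s x hx => ?_) (fun k hk x hx => ?_) (fun k hk x hx => ?_) y 1 ?_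
  · rw [hf] at *
    ext j
    rw [smul_eq_mul, iota_kE_mul, col_kE_mul, hx, Rep.lift_kE_mul]
    by_cases hj : j = β.degree
    · subst hj; rw [Pi.single_eq_same, Pi.single_eq_same, ← SeqOf.ins_degree h s, er_ins _ _ le_rfl]
    · rw [Pi.single_eq_of_ne hj, Pi.single_eq_of_ne hj, mul_zero]
  · rw [hf] at *
    ext j
    rw [smul_eq_mul, iota_kX_mul h hk, col_kX_mul _ _ (by omega), hx, Rep.lift_kX_mul _ hk]
    by_cases hj : j = β.degree
    · subst hj; rw [Pi.single_eq_same, Pi.single_eq_same, xr_lt _ hk]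
    · rw [Pi.single_eq_of_ne hj, Pi.single_eq_of_ne hj, mul_zero]
  · rw [hf] at *
    ext j
    rw [smul_eq_mul, iota_kT_mul h hk, col_kT_mul _ _ (by omega), hx, Rep.lift_kT_mul _ hk]
    by_cases hj : j = β.degree
    · subst hj; rw [tOp_gt _ _ hk, Pi.single_eq_same, Pi.single_eq_same]
    · rw [Pi.single_eq_of_ne hj]
      rcases lt_trichotomy j k with h1 | rfl | h1
      · rw [tOp_lt _ _ h1, Pi.single_eq_of_ne hj, mul_zero]
      · rw [tOp_eq, Pi.single_eq_of_ne hj, Pi.single_eq_of_ne (by omega), mul_zero, add_zero]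
      · rcases (Nat.succ_le_iff.2 h1).eq_or_lt with rfl | h1
        · rw [tOp_succ, Pi.single_eq_of_ne hj, Pi.single_eq_of_ne (by omega), mul_zero, mul_zero,
            sub_zero]
        · rw [tOp_gt _ _ h1, Pi.single_eq_of_ne hj, mul_zero]
  · rw [hf, Rep.lift_one, ρ.one_eq, iota_one, map_sum]
    ext j
    have e (s : SeqOf β) : ρ.col h (D.kE K (s.append h)) j =
        ρ.er h (s.append h) j * (Pi.single β.degree 1 : ℕ → S) j := by
      rw [col_def, kE, Rep.lift_gen]; rfl
    rw [Finset.sum_apply]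
    simp only [e]
    by_cases hj : j = β.degree
    · subst hj
      simp only [Pi.single_eq_same, mul_one, ← SeqOf.ins_degree h, er_ins _ _ le_rfl]
      exact ρ.one_eq
    · simp only [Pi.single_eq_of_ne hj, mul_zero, Finset.sum_const_zero]

variable {k d : ℕ}

theorem col_upProd_lt (hk : k + d = β.degree) (y : D.KLR K β) {j : ℕ} (hj : j < k) :
    ρ.col h (upProd (D.kT ν' K) k d * D.iota h K y) j = 0 := by
  have hn := degree_of_add h
  induction d generalizing k with
  | zero => rw [upProd_zero, one_mul, col_iota, Pi.single_eq_of_ne (by omega)]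
  | succ d ih =>
    rw [upProd_succ', mul_assoc, col_kT_mul _ _ (by omega), tOp_lt _ _ hj, ih (by omega) (by omega),
      mul_zero]

theorem col_upProd (hk : k + d = β.degree) (y : D.KLR K β) :
    ρ.col h (upProd (D.kT ν' K) k d * D.iota h K y) k = ρ.lift K y := by
  have hn := degree_of_add h
  induction d generalizing k with
  | zero => rw [upProd_zero, one_mul, col_iota, ← hk]; exact Pi.single_eq_same _ _
  | succ d ih =>
    rw [upProd_succ', mul_assoc, col_kT_mul _ _ (by omega), tOp_eq,
      col_upProd_lt _ _ (by omega) _ (by omega), ih (by omega), mul_zero, zero_add]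

theorem col_upProd_succ (hk : k + (d + 1) = β.degree) (y : D.KLR K β) :
    ρ.col h (upProd (D.kT ν' K) k (d + 1) * D.iota h K y) (k + 1) = -(ρ.dd i k * ρ.lift K y) := by
  have hn := degree_of_add h
  rw [upProd_succ', mul_assoc, col_kT_mul _ _ (by omega), tOp_succ,
      col_upProd_lt _ _ (by omega) _ (by omega), col_upProd _ _ (by omega), mul_zero, zero_sub]

theorem col_upProd_gt {p : ℕ} (hk : k + p + (d + 1) = β.degree) (y : D.KLR K β) :
    ρ.col h (upProd (D.kT ν' K) k (p + (d + 1)) * D.iota h K y) (k + p + 1) =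
      -(upProd ρ.T k p * (ρ.dd i (k + p) * ρ.lift K y)) := by
  have hn := degree_of_add h
  induction p generalizing k with
  | zero =>
    rw [zero_add, add_zero, col_upProd_succ _ _ (by omega), upProd_zero, one_mul]
  | succ p ih =>
    have e : p + 1 + (d + 1) = (p + (d + 1)) + 1 := by omega
    have := ih (k := k + 1) (by omega)
    rw [show k + 1 + p = k + (p + 1) by omega] at this
    rw [e, upProd_succ', mul_assoc, col_kT_mul _ _ (by omega), tOp_gt _ _ (by omega), this,
      upProd_succ', mul_neg, mul_assoc]

theorem col_pow_mul_upProd_lt (hk : k + d = β.degree) (l : ℕ) (y : D.KLR K β) {j : ℕ}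
    (hj : j < k) :
    ρ.col h (D.kX ν' K k ^ l * (upProd (D.kT ν' K) k d * D.iota h K y)) j = 0 := by
  have hn := degree_of_add h
  rw [col_kX_pow_mul _ _ (by omega), col_upProd_lt _ _ hk _ hj, mul_zero]

theorem col_pow_mul_upProd (hk : k + d = β.degree) (l : ℕ) (y : D.KLR K β) :
    ρ.col h (D.kX ν' K k ^ l * (upProd (D.kT ν' K) k d * D.iota h K y)) k =
      ρ.t ^ l * ρ.lift K y := by
  have hn := degree_of_add h
  rw [col_kX_pow_mul _ _ (by omega), col_upProd _ _ hk, xr_eq]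

theorem col_iota_mul_kT_mul (hk : k + 1 = β.degree) (y z : D.KLR K β) :
    ρ.col h (D.iota h K y * (D.kT ν' K k * D.iota h K z)) β.degree =
      -(ρ.lift K y * (ρ.dd i k * ρ.lift K z)) := by
  rw [col_iota_mul, ← upProd_one (T := D.kT ν' K), ← mul_neg, ← hk,
    ← col_upProd_succ h ρ (d := 0) hk z]

theorem col_pow_mul_iota (l : ℕ) (z : D.KLR K β) :
    ρ.col h (D.kX ν' K β.degree ^ l * D.iota h K z) β.degree = ρ.t ^ l * ρ.lift K z := by
  have := col_pow_mul_upProd h ρ (k := β.degree) (d := 0) rfl l z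
  rwa [upProd_zero, one_mul] at this

theorem col_theta_zero (lam : D.P) (y : D.KLR K β) :
    ρ.col h (theta h lam y) 0 = ρ.t ^ (D.h i lam).toNat * ρ.lift K y := by
  rw [theta_apply, col_pow_mul_upProd _ _ (zero_add _)]

theorem col_theta_succ (lam : D.P) (hl : ∀ j < β.degree, ∀ s : SeqOf β, s.c j = i →
      ρ.X 0 ^ (D.h i lam).toNat * (upProd ρ.T 0 j * ρ.E s) = 0) (y : D.KLR K β) {j : ℕ}
    (hj : j < β.degree) : ρ.col h (theta h lam y) (j + 1) = 0 := by
  have hn := degree_of_add h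
  have hP : ρ.X 0 ^ (D.h i lam).toNat * (upProd ρ.T 0 j * ρ.P i j) = 0 := by
    rw [LocRep.P, Rep.diag, Finset.mul_sum, Finset.mul_sum]
    refine Finset.sum_eq_zero fun s _ => ?_
    unfold delta
    split_ifs with hs
    · rw [one_mul]; exact hl j hj s hs.1.symm
    · simp
  obtain ⟨d, hd⟩ : ∃ d, β.degree = j + (d + 1) := ⟨β.degree - j - 1, by omega⟩
  have := col_upProd_gt h ρ (k := 0) (p := j) (d := d) (by omega) y
  rw [← hd, zero_add] at this
  rw [theta_apply, col_kX_pow_mul _ _ (by omega), this, xr_lt _ (by omega), mul_neg, LocRep.dd]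
  rw [show ρ.X 0 ^ (D.h i lam).toNat * (upProd ρ.T 0 j * (ρ.P i j * ρ.U j * ρ.lift K y)) =
    ρ.X 0 ^ (D.h i lam).toNat * (upProd ρ.T 0 j * ρ.P i j) * (ρ.U j * ρ.lift K y) by
      simp only [mul_assoc], hP, zero_mul, neg_zero]

theorem col_mul (y z : D.KLR K ν') : ρ.col h (y * z) = (ρ.bigRep K h).lift K y (ρ.col h z) := by
  rw [col_def, map_mul]; rfl

end General

end LocRep

end BorcherdsCartanDatum

namespace BorcherdsCartanDatum

variable {I : Type v} (D : BorcherdsCartanDatum.{v, w} I) [Inhabited I]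
  {β ν' : I →₀ ℕ} {i : I} (h : β + Finsupp.single i 1 = ν') (K : Type u) [Field K] (lam : D.P)

variable (β) in
/-- The generators of `𝓡^λ(β)`. -/
def cycRep : D.Rep β (D.Cyc K β lam) := (D.univ K).map (D.cycProj K β lam : D.KLR K β →+* D.Cyc K β lam)

variable (β) in
theorem cycRep_one : (D.cycRep β K lam).one = 1 := by
  refine Eq.trans ?_ (map_one (D.cycProj K β lam))
  rw [← univ_one D β K, Rep.one, Rep.one, map_sum]
  rfl

variable (β) in
/-- The generators of `𝓡^λ(β)` in the Laurent series. -/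
def cycLoc : D.LocRep β (HahnSeries ℤ (D.Cyc K β lam)) :=
  (D.cycRep β K lam).laurent (D.cycRep_one β K lam)

theorem cycLoc_t : (D.cycLoc β K lam).t = hT _ := rfl

variable {K}

theorem cycLoc_lift (y : D.KLR K β) :
    (D.cycLoc β K lam).lift K y = HahnSeries.C (D.cycProj K β lam y) := by
  let f : D.KLR K β →ₗ[K] HahnSeries ℤ (D.Cyc K β lam) :=
    ((D.cycLoc β K lam).lift K : D.KLR K β →ₗ[K] _) -
      (HahnSeries.single.linearMap (0 : ℤ)).comp (D.cycProj K β lam).toLinearMap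
  have hf (y) : y ∈ LinearMap.ker f ↔
      (D.cycLoc β K lam).lift K y = HahnSeries.C (D.cycProj K β lam y) := sub_eq_zero
  refine (hf y).1 ?_
  rw [← mul_one y, ← smul_eq_mul]
  refine klr_mul_mem (fun s x hx => ?_) (fun k hk x hx => ?_) (fun k hk x hx => ?_) y 1 ?_
  · rw [hf] at *
    rw [smul_eq_mul, Rep.lift_kE_mul, hx, map_mul, map_mul]; rfl
  · rw [hf] at *
    rw [smul_eq_mul, Rep.lift_kX_mul _ hk, hx, map_mul, map_mul]; rfl
  · rw [hf] at *
    rw [smul_eq_mul, Rep.lift_kT_mul _ hk, hx, map_mul, map_mul]; rfl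
  · rw [hf, Rep.lift_one, (D.cycLoc β K lam).one_eq, map_one, map_one]

theorem map_upProd {B B' : Type*} [Ring B] [Ring B'] (f : B →+* B') (T : ℕ → B) (a d : ℕ) :
    f (upProd T a d) = upProd (fun k => f (T k)) a d := by
  induction d with
  | zero => exact map_one f
  | succ d ih => rw [upProd_succ, upProd_succ, map_mul, ih]

theorem cycLoc_killed : ∀ j < β.degree, ∀ s : SeqOf β, s.c j = i →
    (D.cycLoc β K lam).X 0 ^ (D.h i lam).toNat * (upProd (D.cycLoc β K lam).T 0 j *
      (D.cycLoc β K lam).E s) = 0 := by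
  intro j hj s hs
  have := kX_pow_mul_upProd_mem (K := K) lam hj hs 1
  rw [mul_one, mem_cycKer] at this
  have := congrArg (HahnSeries.C : _ →+* HahnSeries ℤ (D.Cyc K β lam)) this
  rw [map_zero] at this
  rw [← this]
  change _ = (HahnSeries.C.comp (D.cycProj K β lam : D.KLR K β →+* D.Cyc K β lam)) _
  rw [map_mul, map_mul, map_pow, map_upProd]
  rfl

variable (β K) in
/-- The series by which the strand of colour `i` acts after a detour to the left. -/
def chi (i : I) : HahnSeries ℤ (D.Cyc K β lam) :=
  (D.cycRep β K lam).chi (D.cycRep_one β K lam) i β.degree * hT _ ^ (D.h i lam).toNat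

theorem leadAt_chi {lam : D.P} (hlam : D.IsDominant lam) (i : I) (s : SeqOf β) :
    LeadAt (D.cycProj K β lam (D.kE K s)) (D.h i (lam - D.root β)) (D.chi β K lam i) := by
  have he := (D.cycRep β K lam).E_mul_self s
  have h1 := (D.cycRep β K lam).leadAt_chi (D.cycRep_one β K lam) i (k := β.degree) le_rfl s
  have h2 := (LeadAt.hT (e := (D.cycRep β K lam).E s)).pow he (D.h i lam).toNat
  convert h1.mul he h2 using 1
  · rfl
  · rw [mul_one, Int.toNat_of_nonneg (hlam i), map_sub, s.sum_c (fun j => D.a i j), root,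
      Finsupp.sum, map_sum, Finsupp.sum, sub_eq_neg_add]
    simp [h_α]
  · rfl

section Col

variable {lam}

theorem col_iota_of_mem {y : D.KLR K β} (hy : y ∈ cycKer β K lam) :
    (D.cycLoc β K lam).col h (D.iota h K y) = 0 := by
  rw [LocRep.col_iota, cycLoc_lift, mem_cycKer.1 hy, map_zero, Pi.single_zero]

theorem col_strandSpan {z : D.KLR K ν'} (hz : z ∈ D.strandSpan h K (cycKer β K lam)) :
    (D.cycLoc β K lam).col h z = 0 := by
  unfold strandSpan upSpan at hz
  induction hz using Submodule.span_induction with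
  | mem z hz =>
    obtain ⟨k, d, l, _, ⟨y, hy, rfl⟩, -, rfl⟩ := hz
    rw [← mul_assoc, LocRep.col_mul]
    refine (congrArg _ (D.col_iota_of_mem h hy)).trans (map_zero _)
  | zero => exact map_zero _
  | add y z _ _ hy hz => rw [map_add, hy, hz, add_zero]
  | smul c z _ hz => rw [map_smul, hz, smul_zero]

variable (lam)

theorem col_dnProd_theta {k : ℕ} (hk : k ≤ β.degree) (y : D.KLR K β) :
    (D.cycLoc β K lam).col h (dnProd (D.kT ν' K) 0 k * theta h lam y) k =
      (D.cycRep β K lam).chi (D.cycRep_one β K lam) i k *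
        (hT _ ^ (D.h i lam).toNat * HahnSeries.C (D.cycProj K β lam y)) ∧
    ∀ j, k < j → j ≤ β.degree →
      (D.cycLoc β K lam).col h (dnProd (D.kT ν' K) 0 k * theta h lam y) j = 0 := by
  have hn := degree_of_add h
  induction k with
  | zero =>
    rw [dnProd_zero, one_mul]
    refine ⟨?_, fun j h1 h2 => ?_⟩
    · rw [LocRep.col_theta_zero, cycLoc_lift, cycLoc_t, Rep.chi, one_mul]
    · obtain ⟨j, rfl⟩ : ∃ j', j = j' + 1 := ⟨j - 1, by omega⟩
      exact LocRep.col_theta_succ h _ lam (D.cycLoc_killed lam) y (by omega)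
  | succ k ih =>
    obtain ⟨h1, h2⟩ := ih (by omega)
    rw [dnProd_succ, mul_assoc, zero_add, LocRep.col_kT_mul _ _ (by omega)]
    refine ⟨?_, fun j h3 h4 => ?_⟩
    · rw [LocRep.tOp_succ, h1, h2 (k + 1) (by omega) hk, mul_zero, sub_zero, Rep.chi, mul_assoc]
      rfl
    · rw [LocRep.tOp_gt _ _ (by omega), h2 j (by omega) h4, mul_zero]

/-- The strand of colour `i` makes a detour to the left and gets `l` dots on the right. -/
def detour (l : ℕ) : D.KLR K β →ₗ[K] D.KLR K ν' :=
  (LinearMap.mulLeft K (D.kX ν' K β.degree ^ l * dnProd (D.kT ν' K) 0 β.degree)).comp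
    (theta h lam)

theorem detour_apply (l : ℕ) (y : D.KLR K β) : D.detour h lam l y =
    D.kX ν' K β.degree ^ l * (dnProd (D.kT ν' K) 0 β.degree * theta h lam y) := mul_assoc _ _ _

theorem col_detour (l : ℕ) (y : D.KLR K β) :
    (D.cycLoc β K lam).col h (D.detour h lam l y) β.degree =
      hT _ ^ l * (D.chi β K lam i * HahnSeries.C (D.cycProj K β lam y)) := by
  have hn := degree_of_add h
  rw [detour_apply, LocRep.col_kX_pow_mul _ _ (by omega), (D.col_dnProd_theta h lam le_rfl y).1,
    LocRep.xr_eq, cycLoc_t, chi, mul_assoc]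

theorem detour_mem_cycKer (l : ℕ) (y : D.KLR K β) :
    D.cycProj K ν' lam (D.detour h lam l y) = 0 := by
  have hn := degree_of_add h
  rw [detour_apply, theta_apply, map_mul, map_mul]
  have e : D.cycProj K ν' lam (D.kX ν' K 0 ^ (D.h i lam).toNat *
      (upProd (D.kT ν' K) 0 β.degree * D.iota h K y)) = 0 := by
    rw [← iota_one_mul, iota_one, Finset.sum_mul, Finset.mul_sum, Finset.mul_sum, map_sum]
    refine Finset.sum_eq_zero fun s _ => ?_
    exact mem_cycKer.1 (kX_pow_mul_upProd_mem (K := K) lam (by omega)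
      (by rw [SeqOf.append_c h s le_rfl, if_neg (lt_irrefl _)]) _)
  rw [e, mul_zero, mul_zero]

end Col

section Leading

variable {D} {lam}

theorem eq_zero_of_forall_kE_mul {b : D.Cyc K β lam}
    (hb : ∀ s : SeqOf β, D.cycProj K β lam (D.kE K s) * b = 0) : b = 0 := by
  rw [← one_mul b, ← map_one (D.cycProj K β lam), ← sum_kE K, map_sum, Finset.sum_mul]
  exact Finset.sum_eq_zero fun s _ => hb s

theorem coeff_chi_mul (hlam : D.IsDominant lam) (i : I) (b : D.Cyc K β lam) :
    (∀ a < -D.h i (lam - D.root β), (D.chi β K lam i).coeff a * b = 0) ∧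
    ∀ s : SeqOf β, D.cycProj K β lam (D.kE K s) *
      ((D.chi β K lam i).coeff (-D.h i (lam - D.root β)) * b) =
        D.cycProj K β lam (D.kE K s) * b ∨ D.cycProj K β lam (D.kE K s) *
      ((D.chi β K lam i).coeff (-D.h i (lam - D.root β)) * b) =
        -(D.cycProj K β lam (D.kE K s) * b) := by
  have H := fun s : SeqOf β => leadAt_chi D (K := K) hlam i s
  refine ⟨fun a ha => eq_zero_of_forall_kE_mul fun s => ?_, fun s => ?_⟩
  · rw [← mul_assoc, ← ((H s).comm a).eq, (H s).zero a ha, zero_mul]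
  · rw [← mul_assoc, ← ((H s).comm _).eq, ← neg_mul]
    exact (H s).lead.imp (congrArg (· * b)) (congrArg (· * b))

theorem eq_zero_of_coeff (hlam : D.IsDominant lam) (i : I) (f : ℕ →₀ D.Cyc K β lam)
    (hf : ∀ a ≤ -D.h i (lam - D.root β),
      (f.sum fun l b => hT _ ^ l * (D.chi β K lam i * HahnSeries.C b)).coeff a = 0) : f = 0 := by
  by_contra hne
  have hs : f.support.Nonempty := Finsupp.support_nonempty_iff.2 hne
  set l := f.support.max' hs with hl
  have hl0 : f l ≠ 0 := Finsupp.mem_support_iff.1 (Finset.max'_mem _ _)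
  refine hl0 (eq_zero_of_forall_kE_mul fun s => ?_)
  have h0 := hf (-D.h i (lam - D.root β) - l) (by omega)
  rw [Finsupp.sum, HahnSeries.coeff_sum, Finset.sum_eq_single l] at h0
  · rw [coeff_hT_pow_mul, coeff_mul_C', sub_add_cancel] at h0
    rcases (coeff_chi_mul hlam i (f l)).2 s with e | e
    · rw [← e, h0, mul_zero]
    · rw [← neg_eq_zero, ← e, h0, mul_zero]
  · intro k hk hkl
    have : k < l := lt_of_le_of_ne (Finset.le_max' _ _ hk) hkl
    rw [coeff_hT_pow_mul, coeff_mul_C', (coeff_chi_mul hlam i (f k)).1 _ (by omega)]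
  · intro h; exact absurd (Finset.max'_mem _ _) h

end Leading

end BorcherdsCartanDatum

theorem upProd_flip {B : Type*} [Ring B] (T : ℕ → B) {n k d : ℕ} (hk : k + d = n) :
    upProd (fun j => T (n - 1 - j)) k d = dnProd T 0 d := by
  induction d generalizing k with
  | zero => rfl
  | succ d ih =>
    rw [upProd_succ', ih (by omega), dnProd_succ]
    congr 2
    omega

namespace BorcherdsCartanDatum

variable {I : Type v} {D : BorcherdsCartanDatum.{v, w} I} [Inhabited I]

namespace Rep

variable {ν : I →₀ ℕ} {B : Type*} [Ring B] (ρ : D.Rep ν B)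

theorem one_comm_X {k : ℕ} (hk : k < ν.degree) : Commute ρ.one (ρ.X k) :=
  Commute.sum_left _ _ _ fun s _ => (ρ.X_mul_E k s hk).symm

theorem one_comm_T {k : ℕ} (hk : k + 1 < ν.degree) : Commute ρ.one (ρ.T k) := by
  unfold Commute SemiconjBy
  rw [one, Finset.mul_sum, Finset.sum_congr rfl fun s _ => ρ.T_mul_E k s hk, Finset.sum_mul]
  exact (Equiv.sum_comp (Function.Involutive.toPerm (fun s : SeqOf ν => s.sw k)
    fun s => s.sw_sw k) fun s => ρ.E s * ρ.T k).symm

end Rep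

variable {β β₂ ν' : I →₀ ℕ} {i i' : I} (h : β + Finsupp.single i 1 = ν')
  (h₂ : β₂ + Finsupp.single i' 1 = ν') {K : Type u} [Field K] {lam : D.P}

section Inner

variable (K) (D)

theorem iota_one_comm_kX {k : ℕ} (hk : k < β.degree) :
    Commute (D.iota h K 1) (D.kX ν' K k) := by
  rw [iota_one]; exact ((D.univ K).append h).one_comm_X hk

theorem iota_one_comm_kT {k : ℕ} (hk : k + 1 < β.degree) :
    Commute (D.iota h K 1) (D.kT ν' K k) := by
  rw [iota_one]; exact ((D.univ K).append h).one_comm_T hk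

theorem iota_one_comm_upProd {k d : ℕ} (hk : d = 0 ∨ k + d < β.degree) :
    Commute (D.iota h K 1) (upProd (D.kT ν' K) k d) :=
  commute_upProd fun m _ _ => iota_one_comm_kT D h K (by omega)

theorem iota_one_comm_dnProd {k d : ℕ} (hk : d = 0 ∨ k + d < β.degree) :
    Commute (D.iota h K 1) (dnProd (D.kT ν' K) k d) :=
  commute_dnProd fun m _ _ => iota_one_comm_kT D h K (by omega)

end Inner

include h h₂ in
theorem degree_eq_of_add : β₂.degree = β.degree := by
  have := degree_of_add h
  have := degree_of_add h₂
  omega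

variable (D K) in
/-- The crossing of the last two strands, with diagrams on the other strands above and below. -/
def cross : D.KLR K β₂ →ₗ[K] D.KLR K β →ₗ[K] D.KLR K ν' :=
  ((LinearMap.mul K (D.KLR K ν')).compl₁₂ (D.iota h₂ K : D.KLR K β₂ →ₗ[K] D.KLR K ν')
    ((LinearMap.mulLeft K (D.kT ν' K (β.degree - 1))).comp
      (D.iota h K : D.KLR K β →ₗ[K] D.KLR K ν')))

theorem cross_apply (a : D.KLR K β₂) (b : D.KLR K β) : D.cross h h₂ K a b =
    D.iota h₂ K a * (D.kT ν' K (β.degree - 1) * D.iota h K b) := rfl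

theorem cross_mul_left (a a' : D.KLR K β₂) (b : D.KLR K β) :
    D.cross h h₂ K (a * a') b = D.iota h₂ K a * D.cross h h₂ K a' b := by
  rw [cross_apply, cross_apply, map_mul, mul_assoc]

theorem cross_mul_right (a : D.KLR K β₂) (b b' : D.KLR K β) :
    D.cross h h₂ K a (b * b') = D.cross h h₂ K a b * D.iota h K b' := by
  rw [cross_apply, cross_apply, map_mul]; simp only [mul_assoc]

theorem cross_kX_pow_mul {k : ℕ} (hk : k < β₂.degree) (l : ℕ) (a : D.KLR K β₂) (b : D.KLR K β) :
    D.cross h h₂ K (D.kX β₂ K k ^ l * a) b = D.kX ν' K k ^ l * D.cross h h₂ K a b := by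
  rw [cross_apply, cross_apply, iota_kX_pow_mul h₂ hk, mul_assoc]

theorem cross_upProd_mul {k d : ℕ} (hk : d = 0 ∨ k + d < β₂.degree) (a : D.KLR K β₂)
    (b : D.KLR K β) : D.cross h h₂ K (upProd (D.kT β₂ K) k d * a) b =
      upProd (D.kT ν' K) k d * D.cross h h₂ K a b := by
  rw [cross_apply, cross_apply, iota_upProd_mul h₂ hk, mul_assoc]

theorem cross_dnProd_mul {k d : ℕ} (hk : d = 0 ∨ k + d < β₂.degree) (a : D.KLR K β₂)
    (b : D.KLR K β) : D.cross h h₂ K (dnProd (D.kT β₂ K) k d * a) b =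
      dnProd (D.kT ν' K) k d * D.cross h h₂ K a b := by
  rw [cross_apply, cross_apply, iota_dnProd_mul h₂ hk, mul_assoc]

theorem cross_kE_of_ne (hn : 0 < β.degree) {r : SeqOf β₂} (hr : r.c (β.degree - 1) ≠ i)
    (b : D.KLR K β) : D.cross h h₂ K (D.kE K r) b = 0 := by
  have e := degree_eq_of_add h h₂
  have hd := degree_of_add h
  have h1 : D.kE K (r.append h₂) * D.kT ν' K (β.degree - 1) =
      D.kT ν' K (β.degree - 1) * D.kE K ((r.append h₂).sw (β.degree - 1)) :=
    (D.univ K).E_mul_T (by omega) _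
  rw [cross_apply, ← mul_one (D.kE K r), iota_kE_mul, mul_assoc, ← mul_assoc (D.iota h₂ K 1)]
  rw [← mul_assoc, ← mul_assoc, kE_append_mul_iota_one, h1, mul_assoc, kE_mul_iota_of_ne, mul_zero]
  rw [SeqOf.c_sw _ (by omega), if_neg (by omega), if_pos (by omega),
    SeqOf.append_c h₂ r (by omega), if_pos (by omega)]
  exact hr

theorem cross_eq_sum (a : D.KLR K β₂) (b : D.KLR K β) :
    D.cross h h₂ K a b = ∑ r : SeqOf β₂, D.cross h h₂ K (a * D.kE K r) b := by
  conv_lhs => rw [← mul_one a, ← sum_kE K, Finset.mul_sum, map_sum, LinearMap.sum_apply]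

theorem iota_one_mul_cross_one (b : D.KLR K β) :
    D.iota h₂ K 1 * (D.kT ν' K (β.degree - 1) * D.iota h K b) = D.cross h h₂ K 1 b := rfl

variable {N : Submodule K (D.KLR K ν')}

/-- Every diagram with a strand on the right that ends in `i` at the bottom and in `i'` at the top
comes from the crossing or from the dots on the last strand. -/
theorem cut_mem (hc : 0 < β.degree → ∀ a b, D.cross h h₂ K a b ∈ N)
    (hd : i = i' → ∀ l b, D.kX ν' K β.degree ^ l * D.iota h K b ∈ N) (y : D.KLR K ν') :
    D.iota h₂ K 1 * (y * D.iota h K 1) ∈ N := by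
  have e := degree_eq_of_add h h₂
  have hn := degree_of_add h
  refine mul_upSpan_mem (mul_iota_mem_strandSpan h (J := ⊤) (fun _ _ _ => trivial) trivial y) ?_
  rintro k d l _ ⟨z, -, rfl⟩ hk
  change _ * (_ * (_ * D.iota h K z)) ∈ N
  rcases d with _ | d
  · obtain rfl : k = β.degree := hk
    rw [upProd_zero, one_mul, iota_one, Finset.sum_mul]
    refine N.sum_mem fun r _ => ?_
    have h1 : D.kE K (r.append h₂) * D.kX ν' K β.degree ^ l =
        D.kX ν' K β.degree ^ l * D.kE K (r.append h₂) := (D.univ K).E_mul_X_pow (by omega) _ l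
    rw [← mul_assoc, h1, mul_assoc]
    by_cases hi : i = i'
    · rcases kE_mul_iota h (K := K) (D := D) (r.append h₂) with e | ⟨r, -, -, -, e⟩
      · rw [e, mul_zero]; exact N.zero_mem
      · rw [e]; exact hd hi l _
    · rw [kE_mul_iota_of_ne h, mul_zero]
      · exact N.zero_mem
      · rw [← e, SeqOf.append_c h₂ r le_rfl, if_neg (lt_irrefl _)]
        exact Ne.symm hi
  · have c1 := (iota_one_comm_kX D h₂ K (k := k) (by omega)).pow_right l
    have c2 := iota_one_comm_upProd D h₂ K (k := k) (d := d) (by omega)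
    have hk' : k + d = β.degree - 1 := by omega
    rw [upProd_succ, mul_assoc, ← mul_assoc, c1.eq, mul_assoc, ← mul_assoc _ (upProd _ _ _), c2.eq,
      mul_assoc, hk', iota_one_mul_cross_one, ← cross_upProd_mul h h₂ (by omega),
      ← cross_kX_pow_mul h h₂ (by omega)]
    exact hc (by omega) _ _

/-- The part of the left ideal generated by `thetaSpan` with bottom `i` and top `i'`. -/
theorem cut_thetaIdeal_mem (hc : 0 < β.degree → ∀ a ∈ cycKer β₂ K lam, ∀ b, D.cross h h₂ K a b ∈ N)
    (hs : D.strandSpan h K (cycKer β K lam) ≤ N) (hd : i = i' → ∀ l b, D.detour h lam l b ∈ N)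
    {z : D.KLR K ν'} (hz : z ∈ thetaIdeal h lam) : D.iota h₂ K 1 * z ∈ N := by
  have e := degree_eq_of_add h h₂
  have hn := degree_of_add h
  refine mul_upSpan_mem hz ?_
  rintro k d l z hz hk
  obtain ⟨_, ⟨y, rfl⟩, x, hx, rfl⟩ := Submodule.mem_sup.1 hz
  rw [mul_add, mul_add, mul_add]
  refine N.add_mem ?_ (hs (mul_strandSpan_mem h mul_mem_cycKer _ _
    (mul_strandSpan_mem h mul_mem_cycKer _ _ (mul_strandSpan_mem h mul_mem_cycKer _ _ hx))))
  rw [upProd_flip _ hk, show β.degree - k = d by omega]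
  rcases Nat.eq_zero_or_pos k with rfl | hk0
  · obtain rfl : d = β.degree := by omega
    rw [← detour_apply, iota_one, Finset.sum_mul]
    refine N.sum_mem fun r _ => ?_
    have h1 : D.kE K (r.append h₂) * D.kX ν' K β.degree ^ l =
        D.kX ν' K β.degree ^ l * D.kE K (r.append h₂) := (D.univ K).E_mul_X_pow (by omega) _ l
    obtain ⟨s', h2, h3⟩ := (D.univ K).exists_E_mul_dnProd (a := 0) (d := β.degree) (by omega)
      (r.append h₂)
    have h2 : D.kE K (r.append h₂) * dnProd (D.kT ν' K) 0 β.degree =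
      dnProd (D.kT ν' K) 0 β.degree * D.kE K s' := h2
    rw [detour_apply, ← mul_assoc, h1, mul_assoc, ← mul_assoc _ (dnProd _ _ _), h2, mul_assoc]
    rcases kE_mul_theta h lam s' y with e1 | ⟨e1, y', e2⟩
    · rw [e1, mul_zero, mul_zero]; exact N.zero_mem
    · rw [e2, ← detour_apply]
      refine hd ?_ l y'
      rw [← e1, h3, zero_add, ← e, SeqOf.append_c h₂ r le_rfl, if_neg (lt_irrefl _)]
  · have c1 := (iota_one_comm_kX D h₂ K (k := d) (by omega)).pow_right l
    have c2 := iota_one_comm_dnProd D h₂ K (k := 0) (d := d) (by omega)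
    have c3 := (iota_one_comm_kX D h₂ K (k := 0) (by omega)).pow_right (D.h i lam).toNat
    have c4 := iota_one_comm_upProd D h₂ K (k := 0) (d := β.degree - 1) (by omega)
    have e1 : upProd (D.kT ν' K) 0 β.degree =
        upProd (D.kT ν' K) 0 (β.degree - 1) * D.kT ν' K (β.degree - 1) := by
      conv_lhs => rw [show β.degree = β.degree - 1 + 1 by omega, upProd_succ, zero_add]
    rw [theta_apply, e1, ← mul_assoc, c1.eq, mul_assoc, ← mul_assoc _ (dnProd _ _ _), c2.eq,
      mul_assoc, ← mul_assoc _ (_ ^ (D.h i lam).toNat), c3.eq, mul_assoc, mul_assoc,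
      ← mul_assoc _ (upProd _ _ _), c4.eq, mul_assoc, iota_one_mul_cross_one,
      ← cross_upProd_mul h h₂ (by omega), ← cross_kX_pow_mul h h₂ (by omega),
      ← cross_dnProd_mul h h₂ (by omega), ← cross_kX_pow_mul h h₂ (by omega), cross_eq_sum]
    refine N.sum_mem fun r _ => ?_
    by_cases hr : r.c (β.degree - 1) = i
    · refine hc (by omega) _ ?_ y
      simp only [mul_assoc]
      refine mul_mem_cycKer _ _ (mul_mem_cycKer _ _ ?_)
      rw [← mul_one (D.kE K r), one_mul]
      exact kX_pow_mul_upProd_mem lam (by omega) hr 1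
    · rw [cross_apply, map_mul, mul_assoc, ← cross_apply, cross_kE_of_ne h h₂ (by omega) hr,
        mul_zero]
      exact N.zero_mem

end BorcherdsCartanDatum

namespace BorcherdsCartanDatum

variable {I : Type v} {D : BorcherdsCartanDatum.{v, w} I} [Inhabited I]
  {κ β β₂ ν' : I →₀ ℕ} {i i' : I} (h : β + Finsupp.single i 1 = ν')
  (h₂ : β₂ + Finsupp.single i' 1 = ν') (hκ : κ + Finsupp.single i' 1 = β)
  (hκ₂ : κ + Finsupp.single i 1 = β₂) {K : Type u} [Field K] {lam : D.P}

section StrandMap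

variable (D K)

/-- The linear combinations of the elements `x_k^l τ_k ⋯ τ_{n-1} ι(y)`. -/
def strandMap : (Fin (β.degree + 1) × ℕ →₀ D.KLR K β) →ₗ[K] D.KLR K ν' :=
  Finsupp.lsum K fun p => (LinearMap.mulLeft K (D.kX ν' K p.1 ^ p.2 *
    upProd (D.kT ν' K) p.1 (β.degree - p.1))).comp (D.iota h K : D.KLR K β →ₗ[K] D.KLR K ν')

theorem strandMap_single (k : Fin (β.degree + 1)) (l : ℕ) (y : D.KLR K β) :
    strandMap D h K (Finsupp.single (k, l) y) =
      D.kX ν' K k ^ l * (upProd (D.kT ν' K) k (β.degree - k) * D.iota h K y) := by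
  rw [strandMap, Finsupp.lsum_single]
  exact mul_assoc _ _ _

variable {D K}

theorem coeff_sum_hT_pow {B : Type*} [Ring B] (s : Finset ℕ) (f : ℕ → B) {l : ℕ} (hl : l ∈ s) :
    (∑ j ∈ s, hT B ^ j * HahnSeries.C (f j)).coeff (-(l : ℤ)) = f l := by
  rw [HahnSeries.coeff_sum, Finset.sum_eq_single l]
  · rw [coeff_hT_pow_mul, neg_add_cancel, HahnSeries.C_apply, HahnSeries.coeff_single_same]
  · intro j _ hj
    rw [coeff_hT_pow_mul, HahnSeries.C_apply, HahnSeries.coeff_single_of_ne (by omega)]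
  · exact fun h => absurd hl h

/-- The elements `x_k^l τ_k ⋯ τ_{n-1}` are linearly independent over the cyclotomic quotient. -/
theorem mem_cycKer_of_strandMap_eq_zero {f : Fin (β.degree + 1) × ℕ →₀ D.KLR K β}
    (hf : strandMap D h K f = 0) (p : Fin (β.degree + 1) × ℕ) : f p ∈ cycKer β K lam := by
  obtain ⟨⟨k, hk⟩, l⟩ := p
  induction k using Nat.strong_induction_on generalizing l with
  | _ k ih =>
  have h0 := congrFun (congrArg ((D.cycLoc β K lam).col h) hf) k
  rw [strandMap, Finsupp.lsum_apply, Finsupp.sum, map_sum, Finset.sum_apply, map_zero,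
    Pi.zero_apply] at h0
  have e : ∀ p ∈ f.support, (D.cycLoc β K lam).col h ((LinearMap.mulLeft K (D.kX ν' K p.1 ^ p.2 *
      upProd (D.kT ν' K) p.1 (β.degree - p.1))).comp (D.iota h K : D.KLR K β →ₗ[K] D.KLR K ν')
      (f p)) k = if p.1.1 = k then hT _ ^ p.2 * HahnSeries.C (D.cycProj K β lam (f p)) else 0 := by
    rintro ⟨⟨k', hk'⟩, l'⟩ -
    change (D.cycLoc β K lam).col h (D.kX ν' K k' ^ l' * upProd (D.kT ν' K) k' (β.degree - k') *
      D.iota h K _) k = _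
    rw [mul_assoc]
    rcases lt_trichotomy k' k with hlt | rfl | hlt
    · rw [if_neg hlt.ne, ← mul_assoc, LocRep.col_mul]
      refine congrFun ((congrArg _ (D.col_iota_of_mem h (ih k' hlt l' hk'))).trans
        (map_zero _)) k
    · rw [if_pos rfl, LocRep.col_pow_mul_upProd _ _ (by omega), cycLoc_lift, cycLoc_t]
    · rw [if_neg hlt.ne', LocRep.col_pow_mul_upProd_lt _ _ (by omega) _ _ hlt]
  rw [Finset.sum_congr rfl e] at h0
  by_contra hne
  have hmem : (⟨⟨k, hk⟩, l⟩ : Fin (β.degree + 1) × ℕ) ∈ f.support := by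
    rw [Finsupp.mem_support_iff]
    intro h1
    exact hne (h1 ▸ Submodule.zero_mem _)
  have h1 := congrArg (fun z => HahnSeries.coeff z (-(l : ℤ))) h0
  simp only [HahnSeries.coeff_sum, HahnSeries.coeff_zero] at h1
  rw [Finset.sum_eq_single ⟨⟨k, hk⟩, l⟩ _ fun h => absurd hmem h] at h1
  · rw [if_pos rfl, coeff_hT_pow_mul, neg_add_cancel, HahnSeries.C_apply,
      HahnSeries.coeff_single_same] at h1
    exact hne h1
  · rintro ⟨⟨k', hk'⟩, l'⟩ - hne'
    dsimp only
    split_ifs with hk2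
    · subst hk2
      rw [coeff_hT_pow_mul, HahnSeries.C_apply, HahnSeries.coeff_single_of_ne]
      rintro h2
      exact hne' (by rw [show l' = l by omega])
    · rfl

end StrandMap

section Graph

variable {V : Type*} [AddCommGroup V] [Module K V] (μ : D.KLR K β₂ →ₗ[K] D.KLR K β →ₗ[K] V)

/-- The pairs of an element `∑ x_k^l τ_k ⋯ τ_{n-1} ι(y_{kl})` and of
`∑ μ(x_k^l τ_k ⋯ τ_{n-2}, y_{kl})`. -/
def crossGraph : Submodule K (D.KLR K ν' × V) :=
  LinearMap.range ((strandMap D h K).prod (Finsupp.lsum K fun p =>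
    if p.1.1 < β.degree then
      μ (D.kX β₂ K p.1 ^ p.2 * upProd (D.kT β₂ K) p.1 (β.degree - 1 - p.1)) else 0))

theorem mem_crossGraph {k d : ℕ} (hk : k + (d + 1) = β.degree) (l : ℕ) (y : D.KLR K β) :
    (D.kX ν' K k ^ l * (upProd (D.kT ν' K) k (d + 1) * D.iota h K y),
      μ (D.kX β₂ K k ^ l * upProd (D.kT β₂ K) k d) y) ∈ crossGraph h μ := by
  refine ⟨Finsupp.single (⟨k, by omega⟩, l) y, ?_⟩
  refine Prod.ext ((strandMap_single D h K _ _ _).trans ?_) ?_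
  · simp only [show β.degree - k = d + 1 by omega]
  · refine (Finsupp.lsum_single _ _ _ _).trans ?_
    rw [if_pos (by dsimp only; omega)]
    simp only [show β.degree - 1 - k = d by omega]

theorem mem_crossGraph_of_mem (hμ : ∀ a, ∀ y ∈ cycKer β K lam, μ a y = 0) {z : D.KLR K ν'}
    (hz : z ∈ D.strandSpan h K (cycKer β K lam)) : (z, (0 : V)) ∈ crossGraph h μ := by
  unfold strandSpan upSpan at hz
  induction hz using Submodule.span_induction with
  | mem z hz =>
    obtain ⟨k, d, l, _, ⟨y, hy, rfl⟩, hk, rfl⟩ := hz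
    refine ⟨Finsupp.single (⟨k, by omega⟩, l) y, ?_⟩
    refine Prod.ext ((strandMap_single D h K _ _ _).trans ?_)
      ((Finsupp.lsum_single _ _ _ _).trans ?_)
    · simp only [show β.degree - k = d by omega]
      rfl
    · dsimp only
      split_ifs
      · exact hμ _ y hy
      · rfl
  | zero => exact Submodule.zero_mem _
  | add y z _ _ hy hz => simpa using Submodule.add_mem _ hy hz
  | smul c z _ hz => simpa using Submodule.smul_mem _ c hz

theorem eq_zero_of_mem_crossGraph (hμ : ∀ a, ∀ y ∈ cycKer β K lam, μ a y = 0) {w : V}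
    (hw : ((0 : D.KLR K ν'), w) ∈ crossGraph h μ) : w = 0 := by
  obtain ⟨f, hf⟩ := hw
  have hf1 : strandMap D h K f = 0 := congrArg Prod.fst hf
  rw [← show _ = w from congrArg Prod.snd hf]
  change Finsupp.lsum K _ f = _
  rw [Finsupp.lsum_apply, Finsupp.sum]
  refine Finset.sum_eq_zero fun p _ => ?_
  split_ifs
  · exact hμ _ _ (mem_cycKer_of_strandMap_eq_zero h hf1 p)
  · rfl

variable (hμ : ∀ a, ∀ y ∈ cycKer β K lam, μ a y = 0)
  (hμ₂ : ∀ a ∈ cycKer β₂ K lam, ∀ y, μ a y = 0)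
  (hb : ∀ a c y, μ (a * D.iota hκ₂ K c) y = μ a (D.iota hκ K c * y))
  (h1 : ∀ a y, μ (a * D.iota hκ₂ K 1) y = μ a y)

omit [Inhabited I] in
theorem append_append_ext [Inhabited I] (q : SeqOf κ) :
    ((q.append hκ₂).append h₂).sw κ.degree = (q.append hκ).append h := by
  have e := degree_of_add hκ
  have e2 := degree_of_add hκ₂
  have e3 := degree_of_add h
  refine SeqOf.ext_c fun j hj => ?_
  rw [SeqOf.c_sw _ (by omega), SeqOf.append_c h _ (by omega)]
  split_ifs with h1 h2 h3 h4 h5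
  · subst h1
    rw [SeqOf.append_c h₂ _ (by omega), if_neg (by omega), SeqOf.append_c hκ _ le_rfl, if_neg (by omega)]
  · omega
  · omega
  · rw [SeqOf.append_c h₂ _ (by omega), if_pos (by omega), SeqOf.append_c hκ₂ _ le_rfl,
      if_neg (by omega)]
  · rw [SeqOf.append_c h₂ _ (by omega), if_pos (by omega), SeqOf.append_c hκ₂ _ (by omega),
      SeqOf.append_c hκ _ (by omega), if_pos (by omega), if_pos (by omega)]
  · omega

/-- Diagrams on the first `n - 1` strands move through the crossing. -/
theorem iota_iota_mul_kT (c : D.KLR K κ) (b : D.KLR K β) :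
    D.iota h₂ K (D.iota hκ₂ K c) * (D.kT ν' K κ.degree * D.iota h K b) =
      D.kT ν' K κ.degree * D.iota h K (D.iota hκ K c * b) := by
  have e := degree_of_add hκ
  have e2 := degree_of_add hκ₂
  have e3 := degree_of_add h
  have HE (q : SeqOf κ) : D.kE K ((q.append hκ₂).append h₂) * D.kT ν' K κ.degree =
      D.kT ν' K κ.degree * D.kE K ((q.append hκ).append h) := by
    rw [← append_append_ext h h₂ hκ hκ₂]
    exact (D.univ K).E_mul_T (by omega) _
  let f : D.KLR K κ →ₗ[K] D.KLR K ν' :=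
    (LinearMap.mulRight K (D.kT ν' K κ.degree * D.iota h K b)).comp
      ((D.iota h₂ K : D.KLR K β₂ →ₗ[K] D.KLR K ν').comp
        (D.iota hκ₂ K : D.KLR K κ →ₗ[K] D.KLR K β₂)) -
    (LinearMap.mulLeft K (D.kT ν' K κ.degree)).comp
      ((D.iota h K : D.KLR K β →ₗ[K] D.KLR K ν').comp ((LinearMap.mulRight K b).comp
        (D.iota hκ K : D.KLR K κ →ₗ[K] D.KLR K β)))
  have hf (c) : c ∈ LinearMap.ker f ↔ D.iota h₂ K (D.iota hκ₂ K c) *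
      (D.kT ν' K κ.degree * D.iota h K b) =
      D.kT ν' K κ.degree * D.iota h K (D.iota hκ K c * b) := sub_eq_zero
  refine (hf c).1 ?_
  rw [← mul_one c, ← smul_eq_mul]
  refine klr_mul_mem (fun s x hx => ?_) (fun k hk x hx => ?_) (fun k hk x hx => ?_) c 1 ?_
  · rw [hf] at *
    rw [smul_eq_mul, iota_kE_mul, iota_kE_mul, mul_assoc, hx, iota_kE_mul, mul_assoc, iota_kE_mul,
      ← mul_assoc, ← mul_assoc, HE]
  · rw [hf] at *
    rw [smul_eq_mul, iota_kX_mul hκ₂ hk, iota_kX_mul h₂ (by omega), mul_assoc, hx,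
      iota_kX_mul hκ hk, mul_assoc, iota_kX_mul h (by omega), ← mul_assoc, ← mul_assoc]
    congr 1
    exact ((D.univ K).X_comm_T (univ_one D ν' K) (k := κ.degree) (l := k) (by omega) (by omega)
      (by omega) (by omega)).eq
  · rw [hf] at *
    rw [smul_eq_mul, iota_kT_mul hκ₂ hk, iota_kT_mul h₂ (by omega), mul_assoc, hx,
      iota_kT_mul hκ hk, mul_assoc, iota_kT_mul h (by omega), ← mul_assoc, ← mul_assoc]
    congr 1
    exact ((D.univ K).T_comm_T (univ_one D ν' K) (k := k) (l := κ.degree) (by omega)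
      (by omega)).eq.symm
  · rw [hf, iota_one hκ₂, iota_one hκ, map_sum, Finset.sum_mul, Finset.sum_mul, map_sum,
      Finset.mul_sum]
    refine Finset.sum_congr rfl fun q _ => ?_
    rw [iota_kE_mul, ← mul_one (D.kE K (q.append hκ₂)), iota_kE_mul, ← mul_assoc (D.kT _ _ _),
      ← HE, mul_assoc, mul_assoc]
    rw [← mul_assoc, ← mul_assoc, kE_append_mul_iota_one, mul_assoc]

theorem cross_iota (a : D.KLR K β₂) (c : D.KLR K κ) (b : D.KLR K β) :
    D.cross h h₂ K (a * D.iota hκ₂ K c) b =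
      D.iota h₂ K a * (D.kT ν' K κ.degree * D.iota h K (D.iota hκ K c * b)) := by
  have e := degree_of_add hκ
  rw [cross_mul_left, cross_apply, show β.degree - 1 = κ.degree by omega,
    iota_iota_mul_kT h h₂ hκ hκ₂]

include hκ in
theorem cross_iota_one (a : D.KLR K β₂) (b : D.KLR K β) :
    D.cross h h₂ K (a * D.iota hκ₂ K 1) b = D.cross h h₂ K a b := by
  have e := degree_of_add hκ
  have h0 (r : SeqOf β₂) (hr : r.c κ.degree ≠ i) (a : D.KLR K β₂) :
      D.cross h h₂ K (a * D.kE K r) b = 0 := by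
    rw [cross_mul_left, cross_kE_of_ne h h₂ (by omega)
      (by rwa [show β.degree - 1 = κ.degree by omega]), mul_zero]
  rw [cross_eq_sum h h₂ a, cross_eq_sum]
  refine Finset.sum_congr rfl fun r _ => ?_
  by_cases hr : r.c κ.degree = i
  · obtain ⟨q, rfl⟩ := SeqOf.exists_append hκ₂ r hr
    rw [mul_assoc, iota_one_mul_kE_append]
  · rw [h0 r hr, h0 r hr]

include hκ hb h1

theorem cross_mem_crossGraph (a : D.KLR K β₂) (b : D.KLR K β) :
    (D.cross h h₂ K a b, μ a b) ∈ crossGraph h μ := by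
  have e := degree_of_add hκ
  have e2 := degree_of_add hκ₂
  rw [← h1, ← cross_iota_one h h₂ hκ hκ₂]
  have := mul_iota_mem_strandSpan hκ₂ (K := K) (D := D) (J := ⊤) (fun _ _ _ => trivial)
    (y := 1) trivial a
  unfold strandSpan upSpan at this
  generalize a * D.iota hκ₂ K 1 = z at this ⊢
  induction this using Submodule.span_induction with
  | mem z hz =>
    obtain ⟨k, d, l, _, ⟨c, -, rfl⟩, hk, rfl⟩ := hz
    change (D.cross h h₂ K (_ * (_ * D.iota hκ₂ K c)) b, μ (_ * (_ * D.iota hκ₂ K c)) b) ∈ _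
    rw [← mul_assoc, hb, mul_assoc]
    have := mem_crossGraph h μ (k := k) (d := d) (by omega) l (D.iota hκ K c * b)
    convert this using 2
    rw [cross_kX_pow_mul h h₂ (by omega), cross_upProd_mul h h₂ (by omega), cross_apply,
      show β.degree - 1 = κ.degree by omega, iota_iota_mul_kT h h₂ hκ hκ₂, upProd_succ, hk,
      mul_assoc]
  | zero => simp only [map_zero, LinearMap.zero_apply]; exact Submodule.zero_mem _
  | add y z _ _ hy hz => simpa using Submodule.add_mem _ hy hz
  | smul c z _ hz => simpa using Submodule.smul_mem _ c hz

include hμ hμ₂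

theorem eq_zero_of_cross_mem {W : Submodule K (D.KLR K ν')}
    (hW : W ≤ Submodule.span K {z | ∃ a ∈ cycKer β₂ K lam, ∃ b, z = D.cross h h₂ K a b} ⊔
      D.strandSpan h K (cycKer β K lam)) (x : D.KLR K β₂ ⊗[K] D.KLR K β)
    (hx : TensorProduct.lift (D.cross h h₂ K) x ∈ W) : TensorProduct.lift μ x = 0 := by
  have H1 : (TensorProduct.lift (D.cross h h₂ K) x, TensorProduct.lift μ x) ∈ crossGraph h μ := by
    clear hx
    induction x using TensorProduct.induction_on with
    | zero => simp only [map_zero, LinearMap.zero_apply]; exact Submodule.zero_mem _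
    | add y z hy hz => simpa using Submodule.add_mem _ hy hz
    | tmul a b => simpa using cross_mem_crossGraph h h₂ hκ hκ₂ μ hb h1 a b
  have H2 : ∀ z ∈ W, (z, (0 : V)) ∈ crossGraph h μ := by
    intro z hz
    obtain ⟨y, hy, x, hx, rfl⟩ := Submodule.mem_sup.1 (hW hz)
    have := mem_crossGraph_of_mem h μ hμ hx
    rw [← add_zero (0 : V), ← Prod.mk_add_mk]
    refine Submodule.add_mem _ ?_ this
    clear hz
    induction hy using Submodule.span_induction with
    | mem y hy =>
      obtain ⟨a, ha, b, rfl⟩ := hy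
      have := cross_mem_crossGraph h h₂ hκ hκ₂ μ hb h1 a b
      rwa [hμ₂ a ha b] at this
    | zero => exact Submodule.zero_mem _
    | add y z _ _ hy hz => simpa using Submodule.add_mem _ hy hz
    | smul c z _ hz => simpa using Submodule.smul_mem _ c hz
  have := Submodule.sub_mem _ H1 (H2 _ hx)
  rw [Prod.mk_sub_mk, sub_self, sub_zero] at this
  exact eq_zero_of_mem_crossGraph h μ hμ this

end Graph

end BorcherdsCartanDatum

namespace BorcherdsCartanDatum

variable {I : Type v} (D : BorcherdsCartanDatum.{v, w} I) [Inhabited I]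
  {β β₂ ν' : I →₀ ℕ} {i i' : I} (h : β + Finsupp.single i 1 = ν')
  (h₂ : β₂ + Finsupp.single i' 1 = ν')
  (K : Type u) [Field K] (lam : D.P)

/-- Adding a strand commutes with the quotient maps. -/
theorem strand_cycProj (y : D.KLR K β) :
    D.strand K h lam (D.cycProj K β lam y) = D.cycProj K ν' lam (D.iota h K y) := by
  have hn := degree_of_add h
  obtain ⟨y, rfl⟩ := RingQuot.mkAlgHom_surjective K (D.Rel K β) y
  have h1 : D.strand K h lam (D.cycProj K β lam 1) = D.cycProj K ν' lam (D.iota h K 1) := by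
    rw [map_one, strand_one, iota_one, map_sum]; rfl
  induction y using FreeAlgebra.induction with
  | grade0 c =>
    rw [AlgHom.commutes, Algebra.algebraMap_eq_smul_one, map_smul, map_smul, map_smul, map_smul, h1]
  | grade1 g =>
    refine (D.strand_gen K h lam g).trans (congrArg (D.cycProj K ν' lam) ?_)
    refine Eq.trans ?_ (Rep.lift_gen (K := K) ((D.univ K).append h) g).symm
    cases g with
    | e s => rfl
    | x k s => exact (D.kX_mul_kE K (k := k.1) (by omega) (s.append h)).symm
    | t k hk s => exact (D.kT_mul_kE K (k := k) (by omega) (s.append h)).symm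
  | mul y z hy hz => simp only [map_mul, hy, hz]
  | add y z hy hz => simp only [map_add, hy, hz]

variable {K} {D}

theorem cycProj_surjective : Function.Surjective (D.cycProj K β lam) :=
  RingQuot.mkAlgHom_surjective K _

variable {lam}

section LastRow

variable (K lam)

/-- The last row of the action on Laurent series. -/
def lastRow : D.KLR K ν' →ₗ[K] HahnSeries ℤ (D.Cyc K β lam) :=
  (LinearMap.proj β.degree).comp ((D.cycLoc β K lam).col h)

variable {K} {lam}

theorem lastRow_pow_mul_iota (l : ℕ) (y : D.KLR K β) : lastRow h K lam
    (D.kX ν' K β.degree ^ l * D.iota h K y) = hT _ ^ l * HahnSeries.C (D.cycProj K β lam y) := by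
  refine (LocRep.col_pow_mul_iota h (D.cycLoc β K lam) l y).trans ?_
  rw [cycLoc_lift, cycLoc_t]

theorem lastRow_detour (l : ℕ) (y : D.KLR K β) : lastRow h K lam (D.detour h lam l y) =
    hT _ ^ l * (D.chi β K lam i * HahnSeries.C (D.cycProj K β lam y)) := D.col_detour h lam l y

theorem lastRow_strandSpan {z : D.KLR K ν'} (hz : z ∈ D.strandSpan h K (cycKer β K lam)) :
    lastRow h K lam z = 0 := congrFun (D.col_strandSpan h hz) _

theorem lastRow_cross (hn : 0 < β.degree) (x y : D.KLR K β) : lastRow h K lam (D.cross h h K x y) =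
    -(HahnSeries.C (D.cycProj K β lam x) * ((D.cycLoc β K lam).dd i (β.degree - 1) *
      HahnSeries.C (D.cycProj K β lam y))) := by
  refine (LocRep.col_iota_mul_kT_mul h (D.cycLoc β K lam) (by omega) x y).trans ?_
  rw [cycLoc_lift, cycLoc_lift]

theorem cross_eq_zero_of_degree (hn : β.degree = 0) (x : D.KLR K β₂) (y : D.KLR K β) :
    D.cross h h₂ K x y = 0 := by
  have := degree_of_add h
  rw [cross_apply, kT, dif_neg (by omega), zero_mul, mul_zero]

/-- The indicator of the real colour `i` in position `l`. -/
theorem P_cycLoc (l : ℕ) : (D.cycLoc β K lam).P i l =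
    HahnSeries.C ((D.cycRep β K lam).diag fun s => D.delta _ i (s.c l)) := by
  rw [LocRep.P, Rep.diag, Rep.diag, map_sum]
  refine Finset.sum_congr rfl fun s _ => ?_
  rw [map_mul, delta, delta]
  split_ifs
  · simp; rfl
  · simp

theorem coeff_dd_nonpos (l : ℕ) {a : ℤ} (ha : a ≤ 0) :
    ((D.cycLoc β K lam).dd i l).coeff a = 0 := by
  rw [LocRep.dd, P_cycLoc, coeff_C_mul']
  change _ * (hGeom _ * hTinv _ : HahnSeries ℤ _).coeff a = 0
  rw [coeff_mul_hTinv, coeff_hGeom_neg _ (by omega), mul_zero]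

theorem coeff_dd (l k : ℕ) : ((D.cycLoc β K lam).dd i l).coeff (k + 1) =
    ((D.cycRep β K lam).diag fun s => D.delta _ i (s.c l)) * D.cycProj K β lam (D.kX β K l) ^ k := by
  rw [LocRep.dd, P_cycLoc, coeff_C_mul']
  change _ * (hGeom _ * hTinv _ : HahnSeries ℤ _).coeff _ = _
  rw [coeff_mul_hTinv, add_sub_cancel_right, coeff_hGeom]
  rfl

theorem coeff_lastRow_cross_nonpos {a : ℤ} (ha : a ≤ 0) (x : D.KLR K β ⊗[K] D.KLR K β) :
    (lastRow h K lam (TensorProduct.lift (D.cross h h K) x)).coeff a = 0 := by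
  induction x using TensorProduct.induction_on with
  | zero => rw [map_zero, map_zero, HahnSeries.coeff_zero]
  | add y z hy hz => rw [map_add, map_add, HahnSeries.coeff_add, hy, hz, add_zero]
  | tmul x y =>
    rw [TensorProduct.lift.tmul]
    rcases Nat.eq_zero_or_pos β.degree with hn | hn
    · rw [cross_eq_zero_of_degree h h hn, map_zero, HahnSeries.coeff_zero]
    · rw [lastRow_cross h hn, HahnSeries.coeff_neg, coeff_C_mul', coeff_mul_C',
        coeff_dd_nonpos _ ha, zero_mul, mul_zero, neg_zero]

theorem diag_delta_eq {κ : I →₀ ℕ} (hκ : κ + Finsupp.single i 1 = β) (hi : D.a i i = 2) :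
    ((D.cycRep β K lam).diag fun s => D.delta _ i (s.c κ.degree)) =
      D.cycProj K β lam (D.iota hκ K 1) := by
  have hn := degree_of_add hκ
  refine Rep.ext_E _ (D.cycRep_one β K lam) fun s => ?_
  rw [Rep.diag_mul_E]
  change _ = _ * D.cycProj K β lam (D.kE K s)
  rw [← map_mul]
  by_cases hs : s.c κ.degree = i
  · obtain ⟨q, rfl⟩ := SeqOf.exists_append hκ s hs
    rw [iota_one_mul_kE_append, hs, delta, if_pos ⟨rfl, hi⟩, one_mul]
    rfl
  · rw [delta, if_neg fun h => hs h.1.symm, zero_mul, iota_one, Finset.sum_mul,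
      Finset.sum_eq_zero, map_zero]
    intro r _
    refine D.kE_mul_of_ne K _ _ fun e => hs ?_
    rw [← e, SeqOf.append_c hκ r le_rfl, if_neg (lt_irrefl _)]

theorem coeff_lastRow_cross {κ : I →₀ ℕ} (hκ : κ + Finsupp.single i 1 = β) (hi : D.a i i = 2)
    (k : ℕ) (x y : D.KLR K β) : (lastRow h K lam (D.cross h h K x y)).coeff (k + 1) =
      -D.cycProj K β lam (x * (D.kX β K κ.degree ^ k * (D.iota hκ K 1 * y))) := by
  have hn := degree_of_add hκ
  rw [lastRow_cross h (by omega), HahnSeries.coeff_neg, coeff_C_mul', coeff_mul_C', coeff_dd,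
    show β.degree - 1 = κ.degree by omega, diag_delta_eq hκ hi, ← map_pow, ← map_mul, ← map_mul,
    ← map_mul, ← mul_assoc (_ ^ k)]
  have := (D.univ K : D.Rep β _).E_mul_X_pow (k := κ.degree) (by omega)
  have e : D.iota hκ K 1 * D.kX β K κ.degree ^ k = D.kX β K κ.degree ^ k * D.iota hκ K 1 := by
    rw [iota_one, Finset.sum_mul, Finset.mul_sum]
    exact Finset.sum_congr rfl fun q _ => this (q.append hκ) k
  rw [e]

end LastRow

section Injective

/-- The crossings and strands that vanish in the cyclotomic quotient for trivial reasons. -/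
def crossKer (h : β + Finsupp.single i 1 = ν') (h₂ : β₂ + Finsupp.single i' 1 = ν') (K : Type u)
    [Field K] (lam : D.P) : Submodule K (D.KLR K ν') :=
  Submodule.span K {z | ∃ a ∈ cycKer β₂ K lam, ∃ b, z = D.cross h h₂ K a b} ⊔
      D.strandSpan h K (cycKer β K lam)

theorem cross_mem_crossKer {a : D.KLR K β₂} (ha : a ∈ cycKer β₂ K lam) (b : D.KLR K β) :
    D.cross h h₂ K a b ∈ crossKer h h₂ K lam :=
  Submodule.mem_sup_left (Submodule.subset_span ⟨a, ha, b, rfl⟩)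

theorem iota_one_mul_cross (x : D.KLR K β₂ ⊗[K] D.KLR K β) :
    D.iota h₂ K 1 * TensorProduct.lift (D.cross h h₂ K) x =
      TensorProduct.lift (D.cross h h₂ K) x := by
  induction x using TensorProduct.induction_on with
  | zero => rw [map_zero, mul_zero]
  | add y z hy hz => rw [map_add, mul_add, hy, hz]
  | tmul x y => rw [TensorProduct.lift.tmul, ← cross_mul_left, one_mul]

theorem cross_mul_iota_one (x : D.KLR K β₂ ⊗[K] D.KLR K β) :
    TensorProduct.lift (D.cross h h₂ K) x * D.iota h K 1 =
      TensorProduct.lift (D.cross h h₂ K) x := by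
  induction x using TensorProduct.induction_on with
  | zero => rw [map_zero, zero_mul]
  | add y z hy hz => rw [map_add, add_mul, hy, hz]
  | tmul x y => rw [TensorProduct.lift.tmul, ← cross_mul_right, mul_one]

/-- For different colours, a combination of crossings vanishes in the cyclotomic quotient only for
trivial reasons. -/
theorem lift_cross_mem_of_ne (hi : i ≠ i') {x : D.KLR K β₂ ⊗[K] D.KLR K β}
    (hx : D.cycProj K ν' lam (TensorProduct.lift (D.cross h h₂ K) x) = 0) :
    TensorProduct.lift (D.cross h h₂ K) x ∈ crossKer h h₂ K lam := by
  rw [← cross_mul_iota_one] at hx ⊢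
  rw [← iota_one_mul_cross, mul_assoc]
  exact cut_thetaIdeal_mem h h₂ (fun _ a ha b => cross_mem_crossKer h h₂ ha b) le_sup_right
    (fun e => absurd e hi) (mem_thetaIdeal h lam hx)

theorem iota_one_comm_kX_pow (l : ℕ) : Commute (D.iota h K 1) (D.kX ν' K β.degree ^ l) := by
  have hn := degree_of_add h
  rw [iota_one]
  exact Commute.sum_left _ _ _ fun s _ =>
    (D.univ K : D.Rep ν' _).E_mul_X_pow (k := β.degree) (by omega) (s.append h) l

theorem detour_mem_strandSpan {b : D.KLR K β} (hb : b ∈ cycKer β K lam) (l : ℕ) :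
    D.detour h lam l b ∈ D.strandSpan h K (cycKer β K lam) := by
  rw [detour_apply, theta_apply]
  have H := fun y z hz => mul_strandSpan_mem (D := D) (K := K) h (J := cycKer β K lam)
    mul_mem_cycKer y z hz
  exact H _ _ (H _ _ (H _ _ (H _ _ (iota_mem_strandSpan h hb))))

/-- A combination of crossings and of dots on the last strand vanishes in the cyclotomic quotient
only for trivial reasons. -/
theorem lift_cross_mem (hlam : D.IsDominant lam) {x : D.KLR K β ⊗[K] D.KLR K β} {m : ℕ}
    (hm : m = 0 ∨ m ≤ D.h i (lam - D.root β)) (p : ℕ → D.KLR K β)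
    (hc : ∀ a ≤ -D.h i (lam - D.root β),
      (lastRow h K lam (TensorProduct.lift (D.cross h h K) x)).coeff a = 0)
    (hx : D.cycProj K ν' lam (TensorProduct.lift (D.cross h h K) x +
      ∑ l ∈ Finset.range m, D.kX ν' K β.degree ^ l * D.iota h K (p l)) = 0) :
    (∀ l < m, p l ∈ cycKer β K lam) ∧
      TensorProduct.lift (D.cross h h K) x ∈ crossKer h h K lam := by
  set z := TensorProduct.lift (D.cross h h K) x +
      ∑ l ∈ Finset.range m, D.kX ν' K β.degree ^ l * D.iota h K (p l) with hz
  have e1 : z * D.iota h K 1 = z := by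
    rw [hz, add_mul, cross_mul_iota_one, Finset.sum_mul]
    congr 1
    refine Finset.sum_congr rfl fun l _ => ?_
    rw [mul_assoc, iota_mul_one]
  have e2 : D.iota h K 1 * z = z := by
    rw [hz, mul_add, iota_one_mul_cross, Finset.mul_sum]
    congr 1
    refine Finset.sum_congr rfl fun l _ => ?_
    rw [← mul_assoc, (iota_one_comm_kX_pow h l).eq, mul_assoc, iota_one_mul]
  let Θ : (ℕ →₀ D.KLR K β) →ₗ[K] D.KLR K ν' := Finsupp.lsum K fun l => D.detour h lam l
  rw [← e1] at hx
  have hmem := cut_thetaIdeal_mem h h (N := crossKer h h K lam ⊔ LinearMap.range Θ)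
    (fun _ a ha b => Submodule.mem_sup_left (cross_mem_crossKer h h ha b))
    (le_sup_right.trans le_sup_left)
    (fun _ l b => Submodule.mem_sup_right ⟨Finsupp.single l b, Finsupp.lsum_single _ _ _ _⟩)
    (mem_thetaIdeal h lam hx)
  rw [e1, e2] at hmem
  obtain ⟨w, hw, _, ⟨f, rfl⟩, hwz⟩ := Submodule.mem_sup.1 hmem
  have hLw : lastRow h K lam w = 0 := by
    obtain ⟨y, hy, x, hx, rfl⟩ := Submodule.mem_sup.1 hw
    rw [map_add, lastRow_strandSpan h hx, add_zero]
    clear hw hwz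
    induction hy using Submodule.span_induction with
    | mem y hy =>
      obtain ⟨a, ha, b, rfl⟩ := hy
      rcases Nat.eq_zero_or_pos β.degree with hn | hn
      · rw [cross_eq_zero_of_degree h h hn, map_zero]
      · rw [lastRow_cross h hn, mem_cycKer.1 ha, map_zero, zero_mul, neg_zero]
    | zero => exact map_zero _
    | add y z _ _ hy hz => rw [map_add, hy, hz, add_zero]
    | smul c y _ hy => rw [map_smul, hy, smul_zero]
  have hLΘ : lastRow h K lam (Θ f) = (f.mapRange (D.cycProj K β lam) (map_zero _)).sum
      fun l b => hT _ ^ l * (D.chi β K lam i * HahnSeries.C b) := by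
    rw [Finsupp.sum_mapRange_index fun l => by rw [map_zero, mul_zero, mul_zero]]
    change lastRow h K lam (Finsupp.lsum K _ f) = _
    rw [Finsupp.lsum_apply, Finsupp.sum, map_sum]
    exact Finset.sum_congr rfl fun l _ => lastRow_detour h l (f l)
  have hLz : lastRow h K lam z = lastRow h K lam (TensorProduct.lift (D.cross h h K) x) +
      ∑ l ∈ Finset.range m, hT _ ^ l * HahnSeries.C (D.cycProj K β lam (p l)) := by
    rw [hz, map_add, map_sum]
    congr 1
    exact Finset.sum_congr rfl fun l _ => lastRow_pow_mul_iota h l (p l)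
  have hLe : lastRow h K lam z = lastRow h K lam (Θ f) := by rw [← hwz, map_add, hLw, zero_add]
  have hf0 : f.mapRange (D.cycProj K β lam) (map_zero _) = 0 := by
    refine eq_zero_of_coeff hlam i _ fun a ha => ?_
    rw [← hLΘ, ← hLe, hLz, HahnSeries.coeff_add, hc a ha, zero_add, HahnSeries.coeff_sum]
    refine Finset.sum_eq_zero fun l hl => ?_
    rw [Finset.mem_range] at hl
    rw [coeff_hT_pow_mul, HahnSeries.C_apply, HahnSeries.coeff_single_of_ne (by omega)]
  have hf : ∀ l, f l ∈ cycKer β K lam := fun l => by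
    have := DFunLike.congr_fun hf0 l
    rwa [Finsupp.mapRange_apply] at this
  have hz0 : lastRow h K lam z = 0 := by
    rw [hLe, hLΘ, hf0, Finsupp.sum_zero_index]
  have hp : ∀ l < m, p l ∈ cycKer β K lam := fun l hl => by
    have h0 := congrArg (fun y => HahnSeries.coeff y (-(l : ℤ))) (hLz.symm.trans hz0)
    simp only [HahnSeries.coeff_add, HahnSeries.coeff_zero] at h0
    rwa [coeff_sum_hT_pow _ _ (Finset.mem_range.2 hl),
      coeff_lastRow_cross_nonpos h (by omega), zero_add] at h0
  refine ⟨hp, ?_⟩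
  have hzW : z ∈ crossKer h h K lam := by
    rw [← hwz]
    refine Submodule.add_mem _ hw (Submodule.mem_sup_right ?_)
    change Finsupp.lsum K _ f ∈ _
    rw [Finsupp.lsum_apply, Finsupp.sum]
    exact Submodule.sum_mem _ fun l _ => detour_mem_strandSpan h (hf l) l
  have h3 : ∑ l ∈ Finset.range m, D.kX ν' K β.degree ^ l * D.iota h K (p l) ∈
      crossKer h h K lam := by
    refine Submodule.sum_mem _ fun l hl => Submodule.mem_sup_right ?_
    exact mul_iota_mem_strandSpan h mul_mem_cycKer (hp l (Finset.mem_range.1 hl)) _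
  have := Submodule.sub_mem _ hzW h3
  rwa [hz, add_sub_cancel_right] at this

end Injective

section Surjective

/-- A detour is a combination of crossings and of dots on the last strand. -/
theorem exists_detour_eq (l : ℕ) (b : D.KLR K β) :
    ∃ (x : D.KLR K β ⊗[K] D.KLR K β) (f : ℕ →₀ D.KLR K β), D.iota h K 1 * D.detour h lam l b =
      TensorProduct.lift (D.cross h h K) x +
        f.sum fun r p => D.kX ν' K β.degree ^ r * D.iota h K p := by
  let Φ : (ℕ →₀ D.KLR K β) →ₗ[K] D.KLR K ν' := Finsupp.lsum K fun l =>
    (LinearMap.mulLeft K (D.kX ν' K β.degree ^ l)).comp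
      (D.iota h K : D.KLR K β →ₗ[K] D.KLR K ν')
  have := cut_mem h h (N := LinearMap.range (TensorProduct.lift (D.cross h h K)) ⊔
    LinearMap.range Φ) (fun _ a b => Submodule.mem_sup_left ⟨a ⊗ₜ b, TensorProduct.lift.tmul _ _⟩)
    (fun _ l b => Submodule.mem_sup_right ⟨Finsupp.single l b, Finsupp.lsum_single _ _ _ _⟩)
    (D.detour h lam l b)
  obtain ⟨_, ⟨x, rfl⟩, _, ⟨f, rfl⟩, e⟩ := Submodule.mem_sup.1 this
  refine ⟨x, f, Eq.trans ?_ e.symm⟩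
  rw [detour_apply, theta_apply, mul_assoc, mul_assoc, mul_assoc, mul_assoc, iota_mul_one]

end Surjective

end BorcherdsCartanDatum

namespace BorcherdsCartanDatum

variable {I : Type v} {D : BorcherdsCartanDatum.{v, w} I} [Inhabited I]
  {β β₂ ν' : I →₀ ℕ} {i i' : I} (h : β + Finsupp.single i 1 = ν')
  (h₂ : β₂ + Finsupp.single i' 1 = ν') {K : Type u} [Field K] {lam : D.P}

variable (K lam) in
/-- The combinations of crossings and of fewer than `m` dots on the last strand, where `m` is the
value of the weight. -/
def cutSpan : Submodule K (D.KLR K ν') :=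
  LinearMap.range (TensorProduct.lift (D.cross h h K)) ⊔
    Submodule.span K {z | ∃ l : ℕ, (l : ℤ) < D.h i (lam - D.root β) ∧ ∃ b,
      z = D.kX ν' K β.degree ^ l * D.iota h K b}

theorem coeff_finsuppSum_hT_pow {B : Type*} [Ring B] (f : ℕ →₀ B) (l : ℕ) :
    (f.sum fun j b => hT B ^ j * HahnSeries.C b).coeff (-(l : ℤ)) = f l := by
  by_cases hl : l ∈ f.support
  · exact coeff_sum_hT_pow _ _ hl
  · rw [Finsupp.notMem_support_iff.1 hl, Finsupp.sum, HahnSeries.coeff_sum]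
    refine Finset.sum_eq_zero fun j hj => ?_
    rw [coeff_hT_pow_mul, HahnSeries.C_apply, HahnSeries.coeff_single_of_ne]
    rintro e
    exact hl ((show j = l by omega) ▸ hj)

theorem coeff_finsuppSum_hT_pow_pos {B : Type*} [Ring B] (f : ℕ →₀ B) {a : ℤ} (ha : 0 < a) :
    (f.sum fun j b => hT B ^ j * HahnSeries.C b).coeff a = 0 := by
  rw [Finsupp.sum, HahnSeries.coeff_sum]
  refine Finset.sum_eq_zero fun j hj => ?_
  rw [coeff_hT_pow_mul, HahnSeries.C_apply, HahnSeries.coeff_single_of_ne (by omega)]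

theorem lastRow_iota_one_mul (z : D.KLR K ν') :
    lastRow h K lam (D.iota h K 1 * z) = lastRow h K lam z := by
  refine (LocRep.col_iota_mul h (D.cycLoc β K lam) 1 z).trans ?_
  rw [cycLoc_lift, map_one, map_one, one_mul]
  rfl

/-- The coefficients of a detour. -/
theorem exists_detour_coeff (l : ℕ) (b : D.KLR K β) :
    ∃ (x : D.KLR K β ⊗[K] D.KLR K β) (f : ℕ →₀ D.KLR K β),
      D.cycProj K ν' lam (TensorProduct.lift (D.cross h h K) x) +
        f.sum (fun r p => D.cycProj K ν' lam (D.kX ν' K β.degree ^ r * D.iota h K p)) = 0 ∧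
      (∀ r : ℕ, D.cycProj K β lam (f r) =
        (D.chi β K lam i).coeff (l - r) * D.cycProj K β lam b) ∧
      ∀ a > 0, (lastRow h K lam (TensorProduct.lift (D.cross h h K) x)).coeff a =
        (D.chi β K lam i).coeff (a + l) * D.cycProj K β lam b := by
  obtain ⟨x, f, e⟩ := exists_detour_eq h (lam := lam) l b
  have e1 : lastRow h K lam (f.sum fun r p => D.kX ν' K β.degree ^ r * D.iota h K p) =
      (f.mapRange (D.cycProj K β lam) (map_zero _)).sum fun r p => hT _ ^ r * HahnSeries.C p := by
    rw [Finsupp.sum_mapRange_index fun l => by rw [map_zero, mul_zero], Finsupp.sum, map_sum]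
    exact Finset.sum_congr rfl fun l _ => lastRow_pow_mul_iota h l (f l)
  have e2 := congrArg (lastRow h K lam) e
  rw [lastRow_iota_one_mul, lastRow_detour, map_add, e1] at e2
  refine ⟨x, f, ?_, fun r => ?_, fun a ha => ?_⟩
  · have := congrArg (D.cycProj K ν' lam) e
    rw [map_mul, detour_mem_cycKer, mul_zero, map_add, Finsupp.sum, map_sum] at this
    exact this.symm
  · have := congrArg (fun y => HahnSeries.coeff y (-(r : ℤ))) e2
    simp only [HahnSeries.coeff_add] at this
    rw [coeff_finsuppSum_hT_pow, Finsupp.mapRange_apply, coeff_lastRow_cross_nonpos h (by omega),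
      zero_add, coeff_hT_pow_mul, coeff_mul_C', neg_add_eq_sub] at this
    exact this.symm
  · have := congrArg (fun y => HahnSeries.coeff y a) e2
    simp only [HahnSeries.coeff_add] at this
    rw [coeff_finsuppSum_hT_pow_pos _ ha, add_zero, coeff_hT_pow_mul, coeff_mul_C'] at this
    exact this.symm

theorem coeff_chi_mul_kE (hlam : D.IsDominant lam) (i : I) (s : SeqOf β) (b : D.KLR K β) :
    (D.chi β K lam i).coeff (-D.h i (lam - D.root β)) * D.cycProj K β lam (D.kE K s * b) =
        D.cycProj K β lam (D.kE K s * b) ∨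
    (D.chi β K lam i).coeff (-D.h i (lam - D.root β)) * D.cycProj K β lam (D.kE K s * b) =
        -D.cycProj K β lam (D.kE K s * b) := by
  have H := leadAt_chi D (K := K) hlam i s
  rw [map_mul, ← mul_assoc]
  rcases H.lead with e | e
  · left; rw [e]
  · right; rw [e, neg_mul]

theorem sum_kE_mul (b : D.KLR K β) : ∑ s : SeqOf β, D.kE K s * b = b := by
  rw [← Finset.sum_mul, sum_kE, one_mul]

theorem cycProj_pow_mul_iota (l : ℕ) (b : D.KLR K β) :
    D.cycProj K ν' lam (D.kX ν' K β.degree ^ l * D.iota h K b) =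
      D.cycProj K ν' lam (D.kX ν' K β.degree ^ l) * D.strand K h lam (D.cycProj K β lam b) := by
  rw [map_mul, strand_cycProj]

/-- Many dots on the last strand are a combination of crossings and of few dots. -/
theorem pow_mul_iota_mem (hlam : D.IsDominant lam) (l : ℕ) (b : D.KLR K β) :
    D.cycProj K ν' lam (D.kX ν' K β.degree ^ l * D.iota h K b) ∈
      (cutSpan h K lam).map (D.cycProj K ν' lam).toLinearMap := by
  induction l using Nat.strong_induction_on generalizing b with
  | _ l ih =>
  by_cases hl : (l : ℤ) < D.h i (lam - D.root β)
  · exact ⟨_, Submodule.mem_sup_right (Submodule.subset_span ⟨l, hl, b, rfl⟩), rfl⟩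
  rw [← sum_kE_mul b, map_sum, Finset.mul_sum, map_sum]
  refine Submodule.sum_mem _ fun s _ => ?_
  obtain ⟨l', hl'⟩ : ∃ l' : ℕ, (l' : ℤ) = l - D.h i (lam - D.root β) :=
    ⟨(l - D.h i (lam - D.root β)).toNat, by omega⟩
  obtain ⟨x, f, e, hf, -⟩ := exists_detour_coeff h (lam := lam) l' (D.kE K s * b)
  set N := (cutSpan h K lam).map (D.cycProj K ν' lam).toLinearMap
  have hx : D.cycProj K ν' lam (TensorProduct.lift (D.cross h h K) x) ∈ N :=
    ⟨_, Submodule.mem_sup_left ⟨x, rfl⟩, rfl⟩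
  have hsum : (f.sum fun r p => D.cycProj K ν' lam (D.kX ν' K β.degree ^ r * D.iota h K p)) ∈ N := by
    rw [eq_neg_of_add_eq_zero_right e]
    exact N.neg_mem hx
  have hne : ∀ r ≠ l, D.cycProj K ν' lam (D.kX ν' K β.degree ^ r * D.iota h K (f r)) ∈ N := by
    intro r hr
    rcases lt_or_gt_of_ne hr with hr | hr
    · exact ih r hr (f r)
    · rw [cycProj_pow_mul_iota, hf, (coeff_chi_mul hlam i _).1 _ (by omega), map_zero, mul_zero]
      exact N.zero_mem
  have hmain : D.cycProj K ν' lam (D.kX ν' K β.degree ^ l * D.iota h K (f l)) ∈ N := by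
    by_cases hl2 : l ∈ f.support
    · rw [Finsupp.sum, ← Finset.add_sum_erase _ _ hl2] at hsum
      exact (N.add_mem_iff_left (N.sum_mem fun r hr => hne r (Finset.ne_of_mem_erase hr))).1 hsum
    · rw [Finsupp.notMem_support_iff.1 hl2, map_zero, mul_zero, map_zero]
      exact N.zero_mem
  rw [cycProj_pow_mul_iota, hf, show (l' : ℤ) - l = -D.h i (lam - D.root β) by omega] at hmain
  rw [cycProj_pow_mul_iota]
  rcases coeff_chi_mul_kE hlam i s b with e | e
  · rwa [e] at hmain
  · rw [e, map_neg, mul_neg] at hmain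
    exact N.neg_mem_iff.1 hmain

/-- The algebra with a strand on the right at the top and at the bottom is spanned by crossings
and few dots. -/
theorem cycProj_cut_mem (hlam : D.IsDominant lam) (y : D.KLR K ν') :
    D.cycProj K ν' lam (D.iota h K 1 * (y * D.iota h K 1)) ∈
      (cutSpan h K lam).map (D.cycProj K ν' lam).toLinearMap :=
  cut_mem h h (N := ((cutSpan h K lam).map (D.cycProj K ν' lam).toLinearMap).comap
    (D.cycProj K ν' lam).toLinearMap)
    (fun _ a b => ⟨_, Submodule.mem_sup_left ⟨a ⊗ₜ b, TensorProduct.lift.tmul _ _⟩, rfl⟩)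
    (fun _ l b => pow_mul_iota_mem h hlam l b) y

theorem exists_cross_of_ne (hi : i ≠ i') (y : D.KLR K ν') :
    ∃ x, TensorProduct.lift (D.cross h h₂ K) x = D.iota h₂ K 1 * (y * D.iota h K 1) :=
  cut_mem h h₂ (N := LinearMap.range (TensorProduct.lift (D.cross h h₂ K)))
    (fun _ a b => ⟨a ⊗ₜ b, TensorProduct.lift.tmul _ _⟩) (fun e => absurd e hi) y

/-- The coefficients of the combinations of crossings that vanish in the cyclotomic quotient are
arbitrary. -/
theorem exists_cross_coeff (hlam : D.IsDominant lam) {m : ℕ}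
    (hm : D.h i (lam - D.root β) = -(m : ℤ)) (c : ℕ → D.Cyc K β lam) {j : ℕ} (hj : j ≤ m)
    (hc : ∀ k < j, c k = 0) : ∃ x : D.KLR K β ⊗[K] D.KLR K β,
      D.cycProj K ν' lam (TensorProduct.lift (D.cross h h K) x) = 0 ∧ ∀ k < m,
        (lastRow h K lam (TensorProduct.lift (D.cross h h K) x)).coeff (k + 1) = c k := by
  induction hj using Nat.decreasingInduction generalizing c with
  | self =>
    refine ⟨0, by rw [map_zero, map_zero], fun k hk => ?_⟩
    rw [map_zero, map_zero, hc k hk, HahnSeries.coeff_zero]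
  | of_succ j hj ih =>
    obtain ⟨b, hb⟩ := cycProj_surjective lam (c j)
    have H : ∀ s : SeqOf β, ∃ x : D.KLR K β ⊗[K] D.KLR K β,
        D.cycProj K ν' lam (TensorProduct.lift (D.cross h h K) x) = 0 ∧
        (∀ k < j, (lastRow h K lam (TensorProduct.lift (D.cross h h K) x)).coeff (k + 1) = 0) ∧
        (lastRow h K lam (TensorProduct.lift (D.cross h h K) x)).coeff (j + 1) =
          D.cycProj K β lam (D.kE K s * b) := by
      intro s
      obtain ⟨x, f, e, hf, hx⟩ := exists_detour_coeff h (lam := lam) (m - 1 - j) (D.kE K s * b)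
      have h0 : D.cycProj K ν' lam (TensorProduct.lift (D.cross h h K) x) = 0 := by
        rw [Finsupp.sum, Finset.sum_eq_zero, add_zero] at e
        · exact e
        · intro r _
          rw [cycProj_pow_mul_iota, hf, (coeff_chi_mul hlam i _).1 _ (by omega), map_zero, mul_zero]
      have h1 : ∀ k < j,
          (lastRow h K lam (TensorProduct.lift (D.cross h h K) x)).coeff (k + 1) = 0 := by
        intro k hk
        rw [hx _ (by omega), (coeff_chi_mul hlam i _).1 _ (by omega)]
      have h2 := hx (j + 1) (by omega)
      rw [show (j + 1 + (m - 1 - j : ℕ) : ℤ) = -D.h i (lam - D.root β) by omega] at h2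
      rcases coeff_chi_mul_kE hlam i s b with e | e
      · exact ⟨x, h0, h1, by rw [h2, e]⟩
      · refine ⟨(-1 : K) • x, by rw [map_smul, map_smul, h0, smul_zero], fun k hk => ?_, ?_⟩
        · rw [map_smul, map_smul, HahnSeries.coeff_smul, h1 k hk, smul_zero]
        · rw [map_smul, map_smul, HahnSeries.coeff_smul, h2, e, neg_one_smul, neg_neg]
    choose x h0 h1 h2 using H
    have h1' : ∀ k < j, (lastRow h K lam (TensorProduct.lift (D.cross h h K)
        (∑ s, x s))).coeff (k + 1) = 0 := by
      intro k hk
      rw [map_sum, map_sum, HahnSeries.coeff_sum, Finset.sum_eq_zero fun s _ => h1 s k hk]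
    have h2' : (lastRow h K lam (TensorProduct.lift (D.cross h h K)
        (∑ s, x s))).coeff (j + 1) = c j := by
      rw [map_sum, map_sum, HahnSeries.coeff_sum, Finset.sum_congr rfl fun s _ => h2 s, ← map_sum,
        sum_kE_mul, hb]
    obtain ⟨x', h3, h4⟩ := ih (fun k => c k - (lastRow h K lam (TensorProduct.lift (D.cross h h K)
        (∑ s, x s))).coeff (k + 1)) fun k hk => by
      rcases Nat.lt_succ_iff_lt_or_eq.1 hk with hk | rfl
      · rw [h1' k hk, hc k hk, sub_zero]
      · rw [h2', sub_self]
    refine ⟨∑ s, x s + x', ?_, fun k hk => ?_⟩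
    · rw [map_add, map_add, h3, map_sum, map_sum, Finset.sum_eq_zero fun s _ => h0 s, zero_add]
    · rw [map_add, map_add, HahnSeries.coeff_add, h4 k hk, add_sub_cancel]

end BorcherdsCartanDatum

namespace GrMod

section Iso

variable {K : Type u} [Field K] {A : Type a} [Ring A] [Algebra K A] {𝒜 : ℤ → Submodule K A}

theorem mem_gr_of_map_mem {M N : GrMod 𝒜} (f : M ⟶ N) (hf : Function.Injective f.toLin) {n : ℤ}
    {x : M.carrier} (hx : f.toLin x ∈ N.gr n) : x ∈ M.gr n := by
  have h1 : x ∈ ⨆ d, M.gr d := by rw [iSup_gr]; trivial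
  rw [Submodule.mem_iSup_iff_exists_finsupp] at h1
  obtain ⟨s, hs, rfl⟩ := h1
  obtain ⟨δ, hδ⟩ := exists_component N.isInternal
  have h2 : ∀ d ≠ n, s d = 0 := by
    intro d hd
    have h3 := hδ n _ hx
    rw [Finsupp.sum, map_sum, map_sum] at h3
    have h4 := DFunLike.congr_fun h3 d
    rw [Finsupp.finsetSum_apply, Finsupp.single_eq_of_ne hd] at h4
    by_cases hds : d ∈ s.support
    · rw [Finset.sum_eq_single d, hδ d _ (f.map_mem (hs d)), Finsupp.single_eq_same] at h4
      · exact hf (h4.trans (map_zero _).symm)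
      · intro e _ he
        rw [hδ e _ (f.map_mem (hs e)), Finsupp.single_eq_of_ne he.symm]
      · exact fun h => absurd hds h
    · exact Finsupp.notMem_support_iff.1 hds
  rw [Finsupp.sum, Finset.sum_eq_single n (fun d _ hd => h2 d hd)
    fun h => Finsupp.notMem_support_iff.1 h]
  exact hs n

/-- A bijective homomorphism is an isomorphism. -/
theorem isIso_of_bijective {M N : GrMod 𝒜} (f : M ⟶ N) (hf : Function.Bijective f.toLin) :
    IsIso f := by
  let e := LinearEquiv.ofBijective f.toLin hf
  refine ⟨⟨⟨e.symm.toLinearMap, fun {n x} hx => mem_gr_of_map_mem f hf.1 ?_⟩, ?_, ?_⟩⟩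
  · rwa [show f.toLin (e.symm.toLinearMap x) = x from e.apply_symm_apply x]
  · exact hom_ext (LinearMap.ext fun x => e.symm_apply_apply x)
  · exact hom_ext (LinearMap.ext fun x => e.apply_symm_apply x)

theorem nonempty_iso_of_bijective {C : Type*} [Category* C] {F G : C ⥤ GrMod 𝒜} (f : F ⟶ G)
    (hf : ∀ X, Function.Bijective (Hom.toLin (f.app X))) : Nonempty (F ≅ G) := by
  have : ∀ X, IsIso (f.app X) := fun X => isIso_of_bijective _ (hf X)
  have := NatIso.isIso_of_isIso_app f
  exact ⟨asIso f⟩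

variable {C : Type*} [Category* C] {ι : Type} [Fintype ι] (F : ι → (C ⥤ GrMod 𝒜)) (G : C ⥤ GrMod 𝒜)

/-- The homomorphism from a direct sum given by its components. -/
def dsumDesc (f : ∀ k, F k ⟶ G) : dsum F ⟶ G where
  app X := ⟨∑ k, (Hom.toLin ((f k).app X)).comp (LinearMap.proj k), fun {n x} hx => by
    rw [LinearMap.sum_apply]
    exact Submodule.sum_mem _ fun k _ => ((f k).app X).map_mem (hx k trivial)⟩
  naturality X Y g := hom_ext (LinearMap.ext fun x => by
    refine (LinearMap.sum_apply _ _ _).trans (Eq.trans ?_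
      (congrArg (Hom.toLin (G.map g)) (LinearMap.sum_apply _ _ x)).symm)
    refine Eq.trans ?_ (map_sum (Hom.toLin (G.map g)) _ _).symm
    refine Finset.sum_congr rfl fun k _ => ?_
    exact LinearMap.congr_fun (congrArg Hom.toLin ((f k).naturality g)) (x k))

theorem dsumDesc_apply (f : ∀ k, F k ⟶ G) (X : C) (x : ∀ k, ((F k).obj X).carrier) :
    Hom.toLin ((dsumDesc F G f).app X) x = ∑ k, Hom.toLin ((f k).app X) (x k) :=
  LinearMap.sum_apply _ _ _

/-- The homomorphism to a direct sum given by its components. -/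
def dsumLift (f : ∀ k, G ⟶ F k) : G ⟶ dsum F where
  app X := ⟨LinearMap.pi fun k => Hom.toLin ((f k).app X),
    fun hx k _ => ((f k).app X).map_mem hx⟩
  naturality _ _ g := hom_ext (LinearMap.ext fun x => funext fun k =>
    LinearMap.congr_fun (congrArg Hom.toLin ((f k).naturality g)) x)

end Iso

section ChangeOfRings

variable {K : Type u} [Field K] {A A' : Type a} [Ring A] [Algebra K A] [Ring A'] [Algebra K A']
  (φ : A →ₙₐ[K] A')

section Lift

variable {M : Type*} [AddCommGroup M] [Module K M] [Module A M]

theorem smul_indMk₂ (c b : A') (x : M) : c • indMk₂ φ M b x = indMk₂ φ M (c * b) x := by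
  rw [indMk₂_apply, indMk₂_apply, indMk, indMk, ← map_smul, TensorProduct.smul_tmul']
  congr 2
  exact Subtype.ext (mul_assoc _ _ _).symm

theorem indMk₂_mul (b : A') (r : A) (x : M) : indMk₂ φ M (b * φ r) x = indMk₂ φ M b (r • x) := by
  rw [indMk₂_apply, indMk₂_apply, ← indMk_act]
  congr 1
  refine Subtype.ext ?_
  change b * φ r * φ 1 = b * φ 1 * φ r
  rw [mul_assoc, mul_assoc, mul_map_one, map_one_mul]

theorem indMk₂_mul_map_one (b : A') (x : M) : indMk₂ φ M (b * φ 1) x = indMk₂ φ M b x := by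
  rw [indMk₂_mul, one_smul]

theorem indMk_eq (b : leftIdeal φ) (x : M) : indMk φ M b x = indMk₂ φ M b.1 x := by
  rw [indMk₂_apply, leftIdeal.proj_coe]

variable {φ} in
theorem ind_induction {P : IndCarrier φ M → Prop} (h0 : P 0)
    (hadd : ∀ y z, P y → P z → P (y + z)) (h : ∀ b x, P (indMk₂ φ M b x)) (z : IndCarrier φ M) :
    P z := by
  obtain ⟨z, rfl⟩ := (balanced φ M).mkQ_surjective z
  induction z using TensorProduct.induction_on with
  | zero => rw [map_zero]; exact h0
  | add y z hy hz => rw [map_add]; exact hadd _ _ hy hz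
  | tmul b x =>
    have := h b.1 x
    rwa [← indMk_eq] at this

variable {V : Type*} [AddCommGroup V] [Module K V] (f : A' →ₗ[K] M →ₗ[K] V)
  (hf : ∀ b r x, f (b * φ r) x = f b (r • x))

/-- The linear map on `A'e ⊗ M` given by a balanced bilinear map. -/
def indLift : IndCarrier φ M →ₗ[K] V :=
  (((balanced φ M).restrictScalars K).liftQ
    (TensorProduct.lift (f.comp ((leftIdeal φ).subtype.restrictScalars K))) (fun z hz => by
      have H : ∀ c : A', TensorProduct.lift
          (f.comp ((leftIdeal φ).subtype.restrictScalars K)) (c • z) = 0 := by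
        change z ∈ balanced φ M at hz
        unfold balanced at hz
        induction hz using Submodule.span_induction with
        | mem z hz =>
          obtain ⟨b, r, x, rfl⟩ := hz
          intro c
          rw [smul_sub, TensorProduct.smul_tmul', TensorProduct.smul_tmul', map_sub, sub_eq_zero]
          change f (c * (b.1 * φ r)) x = f (c * b.1) (r • x)
          rw [← mul_assoc, hf]
        | zero => simp
        | add y z _ _ hy hz =>
          intro c
          rw [smul_add, map_add, hy, hz, add_zero]
        | smul c' z _ hz =>
          intro c
          rw [← mul_smul, hz]
      have := H 1
      rwa [one_smul] at this)).comp
      (Submodule.Quotient.restrictScalarsEquiv K (balanced φ M)).symm.toLinearMap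

theorem indLift_mk₂ (b : A') (x : M) : indLift φ f hf (indMk₂ φ M b x) = f b x := by
  refine (show indLift φ f hf (indMk₂ φ M b x) = f (b * φ 1) x from rfl).trans ?_
  rw [hf, one_smul]

/-- The `A'`-linear map on `A'e ⊗ M` given by a balanced map. -/
def indLiftₗ [Module A' V] (hs : ∀ c b x, f (c * b) x = c • f b x) : IndCarrier φ M →ₗ[A'] V where
  toFun := indLift φ f hf
  map_add' := map_add _
  map_smul' c z := by
    rw [RingHom.id_apply]
    induction z using ind_induction with
    | h0 => rw [smul_zero, map_zero, smul_zero]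
    | hadd y z hy hz => rw [smul_add, map_add, hy, hz, map_add, smul_add]
    | h b x => rw [smul_indMk₂, indLift_mk₂, indLift_mk₂, hs]

theorem indLiftₗ_mk₂ [Module A' V] (hs : ∀ c b x, f (c * b) x = c • f b x) (b : A') (x : M) :
    indLiftₗ φ f hf hs (indMk₂ φ M b x) = f b x := indLift_mk₂ φ f hf b x

end Lift

section Bijective

variable {M : Type*} [AddCommGroup M] [Module K M] [Module A M] [IsScalarTower K A M]
  {Ξ V : Type*} [AddCommGroup Ξ]
  [Module K Ξ] [AddCommGroup V] [Module K V] {ι : Type*} [Fintype ι]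
  {p : Ξ →ₗ[K] A'} {q : Ξ →ₗ[K] (ι → A)} {μ : Ξ →ₗ[K] M →ₗ[K] V} (e₂ : A')
  (hinj : ∀ ξ, p ξ = 0 → q ξ = 0 → ∀ x, μ ξ x = 0)
  (hsurj : ∀ b c, ∃ ξ, p ξ = e₂ * (b * φ 1) ∧ q ξ = c)
  (hact : ∀ ξ r, ∃ ξ', p ξ' = p ξ * φ r ∧ (∀ k, q ξ' k = q ξ k * r) ∧ ∀ x, μ ξ' x = μ ξ (r • x))

include hinj in
theorem exists_section : ∃ g : A' × (ι → A) →ₗ[K] M →ₗ[K] V, ∀ ξ x, g (p ξ, q ξ) x = μ ξ x := by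
  obtain ⟨σ, hσ⟩ := (p.prod q).rangeRestrict.exists_rightInverse_of_surjective
    (LinearMap.range_rangeRestrict _)
  obtain ⟨σ', hσ'⟩ := LinearMap.exists_extend σ
  refine ⟨μ.comp σ', fun ξ x => ?_⟩
  have h1 : (p.prod q) (σ' (p ξ, q ξ)) = (p ξ, q ξ) := by
    have h2 := LinearMap.congr_fun hσ' ⟨(p ξ, q ξ), ⟨ξ, rfl⟩⟩
    have h3 := LinearMap.congr_fun hσ ⟨(p ξ, q ξ), ⟨ξ, rfl⟩⟩
    exact (congrArg (p.prod q) h2).trans (congrArg Subtype.val h3)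
  rw [LinearMap.comp_apply, ← sub_eq_zero, ← LinearMap.sub_apply, ← map_sub]
  refine hinj _ ?_ ?_ x
  · rw [map_sub, sub_eq_zero]; exact congrArg Prod.fst h1
  · rw [map_sub, sub_eq_zero]; exact congrArg Prod.snd h1

include hinj hsurj hact

theorem injective_of_presentation (Ψ₁ : V →ₗ[K] IndCarrier φ M) (Ψ₂ : V →ₗ[K] (ι → M))
    (h1 : ∀ ξ x, Ψ₁ (μ ξ x) = indMk₂ φ M (p ξ) x) (h2 : ∀ ξ x k, Ψ₂ (μ ξ x) k = q ξ k • x)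
    (hp : ∀ ξ, e₂ * (p ξ * φ 1) = p ξ)
    (hspan : ∀ v, v ∈ Submodule.span K {v | ∃ ξ x, v = μ ξ x}) {v : V} (hv1 : Ψ₁ v = 0)
    (hv2 : Ψ₂ v = 0) : v = 0 := by
  classical
  obtain ⟨g, hg⟩ := exists_section (p := p) (q := q) (μ := μ) hinj
  let f : A' →ₗ[K] M →ₗ[K] V := g.comp ((LinearMap.inl K A' (ι → A)).comp
    ((LinearMap.mulLeft K e₂).comp (LinearMap.mulRight K (φ 1))))
  have hfa : ∀ b, f b = g (e₂ * (b * φ 1), 0) := fun b => rfl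
  have hf : ∀ b r x, f (b * φ r) x = f b (r • x) := by
    intro b r x
    obtain ⟨ξ, e1, e2⟩ := hsurj b 0
    obtain ⟨ξ', e3, e4, e5⟩ := hact ξ r
    have e6 : q ξ' = 0 := funext fun k => by rw [e4, e2]; exact zero_mul r
    rw [hfa, hfa, ← e1, ← e2, hg, ← e5, ← hg, e2, e6, e3, e1]
    congr 3
    rw [mul_assoc, mul_map_one, mul_assoc, mul_assoc, map_one_mul]
  have hg2 : ∀ k r (x : M), g (0, Pi.single k r) x = g (0, Pi.single k 1) (r • x) := by
    intro k r x
    obtain ⟨ξ, e1, e2⟩ := hsurj 0 (Pi.single k 1)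
    rw [zero_mul, mul_zero] at e1
    obtain ⟨ξ', e3, e4, e5⟩ := hact ξ r
    have e6 : q ξ' = Pi.single k r := funext fun l => by
      rw [e4, e2]
      by_cases hl : l = k
      · subst hl; simp
      · simp [hl]
    rw [e1, zero_mul] at e3
    rw [← e1, ← e2, hg, ← e5, ← hg, e3, e6, e1]
  let G : V →ₗ[K] V := (indLift φ f hf).comp Ψ₁ +
    ∑ k, (g (0, Pi.single k 1)).comp ((LinearMap.proj k).comp Ψ₂)
  have hG : ∀ v, G v = v := by
    intro v
    induction hspan v using Submodule.span_induction with
    | mem v hv =>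
      obtain ⟨ξ, x, rfl⟩ := hv
      have e1 : G (μ ξ x) = indLift φ f hf (Ψ₁ (μ ξ x)) +
          ∑ k, g (0, Pi.single k 1) (Ψ₂ (μ ξ x) k) := by
        rw [LinearMap.add_apply, LinearMap.sum_apply]; rfl
      rw [e1, h1, indLift_mk₂, hfa, hp,
        Finset.sum_congr rfl fun k _ => (congrArg _ (h2 ξ x k)).trans (hg2 k (q ξ k) x).symm,
        ← hg ξ x]
      have e2 : ((p ξ, q ξ) : A' × (ι → A)) = (p ξ, 0) + ∑ k, (0, Pi.single k (q ξ k)) := by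
        refine Prod.ext ?_ ?_
        · rw [Prod.fst_add, Prod.fst_sum]; simp
        · rw [Prod.snd_add, Prod.snd_sum, zero_add]
          exact (Finset.univ_sum_single (q ξ)).symm
      rw [e2, map_add, map_sum, LinearMap.add_apply, LinearMap.sum_apply]
    | zero => exact map_zero G
    | add y z _ _ hy hz => rw [map_add, hy, hz]
    | smul c y _ hy => rw [map_smul, hy]
  rw [← hG v, LinearMap.add_apply, LinearMap.sum_apply, LinearMap.comp_apply, hv1, map_zero,
    zero_add]
  refine Finset.sum_eq_zero fun k _ => ?_
  rw [LinearMap.comp_apply, LinearMap.comp_apply, hv2, map_zero, map_zero]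

omit hinj hact in
theorem surjective_of_presentation (Ψ₁ : V →ₗ[K] IndCarrier φ M) (Ψ₂ : V →ₗ[K] (ι → M))
    (h1 : ∀ ξ x, Ψ₁ (μ ξ x) = indMk₂ φ M (p ξ) x) (h2 : ∀ ξ x k, Ψ₂ (μ ξ x) k = q ξ k • x)
    {z : IndCarrier φ M} (hz : e₂ • z = z) (c : ι → M) : ∃ v, Ψ₁ v = z ∧ Ψ₂ v = c := by
  classical
  have H1 : ∀ z : IndCarrier φ M, ∃ v, Ψ₁ v = e₂ • z ∧ Ψ₂ v = 0 := by
    intro z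
    induction z using ind_induction with
    | h0 => exact ⟨0, by rw [map_zero, smul_zero], map_zero _⟩
    | hadd y z hy hz =>
      obtain ⟨v, hv, hv'⟩ := hy
      obtain ⟨w, hw, hw'⟩ := hz
      exact ⟨v + w, by rw [map_add, hv, hw, smul_add], by rw [map_add, hv', hw', add_zero]⟩
    | h b x =>
      obtain ⟨ξ, e1, e2⟩ := hsurj b 0
      refine ⟨μ ξ x, ?_, ?_⟩
      · rw [h1, e1, smul_indMk₂, ← mul_assoc, indMk₂_mul_map_one]
      · ext k
        rw [h2, e2]
        exact zero_smul _ _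
  have H2 : ∀ k x, ∃ v, Ψ₁ v = 0 ∧ Ψ₂ v = Pi.single k x := by
    intro k x
    obtain ⟨ξ, e1, e2⟩ := hsurj 0 (Pi.single k 1)
    refine ⟨μ ξ x, ?_, ?_⟩
    · rw [h1, e1, zero_mul, mul_zero, map_zero, LinearMap.zero_apply]
    · ext l
      rw [h2, e2]
      by_cases hl : l = k
      · subst hl; simp
      · simp [hl]
  obtain ⟨v, hv, hv'⟩ := H1 z
  choose w hw hw' using fun k => H2 k (c k)
  refine ⟨v + ∑ k, w k, ?_, ?_⟩
  · rw [map_add, map_sum, hv, hz, Finset.sum_eq_zero fun k _ => hw k, add_zero]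
  · rw [map_add, map_sum, hv', Finset.sum_congr rfl fun k _ => hw' k, zero_add]
    exact Finset.univ_sum_single c

end Bijective

end ChangeOfRings

end GrMod

namespace GrMod

variable {K : Type u} [Field K] {C B A A' : Type a} [Ring C] [Algebra K C] [Ring B] [Algebra K B]
  [Ring A] [Algebra K A] [Ring A'] [Algebra K A'] {𝒞 : ℤ → Submodule K C} {ℬ : ℤ → Submodule K B}
  {𝒜 : ℤ → Submodule K A} {𝒜' : ℤ → Submodule K A'}

section

variable (ψ : C →ₙₐ[K] B)

/-- The projection to `eN`. -/
def resProj (N : Type*) [AddCommGroup N] [Module K N] [Module B N] [IsScalarTower K B N] :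
    N →ₗ[K] resCarrier ψ N where
  toFun x := ⟨ψ 1 • x, by
    change ψ 1 • ψ 1 • x = ψ 1 • x
    rw [← mul_smul, map_one_mul]⟩
  map_add' x y := Subtype.ext (smul_add _ _ _)
  map_smul' c x := Subtype.ext (smul_comm _ _ _)

theorem resCarrier_isScalarTower (N : Type*) [AddCommGroup N] [Module K N] [Module B N]
    [IsScalarTower K B N] : letI := resModule ψ N; IsScalarTower K C (resCarrier ψ N) :=
  letI := resModule ψ N
  ⟨fun c r x => Subtype.ext (by
    change ψ (c • r) • x.1 = c • ψ r • x.1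
    rw [map_smul, smul_assoc])⟩

variable (φ : C →ₙₐ[K] A)

theorem indMk₂_mem [GradedAlgebra 𝒞] [GradedAlgebra 𝒜] (hφ : ∀ d, ∀ r ∈ 𝒞 d, φ r ∈ 𝒜 d)
    (M : GrMod 𝒞) {k l n : ℤ} {b : A} {x : M.carrier} (hb : b ∈ 𝒜 k) (hx : x ∈ M.gr l)
    (hn : k + l = n) : indMk₂ φ M.carrier b x ∈ indGr φ 𝒜 M n := by
  refine Submodule.subset_span ⟨k, l, leftIdeal.proj φ b, x, hn, ?_, hx, rfl⟩
  have h1 : φ 1 ∈ 𝒜 0 := hφ 0 1 SetLike.GradedOne.one_mem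
  have := SetLike.GradedMul.mul_mem hb h1
  rwa [add_zero] at this

/-- Homogeneous elements of `A'e ⊗ M` are sums of products of homogeneous elements. -/
theorem indGr_induction {M : GrMod 𝒞} {n : ℤ} {P : Submodule K (IndCarrier φ M.carrier)}
    (h : ∀ k l b x, k + l = n → b ∈ 𝒜 k → x ∈ M.gr l → indMk₂ φ M.carrier b x ∈ P) :
    indGr φ 𝒜 M n ≤ P := by
  refine Submodule.span_le.2 ?_
  rintro _ ⟨k, l, b, x, hn, hb, hx, rfl⟩
  rw [indMk_eq]
  exact h k l b.1 x hn hb hx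

theorem ind_ext₂ {M : GrMod 𝒞} {V : Type*} [AddCommGroup V] [Module A V]
    {f g : IndCarrier φ M.carrier →ₗ[A] V}
    (h : ∀ b x, f (indMk₂ φ M.carrier b x) = g (indMk₂ φ M.carrier b x)) : f = g :=
  ind_ext φ fun b x => by rw [indMk_eq]; exact h b.1 x

end

section Cross

variable (φ₂ : C →ₙₐ[K] A) (ψ : C →ₙₐ[K] B) (φ : B →ₙₐ[K] A') (φ' : A →ₙₐ[K] A')
  (t : A') (ht : ∀ c, φ' (φ₂ c) * t = t * φ (ψ c))

section

variable (M : Type*) [AddCommGroup M] [Module K M] [Module B M] [IsScalarTower K B M]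

/-- The bilinear map `(b, y) ↦ b t ⊗ y`. -/
def crossBilin : A →ₗ[K] resCarrier ψ M →ₗ[K] resCarrier φ' (IndCarrier φ M) :=
  LinearMap.mk₂ K (fun b y => ⟨indMk₂ φ M (φ' b * t) y.1, by
      change φ' 1 • _ = _
      rw [smul_indMk₂, ← mul_assoc, map_one_mul]⟩)
    (fun b b' y => Subtype.ext (by
      change indMk₂ φ M (φ' (b + b') * t) y.1 = indMk₂ φ M (φ' b * t) y.1 + indMk₂ φ M (φ' b' * t) y.1
      rw [map_add, add_mul, map_add, LinearMap.add_apply]))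
    (fun c b y => Subtype.ext (by
      change indMk₂ φ M (φ' (c • b) * t) y.1 = c • indMk₂ φ M (φ' b * t) y.1
      rw [map_smul, smul_mul_assoc, map_smul, LinearMap.smul_apply]))
    (fun b y y' => Subtype.ext (map_add (indMk₂ φ M (φ' b * t)) y.1 y'.1))
    (fun c b y => Subtype.ext (map_smul (indMk₂ φ M (φ' b * t)) c y.1))

include ht in
theorem crossBilin_balanced : letI := resModule ψ M
    ∀ (b : A) (r : C) (y : resCarrier ψ M),
      crossBilin ψ φ φ' t M (b * φ₂ r) y = crossBilin ψ φ φ' t M b (r • y) := by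
  intro b r y
  refine Subtype.ext ?_
  change indMk₂ φ M (φ' (b * φ₂ r) * t) y.1 = indMk₂ φ M (φ' b * t) (ψ r • y.1)
  rw [← indMk₂_mul, map_mul φ', mul_assoc, ht, mul_assoc]

/-- The linear map `b ⊗ y ↦ b t ⊗ y`. -/
def crossLin : letI := resModule ψ M; letI := resModule φ' (IndCarrier φ M)
    IndCarrier φ₂ (resCarrier ψ M) →ₗ[A] resCarrier φ' (IndCarrier φ M) :=
  letI := resModule ψ M
  letI := resModule φ' (IndCarrier φ M)
  indLiftₗ φ₂ (crossBilin ψ φ φ' t M) (crossBilin_balanced φ₂ ψ φ φ' t ht M)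
    (fun c b y => Subtype.ext (by
      change indMk₂ φ M (φ' (c * b) * t) y.1 = φ' c • indMk₂ φ M (φ' b * t) y.1
      rw [smul_indMk₂, map_mul φ', mul_assoc]))

theorem crossLin_mk₂ (b : A) (y : resCarrier ψ M) : letI := resModule ψ M
    (crossLin φ₂ ψ φ φ' t ht M (indMk₂ φ₂ (resCarrier ψ M) b y)).1 =
      indMk₂ φ M (φ' b * t) y.1 := by
  letI := resModule ψ M
  letI := resModule φ' (IndCarrier φ M)
  exact congrArg Subtype.val (indLiftₗ_mk₂ φ₂ (crossBilin ψ φ φ' t M) _ _ b y)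

end

variable [GradedAlgebra 𝒞] [GradedAlgebra ℬ] [GradedAlgebra 𝒜] [GradedAlgebra 𝒜']
  (hφ₂ : ∀ d, ∀ r ∈ 𝒞 d, φ₂ r ∈ 𝒜 d) (hψ : ∀ d, ∀ r ∈ 𝒞 d, ψ r ∈ ℬ d)
  (hφ : ∀ d, ∀ r ∈ ℬ d, φ r ∈ 𝒜' d) (hφ' : ∀ d, ∀ r ∈ 𝒜 d, φ' r ∈ 𝒜' d)
  {s : ℤ} (hs : t ∈ 𝒜' s)

/-- The homomorphism `b ⊗ y ↦ b t ⊗ y` of functors. -/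
def crossNat : (res ψ hψ ⋙ ind φ₂ hφ₂) ⋙ shift s ⟶ ind φ hφ ⋙ res φ' hφ' where
  app M := ⟨crossLin φ₂ ψ φ φ' t ht M.carrier, fun {n x} hx => by
    letI := resModule ψ M.carrier
    letI := resModule φ' (IndCarrier φ M.carrier)
    haveI := resCarrier_isScalarTower φ' (IndCarrier φ M.carrier)
    have : indGr φ₂ 𝒜 ((res ψ hψ).obj M) (n - s) ≤
        ((indGr φ 𝒜' M n).comap ((resCarrier φ' (IndCarrier φ M.carrier)).subtype)).comap
          ((crossLin φ₂ ψ φ φ' t ht M.carrier).restrictScalars K) := by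
      refine indGr_induction φ₂ fun k l b y hn hb hy => ?_
      refine (congrArg (· ∈ indGr φ 𝒜' M n)
        (crossLin_mk₂ φ₂ ψ φ φ' t ht M.carrier b y)).mpr ?_
      exact indMk₂_mem φ hφ M (SetLike.GradedMul.mul_mem (hφ' _ _ hb) hs) hy (by omega)
    exact this hx⟩
  naturality M N f := hom_ext (ind_ext₂ φ₂ fun b y => Subtype.ext (by
    letI := resModule ψ M.carrier
    letI := resModule ψ N.carrier
    letI := resModule φ' (IndCarrier φ M.carrier)
    letI := resModule φ' (IndCarrier φ N.carrier)
    exact (crossLin_mk₂ φ₂ ψ φ φ' t ht N.carrier b _).trans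
      (congrArg (indMap φ f.toLin) (crossLin_mk₂ φ₂ ψ φ φ' t ht M.carrier b y)).symm))

theorem crossNat_app (M : GrMod ℬ) (b : A) (y : resCarrier ψ M.carrier) :
    letI := resModule ψ M.carrier
    ((Hom.toLin ((crossNat φ₂ ψ φ φ' t ht hφ₂ hψ hφ hφ' hs).app M)
      (indMk₂ φ₂ (resCarrier ψ M.carrier) b y) : resCarrier φ' (IndCarrier φ M.carrier)).1) =
      indMk₂ φ M.carrier (φ' b * t) y.1 := crossLin_mk₂ φ₂ ψ φ φ' t ht M.carrier b y

end Cross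

section Dots

variable (φ : B →ₙₐ[K] A') (u : A') (hu : ∀ c, u * φ c = φ c * u)

/-- The linear map `x ↦ u ⊗ x`. -/
def dotLin (M : Type*) [AddCommGroup M] [Module K M] [Module B M] [IsScalarTower K B M] :
    letI := resModule φ (IndCarrier φ M)
    M →ₗ[B] resCarrier φ (IndCarrier φ M) :=
  letI := resModule φ (IndCarrier φ M)
  { toFun := fun x => ⟨indMk₂ φ M u x, by
      change φ 1 • _ = _
      rw [smul_indMk₂, ← hu, indMk₂_mul_map_one]⟩
    map_add' := fun x y => Subtype.ext (map_add (indMk₂ φ M u) x y)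
    map_smul' := fun r x => Subtype.ext (by
      change indMk₂ φ M u (r • x) = φ r • indMk₂ φ M u x
      rw [smul_indMk₂, ← hu, indMk₂_mul]) }

variable [GradedAlgebra ℬ] [GradedAlgebra 𝒜'] (hφ : ∀ d, ∀ r ∈ ℬ d, φ r ∈ 𝒜' d) {s : ℤ}
  (hs : u * φ 1 ∈ 𝒜' s)

/-- The homomorphism `x ↦ u ⊗ x` of functors. -/
def dotNat : shift s ⟶ ind φ hφ ⋙ res φ hφ where
  app M := ⟨dotLin φ u hu M.carrier, fun {n x} hx =>
    (congrArg (· ∈ indGr φ 𝒜' M n) (indMk₂_mul_map_one φ u (M := M.carrier) x)).mp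
      (indMk₂_mem φ hφ M hs hx (by omega))⟩
  naturality M N f := hom_ext (LinearMap.ext fun x => rfl)

end Dots

section Moments

variable (ψ : C →ₙₐ[K] B) (u : B) (hu : ∀ c, u * ψ c = ψ c * u)

section

variable (M : Type*) [AddCommGroup M] [Module K M] [Module B M] [IsScalarTower K B M]

/-- The bilinear map `(b, y) ↦ b u y`. -/
def momentBilin : B →ₗ[K] resCarrier ψ M →ₗ[K] M :=
  LinearMap.mk₂ K (fun b y => (b * u) • y.1)
    (fun b b' y => by rw [add_mul, add_smul])
    (fun c b y => by rw [smul_mul_assoc, smul_assoc])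
    (fun b y y' => smul_add _ _ _)
    (fun c b y => smul_comm _ _ _)

/-- The linear map `b ⊗ y ↦ b u y`. -/
def momentLin : letI := resModule ψ M; IndCarrier ψ (resCarrier ψ M) →ₗ[B] M :=
  letI := resModule ψ M
  indLiftₗ ψ (momentBilin ψ u M) (fun b r y => by
      change (b * ψ r * u) • y.1 = (b * u) • (ψ r • y.1)
      rw [← mul_smul, mul_assoc, mul_assoc, hu])
    (fun c b y => by
      change (c * b * u) • y.1 = c • (b * u) • y.1
      rw [← mul_smul, mul_assoc])

theorem momentLin_mk₂ (b : B) (y : resCarrier ψ M) : letI := resModule ψ M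
    momentLin ψ u hu M (indMk₂ ψ (resCarrier ψ M) b y) = (b * u) • y.1 := by
  letI := resModule ψ M
  exact indLiftₗ_mk₂ ψ (momentBilin ψ u M) _ _ b y

end

variable [GradedAlgebra 𝒞] [GradedAlgebra ℬ] (hψ : ∀ d, ∀ r ∈ 𝒞 d, ψ r ∈ ℬ d)
  {s s' d : ℤ} (hs : u ∈ ℬ d) (hd : s' + d = s)

/-- The homomorphism `b ⊗ y ↦ b u y` of functors. -/
def momentNat : (res ψ hψ ⋙ ind ψ hψ) ⋙ shift s ⟶ shift s' where
  app M := ⟨momentLin ψ u hu M.carrier, fun {n x} hx => by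
    letI := resModule ψ M.carrier
    have : indGr ψ ℬ ((res ψ hψ).obj M) (n - s) ≤
        (M.gr (n - s')).comap ((momentLin ψ u hu M.carrier).restrictScalars K) := by
      refine indGr_induction ψ fun k l b y hn hb hy => ?_
      refine (congrArg (· ∈ M.gr (n - s')) (momentLin_mk₂ ψ u hu M.carrier b y)).mpr ?_
      have := M.smul_mem (SetLike.GradedMul.mul_mem hb hs) hy
      rwa [show k + d + l = n - s' by omega] at this
    exact this hx⟩
  naturality M N f := hom_ext (ind_ext₂ ψ fun b y => by
    letI := resModule ψ M.carrier
    letI := resModule ψ N.carrier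
    exact (momentLin_mk₂ ψ u hu N.carrier b _).trans ((map_smul f.toLin (b * u) y.1).symm.trans
      (congrArg f.toLin (momentLin_mk₂ ψ u hu M.carrier b y)).symm))

theorem momentNat_app (M : GrMod ℬ) (b : B) (y : resCarrier ψ M.carrier) :
    letI := resModule ψ M.carrier
    Hom.toLin ((momentNat ψ u hu hψ hs hd).app M)
      (indMk₂ ψ (resCarrier ψ M.carrier) b y) = (b * u) • y.1 :=
  momentLin_mk₂ ψ u hu M.carrier b y

end Moments

section CrossPresentation

variable (φ₂ : C →ₙₐ[K] A) (ψ : C →ₙₐ[K] B)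
  (M : Type*) [AddCommGroup M] [Module K M] [Module B M] [IsScalarTower K B M]

/-- The trilinear map `(a, b, x) ↦ a ⊗ b x`. -/
def resIndMk : letI := resModule ψ M
    A →ₗ[K] B →ₗ[K] M →ₗ[K] IndCarrier φ₂ (resCarrier ψ M) :=
  letI := resModule ψ M
  LinearMap.mk₂ K (fun a b => (indMk₂ φ₂ (resCarrier ψ M) a).comp
      ((resProj ψ M).comp (Algebra.lsmul K K M b)))
    (fun a a' b => LinearMap.ext fun x => by simp)
    (fun c a b => LinearMap.ext fun x => by simp)
    (fun a b b' => LinearMap.ext fun x => by simp [add_smul])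
    (fun c a b => LinearMap.ext fun x => by simp)

theorem resIndMk_apply (a : A) (b : B) (x : M) : letI := resModule ψ M
    resIndMk φ₂ ψ M a b x = indMk₂ φ₂ (resCarrier ψ M) a (resProj ψ M (b • x)) := rfl

theorem mem_span_resIndMk (v : letI := resModule ψ M; IndCarrier φ₂ (resCarrier ψ M)) :
    letI := resModule ψ M
    v ∈ Submodule.span K {v | ∃ a b x, v = resIndMk φ₂ ψ M a b x} := by
  letI := resModule ψ M
  induction v using ind_induction with
  | h0 => exact Submodule.zero_mem _
  | hadd y z hy hz => exact Submodule.add_mem _ hy hz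
  | h b y =>
    refine Submodule.subset_span ⟨b, 1, y.1, ?_⟩
    rw [resIndMk_apply, one_smul]
    congr 1
    exact Subtype.ext y.2.symm

end CrossPresentation

end GrMod

namespace GrMod

variable {K : Type u} [Field K] {A : Type a} [Ring A] [Algebra K A] {𝒜 : ℤ → Submodule K A}
  {C : Type*} [Category* C] {F₁ F₂ G : C ⥤ GrMod 𝒜}

/-- The homomorphism to a direct sum of two functors given by its components. -/
def addLift (f : G ⟶ F₁) (g : G ⟶ F₂) : G ⟶ add F₁ F₂ :=
  dsumLift _ _ fun k => match k with
    | ⟨0, _⟩ => f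
    | ⟨1, _⟩ => g

/-- The homomorphism from a direct sum of two functors given by its components. -/
def addDesc (f : F₁ ⟶ G) (g : F₂ ⟶ G) : add F₁ F₂ ⟶ G :=
  dsumDesc _ _ fun k => match k with
    | ⟨0, _⟩ => f
    | ⟨1, _⟩ => g

/-- A pair of elements as an element of the direct sum. -/
def addPair {X : C} (y : (F₁.obj X).carrier) (z : (F₂.obj X).carrier) :
    ((add F₁ F₂).obj X).carrier := fun k => match k with
    | ⟨0, _⟩ => y
    | ⟨1, _⟩ => z

theorem addPair_eta {X : C} (x : ((add F₁ F₂).obj X).carrier) :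
    addPair (x (0 : Fin 2)) (x (1 : Fin 2)) = x := by
  funext k
  match k with
  | ⟨0, _⟩ => rfl
  | ⟨1, _⟩ => rfl

theorem addLift_apply (f : G ⟶ F₁) (g : G ⟶ F₂) (X : C) (x : (G.obj X).carrier) :
    Hom.toLin ((addLift f g).app X) x =
      addPair (Hom.toLin (f.app X) x) (Hom.toLin (g.app X) x) := by
  funext k
  match k with
  | ⟨0, _⟩ => rfl
  | ⟨1, _⟩ => rfl

theorem addDesc_apply (f : F₁ ⟶ G) (g : F₂ ⟶ G) (X : C) (y : (F₁.obj X).carrier)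
    (z : (F₂.obj X).carrier) : Hom.toLin ((addDesc f g).app X) (addPair y z) =
      Hom.toLin (f.app X) y + Hom.toLin (g.app X) z :=
  (dsumDesc_apply _ _ _ _ _).trans (Fin.sum_univ_two _)

end GrMod

namespace BorcherdsCartanDatum

variable {I : Type v} {D : BorcherdsCartanDatum.{v, w} I} [Inhabited I]
  {κ β β₂ ν' : I →₀ ℕ} {i i' : I} (h : β + Finsupp.single i 1 = ν')
  (h₂ : β₂ + Finsupp.single i' 1 = ν') (hκ : κ + Finsupp.single i' 1 = β)
  (hκ₂ : κ + Finsupp.single i 1 = β₂) {K : Type u} [Field K] {lam : D.P}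

section Elements

/-- Dots on the last strand commute with the diagrams on the other strands. -/
theorem iota_mul_kX_pow (y : D.KLR K β) (l : ℕ) :
    D.iota h K y * D.kX ν' K β.degree ^ l = D.kX ν' K β.degree ^ l * D.iota h K y := by
  have hn := degree_of_add h
  let f : D.KLR K β →ₗ[K] D.KLR K ν' :=
    (LinearMap.mulRight K (D.kX ν' K β.degree ^ l) - LinearMap.mulLeft K (D.kX ν' K β.degree ^ l)).comp
      (D.iota h K : D.KLR K β →ₗ[K] D.KLR K ν')
  have hf (y) : y ∈ LinearMap.ker f ↔
    D.iota h K y * D.kX ν' K β.degree ^ l = D.kX ν' K β.degree ^ l * D.iota h K y := sub_eq_zero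
  refine (hf y).1 ?_
  rw [← mul_one y, ← smul_eq_mul]
  refine klr_mul_mem (fun s x hx => ?_) (fun k hk x hx => ?_) (fun k hk x hx => ?_) y 1 ?_
  · rw [hf] at *
    have e : D.kE K (s.append h) * D.kX ν' K β.degree ^ l = D.kX ν' K β.degree ^ l * _ :=
      (D.univ K).E_mul_X_pow (by omega) _ l
    rw [smul_eq_mul, iota_kE_mul, mul_assoc, hx, ← mul_assoc, e, mul_assoc]
    rfl
  · rw [hf] at *
    have e : Commute (D.kX ν' K k) (D.kX ν' K β.degree) :=
      (D.univ K).X_comm_X (univ_one D ν' K) (by omega) (by omega)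
    rw [smul_eq_mul, iota_kX_mul h hk, mul_assoc, hx, ← mul_assoc, (e.pow_right l).eq, mul_assoc]
  · rw [hf] at *
    have e : Commute (D.kX ν' K β.degree) (D.kT ν' K k) :=
      (D.univ K).X_comm_T (univ_one D ν' K) (by omega) (by omega) (by omega) (by omega)
    rw [smul_eq_mul, iota_kT_mul h hk, mul_assoc, hx, ← mul_assoc, ← (e.pow_left l).eq, mul_assoc]
  · rw [hf, (iota_one_comm_kX_pow h l).eq]

theorem kX_pow_mul_iota_one_mem (l : ℕ) :
    D.cycProj K ν' lam (D.kX ν' K β.degree ^ l * D.iota h K 1) ∈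
      D.cycGrading K ν' lam (D.r i * (2 * l)) := by
  have hn := degree_of_add h
  rw [iota_one, Finset.mul_sum, map_sum]
  refine Submodule.sum_mem _ fun s _ => ?_
  have e : D.klrGen K (.x ⟨β.degree, by omega⟩ (s.append h)) ^ l * D.kE K (s.append h) =
      D.kX ν' K β.degree ^ l * D.kE K (s.append h) := ((agreeOn_x D K (by omega) _).pow l).1
  rw [← e, map_mul, map_pow]
  refine monomialGrading.mul_mem' (monomialGrading.pow_mem
    (monomialGrading.gen_mem (g := D.cycGen K lam) (deg := D.genDeg) _) l)
    (monomialGrading.gen_mem (g := D.cycGen K lam) (deg := D.genDeg) (.e _)) ?_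
  have : (s.append h).col ⟨β.degree, by omega⟩ = i := by
    rw [SeqOf.append]; simp
  rw [genDeg, genDeg, this]
  ring

variable (K lam) in
/-- The crossing of the last two strands, of given colours. -/
def cycCross : D.Cyc K ν' lam :=
  D.cycProj K ν' lam (D.kT ν' K κ.degree * D.iota h K (D.iota hκ K 1))

include h₂ hκ₂ in
theorem strand_mul_cycCross (c : D.Cyc K κ lam) :
    D.strand K h₂ lam (D.strand K hκ₂ lam c) * cycCross h hκ K lam =
      cycCross h hκ K lam * D.strand K h lam (D.strand K hκ lam c) := by
  obtain ⟨c, rfl⟩ := cycProj_surjective lam c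
  rw [cycCross, strand_cycProj, strand_cycProj, strand_cycProj, strand_cycProj, ← map_mul,
    ← map_mul, iota_iota_mul_kT h h₂ hκ hκ₂, mul_assoc, ← map_mul (D.iota h K), iota_one_mul,
    iota_mul_one]

theorem cycCross_mem : cycCross h hκ K lam ∈ D.cycGrading K ν' lam (D.r i' * -D.a i' i) := by
  have hn := degree_of_add h
  have hn2 := degree_of_add hκ
  rw [cycCross, iota_one hκ, map_sum, Finset.mul_sum, map_sum]
  refine Submodule.sum_mem _ fun s _ => ?_
  rw [← mul_one (D.kE K _), iota_kE_mul, kE_append_mul_iota_one, D.kT_mul_kE K (by omega)]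
  have := monomialGrading.gen_mem (K := K) (g := D.cycGen K lam) (deg := D.genDeg)
    (Gen.t (ν := ν') κ.degree (by omega) ((s.append hκ).append h))
  have e1 : ((s.append hκ).append h).col ⟨κ.degree, by omega⟩ = i' := by
    rw [SeqOf.append_col h _ κ.degree (by omega), SeqOf.append]; simp
  have e2 : ((s.append hκ).append h).col ⟨κ.degree + 1, by omega⟩ = i := by
    simp [SeqOf.append, hn2]
  rw [genDeg, e1, e2, form_α_α, D.r_symm, ← mul_neg] at this
  exact this

include h₂ hκ₂ in
theorem strand_mul_cycCross_mul (x : D.KLR K β₂) (y : D.KLR K β) :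
    D.strand K h₂ lam (D.cycProj K β₂ lam x) * cycCross h hκ K lam *
      (D.strand K h lam (D.strand K hκ lam 1 * D.cycProj K β lam y)) =
      D.cycProj K ν' lam (D.cross h h₂ K x y) := by
  have e1 := cross_iota h h₂ hκ hκ₂ x 1 y
  rw [cross_iota_one h h₂ hκ hκ₂] at e1
  rw [e1, cycCross, ← map_one (D.cycProj K κ lam), strand_cycProj, strand_cycProj,
    ← map_mul (D.cycProj K β lam), strand_cycProj, ← map_mul, ← map_mul, mul_assoc, mul_assoc,
    ← map_mul (D.iota h K), ← mul_assoc (D.iota hκ K 1), iota_one_mul]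

end Elements

section Mu

variable (M : Type*) [AddCommGroup M] [Module K M] [Module (D.Cyc K β lam) M]
  [IsScalarTower K (D.Cyc K β lam) M]

variable (K lam) in
/-- The bilinear map `(a ⊗ b, x) ↦ a ⊗ b x`. -/
def crossMu : letI := GrMod.resModule (D.strand K hκ lam) M
    D.KLR K β₂ →ₗ[K] D.KLR K β →ₗ[K] M →ₗ[K]
      GrMod.IndCarrier (D.strand K hκ₂ lam) (GrMod.resCarrier (D.strand K hκ lam) M) :=
  letI := GrMod.resModule (D.strand K hκ lam) M
  (GrMod.resIndMk (D.strand K hκ₂ lam) (D.strand K hκ lam) M).compl₁₂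
    (D.cycProj K β₂ lam).toLinearMap (D.cycProj K β lam).toLinearMap

theorem crossMu_apply (x : D.KLR K β₂) (y : D.KLR K β) (z : M) :
    letI := GrMod.resModule (D.strand K hκ lam) M
    crossMu hκ hκ₂ K lam M x y z = GrMod.indMk₂ (D.strand K hκ₂ lam)
      (GrMod.resCarrier (D.strand K hκ lam) M) (D.cycProj K β₂ lam x)
      (GrMod.resProj (D.strand K hκ lam) M (D.cycProj K β lam y • z)) := rfl

theorem lift_crossMu_eq_zero {x : D.KLR K β₂ ⊗[K] D.KLR K β}
    (hx : TensorProduct.lift (D.cross h h₂ K) x ∈ crossKer h h₂ K lam) :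
    letI := GrMod.resModule (D.strand K hκ lam) M
    TensorProduct.lift (crossMu hκ hκ₂ K lam M) x = 0 := by
  letI := GrMod.resModule (D.strand K hκ lam) M
  refine eq_zero_of_cross_mem h h₂ hκ hκ₂ (lam := lam) (crossMu hκ hκ₂ K lam M)
    (fun a y hy => ?_) (fun a ha y => ?_) (fun a c y => ?_) (fun a y => ?_) le_rfl x hx
  · ext z
    rw [crossMu_apply, mem_cycKer.1 hy, zero_smul, map_zero, map_zero, LinearMap.zero_apply]
  · ext z
    rw [crossMu_apply, mem_cycKer.1 ha, map_zero, LinearMap.zero_apply, LinearMap.zero_apply]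
  · ext z
    rw [crossMu_apply, crossMu_apply, map_mul, ← strand_cycProj, GrMod.indMk₂_mul, map_mul,
      ← strand_cycProj, mul_smul]
    congr 1
    refine Subtype.ext ?_
    change D.strand K hκ lam _ • D.strand K hκ lam 1 • _ = D.strand K hκ lam 1 • _
    rw [← mul_smul, ← mul_smul, GrMod.mul_map_one, mul_smul, ← mul_smul, ← mul_smul,
      ← mul_assoc, GrMod.map_one_mul]
  · ext z
    rw [crossMu_apply, crossMu_apply, map_mul, ← strand_cycProj, map_one, GrMod.indMk₂_mul_map_one]

/-- The right action. -/
theorem lift_crossMu_mul (x : D.KLR K β₂ ⊗[K] D.KLR K β) (r : D.KLR K β) (z : M) :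
    letI := GrMod.resModule (D.strand K hκ lam) M
    TensorProduct.lift (crossMu hκ hκ₂ K lam M) (LinearMap.lTensor _ (LinearMap.mulRight K r) x) z =
      TensorProduct.lift (crossMu hκ hκ₂ K lam M) x (D.cycProj K β lam r • z) := by
  letI := GrMod.resModule (D.strand K hκ lam) M
  induction x using TensorProduct.induction_on with
  | zero => simp
  | add y z hy hz => simp only [map_add, LinearMap.add_apply, hy, hz]
  | tmul x y =>
    rw [LinearMap.lTensor_tmul, TensorProduct.lift.tmul, TensorProduct.lift.tmul, crossMu_apply,
      crossMu_apply, LinearMap.mulRight_apply, map_mul, mul_smul]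

theorem mem_span_crossMu (v : letI := GrMod.resModule (D.strand K hκ lam) M
      GrMod.IndCarrier (D.strand K hκ₂ lam) (GrMod.resCarrier (D.strand K hκ lam) M)) :
    letI := GrMod.resModule (D.strand K hκ lam) M
    v ∈ Submodule.span K {v | ∃ x z, v = TensorProduct.lift (crossMu hκ hκ₂ K lam M) x z} := by
  letI := GrMod.resModule (D.strand K hκ lam) M
  refine Submodule.span_mono ?_
    (GrMod.mem_span_resIndMk (D.strand K hκ₂ lam) (D.strand K hκ lam) M v)
  rintro _ ⟨a, b, z, rfl⟩
  obtain ⟨a, rfl⟩ := cycProj_surjective lam a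
  obtain ⟨b, rfl⟩ := cycProj_surjective lam b
  exact ⟨a ⊗ₜ b, z, by rw [TensorProduct.lift.tmul]; rfl⟩

theorem lift_cross_mul (x : D.KLR K β₂ ⊗[K] D.KLR K β) (r : D.KLR K β) :
    TensorProduct.lift (D.cross h h₂ K) (LinearMap.lTensor _ (LinearMap.mulRight K r) x) =
      TensorProduct.lift (D.cross h h₂ K) x * D.iota h K r := by
  induction x using TensorProduct.induction_on with
  | zero => simp
  | add y z hy hz => simp only [map_add, add_mul, hy, hz]
  | tmul x y =>
    rw [LinearMap.lTensor_tmul, TensorProduct.lift.tmul, TensorProduct.lift.tmul,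
      LinearMap.mulRight_apply, cross_mul_right]

end Mu

section Transformations

variable (K lam)

/-- The homomorphism of functors given by the crossing of the last two strands. -/
def crossTrans : (D.E K hκ lam ⋙ D.F K hκ₂ lam) ⋙ D.qShift K lam i' (-D.a i' i) ⟶
    D.F K h lam ⋙ D.E K h₂ lam :=
  GrMod.crossNat (D.strand K hκ₂ lam) (D.strand K hκ lam) (D.strand K h lam) (D.strand K h₂ lam)
    (cycCross h hκ K lam) (strand_mul_cycCross h h₂ hκ hκ₂) (D.strand_mem K hκ₂ lam)
    (D.strand_mem K hκ lam) (D.strand_mem K h lam) (D.strand_mem K h₂ lam) (cycCross_mem h hκ)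

theorem crossTrans_lift (M : D.CycMod K β lam) (x : D.KLR K β₂ ⊗[K] D.KLR K β) (z : M.carrier) :
    (GrMod.Hom.toLin ((crossTrans h h₂ hκ hκ₂ K lam).app M)
      (TensorProduct.lift (crossMu hκ hκ₂ K lam M.carrier) x z) : GrMod.resCarrier
        (D.strand K h₂ lam) (GrMod.IndCarrier (D.strand K h lam) M.carrier)).1 =
      GrMod.indMk₂ (D.strand K h lam) M.carrier
        (D.cycProj K ν' lam (TensorProduct.lift (D.cross h h₂ K) x)) z := by
  letI := GrMod.resModule (D.strand K hκ lam) M.carrier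
  induction x using TensorProduct.induction_on with
  | zero =>
    simp only [map_zero, LinearMap.zero_apply]
    exact congrArg Subtype.val (map_zero (GrMod.Hom.toLin ((crossTrans h h₂ hκ hκ₂ K lam).app M)))
  | add x y hx hy =>
    simp only [map_add, LinearMap.add_apply]
    rw [← hx, ← hy]
    exact congrArg Subtype.val (map_add (GrMod.Hom.toLin ((crossTrans h h₂ hκ hκ₂ K lam).app M)) _ _)
  | tmul x y =>
    rw [TensorProduct.lift.tmul, TensorProduct.lift.tmul,
      ← strand_mul_cycCross_mul h h₂ hκ hκ₂, GrMod.indMk₂_mul, mul_smul]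
    exact GrMod.crossNat_app (D.strand K hκ₂ lam) (D.strand K hκ lam) (D.strand K h lam)
      (D.strand K h₂ lam) (cycCross h hκ K lam) (strand_mul_cycCross h h₂ hκ hκ₂)
      (D.strand_mem K hκ₂ lam) (D.strand_mem K hκ lam) (D.strand_mem K h lam)
      (D.strand_mem K h₂ lam) (cycCross_mem h hκ) M _ _

/-- The homomorphism of functors given by dots on the last strand. -/
def dotTrans (l : ℕ) : D.qShift K lam i (2 * (l : ℤ)) ⟶ D.F K h lam ⋙ D.E K h lam :=
  GrMod.dotNat (D.strand K h lam) (D.cycProj K ν' lam (D.kX ν' K β.degree ^ l))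
    (fun c => by
      obtain ⟨c, rfl⟩ := cycProj_surjective lam c
      rw [strand_cycProj, ← map_mul, ← map_mul, iota_mul_kX_pow])
    (D.strand_mem K h lam) (by
      rw [← map_one (D.cycProj K β lam), strand_cycProj, ← map_mul]
      exact kX_pow_mul_iota_one_mem h l)

/-- The homomorphism of functors given by dots on the strand that is cut off. -/
def momentTrans (hκ : κ + Finsupp.single i 1 = β) (hi : D.a i i = 2) (k : ℕ) :
    (D.E K hκ lam ⋙ D.F K hκ lam) ⋙ D.qShift K lam i (-D.a i i) ⟶
      D.qShift K lam i (-2 * (k : ℤ) - 2) :=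
  GrMod.momentNat (D.strand K hκ lam) (D.cycProj K β lam (D.kX β K κ.degree ^ k * D.iota hκ K 1))
    (fun c => by
      obtain ⟨c, rfl⟩ := cycProj_surjective lam c
      rw [strand_cycProj, ← map_mul, ← map_mul, mul_assoc, iota_one_mul, ← mul_assoc,
        iota_mul_kX_pow, mul_assoc, iota_mul_one])
    (D.strand_mem K hκ lam) (kX_pow_mul_iota_one_mem hκ k) (by rw [hi]; ring)

end Transformations

end BorcherdsCartanDatum

namespace GrMod

section Presentation

variable {K : Type u} [Field K] {B C A' : Type a} [Ring B] [Algebra K B] [Ring C] [Algebra K C]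
  [Ring A'] [Algebra K A'] {ℬ : ℤ → Submodule K B} {𝒞 : ℤ → Submodule K C}
  {𝒜' : ℤ → Submodule K A'} [GradedAlgebra ℬ] [GradedAlgebra 𝒞] [GradedAlgebra 𝒜']
  {φ : B →ₙₐ[K] A'} {φ' : C →ₙₐ[K] A'} {hφ : ∀ d, ∀ r ∈ ℬ d, φ r ∈ 𝒜' d}
  {hφ' : ∀ d, ∀ r ∈ 𝒞 d, φ' r ∈ 𝒜' d} {M : GrMod ℬ} {X : GrMod 𝒞}
  {Ξ : Type*} [AddCommGroup Ξ] [Module K Ξ]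

theorem bijective_of_moments (f : X ⟶ (ind φ hφ ⋙ res φ' hφ').obj M) {ι : Type*} [Fintype ι]
    (Ψ : X.carrier →ₗ[K] (ι → M.carrier))
    (p : Ξ →ₗ[K] A') (q : Ξ →ₗ[K] (ι → B)) (μ : Ξ →ₗ[K] M.carrier →ₗ[K] X.carrier)
    (hinj : ∀ ξ, p ξ = 0 → q ξ = 0 → ∀ x, μ ξ x = 0)
    (hsurj : ∀ b c, ∃ ξ, p ξ = φ' 1 * (b * φ 1) ∧ q ξ = c)
    (hact : ∀ ξ r, ∃ ξ', p ξ' = p ξ * φ r ∧ (∀ k, q ξ' k = q ξ k * r) ∧ ∀ x, μ ξ' x = μ ξ (r • x))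
    (h1 : ∀ ξ x, (Hom.toLin f (μ ξ x) : resCarrier φ' (IndCarrier φ M.carrier)).1 =
      indMk₂ φ M.carrier (p ξ) x)
    (h2 : ∀ ξ x k, Ψ (μ ξ x) k = q ξ k • x) (hp : ∀ ξ, φ' 1 * (p ξ * φ 1) = p ξ)
    (hspan : ∀ v, v ∈ Submodule.span K {v | ∃ ξ x, v = μ ξ x}) :
    Function.Bijective fun v => (Hom.toLin f v, Ψ v) := by
  let Ψ₁ : X.carrier →ₗ[K] IndCarrier φ M.carrier :=
    (resCarrier φ' (IndCarrier φ M.carrier)).subtype.comp ((Hom.toLin f).restrictScalars K)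
  constructor
  · intro v w hvw
    obtain ⟨e1, e2⟩ := Prod.ext_iff.1 hvw
    rw [← sub_eq_zero]
    refine injective_of_presentation φ (φ' 1) hinj hsurj hact Ψ₁ Ψ h1 h2 hp hspan ?_ ?_
    · rw [map_sub, sub_eq_zero]
      exact congrArg Subtype.val e1
    · rw [map_sub, sub_eq_zero]
      exact e2
  · rintro ⟨z, c⟩
    obtain ⟨v, e1, e2⟩ := surjective_of_presentation φ (φ' 1) hsurj Ψ₁ Ψ h1 h2
      (z := (z : resCarrier φ' (IndCarrier φ M.carrier)).1)
      (z : resCarrier φ' (IndCarrier φ M.carrier)).2 c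
    exact ⟨v, Prod.ext (Subtype.ext e1) e2⟩

theorem bijective_of_presentation (f : X ⟶ (ind φ hφ ⋙ res φ' hφ').obj M)
    (p : Ξ →ₗ[K] A') (μ : Ξ →ₗ[K] M.carrier →ₗ[K] X.carrier)
    (hinj : ∀ ξ, p ξ = 0 → ∀ x, μ ξ x = 0)
    (hsurj : ∀ b, ∃ ξ, p ξ = φ' 1 * (b * φ 1))
    (hact : ∀ ξ r, ∃ ξ', p ξ' = p ξ * φ r ∧ ∀ x, μ ξ' x = μ ξ (r • x))
    (h1 : ∀ ξ x, (Hom.toLin f (μ ξ x) : resCarrier φ' (IndCarrier φ M.carrier)).1 =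
      indMk₂ φ M.carrier (p ξ) x)
    (hp : ∀ ξ, φ' 1 * (p ξ * φ 1) = p ξ)
    (hspan : ∀ v, v ∈ Submodule.span K {v | ∃ ξ x, v = μ ξ x}) :
    Function.Bijective (Hom.toLin f) := by
  have := bijective_of_moments f (ι := Fin 0) 0 p 0 μ (fun ξ h _ => hinj ξ h)
    (fun b c => (hsurj b).imp fun ξ h => ⟨h, Subsingleton.elim _ _⟩)
    (fun ξ r => (hact ξ r).imp fun ξ' h => ⟨h.1, fun k => k.elim0, h.2⟩) h1
    (fun _ _ k => k.elim0) hp hspan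
  refine ⟨fun v w h => this.1 (Prod.ext h rfl), fun z => ?_⟩
  obtain ⟨v, hv⟩ := this.2 (z, 0)
  exact ⟨v, congrArg Prod.fst hv⟩

end Presentation

section Add

variable {K : Type u} [Field K] {A : Type a} [Ring A] [Algebra K A] {𝒜 : ℤ → Submodule K A}
  {C : Type*} [Category* C] {F₁ F₂ : C ⥤ GrMod 𝒜}

variable (F₁ F₂) in
/-- Pairs of elements as elements of the direct sum. -/
def addPairₗ (X : C) : ((F₁.obj X).carrier × (F₂.obj X).carrier) →ₗ[K]
    ((add F₁ F₂).obj X).carrier where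
  toFun y := addPair y.1 y.2
  map_add' _ _ := funext fun k => match k with
    | ⟨0, _⟩ => rfl
    | ⟨1, _⟩ => rfl
  map_smul' _ _ := funext fun k => match k with
    | ⟨0, _⟩ => rfl
    | ⟨1, _⟩ => rfl

end Add

end GrMod

namespace BorcherdsCartanDatum

variable {I : Type v} {D : BorcherdsCartanDatum.{v, w} I} [Inhabited I]
  {κ β β₂ ν' : I →₀ ℕ} {i i' : I} (h : β + Finsupp.single i 1 = ν')
  (h₂ : β₂ + Finsupp.single i' 1 = ν') (hκ : κ + Finsupp.single i' 1 = β)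
  (hκ₂ : κ + Finsupp.single i 1 = β₂) {K : Type u} [Field K] {lam : D.P}

variable (lam) in
theorem strand_one_mul_cycProj (z : D.KLR K ν') : D.strand K h lam 1 * D.cycProj K ν' lam z =
    D.cycProj K ν' lam (D.iota h K 1 * z) := by
  rw [← map_one (D.cycProj K β lam), strand_cycProj, map_mul]

variable (lam) in
theorem cycProj_mul_strand_one (z : D.KLR K ν') : D.cycProj K ν' lam z * D.strand K h lam 1 =
    D.cycProj K ν' lam (z * D.iota h K 1) := by
  rw [← map_one (D.cycProj K β lam), strand_cycProj, map_mul]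

/-- For different colours, `F` and `E` commute up to a shift. -/
theorem nonempty_iso_of_ne (hi : i ≠ i') :
    Nonempty ((D.E K hκ lam ⋙ D.F K hκ₂ lam) ⋙ D.qShift K lam i' (-D.a i' i) ≅
      D.F K h lam ⋙ D.E K h₂ lam) := by
  refine GrMod.nonempty_iso_of_bijective (crossTrans h h₂ hκ hκ₂ K lam) fun M => ?_
  let μ : D.KLR K β₂ ⊗[K] D.KLR K β →ₗ[K] M.carrier →ₗ[K]
      (((D.E K hκ lam ⋙ D.F K hκ₂ lam) ⋙ D.qShift K lam i' (-D.a i' i)).obj M).carrier :=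
    TensorProduct.lift (crossMu hκ hκ₂ K lam M.carrier)
  have H := GrMod.bijective_of_presentation (Ξ := D.KLR K β₂ ⊗[K] D.KLR K β)
    ((crossTrans h h₂ hκ hκ₂ K lam).app M)
    ((D.cycProj K ν' lam).toLinearMap.comp (TensorProduct.lift (D.cross h h₂ K))) μ
  refine H (fun ξ hξ x => ?_) (fun b => ?_) (fun ξ r => ?_) (crossTrans_lift h h₂ hκ hκ₂ K lam M)
    (fun ξ => ?_) (mem_span_crossMu hκ hκ₂ M.carrier)
  · exact LinearMap.congr_fun
      (lift_crossMu_eq_zero h h₂ hκ hκ₂ M.carrier (lift_cross_mem_of_ne h h₂ hi hξ)) x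
  · obtain ⟨b, rfl⟩ := cycProj_surjective lam b
    obtain ⟨x, hx⟩ := exists_cross_of_ne h h₂ hi b
    refine ⟨x, ?_⟩
    rw [cycProj_mul_strand_one, strand_one_mul_cycProj, ← hx]
    rfl
  · obtain ⟨r, rfl⟩ := cycProj_surjective lam r
    refine ⟨LinearMap.lTensor _ (LinearMap.mulRight K r) ξ, ?_,
      lift_crossMu_mul hκ hκ₂ M.carrier ξ r⟩
    rw [LinearMap.comp_apply, lift_cross_mul, strand_cycProj]
    exact map_mul (D.cycProj K ν' lam) _ _
  · rw [LinearMap.comp_apply, AlgHom.toLinearMap_apply, cycProj_mul_strand_one,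
      strand_one_mul_cycProj, cross_mul_iota_one, iota_one_mul_cross]

end BorcherdsCartanDatum

namespace BorcherdsCartanDatum

variable {I : Type v} {D : BorcherdsCartanDatum.{v, w} I} [Inhabited I]
  {κ β ν' : I →₀ ℕ} {i : I} (h : β + Finsupp.single i 1 = ν')
  {K : Type u} [Field K] {lam : D.P}

section Dominant

variable (K) in
/-- The sum of the products of the given diagrams with dots on the last strand. -/
def dotSum (m : ℕ) : (Fin m → D.KLR K β) →ₗ[K] D.KLR K ν' :=
  ∑ l : Fin m, (LinearMap.mulLeft K (D.kX ν' K β.degree ^ (l : ℕ))).comp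
    ((D.iota h K : D.KLR K β →ₗ[K] D.KLR K ν').comp (LinearMap.proj l))

theorem dotSum_apply (m : ℕ) (b : Fin m → D.KLR K β) :
    dotSum h K m b = ∑ l : Fin m, D.kX ν' K β.degree ^ (l : ℕ) * D.iota h K (b l) :=
  LinearMap.sum_apply _ _ _

theorem dotSum_mul (m : ℕ) (b : Fin m → D.KLR K β) (r : D.KLR K β) :
    dotSum h K m (fun l => b l * r) = dotSum h K m b * D.iota h K r := by
  rw [dotSum_apply, dotSum_apply, Finset.sum_mul]
  refine Finset.sum_congr rfl fun l _ => ?_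
  rw [map_mul, mul_assoc]

theorem iota_one_mul_dotSum (m : ℕ) (b : Fin m → D.KLR K β) :
    D.iota h K 1 * dotSum h K m b = dotSum h K m b := by
  rw [dotSum_apply, Finset.mul_sum]
  refine Finset.sum_congr rfl fun l _ => ?_
  rw [← mul_assoc, (iota_one_comm_kX_pow h _).eq, mul_assoc, iota_one_mul]

theorem dotSum_mul_iota_one (m : ℕ) (b : Fin m → D.KLR K β) :
    dotSum h K m b * D.iota h K 1 = dotSum h K m b := by
  rw [← dotSum_mul]
  simp only [mul_one]

theorem exists_dotSum {m : ℕ} (hm : D.h i (lam - D.root β) ≤ m) {z : D.KLR K ν'}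
    (hz : z ∈ cutSpan h K lam) : ∃ x b,
      TensorProduct.lift (D.cross h h K) x + dotSum h K m b = z := by
  obtain ⟨_, ⟨x, rfl⟩, y, hy, rfl⟩ := Submodule.mem_sup.1 hz
  have : y ∈ LinearMap.range (dotSum (D := D) h K m) := by
    refine Submodule.span_le.2 ?_ hy
    rintro _ ⟨l, hl, b, rfl⟩
    refine ⟨Pi.single ⟨l, by omega⟩ b, ?_⟩
    rw [dotSum_apply, Finset.sum_eq_single ⟨l, by omega⟩ (fun k _ hk => ?_)
      (fun hk => absurd (Finset.mem_univ _) hk), Pi.single_eq_same]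
    rw [Pi.single_eq_of_ne hk, map_zero, mul_zero]
  obtain ⟨b, rfl⟩ := this
  exact ⟨x, b, rfl⟩

theorem lift_cross_add_dotSum_mem (hlam : D.IsDominant lam) {m : ℕ}
    (hm : m ≤ D.h i (lam - D.root β)) {x : D.KLR K β ⊗[K] D.KLR K β} {b : Fin m → D.KLR K β}
    (hx : D.cycProj K ν' lam (TensorProduct.lift (D.cross h h K) x + dotSum h K m b) = 0) :
    (∀ l, b l ∈ cycKer β K lam) ∧
      TensorProduct.lift (D.cross h h K) x ∈ crossKer h h K lam := by
  have := lift_cross_mem h hlam (Or.inr hm) (fun l => if hl : l < m then b ⟨l, hl⟩ else 0)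
    (fun a ha => coeff_lastRow_cross_nonpos h (by omega) x) (by
      rw [Finset.sum_range]
      simpa only [Fin.is_lt, dite_true, Fin.eta, ← dotSum_apply h m b] using hx)
  refine ⟨fun l => ?_, this.2⟩
  have := this.1 l l.2
  rwa [dif_pos l.2] at this

variable (lam) in
/-- The action of tuples. -/
def tupleSMul (m : ℕ) (M : Type*) [AddCommGroup M] [Module K M] [Module (D.Cyc K β lam) M]
    [IsScalarTower K (D.Cyc K β lam) M] : (Fin m → D.KLR K β) →ₗ[K] M →ₗ[K] (Fin m → M) :=
  LinearMap.mk₂ K (fun b z l => D.cycProj K β lam (b l) • z)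
    (fun b b' z => funext fun l => by
      rw [Pi.add_apply, map_add, add_smul]
      rfl)
    (fun c b z => funext fun l => by
      rw [Pi.smul_apply, map_smul, smul_assoc]
      rfl)
    (fun b z z' => funext fun l => smul_add _ _ _)
    (fun c b z => funext fun l => smul_comm _ _ _)

theorem tupleSMul_apply (m : ℕ) {M : Type*} [AddCommGroup M] [Module K M]
    [Module (D.Cyc K β lam) M] [IsScalarTower K (D.Cyc K β lam) M] (b : Fin m → D.KLR K β) (z : M)
    (l : Fin m) : tupleSMul lam m M b z l = D.cycProj K β lam (b l) • z := rfl

theorem tupleSMul_mul (m : ℕ) {M : Type*} [AddCommGroup M] [Module K M]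
    [Module (D.Cyc K β lam) M] [IsScalarTower K (D.Cyc K β lam) M] (b : Fin m → D.KLR K β)
    (r : D.KLR K β) (z : M) :
    tupleSMul lam m M (fun l => b l * r) z = tupleSMul lam m M b (D.cycProj K β lam r • z) :=
  funext fun l => by rw [tupleSMul_apply, tupleSMul_apply, map_mul, mul_smul]

theorem mem_span_tupleSMul (m : ℕ) {M : Type*} [AddCommGroup M] [Module K M]
    [Module (D.Cyc K β lam) M] [IsScalarTower K (D.Cyc K β lam) M] (w : Fin m → M) :
    w ∈ Submodule.span K {w | ∃ (b : Fin m → D.KLR K β) (z : _), w = tupleSMul lam m M b z} := by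
  have : w = ∑ l : Fin m, tupleSMul lam m M (Pi.single l (1 : D.KLR K β)) (w l) := by
    funext k
    rw [Finset.sum_apply, Finset.sum_eq_single k (fun l _ hl => ?_)
      (fun hk => absurd (Finset.mem_univ _) hk), tupleSMul_apply, Pi.single_eq_same, map_one,
      one_smul]
    rw [tupleSMul_apply, Pi.single_eq_of_ne hl.symm, map_zero, zero_smul]
  rw [this]
  exact Submodule.sum_mem _ fun l _ => Submodule.subset_span ⟨_, _, rfl⟩

variable (K lam) in
/-- The homomorphism given by dots on the last strand. -/
def dotsTrans (m : ℕ) : (GrMod.dsum fun k : Fin m => D.qShift K lam i (2 * (k : ℤ))) ⟶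
    D.F K h lam ⋙ D.E K h lam :=
  GrMod.dsumDesc _ _ fun k => dotTrans h K lam k

theorem dotsTrans_tupleSMul (m : ℕ) (M : D.CycMod K β lam) (b : Fin m → D.KLR K β)
    (z : M.carrier) :
    (GrMod.Hom.toLin ((dotsTrans h K lam m).app M) (tupleSMul lam m M.carrier b z) :
      GrMod.resCarrier (D.strand K h lam) (GrMod.IndCarrier (D.strand K h lam) M.carrier)).1 =
      GrMod.indMk₂ (D.strand K h lam) M.carrier (D.cycProj K ν' lam (dotSum h K m b)) z := by
  refine (congrArg Subtype.val (GrMod.dsumDesc_apply _ _ _ M _)).trans ?_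
  refine (map_sum (GrMod.resCarrier (D.strand K h lam)
    (GrMod.IndCarrier (D.strand K h lam) M.carrier)).subtype _ _).trans ?_
  rw [dotSum_apply, map_sum, map_sum, LinearMap.sum_apply]
  refine Finset.sum_congr rfl fun l _ => ?_
  rw [map_mul, ← strand_cycProj, GrMod.indMk₂_mul]
  rfl

theorem nonempty_iso_of_nonneg (hlam : D.IsDominant lam) {m : ℕ}
    (hm : D.h i (lam - D.root β) = m) (X : D.CycMod K β lam ⥤ D.CycMod K β lam)
    (T : X ⟶ D.F K h lam ⋙ D.E K h lam)
    (μ : ∀ M : D.CycMod K β lam,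
      D.KLR K β ⊗[K] D.KLR K β →ₗ[K] M.carrier →ₗ[K] (X.obj M).carrier)
    (hT : ∀ M x z, (GrMod.Hom.toLin (T.app M) (μ M x z) : GrMod.resCarrier
        (D.strand K h lam) (GrMod.IndCarrier (D.strand K h lam) M.carrier)).1 =
      GrMod.indMk₂ (D.strand K h lam) M.carrier
        (D.cycProj K ν' lam (TensorProduct.lift (D.cross h h K) x)) z)
    (hinj : ∀ M x, TensorProduct.lift (D.cross h h K) x ∈ crossKer h h K lam → μ M x = 0)
    (hact : ∀ M x r z, μ M (LinearMap.lTensor _ (LinearMap.mulRight K r) x) z =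
      μ M x (D.cycProj K β lam r • z))
    (hspan : ∀ M v, v ∈ Submodule.span K {v | ∃ x z, v = μ M x z}) :
    Nonempty (GrMod.add X (GrMod.dsum fun k : Fin m => D.qShift K lam i (2 * (k : ℤ))) ≅
      D.F K h lam ⋙ D.E K h lam) := by
  refine GrMod.nonempty_iso_of_bijective (GrMod.addDesc T (dotsTrans h K lam m)) fun M => ?_
  let P := GrMod.addPairₗ X (GrMod.dsum fun k : Fin m => D.qShift K lam i (2 * (k : ℤ))) M
  let ξμ : (D.KLR K β ⊗[K] D.KLR K β) × (Fin m → D.KLR K β) →ₗ[K] M.carrier →ₗ[K]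
      ((GrMod.add X (GrMod.dsum fun k : Fin m => D.qShift K lam i (2 * (k : ℤ)))).obj M).carrier :=
    LinearMap.mk₂ K (fun ξ z => P (μ M ξ.1 z, tupleSMul lam m M.carrier ξ.2 z))
      (fun ξ ξ' z => (congrArg P (Prod.ext (LinearMap.map_add₂ (μ M) _ _ _)
        (LinearMap.map_add₂ (tupleSMul lam m M.carrier) _ _ _))).trans (map_add P _ _))
      (fun c ξ z => (congrArg P (Prod.ext (LinearMap.map_smul₂ (μ M) _ _ _)
        (LinearMap.map_smul₂ (tupleSMul lam m M.carrier) _ _ _))).trans (map_smul P _ _))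
      (fun ξ z z' => (congrArg P (Prod.ext (map_add (μ M _) _ _)
        (map_add (tupleSMul lam m M.carrier _) _ _))).trans (map_add P _ _))
      (fun c ξ z => (congrArg P (Prod.ext (map_smul (μ M _) _ _)
        (map_smul (tupleSMul lam m M.carrier _) _ _))).trans (map_smul P _ _))
  have H := GrMod.bijective_of_presentation
    (Ξ := (D.KLR K β ⊗[K] D.KLR K β) × (Fin m → D.KLR K β))
    ((GrMod.addDesc T (dotsTrans h K lam m)).app M)
    ((D.cycProj K ν' lam).toLinearMap.comp
      ((TensorProduct.lift (D.cross h h K)).coprod (dotSum h K m))) ξμ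
  refine H (fun ξ hξ z => ?_) (fun b => ?_) (fun ξ r => ?_) (fun ξ z => ?_) (fun ξ => ?_)
    (fun v => ?_)
  · obtain ⟨h1, h2⟩ := lift_cross_add_dotSum_mem h hlam hm.ge hξ
    refine (congrArg P (Prod.ext (LinearMap.congr_fun (hinj M ξ.1 h2) z)
      (funext fun l => ?_))).trans (map_zero P)
    exact (congrArg (· • z) (mem_cycKer.1 (h1 l))).trans (zero_smul _ _)
  · obtain ⟨b, rfl⟩ := cycProj_surjective lam b
    obtain ⟨z, hz, e⟩ := cycProj_cut_mem h hlam b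
    obtain ⟨x, p, rfl⟩ := exists_dotSum h hm.le hz
    refine ⟨(x, p), ?_⟩
    rw [cycProj_mul_strand_one, strand_one_mul_cycProj]
    exact e
  · obtain ⟨r, rfl⟩ := cycProj_surjective lam r
    refine ⟨(LinearMap.lTensor _ (LinearMap.mulRight K r) ξ.1, fun l => ξ.2 l * r), ?_,
      fun z => ?_⟩
    · rw [LinearMap.comp_apply, LinearMap.coprod_apply, lift_cross_mul, strand_cycProj, dotSum_mul,
        ← add_mul]
      exact map_mul (D.cycProj K ν' lam) _ _
    · exact congrArg P (Prod.ext (hact M ξ.1 r z) (tupleSMul_mul m ξ.2 r z))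
  · refine (congrArg Subtype.val (GrMod.addDesc_apply _ _ M _ _)).trans
      ((congrArg₂ (· + ·) (hT M ξ.1 z) (dotsTrans_tupleSMul h m M ξ.2 z)).trans ?_)
    rw [LinearMap.comp_apply, LinearMap.coprod_apply, AlgHom.toLinearMap_apply, map_add, map_add,
      LinearMap.add_apply]
    rfl
  · rw [LinearMap.comp_apply, AlgHom.toLinearMap_apply, cycProj_mul_strand_one,
      strand_one_mul_cycProj, LinearMap.coprod_apply, add_mul, mul_add, cross_mul_iota_one,
      iota_one_mul_cross, dotSum_mul_iota_one, iota_one_mul_dotSum]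
  · let W := Submodule.span K {v | ∃ ξ z, v = ξμ ξ z}
    have h1 : Submodule.span K {v | ∃ x z, v = μ M x z} ≤
        W.comap (P.comp (LinearMap.inl K _ _)) := by
      refine Submodule.span_le.2 ?_
      rintro _ ⟨x, z, rfl⟩
      exact Submodule.subset_span ⟨(x, 0), z, congrArg P (Prod.ext rfl
        (LinearMap.map_zero₂ (tupleSMul lam m M.carrier) z).symm)⟩
    have h2 : Submodule.span K {w | ∃ (b : Fin m → D.KLR K β) (z : _), w = tupleSMul lam m M.carrier b z} ≤
        W.comap (P.comp (LinearMap.inr K _ _)) := by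
      refine Submodule.span_le.2 ?_
      rintro _ ⟨b, z, rfl⟩
      exact Submodule.subset_span ⟨(0, b), z, congrArg P (Prod.ext
        (LinearMap.map_zero₂ (μ M) z).symm rfl)⟩
    obtain ⟨y, z, rfl⟩ : ∃ y z, v = P (y, z) :=
      ⟨v (0 : Fin 2), v (1 : Fin 2), (GrMod.addPair_eta v).symm⟩
    have e : P (y, z) = P (y, 0) + P (0, z) := by
      rw [← map_add, Prod.mk_add_mk, add_zero, zero_add]
    rw [e]
    exact W.add_mem (h1 (hspan M y)) (h2 (mem_span_tupleSMul m z))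

theorem lift_cross_eq_zero {β₂ : I →₀ ℕ} {i' : I} (h₂ : β₂ + Finsupp.single i' 1 = ν')
    (hκ : β₂ - Finsupp.single i 1 + Finsupp.single i 1 ≠ β₂) (x : D.KLR K β₂ ⊗[K] D.KLR K β) :
    TensorProduct.lift (D.cross h h₂ K) x = 0 := by
  have e := degree_eq_of_add h h₂
  induction x using TensorProduct.induction_on with
  | zero => exact map_zero _
  | add y z hy hz => rw [map_add, hy, hz, add_zero]
  | tmul x y =>
    rw [TensorProduct.lift.tmul]
    rcases Nat.eq_zero_or_pos β.degree with hn | hn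
    · exact cross_eq_zero_of_degree h h₂ hn x y
    · rw [cross_eq_sum]
      refine Finset.sum_eq_zero fun r _ => ?_
      rw [cross_mul_left, cross_kE_of_ne h h₂ hn fun hr => hκ (SeqOf.exists_sub r (by omega) hr),
        mul_zero]

/-- The case of a non-negative weight. -/
theorem nonempty_add_FE_iso (hlam : D.IsDominant lam) (i : I) (ν : I →₀ ℕ) {m : ℕ}
    (hm : D.h i (lam - D.root ν) = m) :
    Nonempty (GrMod.add (D.FE K lam i ν ⋙ D.qShift K lam i (-D.a i i))
      (GrMod.dsum fun k : Fin m => D.qShift K lam i (2 * (k : ℤ))) ≅ D.EF K lam i ν) := by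
  by_cases hκ : ν - Finsupp.single i 1 + Finsupp.single i 1 = ν
  · rw [FE, dif_pos hκ]
    refine nonempty_iso_of_nonneg rfl hlam hm
      ((D.E K hκ lam ⋙ D.F K hκ lam) ⋙ D.qShift K lam i (-D.a i i))
      (crossTrans rfl rfl hκ hκ K lam)
      (fun M => TensorProduct.lift (crossMu hκ hκ K lam M.carrier))
      (crossTrans_lift rfl rfl hκ hκ K lam)
      (fun M x hx => lift_crossMu_eq_zero rfl rfl hκ hκ M.carrier hx)
      (fun M => lift_crossMu_mul hκ hκ M.carrier) (fun M => mem_span_crossMu hκ hκ M.carrier)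
  · rw [FE, dif_neg hκ]
    refine nonempty_iso_of_nonneg rfl hlam hm _ ⟨fun M => ⟨0, fun _ => ?_⟩, fun _ _ _ => ?_⟩
      (fun M => 0) (fun M x z => ?_) (fun M x _ => rfl) (fun M x r z => rfl) (fun M v => ?_)
    · exact Submodule.zero_mem _
    · exact GrMod.hom_ext (LinearMap.ext fun _ => (map_zero _).symm)
    · rw [lift_cross_eq_zero rfl rfl hκ, map_zero, map_zero]
      rfl
    · exact (show v = 0 from rfl) ▸ Submodule.zero_mem _

end Dominant

end BorcherdsCartanDatum

namespace BorcherdsCartanDatum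

variable {I : Type v} {D : BorcherdsCartanDatum.{v, w} I} [Inhabited I]
  {κ β ν' : I →₀ ℕ} {i : I} (h : β + Finsupp.single i 1 = ν')
  (hκ : κ + Finsupp.single i 1 = β) {K : Type u} [Field K] {lam : D.P}

section Negative

variable (K lam) in
/-- The bilinear map `(x, y) ↦ x u y`, where `u` consists of dots on the last strand. -/
def moment (k : ℕ) : D.KLR K β →ₗ[K] D.KLR K β →ₗ[K] D.Cyc K β lam :=
  ((LinearMap.mul K (D.KLR K β)).compl₂
    (LinearMap.mulLeft K (D.kX β K κ.degree ^ k * D.iota hκ K 1))).compr₂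
      (D.cycProj K β lam).toLinearMap

theorem moment_apply (k : ℕ) (x y : D.KLR K β) : moment hκ K lam k x y =
    D.cycProj K β lam (x * (D.kX β K κ.degree ^ k * D.iota hκ K 1 * y)) := rfl

theorem coeff_lastRow_lift_cross (hi : D.a i i = 2) (k : ℕ) (x : D.KLR K β ⊗[K] D.KLR K β) :
    (lastRow h K lam (TensorProduct.lift (D.cross h h K) x)).coeff (k + 1) =
      -TensorProduct.lift (moment hκ K lam k) x := by
  induction x using TensorProduct.induction_on with
  | zero => rw [map_zero, map_zero, map_zero, HahnSeries.coeff_zero, neg_zero]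
  | add y z hy hz => rw [map_add, map_add, map_add, HahnSeries.coeff_add, hy, hz, neg_add]
  | tmul x y =>
    rw [TensorProduct.lift.tmul, TensorProduct.lift.tmul, coeff_lastRow_cross h hκ hi,
      moment_apply, mul_assoc (_ ^ k)]

theorem lift_moment_mul (k : ℕ) (x : D.KLR K β ⊗[K] D.KLR K β) (r : D.KLR K β) :
    TensorProduct.lift (moment hκ K lam k) (LinearMap.lTensor _ (LinearMap.mulRight K r) x) =
      TensorProduct.lift (moment hκ K lam k) x * D.cycProj K β lam r := by
  induction x using TensorProduct.induction_on with
  | zero => simp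
  | add y z hy hz => simp only [map_add, add_mul, hy, hz]
  | tmul x y =>
    rw [LinearMap.lTensor_tmul, TensorProduct.lift.tmul, TensorProduct.lift.tmul, moment_apply,
      moment_apply, LinearMap.mulRight_apply, ← map_mul]
    simp only [mul_assoc]

theorem momentTrans_lift (hi : D.a i i = 2) (k : ℕ) (M : D.CycMod K β lam)
    (x : D.KLR K β ⊗[K] D.KLR K β) (z : M.carrier) :
    (GrMod.Hom.toLin ((momentTrans K lam hκ hi k).app M)
      (TensorProduct.lift (crossMu hκ hκ K lam M.carrier) x z) : M.carrier) =
      TensorProduct.lift (moment hκ K lam k) x • z := by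
  letI := GrMod.resModule (D.strand K hκ lam) M.carrier
  induction x using TensorProduct.induction_on with
  | zero =>
    simp only [map_zero, LinearMap.zero_apply, zero_smul]
    exact map_zero (GrMod.Hom.toLin ((momentTrans K lam hκ hi k).app M))
  | add x y hx hy =>
    simp only [map_add, LinearMap.add_apply, add_smul]
    rw [← hx, ← hy]
    exact map_add (GrMod.Hom.toLin ((momentTrans K lam hκ hi k).app M)) _ _
  | tmul x y =>
    rw [TensorProduct.lift.tmul, TensorProduct.lift.tmul]
    refine (GrMod.momentNat_app (D.strand K hκ lam)
      (D.cycProj K β lam (D.kX β K κ.degree ^ k * D.iota hκ K 1)) _ (D.strand_mem K hκ lam) _ _ M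
      (D.cycProj K β lam x) _).trans ?_
    change _ • D.strand K hκ lam 1 • D.cycProj K β lam y • z = _
    rw [← map_one (D.cycProj K κ lam), strand_cycProj, ← mul_smul, ← mul_smul, ← map_mul,
      ← map_mul, ← map_mul, moment_apply]
    have e : D.iota hκ K 1 * (D.iota hκ K 1 * y) = D.iota hκ K 1 * y := by
      rw [← mul_assoc, iota_one_mul]
    simp only [mul_assoc, e]

theorem neg_of_weight_neg (hlam : D.IsDominant lam) (hm : D.h i (lam - D.root β) < 0) :
    D.a i i = 2 ∧ β - Finsupp.single i 1 + Finsupp.single i 1 = β := by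
  have H : ¬ (β i = 0 ∨ D.a i i ≤ 0) := by
    intro h0
    refine absurd hm (not_lt.2 ?_)
    rw [map_sub, root, Finsupp.sum, map_sum, sub_nonneg]
    refine (Finset.sum_nonpos fun j _ => ?_).trans (hlam i)
    rw [map_nsmul, D.h_α, nsmul_eq_mul]
    by_cases hj : i = j
    · subst hj
      rcases h0 with h0 | h0
      · rw [h0, Nat.cast_zero, zero_mul]
      · exact mul_nonpos_of_nonneg_of_nonpos (Nat.cast_nonneg _) h0
    · exact mul_nonpos_of_nonneg_of_nonpos (Nat.cast_nonneg _) (D.a_offDiag i j hj)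
  rw [not_or] at H
  refine ⟨(D.a_diag i).resolve_right fun h0 => H.2 h0.1, tsub_add_cancel_of_le ?_⟩
  rw [Finsupp.single_le_iff]
  exact Nat.one_le_iff_ne_zero.2 H.1

variable (K lam) in
/-- The homomorphism given by dots on the strand that is cut off. -/
def momentsTrans (hi : D.a i i = 2) (m : ℕ) :
    (D.E K hκ lam ⋙ D.F K hκ lam) ⋙ D.qShift K lam i (-D.a i i) ⟶
      GrMod.dsum fun k : Fin m => D.qShift K lam i (-2 * (k : ℤ) - 2) :=
  GrMod.dsumLift _ _ fun k => momentTrans K lam hκ hi k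

theorem nonempty_iso_of_neg (hlam : D.IsDominant lam) (hi : D.a i i = 2) {m : ℕ}
    (hm : D.h i (lam - D.root β) = -m) :
    Nonempty ((D.E K hκ lam ⋙ D.F K hκ lam) ⋙ D.qShift K lam i (-D.a i i) ≅
      GrMod.add (D.F K h lam ⋙ D.E K h lam)
        (GrMod.dsum fun k : Fin m => D.qShift K lam i (-2 * (k : ℤ) - 2))) := by
  refine GrMod.nonempty_iso_of_bijective (GrMod.addLift (crossTrans h h hκ hκ K lam)
    (momentsTrans hκ K lam hi m)) fun M => ?_
  let μ : D.KLR K β ⊗[K] D.KLR K β →ₗ[K] M.carrier →ₗ[K]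
      (((D.E K hκ lam ⋙ D.F K hκ lam) ⋙ D.qShift K lam i (-D.a i i)).obj M).carrier :=
    TensorProduct.lift (crossMu hκ hκ K lam M.carrier)
  let Ψ : (((D.E K hκ lam ⋙ D.F K hκ lam) ⋙ D.qShift K lam i (-D.a i i)).obj M).carrier →ₗ[K]
      (Fin m → M.carrier) :=
    LinearMap.pi fun k => (GrMod.Hom.toLin ((momentTrans K lam hκ hi k).app M)).restrictScalars K
  have H := GrMod.bijective_of_moments (Ξ := D.KLR K β ⊗[K] D.KLR K β)
    ((crossTrans h h hκ hκ K lam).app M) Ψ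
    ((D.cycProj K ν' lam).toLinearMap.comp (TensorProduct.lift (D.cross h h K)))
    (LinearMap.pi fun k : Fin m => TensorProduct.lift (moment hκ K lam k)) μ
  have H' : Function.Bijective fun v =>
      (GrMod.Hom.toLin ((crossTrans h h hκ hκ K lam).app M) v, Ψ v) := by
    refine H (fun ξ h1 h2 z => ?_) (fun b c => ?_) (fun ξ r => ?_)
      (crossTrans_lift h h hκ hκ K lam M)
      (fun ξ z k => momentTrans_lift hκ hi k M ξ z) (fun ξ => ?_)
      (mem_span_crossMu hκ hκ M.carrier)
    · have := lift_cross_mem h hlam (m := 0) (Or.inl rfl) 0 (x := ξ) (fun a ha => ?_)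
        (by rw [Finset.range_zero, Finset.sum_empty, add_zero]; exact h1)
      · exact LinearMap.congr_fun (lift_crossMu_eq_zero h h hκ hκ M.carrier this.2) z
      · rcases le_or_gt a 0 with h0 | h0
        · exact coeff_lastRow_cross_nonpos h h0 ξ
        · obtain ⟨k, rfl⟩ : ∃ k : ℕ, a = k + 1 := ⟨(a - 1).toNat, by omega⟩
          rw [coeff_lastRow_lift_cross h hκ hi, neg_eq_zero]
          exact congrFun h2 ⟨k, by omega⟩
    · obtain ⟨b, rfl⟩ := cycProj_surjective lam b
      obtain ⟨z, hz, e⟩ := cycProj_cut_mem h hlam b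
      obtain ⟨x, p, rfl⟩ := exists_dotSum (m := 0) h (by rw [hm]; simp) hz
      obtain ⟨x', hx', hc'⟩ := exists_cross_coeff h hlam (K := K) hm
        (fun k => if hk : k < m then TensorProduct.lift (moment hκ K lam k) x - c ⟨k, hk⟩ else 0)
        (Nat.zero_le m) (fun k hk => absurd hk (Nat.not_lt_zero k))
      refine ⟨x + x', ?_, funext fun k => ?_⟩
      · rw [cycProj_mul_strand_one, strand_one_mul_cycProj, map_add]
        refine (congrArg₂ (· + ·) ?_ hx').trans (add_zero _)
        rw [← e, dotSum_apply, Fin.sum_univ_zero, add_zero]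
        rfl
      · have := hc' k k.2
        rw [coeff_lastRow_lift_cross h hκ hi, dif_pos k.2, neg_eq_iff_eq_neg, neg_sub] at this
        rw [LinearMap.pi_apply, map_add, this]
        exact add_sub_cancel _ _
    · obtain ⟨r, rfl⟩ := cycProj_surjective lam r
      refine ⟨LinearMap.lTensor _ (LinearMap.mulRight K r) ξ, ?_,
        fun k => lift_moment_mul hκ k ξ r, lift_crossMu_mul hκ hκ M.carrier ξ r⟩
      rw [LinearMap.comp_apply, lift_cross_mul, strand_cycProj]
      exact map_mul (D.cycProj K ν' lam) _ _
    · rw [LinearMap.comp_apply, AlgHom.toLinearMap_apply, cycProj_mul_strand_one,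
        strand_one_mul_cycProj, cross_mul_iota_one, iota_one_mul_cross]
  constructor
  · intro v w hvw
    refine H'.1 (Prod.ext ?_ ?_)
    · exact congrFun hvw (0 : Fin 2)
    · exact congrFun hvw (1 : Fin 2)
  · intro v
    obtain ⟨y, z, rfl⟩ : ∃ y z, v = GrMod.addPair y z :=
      ⟨v (0 : Fin 2), v (1 : Fin 2), (GrMod.addPair_eta v).symm⟩
    obtain ⟨w, hw⟩ := H'.2 (y, z)
    refine ⟨w, (GrMod.addLift_apply _ _ M w).trans ?_⟩
    exact congrArg₂ GrMod.addPair (congrArg Prod.fst hw) (congrArg Prod.snd hw)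

/-- The case of a negative weight. -/
theorem nonempty_FE_iso_add (hlam : D.IsDominant lam) (i : I) (ν : I →₀ ℕ) {m : ℕ}
    (hi : D.a i i = 2) (hν : ν - Finsupp.single i 1 + Finsupp.single i 1 = ν)
    (hm : D.h i (lam - D.root ν) = -m) :
    Nonempty (D.FE K lam i ν ⋙ D.qShift K lam i (-D.a i i) ≅ GrMod.add (D.EF K lam i ν)
      (GrMod.dsum fun k : Fin m => D.qShift K lam i (-2 * (k : ℤ) - 2))) := by
  rw [FE, dif_pos hν]
  exact nonempty_iso_of_neg rfl hν hlam hi hm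

end Negative

end BorcherdsCartanDatum

namespace GrMod

variable {K : Type u} [Field K] {A A' : Type a} [Ring A] [Algebra K A] [Ring A'] [Algebra K A']
  (φ : A →ₙₐ[K] A')

theorem finite_indCarrier (M : Type*) [AddCommGroup M] [Module K M] [Module A M]
    [Module.Finite A M] : Module.Finite A' (IndCarrier φ M) := by
  obtain ⟨s, hs⟩ := Module.Finite.fg_top (R := A) (M := M)
  have hfin : ((fun x => indMk₂ φ M 1 x) '' (s : Set M)).Finite := s.finite_toSet.image _
  refine ⟨Submodule.fg_def.2 ⟨_, hfin, eq_top_iff.2 fun z _ => ?_⟩⟩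
  clear * - hs
  induction z using ind_induction with
  | h0 => exact Submodule.zero_mem _
  | hadd y z hy hz => exact Submodule.add_mem _ hy hz
  | h b x =>
    have hx : x ∈ Submodule.span A (s : Set M) := hs ▸ Submodule.mem_top
    induction hx using Submodule.span_induction generalizing b with
    | mem x hx =>
      rw [← mul_one b, ← smul_indMk₂]
      exact Submodule.smul_mem _ _ (Submodule.subset_span ⟨x, hx, rfl⟩)
    | zero => rw [map_zero]; exact Submodule.zero_mem _
    | add x y _ _ hx hy => rw [map_add]; exact Submodule.add_mem _ (hx b) (hy b)
    | smul r x _ hx => rw [← indMk₂_mul]; exact hx _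

/-- The left `A`-submodule of `A'` generated by `t`. -/
def leftSpan (t : Set A') : Submodule K A' :=
  Submodule.span K {z | ∃ a, ∃ g ∈ t, z = φ a * g}

variable {φ} in
theorem leftSpan_mono {t t' : Set A'} (h : t ⊆ t') : leftSpan φ t ≤ leftSpan φ t' :=
  Submodule.span_mono fun _ ⟨a, g, hg, e⟩ => ⟨a, g, h hg, e⟩

theorem finite_resCarrier {t : Set A'} (ht : t.Finite) (h : ∀ b, φ 1 * b ∈ leftSpan φ t)
    (N : Type*) [AddCommGroup N] [Module K N] [Module A' N] [IsScalarTower K A' N]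
    [Module.Finite A' N] : letI := resModule φ N; Module.Finite A (resCarrier φ N) := by
  letI := resModule φ N
  haveI := resCarrier_isScalarTower φ N
  obtain ⟨s, hs⟩ := Module.Finite.fg_top (R := A') (M := N)
  have hfin : ((fun p : A' × N => resProj φ N (p.1 • p.2)) '' (t ×ˢ (s : Set N))).Finite :=
    (ht.prod s.finite_toSet).image _
  refine ⟨Submodule.fg_def.2 ⟨_, hfin, eq_top_iff.2 fun z _ => ?_⟩⟩
  set S := Submodule.span A ((fun p : A' × N => resProj φ N (p.1 • p.2)) '' (t ×ˢ (s : Set N)))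
  have key : ∀ n : N, ∀ b : A', resProj φ N (b • n) ∈ S := by
    intro n
    have hn : n ∈ Submodule.span A' (s : Set N) := hs ▸ Submodule.mem_top
    induction hn using Submodule.span_induction with
    | mem x hx =>
      have H : ∀ c ∈ leftSpan φ t, resProj φ N (c • x) ∈ S := by
        intro c hc
        induction hc using Submodule.span_induction with
        | mem c hc =>
          obtain ⟨a, g, hg, rfl⟩ := hc
          have : resProj φ N ((φ a * g) • x) = a • resProj φ N (g • x) := Subtype.ext (by
            change φ 1 • (φ a * g) • x = φ a • φ 1 • g • x
            rw [← mul_smul, ← mul_smul, ← mul_smul, ← mul_assoc, map_one_mul, mul_map_one])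
          rw [this]
          exact Submodule.smul_mem _ _ (Submodule.subset_span ⟨(g, x), ⟨hg, hx⟩, rfl⟩)
        | zero => rw [zero_smul, map_zero]; exact Submodule.zero_mem _
        | add y z _ _ hy hz => rw [add_smul, map_add]; exact Submodule.add_mem _ hy hz
        | smul c y _ hy => rw [smul_assoc, map_smul]; exact Submodule.smul_of_tower_mem _ c hy
      intro b
      have := H _ (h b)
      have e : resProj φ N ((φ 1 * b) • x) = resProj φ N (b • x) := Subtype.ext (by
        change φ 1 • (φ 1 * b) • x = φ 1 • b • x
        rw [← mul_smul, ← mul_smul, ← mul_assoc, map_one_mul])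
      rwa [e] at this
    | zero => intro b; rw [smul_zero, map_zero]; exact Submodule.zero_mem _
    | add x y _ _ hx hy => intro b; rw [smul_add, map_add]; exact Submodule.add_mem _ (hx b) (hy b)
    | smul r x _ hx => intro b; rw [← mul_smul]; exact hx _
  have := key z.1 1
  rw [one_smul] at this
  exact (Subtype.ext z.2.symm : z = resProj φ N z.1) ▸ this

end GrMod

namespace BorcherdsCartanDatum

variable {I : Type v} {D : BorcherdsCartanDatum.{v, w} I} [Inhabited I]
  {κ β β₂ ν' : I →₀ ℕ} {i i' : I} (h : β + Finsupp.single i 1 = ν')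
  (h₂ : β₂ + Finsupp.single i' 1 = ν') (hκ : κ + Finsupp.single i' 1 = β)
  (hκ₂ : κ + Finsupp.single i 1 = β₂) {K : Type u} [Field K] {lam : D.P}

include hκ₂ in
theorem exists_finite_lift_cross_of_sub {t : Set (D.Cyc K β lam)} (ht : t.Finite)
    (H : ∀ b, D.strand K hκ lam 1 * b ∈ GrMod.leftSpan (D.strand K hκ lam) t) :
    ∃ t' : Set (D.Cyc K ν' lam), t'.Finite ∧ ∀ x, D.cycProj K ν' lam
      (TensorProduct.lift (D.cross h h₂ K) x) ∈ GrMod.leftSpan (D.strand K h₂ lam) t' := by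
  refine ⟨_, ht.image fun g => cycCross h hκ K lam * D.strand K h lam g, fun x => ?_⟩
  induction x using TensorProduct.induction_on with
  | zero => rw [map_zero, map_zero]; exact Submodule.zero_mem _
  | add y z hy hz => rw [map_add, map_add]; exact Submodule.add_mem _ hy hz
  | tmul x y =>
    rw [TensorProduct.lift.tmul, ← strand_mul_cycCross_mul h h₂ hκ hκ₂]
    have := H (D.cycProj K β lam y)
    generalize D.strand K hκ lam 1 * D.cycProj K β lam y = c at this ⊢
    induction this using Submodule.span_induction with
    | mem c hc =>
      obtain ⟨a, g, hg, rfl⟩ := hc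
      refine Submodule.subset_span
        ⟨D.cycProj K β₂ lam x * D.strand K hκ₂ lam a, _, ⟨g, hg, rfl⟩, ?_⟩
      rw [map_mul (D.strand K h lam), ← mul_assoc, mul_assoc (D.strand K h₂ lam _),
        ← strand_mul_cycCross h h₂ hκ hκ₂, map_mul (D.strand K h₂ lam)]
      simp only [mul_assoc]
    | zero => rw [map_zero, mul_zero]; exact Submodule.zero_mem _
    | add y z _ _ hy hz => rw [map_add, mul_add]; exact Submodule.add_mem _ hy hz
    | smul c y _ hy => rw [map_smul, mul_smul_comm]; exact Submodule.smul_mem _ c hy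

variable (K lam) in
/-- Finiteness of the algebra over the smaller algebra. -/
theorem exists_finite_leftSpan (hlam : D.IsDominant lam) :
    ∃ t : Set (D.Cyc K ν' lam), t.Finite ∧
      ∀ b, D.strand K h₂ lam 1 * b ∈ GrMod.leftSpan (D.strand K h₂ lam) t := by
  induction hn : ν'.degree generalizing β₂ i' ν' with
  | zero => have := degree_of_add h₂; omega
  | succ n ih =>
  have hcross : ∀ {β : I →₀ ℕ} {i : I} (h : β + Finsupp.single i 1 = ν'),
      ∃ t' : Set (D.Cyc K ν' lam), t'.Finite ∧ ∀ x, D.cycProj K ν' lam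
        (TensorProduct.lift (D.cross h h₂ K) x) ∈ GrMod.leftSpan (D.strand K h₂ lam) t' := by
    intro β i h
    by_cases hκ₂ : β₂ - Finsupp.single i 1 + Finsupp.single i 1 = β₂
    · have hκ : β₂ - Finsupp.single i 1 + Finsupp.single i' 1 = β := by
        refine add_right_cancel (b := Finsupp.single i 1) ?_
        rw [add_right_comm, hκ₂, h, h₂]
      obtain ⟨t, ht, H⟩ := ih hκ (by have := degree_of_add h; omega)
      exact exists_finite_lift_cross_of_sub h h₂ hκ hκ₂ ht H
    · refine ⟨∅, Set.finite_empty, fun x => ?_⟩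
      rw [lift_cross_eq_zero h h₂ hκ₂, map_zero]
      exact Submodule.zero_mem _
  have hcut : ∀ {β : I →₀ ℕ} {i : I} (h : β + Finsupp.single i 1 = ν'),
      ∃ t' : Set (D.Cyc K ν' lam), t'.Finite ∧ ∀ b, D.strand K h₂ lam 1 *
        (b * D.strand K h lam 1) ∈ GrMod.leftSpan (D.strand K h₂ lam) t' := by
    intro β i h
    obtain ⟨t, ht, H⟩ := hcross h
    by_cases hi : i = i'
    · subst hi
      obtain rfl : β = β₂ := add_right_cancel (h.trans h₂.symm)
      refine ⟨t ∪ (fun l : ℕ => D.cycProj K ν' lam (D.kX ν' K β.degree ^ l)) ''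
        (Set.Iio (D.h i (lam - D.root β)).toNat), ht.union ((Set.finite_Iio _).image _),
        fun b => ?_⟩
      obtain ⟨b, rfl⟩ := cycProj_surjective lam b
      rw [cycProj_mul_strand_one, strand_one_mul_cycProj]
      refine (Submodule.map_le_iff_le_comap.2 (sup_le ?_ (Submodule.span_le.2 ?_)) :
        (cutSpan h K lam).map (D.cycProj K ν' lam).toLinearMap ≤ _) (cycProj_cut_mem h hlam b)
      · rintro _ ⟨x, rfl⟩
        exact GrMod.leftSpan_mono Set.subset_union_left (H x)
      · rintro _ ⟨l, hl, b, rfl⟩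
        refine Submodule.subset_span ⟨D.cycProj K β lam b, _,
          Or.inr ⟨l, (by simp only [Set.mem_Iio]; omega), rfl⟩, ?_⟩
        rw [strand_cycProj, ← map_mul, iota_mul_kX_pow]
        rfl
    · refine ⟨t, ht, fun b => ?_⟩
      obtain ⟨b, rfl⟩ := cycProj_surjective lam b
      obtain ⟨x, hx⟩ := exists_cross_of_ne h h₂ hi b
      rw [cycProj_mul_strand_one, strand_one_mul_cycProj, ← hx]
      exact H x
  have hE : ∀ s : SeqOf ν', ∃ t' : Set (D.Cyc K ν' lam), t'.Finite ∧ ∀ b, D.strand K h₂ lam 1 *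
      (b * D.cycProj K ν' lam (D.kE K s)) ∈ GrMod.leftSpan (D.strand K h₂ lam) t' := by
    intro s
    have h := SeqOf.exists_sub s hn rfl
    obtain ⟨i, hi⟩ : ∃ i, i = s.c n := ⟨_, rfl⟩
    rw [← hi] at h
    obtain ⟨r, rfl⟩ := SeqOf.exists_append h s (by
      have := degree_of_add h
      exact (congrArg s.c (by omega)).trans hi.symm)
    obtain ⟨t, ht, H⟩ := hcut h
    refine ⟨t, ht, fun b => ?_⟩
    have := H (b * D.cycProj K ν' lam (D.kE K (r.append h)))
    rwa [mul_assoc, cycProj_mul_strand_one, kE_append_mul_iota_one] at this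
  choose t ht H using hE
  refine ⟨⋃ s, t s, Set.finite_iUnion ht, fun b => ?_⟩
  have e : b = ∑ s, b * D.cycProj K ν' lam (D.kE K s) := by
    rw [← Finset.mul_sum, ← map_sum, sum_kE, map_one, mul_one]
  rw [e, Finset.mul_sum]
  exact Submodule.sum_mem _ fun s _ =>
    GrMod.leftSpan_mono (Set.subset_iUnion t s) (H s b)

theorem fg_E (hlam : D.IsDominant lam) {N : D.CycMod K ν' lam} (hN : N.FG) :
    ((D.E K h lam).obj N).FG := by
  obtain ⟨t, ht, H⟩ := exists_finite_leftSpan h K lam hlam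
  haveI : Module.Finite _ N.carrier := hN
  exact GrMod.finite_resCarrier (D.strand K h lam) ht H N.carrier

theorem fg_F {M : D.CycMod K β lam} (hM : M.FG) : ((D.F K h lam).obj M).FG := by
  haveI : Module.Finite _ M.carrier := hM
  exact GrMod.finite_indCarrier (D.strand K h lam) M.carrier

end BorcherdsCartanDatum

end

theorem mainTheorem5 {K : Type u} [Field K] [IsAlgClosed K] {I : Type v}
    (D : BorcherdsCartanDatum.{v, w} I) (lam : D.P) (hlam : D.IsDominant lam) :
    -- the functors preserve finitely generated graded modules
    (∀ (i : I) (ν ν' : I →₀ ℕ) (h : ν + Finsupp.single i 1 = ν'),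
      (∀ N : D.CycMod K ν' lam, N.FG → ((D.E K h lam).obj N).FG) ∧
      (∀ M : D.CycMod K ν lam, M.FG → ((D.F K h lam).obj M).FG)) ∧
    -- (1)
    (∀ (i j : I), i ≠ j → ∀ (κ κi κj κij : I →₀ ℕ)
      (hi : κ + Finsupp.single i 1 = κi) (hj : κ + Finsupp.single j 1 = κj)
      (hij : κi + Finsupp.single j 1 = κij) (hji : κj + Finsupp.single i 1 = κij),
      Nonempty ((D.E K hi lam ⋙ D.F K hj lam) ⋙ D.qShift K lam i (-D.a i j) ≅
        D.F K hij lam ⋙ D.E K hji lam)) ∧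
    -- (2)
    (∀ (i : I) (ν : I →₀ ℕ),
      (0 ≤ D.h i (lam - D.root ν) →
        Nonempty (GrMod.add (D.FE K lam i ν ⋙ D.qShift K lam i (-D.a i i))
            (GrMod.dsum fun k : Fin (D.h i (lam - D.root ν)).toNat =>
              D.qShift K lam i (2 * (k : ℤ))) ≅
          D.EF K lam i ν)) ∧
      (D.h i (lam - D.root ν) < 0 →
        D.a i i = 2 ∧
        Nonempty (D.FE K lam i ν ⋙ D.qShift K lam i (-D.a i i) ≅
          GrMod.add (D.EF K lam i ν)
            (GrMod.dsum fun k : Fin (-D.h i (lam - D.root ν)).toNat =>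
              D.qShift K lam i (-2 * (k : ℤ) - 2))))) := by
  refine ⟨fun i ν ν' h => ?_, fun i j hne κ κi κj κij hi hj hij hji => ?_, fun i ν => ⟨?_, ?_⟩⟩
  · have : Inhabited I := ⟨i⟩
    exact ⟨fun _ hN => BorcherdsCartanDatum.fg_E h hlam hN,
      fun _ hM => BorcherdsCartanDatum.fg_F h hM⟩
  · have : Inhabited I := ⟨i⟩
    exact BorcherdsCartanDatum.nonempty_iso_of_ne hij hji hi hj hne.symm
  · intro hm
    have : Inhabited I := ⟨i⟩
    exact BorcherdsCartanDatum.nonempty_add_FE_iso hlam i ν (Int.toNat_of_nonneg hm).symm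
  · intro hm
    have : Inhabited I := ⟨i⟩
    obtain ⟨hi, hν⟩ := BorcherdsCartanDatum.neg_of_weight_neg hlam hm
    exact ⟨hi, BorcherdsCartanDatum.nonempty_FE_iso_add hlam i ν hi hν (by
      rw [Int.toNat_of_nonneg (by omega), neg_neg])⟩
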